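/- Setting. Write $y\in\mathbb{R}^3$, $\theta\in\mathbb{T}=\mathbb{R}/2\pi\mathbb{Z}$, $\langle y\rangle=(1+|y|^2)^{1/2}$. For $\tau\ge\tau_0$ let $$R(\tau)=\sqrt{\tfrac{26}{5}\ln\tau+100\ln(1+\tau-\tau_0)} .$$ Let $\varepsilon>0$, and let $\chi(z)=\chi(|z|)$ be a $C^5$ radial cutoff function, nonincreasing in $|z|$, with $\chi=1$ for $|z|\le1$, $\chi=0$ for $|z|\ge1+\varepsilon$, such that for some constants $M_0,\dots,M_4$ with $M_0\ne0$, as $|z|\uparrow1+\varepsilon$, $$\frac{d^k\chi}{d|z|^k}=10M_k(|z|-1-\varepsilon)^{20-k}+O\big((|z|-1-\varepsilon)^{21-k}\big),\qquad k=0,\dots,4 .$$ Put $\chi_R(y)=\chi(y/R)$. For large $R$ let $\tilde\chi_R\ge0$ be smooth in $y$, jointly continuous in $(R,y)$, equal to $1$ for $|y|\le R(1+\varepsilon-2R^{-1/4})$ and to $0$ for $|y|\ge R(1+\varepsilon-R^{-1/4})$, with $|\nabla_y^k\tilde\chi_R|\lesssim R^{-\frac34k}$ for $k=1,2$. Define the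 nonnegative potential $$V(y,\tau)=\Big|\frac{\tilde\chi_{R}\;y\cdot\nabla_y\chi_{R}}{\chi_{R}}\Big|_{R=R(\tau)}$$ (equal to $0$ where $\chi_R=0$), and the operators $$\mathcal{L}_1=-\Delta+\tfrac1{16}|y|^2-\tfrac74+V \ \text{ on } L^2(\mathbb{R}^3),\qquad \mathcal{L}=-\Delta_y+\tfrac1{16}|y|^2-\tfrac74-\tfrac12\partial_\theta^2+V\ \text{ on } L^2(\mathbb{R}^3\times\mathbb{T}).$$ Let $\tilde P_4,\tilde P_{10}$ (on $L^2(\mathbb{R}^3)$) and $P_1,P_6,P_{18}$ (on $L^2(\mathbb{R}^3\times\mathbb{T})$) be the orthogonal projections onto the orthogonal complements of the following functions, each multiplied by $e^{-|y|^2/8}$ (with $k,m,n=1,2,3$, $m\ne n$): - $\tilde P_4$: $1,\ y_k$; - $\tilde P_{10}$: $1,\ y_k,\ \tfrac12y_k^2-1,\ y_my_n$; - $P_1$: $1$; - $P_6$: $1,\ y_k,\ \cos\theta,\ \sin\theta$; - $P_{18}$: $1,\ y_k,\ \tfrac12y_k^2-1,\ y_my_n,\ \cos\theta,\ \sin\theta,\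 y_k\cos\theta,\ y_k\sin\theta$. The propagator generated by a family $-A(\tau)$ of symmetric operators is the strongly continuous evolution family $U(\tau,\sigma)$, $\tau\ge\sigma\ge\tau_0$, of bounded operators on $L^2$ such that $u(\tau)=U(\tau,\sigma)g$ is the weak solution of $\partial_\tau u=-A(\tau)u$, $u(\sigma)=g$. Theorem. There is a universal constant $C$ such that for all $\varepsilon,\chi,\tilde\chi$ as above and all sufficiently large $\tau_0$ (depending on $\varepsilon,\chi,\tilde\chi$), the propagators below exist and satisfy the following bounds for all $\tau\ge\sigma\ge\tau_0$ and all $g$ (in $L^2$, complex valued; the right-hand sides may be infinite). On $\mathbb{R}^3$, with $\tilde U_1,\tilde U_2,\tilde U_3$ generated by $-\tilde P_{10}(\mathcal{L}_1+1)\tilde P_{10}$, $-\tilde P_4(\mathcal{L}_1+1)\tilde P_4$ and $-\mathcal{L}_1$ respectively: $$\|\langle y\rangle^{-3}e^{\frac{|y|^2}8}\tilde U_1(\tau,\sigma)\tilde P_{10}g\|_\infty\le Ce^{-\frac75(\tau-\sigma)}\|\langle y\rangle^{-3}e^{\frac{|y|^2}8}g\|_\infty,$$ $$\|\langle y\rangle^{-k}e^{\frac{|y|^2}8}\tilde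 U_2(\tau,\sigma)\tilde P_4g\|_\infty\le Ce^{-\frac9{10}(\tau-\sigma)}\|\langle y\rangle^{-k}e^{\frac{|y|^2}8}g\|_\infty,\quad k=2,3,$$ $$\|\langle y\rangle^{-k}e^{\frac{|y|^2}8}\tilde U_3(\tau,\sigma)g\|_\infty\le Ce^{\tau-\sigma}\|\langle y\rangle^{-k}e^{\frac{|y|^2}8}g\|_\infty,\quad k=0,1,2,3.$$ On $\mathbb{R}^3\times\mathbb{T}$, with $U_1,U_2,U_3,U_4$ generated by $-P_{18}\mathcal{L}P_{18}$, $-P_6(\mathcal{L}+\frac12)P_6$, $-\mathcal{L}$ and $-P_1(\mathcal{L}+1)P_1$ respectively: $$\|\langle y\rangle^{-3}e^{\frac{|y|^2}8}U_1(\tau,\sigma)P_{18}g\|_\infty\le Ce^{-\frac25(\tau-\sigma)}\|\langle y\rangle^{-3}e^{\frac{|y|^2}8}g\|_\infty,$$ $$\|\langle y\rangle^{-2}e^{\frac{|y|^2}8}U_1(\tau,\sigma)P_{18}\partial_\theta g\|_\infty\le Ce^{-\frac25(\tau-\sigma)}\|\langle y\rangle^{-2}e^{\frac{|y|^2}8}\partial_\theta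 g\|_\infty\quad\text{if }\partial_\theta g\in L^2,$$ $$\|\langle y\rangle^{-2}e^{\frac{|y|^2}8}U_2(\tau,\sigma)P_6g\|_\infty\le Ce^{-\frac25(\tau-\sigma)}\|\langle y\rangle^{-2}e^{\frac{|y|^2}8}g\|_\infty,$$ $$\|\langle y\rangle^{-1}e^{\frac{|y|^2}8}U_3(\tau,\sigma)g\|_\infty\le Ce^{-\frac25(\tau-\sigma)}\|\langle y\rangle^{-1}e^{\frac{|y|^2}8}g\|_\infty\quad\text{if }\langle g(y,\cdot),e^{in\theta}\rangle_\theta=0\text{ for a.e. }y\text{ and }n=-1,0,1,$$ $$\|\langle y\rangle^{-1}e^{\frac{|y|^2}8}U_4(\tau,\sigma)P_1g\|_\infty\le Ce^{-\frac25(\tau-\sigma)}\|\langle y\rangle^{-1}e^{\frac{|y|^2}8}g\|_\infty.$$ -/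

import Mathlib

open MeasureTheory Set Filter Topology
open scoped ENNReal ContDiff SchwartzMap

noncomputable section

namespace CylinderPropagator

/-- The space variable `y ∈ ℝ³`. -/
abbrev E : Type := EuclideanSpace ℝ (Fin 3)

/-- Points `(y, θ)`; functions on `ℝ³ × 𝕋`, `𝕋 = ℝ / 2πℤ`, are restricted to the fundamental domain
`0 < θ ≤ 2π` (see `cylMeasure`), and smooth ones are represented by `2π`-periodic functions. -/
abbrev Cyl : Type := E × ℝ

/-- The measure `dy dθ` on `ℝ³ × 𝕋`. -/
def cylMeasure : Measure Cyl :=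
  (volume : Measure E).prod ((volume : Measure ℝ).restrict (Ioc 0 (2 * Real.pi)))

/-- `L²(ℝ³; ℂ)`. -/
abbrev HE : Type := Lp ℂ 2 (volume : Measure E)

/-- `L²(ℝ³ × 𝕋; ℂ)`. -/
abbrev HC : Type := Lp ℂ 2 cylMeasure

/-! ### The potential -/

/-- The radius `R(τ) = √(26/5 · ln τ + 100 · ln (1 + τ - τ₀))`. -/
def radius (τ₀ τ : ℝ) : ℝ :=
  Real.sqrt (26 / 5 * Real.log τ + 100 * Real.log (1 + τ - τ₀))

/-- `χ` is the radial profile of the cutoff function: equal to `1` up to `1`, equal to `0` from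
`1 + ε` on, nonincreasing, and vanishing exactly to order `20` at `1 + ε`. Only the values of `χ`
on `[0, ∞)` matter. Such a function is not `C^20` at `1 + ε`, so it is only required to be `C^5`. -/
structure IsCutoff (ε : ℝ) (χ : ℝ → ℝ) : Prop where
  contDiff : ContDiff ℝ 5 χ
  antitone : Antitone χ
  eq_one : ∀ s ≤ 1, χ s = 1
  eq_zero : ∀ s, 1 + ε ≤ s → χ s = 0
  edge : ∃ M : ℕ → ℝ, M 0 ≠ 0 ∧ ∀ k ≤ 4,
    (fun s => iteratedDeriv k χ s - 10 * M k * (s - 1 - ε) ^ (20 - k))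
      =O[𝓝[≤] (1 + ε)] fun s => (s - 1 - ε) ^ (21 - k)

/-- `χ_r(y) = χ(|y| / r)`. -/
def scaledCutoff (χ : ℝ → ℝ) (r : ℝ) (y : E) : ℝ := χ (‖y‖ / r)

/-- `χt r` is, for large `r`, the second cutoff function: smooth, nonnegative, equal to `1` for
`|y| ≤ r (1 + ε - 2 r^(-1/4))`, equal to `0` for `|y| ≥ r (1 + ε - r^(-1/4))`, with first and second
derivatives bounded by a constant times `r^(-3/4)` and `r^(-3/2)`; it depends continuously
on `r`. -/
structure IsInnerCutoff (ε : ℝ) (χt : ℝ → E → ℝ) : Prop where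
  exists_bounds : ∃ c r₀ : ℝ, 0 < r₀ ∧
    ContinuousOn (fun p : ℝ × E => χt p.1 p.2) (Ici r₀ ×ˢ univ) ∧
    ∀ r ≥ r₀, ContDiff ℝ ∞ (χt r) ∧ (∀ y, 0 ≤ χt r y) ∧
      (∀ y, ‖y‖ ≤ r * (1 + ε - 2 * r ^ (-(1 / 4) : ℝ)) → χt r y = 1) ∧
      (∀ y, r * (1 + ε - r ^ (-(1 / 4) : ℝ)) ≤ ‖y‖ → χt r y = 0) ∧
      ∀ k : ℕ, k = 1 ∨ k = 2 → ∀ y,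
        ‖iteratedFDeriv ℝ k (χt r) y‖ ≤ c * r ^ (-(3 / 4) * (k : ℝ))

/-- The potential `|χ̃_r (y · ∇χ_r) / χ_r|` at radius `r`; where `χ_r = 0` the factor `χ̃_r`
vanishes too, and the potential is `0`. -/
def potentialAt (χ : ℝ → ℝ) (χt : ℝ → E → ℝ) (r : ℝ) (y : E) : ℝ :=
  |χt r y * fderiv ℝ (scaledCutoff χ r) y y / scaledCutoff χ r y|

/-- The time-dependent potential `V(y, τ)`. -/
def potential (χ : ℝ → ℝ) (χt : ℝ → E → ℝ) (τ₀ τ : ℝ) (y : E) : ℝ :=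
  potentialAt χ χt (radius τ₀ τ) y

/-! ### The operators, as graphs in the product of `L²` with itself -/

/-- The graph of `-Δ + |y|²/16 - c + V` on the Schwartz functions of `ℝ³`. -/
def oscillator (c : ℝ) (V : E → ℝ) : Set (HE × HE) :=
  {p | ∃ ψ : 𝓢(E, ℂ), (p.1 =ᵐ[volume] fun y => ψ y) ∧
    p.2 =ᵐ[volume] fun y =>
      -(Laplacian.laplacian (fun z : E => ψ z) y) + ((‖y‖ ^ 2 / 16 - c + V y : ℝ) : ℂ) * ψ y}

/-- Test functions on `ℝ³ × 𝕋`: smooth, `2π`-periodic in `θ`, and rapidly decreasing in `y`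
together with all derivatives. -/
structure IsCylTest (ψ : Cyl → ℂ) : Prop where
  smooth : ContDiff ℝ ∞ ψ
  periodic : ∀ (y : E) (θ : ℝ), ψ (y, θ + 2 * Real.pi) = ψ (y, θ)
  decay : ∀ k n : ℕ, ∃ C : ℝ, ∀ x : Cyl, ‖x.1‖ ^ k * ‖iteratedFDeriv ℝ n ψ x‖ ≤ C

/-- The graph of `-Δ_y + |y|²/16 - ½ ∂_θ² - c + V` on the test functions of `ℝ³ × 𝕋`. -/
def cylOscillator (c : ℝ) (V : E → ℝ) : Set (HC × HC) :=
  {p | ∃ ψ : Cyl → ℂ, IsCylTest ψ ∧ (p.1 =ᵐ[cylMeasure] ψ) ∧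
    p.2 =ᵐ[cylMeasure] fun x =>
      -(Laplacian.laplacian (fun z : E => ψ (z, x.2)) x.1)
        - (1 / 2 : ℂ) * iteratedDeriv 2 (fun θ : ℝ => ψ (x.1, θ)) x.2
        + ((‖x.1‖ ^ 2 / 16 - c + V x.1 : ℝ) : ℂ) * ψ x}

/-- The graph of `P A P`, for a bounded operator `P` and an operator with graph `A`. -/
def compression {H : Type*} [NormedAddCommGroup H] [InnerProductSpace ℂ H]
    (P : H →L[ℂ] H) (A : Set (H × H)) : Set (H × H) :=
  {p | ∃ h : H, (P p.1, h) ∈ A ∧ p.2 = P h}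

/-! ### Propagators -/

/-- `U(τ, σ)`, `τ ≥ σ ≥ τ₀`, is the propagator generated by `-A(τ)`, where `A(τ)` is a family of
symmetric operators given by their graphs: an evolution family, strongly continuous in `τ`, such that
`u(τ) = U(τ, σ) g` is the weak solution of `∂_τ u = -A(τ) u`, `u(σ) = g`. -/
structure IsPropagator {H : Type*} [NormedAddCommGroup H] [InnerProductSpace ℂ H]
    (A : ℝ → Set (H × H)) (τ₀ : ℝ) (U : ℝ → ℝ → H →L[ℂ] H) : Prop where
  self : ∀ σ ≥ τ₀, U σ σ = ContinuousLinearMap.id ℂ H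
  comp : ∀ σ ≥ τ₀, ∀ s ≥ σ, ∀ τ ≥ s, (U τ s).comp (U s σ) = U τ σ
  continuousOn : ∀ σ ≥ τ₀, ∀ g : H, ContinuousOn (fun τ => U τ σ g) (Ici σ)
  weak : ∀ σ ≥ τ₀, ∀ g : H, ∀ (φ : H) (Aφ : ℝ → H), (∀ s ≥ τ₀, (φ, Aφ s) ∈ A s) → ∀ τ ≥ σ,
    IntervalIntegrable (fun s => inner ℂ (Aφ s) (U s σ g)) volume σ τ ∧
    inner ℂ φ (U τ σ g) = inner ℂ φ g - ∫ s in σ..τ, inner ℂ (Aφ s) (U s σ g)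

/-! ### Projections away from the low modes -/

/-- The orthogonal projection of `L²(μ; ℂ)` onto the orthogonal complement of (the span of) the given
functions. -/
def projAway {X : Type*} [MeasurableSpace X] (μ : Measure X) (S : Set (X → ℝ)) :
    Lp ℂ 2 μ →L[ℂ] Lp ℂ 2 μ :=
  (Submodule.span ℂ {f : Lp ℂ 2 μ | ∃ p ∈ S, f =ᵐ[μ] fun x => ((p x : ℝ) : ℂ)})ᗮ.starProjection

/-- `e^{-|y|²/8}`. -/
def gauss (y : E) : ℝ := Real.exp (-(‖y‖ ^ 2) / 8)

/-- `e^{-|y|²/8}` and `e^{-|y|²/8} y_k`. -/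
def modes4 : Set (E → ℝ) :=
  {gauss} ∪ {p | ∃ k : Fin 3, p = fun y => gauss y * y k}

/-- The functions in `modes4`, `e^{-|y|²/8} (y_k²/2 - 1)` and `e^{-|y|²/8} y_m y_n`, `m ≠ n`. -/
def modes10 : Set (E → ℝ) :=
  modes4 ∪ {p | ∃ k : Fin 3, p = fun y => gauss y * (1 / 2 * y k ^ 2 - 1)}
    ∪ {p | ∃ m n : Fin 3, m ≠ n ∧ p = fun y => gauss y * (y m * y n)}

/-- `e^{-|y|²/8}` on `ℝ³ × 𝕋`. -/
def cylModes1 : Set (Cyl → ℝ) := {fun x => gauss x.1}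

/-- `e^{-|y|²/8}`, `e^{-|y|²/8} y_k`, `e^{-|y|²/8} cos θ`, `e^{-|y|²/8} sin θ`. -/
def cylModes6 : Set (Cyl → ℝ) :=
  {p | ∃ q ∈ modes4, p = fun x => q x.1}
    ∪ {fun x => gauss x.1 * Real.cos x.2, fun x => gauss x.1 * Real.sin x.2}

/-- The ten functions of `y` alone, and the four functions `e^{-|y|²/8}`, `e^{-|y|²/8} y_k` times
`cos θ` and times `sin θ`. -/
def cylModes18 : Set (Cyl → ℝ) :=
  {p | ∃ q ∈ modes10, p = fun x => q x.1}
    ∪ {p | ∃ q ∈ modes4, p = fun x => q x.1 * Real.cos x.2}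
    ∪ {p | ∃ q ∈ modes4, p = fun x => q x.1 * Real.sin x.2}

/-- `P̃₄`, `P̃₁₀`, `P₁`, `P₆`, `P₁₈`. -/
def Pt4 : HE →L[ℂ] HE := projAway volume modes4
def Pt10 : HE →L[ℂ] HE := projAway volume modes10
def P1 : HC →L[ℂ] HC := projAway cylMeasure cylModes1
def P6 : HC →L[ℂ] HC := projAway cylMeasure cylModes6
def P18 : HC →L[ℂ] HC := projAway cylMeasure cylModes18

/-! ### Weighted norms -/

/-- `⟨y⟩^{-k} e^{|y|²/8}`, with `⟨y⟩ = (1 + |y|²)^{1/2}`. -/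
def weight (k : ℕ) (y : E) : ℝ :=
  (1 + ‖y‖ ^ 2) ^ (-((k : ℝ) / 2)) * Real.exp (‖y‖ ^ 2 / 8)

/-- `‖⟨y⟩^{-k} e^{|y|²/8} g‖_∞` on `ℝ³`, possibly infinite. -/
def normE (k : ℕ) (g : HE) : ℝ≥0∞ :=
  eLpNorm (fun y => ((weight k y : ℝ) : ℂ) * g y) ∞ (volume : Measure E)

/-- `‖⟨y⟩^{-k} e^{|y|²/8} g‖_∞` on `ℝ³ × 𝕋`, possibly infinite. -/
def normC (k : ℕ) (g : HC) : ℝ≥0∞ :=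
  eLpNorm (fun x => ((weight k x.1 : ℝ) : ℂ) * g x) ∞ cylMeasure

/-! ### Conditions in the variable `θ` -/

/-- `d = ∂_θ g` in the weak sense on `ℝ³ × 𝕋`. -/
def IsThetaDeriv (g d : HC) : Prop :=
  ∀ ψ : Cyl → ℂ, IsCylTest ψ →
    ∫ x, g x * deriv (fun θ : ℝ => ψ (x.1, θ)) x.2 ∂cylMeasure = -∫ x, d x * ψ x ∂cylMeasure

/-- `⟨g(y, ·), e^{inθ}⟩_θ = 0` for almost every `y`. -/
def FourierVanishes (n : ℤ) (g : HC) : Prop :=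
  ∀ᵐ y : E, ∫ θ in (0 : ℝ)..(2 * Real.pi),
    g (y, θ) * Complex.exp (-(Complex.I * (n : ℂ) * (θ : ℂ))) = 0

end CylinderPropagator

end

noncomputable section

namespace CylinderPropagator

/-! ### Diagonal operators and evolution equations in a Hilbert space -/

section Abstract

variable {H : Type*} [NormedAddCommGroup H] [InnerProductSpace ℂ H] {ι : Type*}

/-! Only two facts about the potential enter the estimates: `V ≥ 0`, and `V ≤ |y|` once `R` is large
(`exists_isPotential`). This is why the constant is universal and the cutoffs influence only how
large `τ₀` must be.

Let `Λ = -Δ + |y|²/16 - 3/4`, diagonal in the Hermite functions with eigenvalue half the degree. The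
functions projected away on `ℝ³` are, up to factors, the Hermite functions of degree less than some
`d`. Two estimates are combined, neither sufficient alone. In `L²`, the term with `V` has a
favourable sign in the energy identity, also after compression by the projection `P`, so solutions
orthogonal to the low modes decay like `e^{-dt/2}` (`norm_le_of_projected`). Pointwise, `e^{-tΛ}`
has the positive Mehler kernel and `K - V ≥ 0` for large `K`, so a solution with potential is
dominated by the free evolution of its absolute value (`LinSol.dominated`). The projection spoils
this only through the source `(1 - P)Vu`, a combination of finitely many modes `b` with coefficients
`⟨Vb, u⟩`; these are controlled by the `L²` norm of `u`, because `V ≤ |y|` bounds `Vb` in `L²`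
uniformly in time.

Conjugated with `e^{|y|²/8}`, the Mehler kernel is a Gaussian probability density centred at
`e^{-t/2} y`. It therefore shrinks `⟨y⟩^k` by almost `e^{-kt/2}` where `|y|` is large; where `|y|`
is bounded, the kernel maps `L²` to `L^∞`. So over one unit of time the weighted norm is multiplied
by `e^{-(k/2 - 1/20)}`, up to a multiple of the `L²` norm (`exists_contraction`). Inserting the `L²`
decay and iterating gives the rate `d/2 - 1/10` for `1 ≤ d ≤ k` (`exists_weighted_decay`).

On the cylinder `V` does not depend on `θ`, so the `n`-th Fourier coefficient solves a problem on
`ℝ³` with extra damping `n²/2` and its own degree `d n`. For times at least `1` the factors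
`e^{-n²/2}` make the Fourier series of bounds summable; for shorter times the positive kernel of the
cylinder, Mehler's kernel times a theta function, is used directly (`exists_cyl_decay`). A
coefficient that vanishes initially vanishes for ever, which accounts for the data `∂_θ g` and for
the conditions imposed with `U₃`.

Domains of unbounded operators are avoided: the weak equation tested on basis vectors becomes a
system of scalar equations (`LinSol`), solvable by Volterra iteration and uniquely so by the energy
estimate. The bounds thus hold for every propagator, not only for the one constructed. -/

theorem hilbert_parseval (b : HilbertBasis ι ℂ H) (x : H) :
    HasSum (fun i => ‖inner ℂ (b i) x‖ ^ 2) (‖x‖ ^ 2) := by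
  have h := b.hasSum_inner_mul_inner x x
  rw [← Complex.hasSum_ofReal]
  have e1 : (fun i => ((‖inner ℂ (b i) x‖ ^ 2 : ℝ) : ℂ))
      = fun i => inner ℂ x (b i) * inner ℂ (b i) x := by
    funext i
    rw [← inner_conj_symm x (b i), RCLike.conj_mul]
    simp
  have e2 : ((‖x‖ ^ 2 : ℝ) : ℂ) = inner ℂ x x := by
    rw [inner_self_eq_norm_sq_to_K]
    simp
  rw [e1, e2]
  exact h

theorem hilbert_ext (b : HilbertBasis ι ℂ H) {x y : H}
    (h : ∀ i, inner ℂ (b i) x = inner ℂ (b i) y) : x = y := by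
  apply b.repr.injective
  ext i
  simpa [b.repr_apply_apply] using h i

/-- A bound independent of `J`: it is the integrable majorant whenever a Parseval sum is passed to
the limit under a time integral. -/
theorem hilbert_partial_inner_le (b : HilbertBasis ι ℂ H) (J : Finset ι) (x y : H) :
    ‖∑ i ∈ J, inner ℂ x (b i) * inner ℂ (b i) y‖ ≤ ‖x‖ ^ 2 + ‖y‖ ^ 2 := by
  calc ‖∑ i ∈ J, inner ℂ x (b i) * inner ℂ (b i) y‖
      ≤ ∑ i ∈ J, ‖inner ℂ x (b i) * inner ℂ (b i) y‖ := norm_sum_le _ _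
    _ ≤ ∑ i ∈ J, (‖inner ℂ (b i) x‖ ^ 2 + ‖inner ℂ (b i) y‖ ^ 2) := by
        refine Finset.sum_le_sum fun i _ => ?_
        rw [norm_mul, norm_inner_symm x (b i)]
        nlinarith [sq_nonneg (‖inner ℂ (b i) x‖ - ‖inner ℂ (b i) y‖),
          sq_nonneg (‖inner ℂ (b i) x‖), sq_nonneg (‖inner ℂ (b i) y‖)]
    _ ≤ ‖x‖ ^ 2 + ‖y‖ ^ 2 := by
        rw [Finset.sum_add_distrib]
        exact add_le_add
          (sum_le_hasSum J (fun i _ => by positivity) (hilbert_parseval b x))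
          (sum_le_hasSum J (fun i _ => by positivity) (hilbert_parseval b y))

theorem exists_diagonal (b : HilbertBasis ι ℂ H) (c : ι → ℂ) {M : ℝ} (hM : 0 ≤ M)
    (hc : ∀ i, ‖c i‖ ≤ M) :
    ∃ T : H →L[ℂ] H, ∀ x i, inner ℂ (b i) (T x) = c i * inner ℂ (b i) x := by
  have hle : ∀ (x : H) i, ‖c i * b.repr x i‖ ^ 2 ≤ M ^ 2 * ‖b.repr x i‖ ^ 2 := by
    intro x i
    rw [norm_mul, mul_pow]
    gcongr
    exact hc i
  have hsum : ∀ x : H, Summable fun i => M ^ 2 * ‖b.repr x i‖ ^ 2 := by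
    intro x
    have := (hilbert_parseval b x).summable.mul_left (M ^ 2)
    simpa [b.repr_apply_apply] using this
  have hmem : ∀ x : H, Memℓp (fun i => c i * b.repr x i) 2 := by
    intro x
    rw [memℓp_gen_iff (by norm_num)]
    have := Summable.of_nonneg_of_le (fun i => by positivity) (hle x) (hsum x)
    simpa using this
  let L : H →ₗ[ℂ] H :=
    { toFun := fun x => b.repr.symm ⟨fun i => c i * b.repr x i, hmem x⟩
      map_add' := by
        intro x y
        rw [← map_add]
        congr 1
        ext i
        change c i * b.repr (x + y) i = c i * b.repr x i + c i * b.repr y i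
        rw [map_add, lp.coeFn_add, Pi.add_apply, mul_add]
      map_smul' := by
        intro a x
        rw [RingHom.id_apply, ← map_smul]
        congr 1
        ext i
        change c i * b.repr (a • x) i = a * (c i * b.repr x i)
        rw [map_smul, lp.coeFn_smul, Pi.smul_apply, smul_eq_mul]
        ring }
  have hL : ∀ x i, inner ℂ (b i) (L x) = c i * inner ℂ (b i) x := by
    intro x i
    rw [← b.repr_apply_apply, ← b.repr_apply_apply]
    simp [L]
  refine ⟨L.mkContinuous M ?_, fun x i => hL x i⟩
  intro x
  refine (sq_le_sq₀ (norm_nonneg _) (by positivity)).1 ?_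
  rw [mul_pow]
  refine hasSum_le (fun i => ?_) (hilbert_parseval b (L x))
    ((hilbert_parseval b x).mul_left (M ^ 2))
  rw [hL, ← b.repr_apply_apply]
  exact hle x i

theorem norm_exp_neg_le_one {ν : ι → ℝ} (hν : ∀ i, 0 ≤ ν i) (t : ℝ) (i : ι) :
    ‖((Real.exp (-(ν i * max t 0)) : ℝ) : ℂ)‖ ≤ 1 := by
  rw [Complex.norm_real, Real.norm_eq_abs, abs_of_pos (Real.exp_pos _), Real.exp_le_one_iff]
  have := mul_nonneg (hν i) (le_max_right t 0)
  linarith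

/-- The semigroup `e^{-tΛ}` of the diagonal operator `Λ` with nonnegative eigenvalues `ν`, extended by
the identity to `t ≤ 0`. -/
def heat (b : HilbertBasis ι ℂ H) {ν : ι → ℝ} (hν : ∀ i, 0 ≤ ν i) (t : ℝ) : H →L[ℂ] H :=
  (exists_diagonal b (fun i => ((Real.exp (-(ν i * max t 0)) : ℝ) : ℂ)) zero_le_one
    (norm_exp_neg_le_one hν t)).choose

theorem inner_heat (b : HilbertBasis ι ℂ H) {ν : ι → ℝ} (hν : ∀ i, 0 ≤ ν i) (t : ℝ) (x : H) (i : ι) :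
    inner ℂ (b i) (heat b hν t x) = (Real.exp (-(ν i * max t 0)) : ℝ) * inner ℂ (b i) x :=
  (exists_diagonal b (fun i => ((Real.exp (-(ν i * max t 0)) : ℝ) : ℂ)) zero_le_one
    (norm_exp_neg_le_one hν t)).choose_spec x i

attribute [irreducible] heat

theorem inner_heat_of_nonneg (b : HilbertBasis ι ℂ H) {ν : ι → ℝ} (hν : ∀ i, 0 ≤ ν i) {t : ℝ}
    (ht : 0 ≤ t) (x : H) (i : ι) :
    inner ℂ (b i) (heat b hν t x) = (Real.exp (-(ν i * t)) : ℝ) * inner ℂ (b i) x := by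
  rw [inner_heat, max_eq_left ht]

theorem heat_of_nonpos (b : HilbertBasis ι ℂ H) {ν : ι → ℝ} (hν : ∀ i, 0 ≤ ν i) {t : ℝ}
    (ht : t ≤ 0) (x : H) : heat b hν t x = x := by
  refine hilbert_ext b fun i => ?_
  rw [inner_heat, max_eq_right ht]
  simp

theorem heat_basis (b : HilbertBasis ι ℂ H) {ν : ι → ℝ} (hν : ∀ i, 0 ≤ ν i) {t : ℝ}
    (ht : 0 ≤ t) (i : ι) : heat b hν t (b i) = ((Real.exp (-(ν i * t)) : ℝ) : ℂ) • b i := by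
  refine hilbert_ext b fun j => ?_
  rw [inner_heat_of_nonneg b hν ht, inner_smul_right]
  by_cases h : j = i
  · rw [h]
  · rw [b.orthonormal.2 h]; simp

theorem norm_heat_le (b : HilbertBasis ι ℂ H) {ν : ι → ℝ} (hν : ∀ i, 0 ≤ ν i) {K : ℝ}
    (hK : ∀ i, K ≤ ν i) {t : ℝ} (ht : 0 ≤ t) (x : H) :
    ‖heat b hν t x‖ ≤ Real.exp (-(K * t)) * ‖x‖ := by
  refine (sq_le_sq₀ (norm_nonneg _) (by positivity)).1 ?_
  rw [mul_pow]
  refine hasSum_le (fun i => ?_) (hilbert_parseval b _) ((hilbert_parseval b x).mul_left _)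
  rw [inner_heat_of_nonneg b hν ht, norm_mul, mul_pow, Complex.norm_real, Real.norm_eq_abs,
    abs_of_pos (Real.exp_pos _)]
  gcongr
  exact hK i

theorem norm_heat_le_norm (b : HilbertBasis ι ℂ H) {ν : ι → ℝ} (hν : ∀ i, 0 ≤ ν i) (t : ℝ) (x : H) :
    ‖heat b hν t x‖ ≤ ‖x‖ := by
  rcases le_total 0 t with ht | ht
  · simpa using norm_heat_le b hν hν ht x
  · rw [heat_of_nonpos b hν ht]

/-- Dominated convergence in Parseval's series: the difference of two exponential factors is at most
`1` in absolute value. -/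
theorem continuous_heat_apply (b : HilbertBasis ι ℂ H) {ν : ι → ℝ} (hν : ∀ i, 0 ≤ ν i) (x : H) :
    Continuous fun t => heat b hν t x := by
  rw [continuous_iff_continuousAt]
  intro t
  rw [ContinuousAt, tendsto_iff_norm_sub_tendsto_zero]
  have hsq : Tendsto (fun s => ‖heat b hν s x - heat b hν t x‖ ^ 2) (𝓝 t) (𝓝 0) := by
    have hform : ∀ s, ‖heat b hν s x - heat b hν t x‖ ^ 2 =
        ∑' i, (Real.exp (-(ν i * max s 0)) - Real.exp (-(ν i * max t 0))) ^ 2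
          * ‖inner ℂ (b i) x‖ ^ 2 := by
      intro s
      rw [← (hilbert_parseval b _).tsum_eq]
      congr 1
      ext i
      rw [inner_sub_right, inner_heat, inner_heat, ← sub_mul, norm_mul, mul_pow,
        ← Complex.ofReal_sub, Complex.norm_real, Real.norm_eq_abs, sq_abs]
    simp_rw [hform]
    have h0 : ∑' i, (Real.exp (-(ν i * max t 0)) - Real.exp (-(ν i * max t 0))) ^ 2
          * ‖inner ℂ (b i) x‖ ^ 2 = 0 := by simp
    refine Eq.subst (motive := fun l => Tendsto _ (𝓝 t) (𝓝 l)) h0 ?_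
    refine tendsto_tsum_of_dominated_convergence (hilbert_parseval b x).summable ?_ ?_
    · intro i
      have : Continuous fun s : ℝ => (Real.exp (-(ν i * max s 0)) - Real.exp (-(ν i * max t 0))) ^ 2
          * ‖inner ℂ (b i) x‖ ^ 2 := by fun_prop
      exact this.tendsto t
    · refine Eventually.of_forall fun s i => ?_
      rw [Real.norm_eq_abs, abs_of_nonneg (by positivity)]
      have e1 : Real.exp (-(ν i * max s 0)) ≤ 1 := by
        rw [Real.exp_le_one_iff]
        have := mul_nonneg (hν i) (le_max_right s 0)
        linarith
      have e2 : Real.exp (-(ν i * max t 0)) ≤ 1 := by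
        rw [Real.exp_le_one_iff]
        have := mul_nonneg (hν i) (le_max_right t 0)
        linarith
      have p1 := Real.exp_pos (-(ν i * max s 0))
      have p2 := Real.exp_pos (-(ν i * max t 0))
      have : (Real.exp (-(ν i * max s 0)) - Real.exp (-(ν i * max t 0))) ^ 2 ≤ 1 := by
        rw [sq_le_one_iff_abs_le_one, abs_le]
        constructor <;> linarith
      exact mul_le_of_le_one_left (by positivity) this
  have h2 := hsq.sqrt
  simpa [Real.sqrt_sq] using h2

/-- Strong continuity together with the uniform bound `1` on the operator norms gives joint
continuity. -/
theorem continuous_heat (b : HilbertBasis ι ℂ H) {ν : ι → ℝ} (hν : ∀ i, 0 ≤ ν i) :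
    Continuous fun p : ℝ × H => heat b hν p.1 p.2 := by
  rw [continuous_iff_continuousAt]
  rintro ⟨t, x⟩
  rw [ContinuousAt, tendsto_iff_norm_sub_tendsto_zero]
  have h1 : Tendsto (fun p : ℝ × H => ‖p.2 - x‖ + ‖heat b hν p.1 x - heat b hν t x‖) (𝓝 (t, x))
      (𝓝 0) := by
    have c : Continuous fun p : ℝ × H => ‖p.2 - x‖ + ‖heat b hν p.1 x - heat b hν t x‖ := by
      have := continuous_heat_apply b hν x
      fun_prop
    simpa using c.tendsto (t, x)
  refine squeeze_zero (fun p => norm_nonneg _) (fun p => ?_) h1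
  calc ‖heat b hν p.1 p.2 - heat b hν t x‖
      = ‖heat b hν p.1 (p.2 - x) + (heat b hν p.1 x - heat b hν t x)‖ := by
        rw [map_sub]; congr 1; abel
    _ ≤ ‖heat b hν p.1 (p.2 - x)‖ + ‖heat b hν p.1 x - heat b hν t x‖ := norm_add_le _ _
    _ ≤ _ := by gcongr; exact norm_heat_le_norm b hν _ _

theorem continuousOn_heat (b : HilbertBasis ι ℂ H) {ν : ι → ℝ} (hν : ∀ i, 0 ≤ ν i)
    {X : Type*} [TopologicalSpace X] {s : Set X} {f : X → ℝ} {F : X → H} (hf : ContinuousOn f s)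
    (hF : ContinuousOn F s) : ContinuousOn (fun x => heat b hν (f x) (F x)) s :=
  Continuous.comp_continuousOn (g := fun p : ℝ × H => heat b hν p.1 p.2)
    (continuous_heat b hν) (hf.prodMk hF)

/-! ### Inhomogeneous evolution equations -/

/-- `u` solves `u' = -Λ u + F` on `[σ, τ]` in the coordinates of the basis `b`, where `Λ` is diagonal
with eigenvalues `ν`. -/
structure LinSol (b : HilbertBasis ι ℂ H) (ν : ι → ℝ) (σ τ : ℝ) (u F : ℝ → H) : Prop where
  cont : ContinuousOn u (Icc σ τ)
  contF : ContinuousOn F (Icc σ τ)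
  deriv : ∀ i, ∀ t ∈ Icc σ τ, HasDerivWithinAt (fun s => inner ℂ (b i) (u s))
    (-(ν i : ℂ) * inner ℂ (b i) (u t) + inner ℂ (b i) (F t)) (Icc σ τ) t

namespace LinSol

variable {b : HilbertBasis ι ℂ H} {ν : ι → ℝ} {σ τ : ℝ} {u v F G : ℝ → H}

theorem mono (h : LinSol b ν σ τ u F) {σ' τ' : ℝ} (hσ : σ ≤ σ') (hτ : τ' ≤ τ) :
    LinSol b ν σ' τ' u F :=
  have hs : Icc σ' τ' ⊆ Icc σ τ := Icc_subset_Icc hσ hτ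
  ⟨h.cont.mono hs, h.contF.mono hs, fun i t ht => (h.deriv i t (hs ht)).mono hs⟩

theorem congr (h : LinSol b ν σ τ u F) (hu : ∀ t ∈ Icc σ τ, v t = u t)
    (hF : ∀ t ∈ Icc σ τ, G t = F t) : LinSol b ν σ τ v G := by
  refine ⟨h.cont.congr hu, h.contF.congr hF, fun i t ht => ?_⟩
  rw [hu t ht, hF t ht]
  exact (h.deriv i t ht).congr (fun s hs => by rw [hu s hs]) (by rw [hu t ht])

theorem sub (h : LinSol b ν σ τ u F) (h' : LinSol b ν σ τ v G) :
    LinSol b ν σ τ (fun t => u t - v t) (fun t => F t - G t) := by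
  refine ⟨h.cont.sub h'.cont, h.contF.sub h'.contF, fun i t ht => ?_⟩
  simp only [inner_sub_right]
  refine ((h.deriv i t ht).fun_sub (h'.deriv i t ht)).congr_deriv ?_
  ring

theorem add (h : LinSol b ν σ τ u F) (h' : LinSol b ν σ τ v G) :
    LinSol b ν σ τ (fun t => u t + v t) (fun t => F t + G t) := by
  refine ⟨h.cont.add h'.cont, h.contF.add h'.contF, fun i t ht => ?_⟩
  simp only [inner_add_right]
  refine ((h.deriv i t ht).fun_add (h'.deriv i t ht)).congr_deriv ?_
  ring

theorem const_smul (h : LinSol b ν σ τ u F) (c : ℂ) :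
    LinSol b ν σ τ (fun t => c • u t) (fun t => c • F t) := by
  refine ⟨h.cont.const_smul c, h.contF.const_smul c, fun i t ht => ?_⟩
  simp only [inner_smul_right]
  refine ((h.deriv i t ht).const_mul c).congr_deriv ?_
  ring

/-- Moving a constant from the operator to the source. -/
theorem shift (h : LinSol b ν σ τ u F) (c : ℝ) :
    LinSol b (fun i => ν i + c) σ τ u (fun t => F t + (c : ℂ) • u t) := by
  refine ⟨h.cont, h.contF.add (h.cont.const_smul _), fun i t ht => ?_⟩
  convert h.deriv i t ht using 1
  rw [inner_add_right, inner_smul_right]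
  push_cast
  ring

/-- Exponential rescaling. -/
theorem rescale (h : LinSol b ν σ τ u F) (c a : ℝ) :
    LinSol b (fun i => ν i + c) σ τ (fun t => ((Real.exp (-c * (t - a)) : ℝ) : ℂ) • u t)
      (fun t => ((Real.exp (-c * (t - a)) : ℝ) : ℂ) • F t) := by
  have hc : Continuous fun t : ℝ => ((Real.exp (-c * (t - a)) : ℝ) : ℂ) := by fun_prop
  refine ⟨hc.continuousOn.smul h.cont, hc.continuousOn.smul h.contF, fun i t ht => ?_⟩
  simp only [inner_smul_right]
  have hd : HasDerivAt (fun t : ℝ => ((Real.exp (-c * (t - a)) : ℝ) : ℂ))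
      ((-c * Real.exp (-c * (t - a)) : ℝ) : ℂ) t := by
    have := (((hasDerivAt_id t).sub_const a).const_mul (-c)).exp.ofReal_comp
    refine this.congr_deriv ?_
    simp only [id]
    push_cast
    ring
  refine (hd.hasDerivWithinAt.fun_mul (h.deriv i t ht)).congr_deriv ?_
  push_cast
  ring

/-- Transport by an operator that intertwines the coordinates. -/
theorem map {H' : Type*} [NormedAddCommGroup H'] [InnerProductSpace ℂ H'] {κ : Type*}
    {b' : HilbertBasis κ ℂ H'} {ν' : κ → ℝ} (h : LinSol b ν σ τ u F) (T : H →L[ℂ] H') (f : κ → ι)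
    (hT : ∀ x k, inner ℂ (b' k) (T x) = inner ℂ (b (f k)) x) (hν : ∀ k, ν' k = ν (f k)) :
    LinSol b' ν' σ τ (fun t => T (u t)) (fun t => T (F t)) := by
  refine ⟨T.continuous.comp_continuousOn h.cont, T.continuous.comp_continuousOn h.contF,
    fun k t ht => ?_⟩
  simp only [hT, hν]
  exact h.deriv (f k) t ht

end LinSol

theorem hasDerivWithinAt_of_eq_integral {V : Type*} [NormedAddCommGroup V] [NormedSpace ℝ V]
    [CompleteSpace V] {f y : ℝ → V} {σ τ : ℝ} {y₀ : V} (hf : ContinuousOn f (Icc σ τ))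
    (hy : ∀ t ∈ Icc σ τ, y t = y₀ + ∫ s in σ..t, f s) {t : ℝ} (ht : t ∈ Icc σ τ) :
    HasDerivWithinAt y (f t) (Icc σ τ) t := by
  have hst : σ ≤ τ := ht.1.trans ht.2
  -- Extending `f` by its endpoint values makes it continuous on the line, so the two-sided
  -- fundamental theorem applies at the endpoints as well.
  let g : ℝ → V := fun s => f (projIcc σ τ hst s)
  have hg : Continuous g := by
    have h1 : Continuous ((Icc σ τ).domRestrict f) := continuousOn_iff_continuous_domRestrict.1 hf
    exact h1.comp continuous_projIcc
  have hgf : ∀ s ∈ Icc σ τ, g s = f s := fun s hs => by simp [g, projIcc_of_mem hst hs]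
  have hd : HasDerivAt (fun t => y₀ + ∫ s in σ..t, g s) (g t) t :=
    (intervalIntegral.integral_hasDerivAt_right (hg.intervalIntegrable _ _)
      (hg.stronglyMeasurableAtFilter _ _) hg.continuousAt).const_add y₀
  have hyg : ∀ t ∈ Icc σ τ, y t = y₀ + ∫ s in σ..t, g s := by
    intro r hr
    rw [hy r hr]
    congr 1
    refine intervalIntegral.integral_congr fun s hs => ?_
    rw [uIcc_of_le hr.1] at hs
    exact (hgf s ⟨hs.1, hs.2.trans hr.2⟩).symm
  rw [← hgf t ht]
  exact hd.hasDerivWithinAt.congr hyg (hyg t ht)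

theorem integral_eq_of_hasDerivWithinAt {V : Type*} [NormedAddCommGroup V] [NormedSpace ℝ V]
    [CompleteSpace V] {y y' : ℝ → V} {σ τ : ℝ} (hst : σ ≤ τ)
    (hy : ∀ t ∈ Icc σ τ, HasDerivWithinAt y (y' t) (Icc σ τ) t) (hy' : ContinuousOn y' (Icc σ τ)) :
    ∫ s in σ..τ, y' s = y τ - y σ := by
  refine intervalIntegral.integral_eq_sub_of_hasDerivAt_of_le hst
    (fun t ht => (hy t ht).continuousWithinAt) (fun t ht => ?_)
    (hy'.intervalIntegrable_of_Icc hst)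
  exact (hy t (Ioo_subset_Icc_self ht)).hasDerivAt (Icc_mem_nhds ht.1 ht.2)

/-! ### The energy estimate and uniqueness -/

section Energy

variable [Countable ι]

/-- The energy identity is derived for each coordinate, since `u` need not be differentiable in `H`.
The term `-ν i |c i|²` is dropped: it is nonpositive, or the coordinate vanishes. The inequalities
are summed over finite sets of indices, and dominated convergence then restores the inner product
with the full source. -/
theorem LinSol.norm_le_of_nonneg {b : HilbertBasis ι ℂ H} {ν : ι → ℝ} {σ τ : ℝ} {u F : ℝ → H}
    (h : LinSol b ν σ τ u F) (hst : σ ≤ τ)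
    (hu : ∀ t ∈ Icc σ τ, ∀ i, ν i < 0 → inner ℂ (b i) (u t) = 0)
    (hF : ∀ t ∈ Icc σ τ, (inner ℂ (u t) (F t) : ℂ).re ≤ 0) : ‖u τ‖ ≤ ‖u σ‖ := by
  let c : ι → ℝ → ℂ := fun i t => inner ℂ (b i) (u t)
  let f : ι → ℝ → ℂ := fun i t => inner ℂ (b i) (F t)
  have hc : ∀ i, ContinuousOn (c i) (Icc σ τ) := fun i =>
    (innerSL ℂ (b i)).continuous.comp_continuousOn h.cont
  have hf : ∀ i, ContinuousOn (f i) (Icc σ τ) := fun i =>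
    (innerSL ℂ (b i)).continuous.comp_continuousOn h.contF
  have hd : ∀ i, ∀ t ∈ Icc σ τ, HasDerivWithinAt (fun s => ‖c i s‖ ^ 2)
      (2 * inner ℝ (c i t) (-(ν i : ℂ) * c i t + f i t)) (Icc σ τ) t := fun i t ht =>
    (h.deriv i t ht).norm_sq
  have hcont : ∀ i, ContinuousOn
      (fun t => 2 * inner ℝ (c i t) (-(ν i : ℂ) * c i t + f i t)) (Icc σ τ) := by
    intro i
    have h1 := hc i
    have h2 := hf i
    exact continuousOn_const.mul (h1.inner (𝕜 := ℝ) ((continuousOn_const.mul h1).add h2))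
  have hint : ∀ i, ‖c i τ‖ ^ 2 - ‖c i σ‖ ^ 2 ≤ ∫ s in σ..τ, 2 * (inner ℂ (u s) (b i) * f i s).re := by
    intro i
    rw [← integral_eq_of_hasDerivWithinAt hst (hd i) (hcont i)]
    refine intervalIntegral.integral_mono_on hst ((hcont i).intervalIntegrable_of_Icc hst) ?_ ?_
    · refine ContinuousOn.intervalIntegrable_of_Icc hst ?_
      have h1 : ContinuousOn (fun s => inner ℂ (u s) (b i)) (Icc σ τ) :=
        h.cont.inner (𝕜 := ℂ) continuousOn_const
      exact continuousOn_const.mul (Complex.continuous_re.comp_continuousOn (h1.mul (hf i)))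
    · intro t ht
      have e : inner ℂ (u t) (b i) = (starRingEnd ℂ) (c i t) := (inner_conj_symm _ _).symm
      rw [e]
      have : inner ℝ (c i t) (-(ν i : ℂ) * c i t + f i t)
          = -(ν i) * ‖c i t‖ ^ 2 + ((starRingEnd ℂ) (c i t) * f i t).re := by
        rw [Complex.inner, Complex.sq_norm, Complex.normSq_apply]
        simp
        ring
      rw [this]
      have h0 : 0 ≤ ν i * ‖c i t‖ ^ 2 := by
        rcases lt_or_ge (ν i) 0 with hn | hn
        · simp [c, hu t ht i hn]
        · positivity
      nlinarith
  have hJ : ∀ J : Finset ι, ∑ i ∈ J, (‖c i τ‖ ^ 2 - ‖c i σ‖ ^ 2)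
      ≤ ∫ s in σ..τ, 2 * (∑ i ∈ J, inner ℂ (u s) (b i) * f i s).re := by
    intro J
    refine (Finset.sum_le_sum fun i _ => hint i).trans (le_of_eq ?_)
    rw [← intervalIntegral.integral_finsetSum]
    · refine intervalIntegral.integral_congr fun s _ => ?_
      simp only [Complex.re_sum, Finset.mul_sum]
    · intro i _
      refine ContinuousOn.intervalIntegrable_of_Icc hst ?_
      have h1 : ContinuousOn (fun s => inner ℂ (u s) (b i)) (Icc σ τ) :=
        h.cont.inner (𝕜 := ℂ) continuousOn_const
      exact continuousOn_const.mul (Complex.continuous_re.comp_continuousOn (h1.mul (hf i)))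
  have hl : Tendsto (fun J : Finset ι => ∑ i ∈ J, (‖c i τ‖ ^ 2 - ‖c i σ‖ ^ 2)) atTop
      (𝓝 (‖u τ‖ ^ 2 - ‖u σ‖ ^ 2)) :=
    (hilbert_parseval b (u τ)).sub (hilbert_parseval b (u σ))
  have hr : Tendsto (fun J : Finset ι => ∫ s in σ..τ, 2 * (∑ i ∈ J, inner ℂ (u s) (b i) * f i s).re)
      atTop (𝓝 (∫ s in σ..τ, 2 * (inner ℂ (u s) (F s) : ℂ).re)) := by
    refine intervalIntegral.tendsto_integral_filter_of_dominated_convergence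
      (fun s => 2 * (‖u s‖ ^ 2 + ‖F s‖ ^ 2)) ?_ ?_ ?_ ?_
    · refine Eventually.of_forall fun J => ?_
      have : ContinuousOn (fun s => 2 * (∑ i ∈ J, inner ℂ (u s) (b i) * f i s).re) (Icc σ τ) := by
        refine continuousOn_const.mul (Complex.continuous_re.comp_continuousOn ?_)
        refine continuousOn_finsetSum _ fun i _ => ?_
        exact (h.cont.inner (𝕜 := ℂ) continuousOn_const).mul (hf i)
      rw [uIoc_of_le hst]
      exact (this.mono Ioc_subset_Icc_self).aestronglyMeasurable measurableSet_Ioc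
    · refine Eventually.of_forall fun J => Eventually.of_forall fun s _ => ?_
      rw [Real.norm_eq_abs, abs_mul, abs_two]
      gcongr
      exact (Complex.abs_re_le_norm _).trans (hilbert_partial_inner_le b J _ _)
    · refine ContinuousOn.intervalIntegrable_of_Icc hst ?_
      exact continuousOn_const.mul ((h.cont.norm.pow 2).add (h.contF.norm.pow 2))
    · refine Eventually.of_forall fun s _ => ?_
      have := (Complex.continuous_re.tendsto _).comp (b.hasSum_inner_mul_inner (u s) (F s))
      exact this.const_mul 2
  have hfin := le_of_tendsto_of_tendsto' hl hr hJ
  have hneg : ∫ s in σ..τ, 2 * (inner ℂ (u s) (F s) : ℂ).re ≤ 0 := by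
    rw [← neg_nonneg, ← intervalIntegral.integral_neg]
    refine intervalIntegral.integral_nonneg hst fun s hs => ?_
    linarith [hF s hs]
  refine (sq_le_sq₀ (norm_nonneg _) (norm_nonneg _)).1 ?_
  linarith

/-- The energy estimate: exponential decay with the rate of the lowest mode present. -/
theorem LinSol.norm_le {b : HilbertBasis ι ℂ H} {ν : ι → ℝ} {σ τ : ℝ} {u F : ℝ → H}
    (h : LinSol b ν σ τ u F) (hst : σ ≤ τ) (γ : ℝ)
    (hu : ∀ t ∈ Icc σ τ, ∀ i, ν i < γ → inner ℂ (b i) (u t) = 0)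
    (hF : ∀ t ∈ Icc σ τ, (inner ℂ (u t) (F t) : ℂ).re ≤ 0) :
    ‖u τ‖ ≤ Real.exp (-γ * (τ - σ)) * ‖u σ‖ := by
  -- Multiplying by `e^{γ(t-σ)}` lowers all eigenvalues by `γ`, so the modes that are present have
  -- nonnegative ones.
  have h1 := (h.rescale (-γ) σ).norm_le_of_nonneg hst (fun t ht i hi => by
      rw [inner_smul_right, hu t ht i (by linarith), mul_zero]) (fun t ht => by
      rw [inner_smul_left, inner_smul_right, Complex.conj_ofReal, ← mul_assoc, ← Complex.ofReal_mul,
        Complex.re_ofReal_mul]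
      exact mul_nonpos_of_nonneg_of_nonpos (by positivity) (hF t ht))
  simp only [sub_self, mul_zero, Real.exp_zero, Complex.ofReal_one, one_smul, norm_smul,
    Complex.norm_real, Real.norm_eq_abs, Real.abs_exp, neg_neg] at h1
  calc ‖u τ‖ = Real.exp (-γ * (τ - σ)) * (Real.exp (γ * (τ - σ)) * ‖u τ‖) := by
        rw [← mul_assoc, ← Real.exp_add]; simp
    _ ≤ _ := by gcongr

/-- The difference has zero data and source `-B (u - v)`, whose inner product with `u - v` has
nonpositive real part; the energy estimate with rate `-m` forces it to vanish. -/
theorem LinSol.unique {b : HilbertBasis ι ℂ H} {ν : ι → ℝ} {σ τ m : ℝ} {u v F : ℝ → H}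
    {B : ℝ → H →L[ℂ] H} (hm : ∀ i, -m ≤ ν i)
    (hB : ∀ s ∈ Icc σ τ, ∀ x, 0 ≤ (inner ℂ x (B s x) : ℂ).re)
    (hu : LinSol b ν σ τ u (fun s => -(B s (u s)) + F s))
    (hv : LinSol b ν σ τ v (fun s => -(B s (v s)) + F s))
    (h0 : u σ = v σ) : ∀ t ∈ Icc σ τ, u t = v t := by
  intro t ht
  have h1 := ((hu.sub hv).mono le_rfl ht.2).norm_le ht.1 (-m)
    (fun s _ i hi => absurd hi (not_lt.2 (hm i))) (fun s hs => by
      have e : -(B s (u s)) + F s - (-(B s (v s)) + F s) = -(B s (u s - v s)) := by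
        rw [map_sub]; abel
      rw [e, inner_neg_right, Complex.neg_re]
      linarith [hB s ⟨hs.1, hs.2.trans ht.2⟩ (u s - v s)])
  simp only [h0, sub_self, norm_zero, mul_zero] at h1
  exact sub_eq_zero.1 (norm_le_zero_iff.1 h1)

end Energy

variable [CompleteSpace H]

theorem inner_intervalIntegral (x : H) {f : ℝ → H} {a c : ℝ}
    (hf : IntervalIntegrable f volume a c) :
    inner ℂ x (∫ s in a..c, f s) = ∫ s in a..c, inner ℂ x (f s) := by
  rw [intervalIntegral, intervalIntegral, inner_sub_right, integral_inner hf.1, integral_inner hf.2]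

/-- In each coordinate, integrate the derivative of `e^{-ν i (τ-s)} ⟨b i, u s⟩`, in which the
diagonal terms cancel. -/
theorem LinSol.duhamel {b : HilbertBasis ι ℂ H} {ν : ι → ℝ} (hν : ∀ i, 0 ≤ ν i) {σ τ : ℝ}
    {u F : ℝ → H} (h : LinSol b ν σ τ u F) (hst : σ ≤ τ) :
    u τ = heat b hν (τ - σ) (u σ) + ∫ s in σ..τ, heat b hν (τ - s) (F s) := by
  have hcF : ContinuousOn (fun s => heat b hν (τ - s) (F s)) (Icc σ τ) :=
    continuousOn_heat b hν (continuousOn_const.sub continuousOn_id) h.contF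
  refine hilbert_ext b fun i => ?_
  rw [inner_add_right, inner_heat_of_nonneg b hν (sub_nonneg.2 hst)]
  have e1 : inner ℂ (b i) (∫ s in σ..τ, heat b hν (τ - s) (F s))
      = ∫ s in σ..τ, inner ℂ (b i) (heat b hν (τ - s) (F s)) :=
    inner_intervalIntegral _ (hcF.intervalIntegrable_of_Icc hst)
  rw [e1]
  have hder : ∀ t ∈ Icc σ τ, HasDerivWithinAt
      (fun s => ((Real.exp (-(ν i * (τ - s))) : ℝ) : ℂ) * inner ℂ (b i) (u s))
      (inner ℂ (b i) (heat b hν (τ - t) (F t))) (Icc σ τ) t := by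
    intro t ht
    have hd : HasDerivAt (fun s : ℝ => ((Real.exp (-(ν i * (τ - s))) : ℝ) : ℂ))
        ((ν i * Real.exp (-(ν i * (τ - t))) : ℝ) : ℂ) t := by
      have := ((((hasDerivAt_id t).const_sub τ).const_mul (ν i)).neg).exp.ofReal_comp
      refine this.congr_deriv ?_
      simp only [id, Pi.neg_apply]
      push_cast
      ring
    refine (hd.hasDerivWithinAt.fun_mul (h.deriv i t ht)).congr_deriv ?_
    rw [inner_heat_of_nonneg b hν (sub_nonneg.2 ht.2)]
    push_cast
    ring
  have := integral_eq_of_hasDerivWithinAt hst hder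
    ((innerSL ℂ (b i)).continuous.comp_continuousOn hcF)
  rw [this]
  simp

theorem linSol_of_duhamel (b : HilbertBasis ι ℂ H) {ν : ι → ℝ} (hν : ∀ i, 0 ≤ ν i) {σ τ : ℝ}
    (g : H) {u F : ℝ → H} (hF : Continuous F)
    (hu : ∀ t ∈ Icc σ τ, u t = heat b hν (t - σ) g + ∫ s in σ..t, heat b hν (t - s) (F s)) :
    LinSol b ν σ τ u F := by
  have hjoint : Continuous (Function.uncurry fun t s : ℝ => heat b hν (t - s) (F s)) := by
    rw [← continuousOn_univ]
    exact continuousOn_heat b hν (f := fun p : ℝ × ℝ => p.1 - p.2) (F := fun p => F p.2)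
      (by fun_prop) (by fun_prop)
  refine ⟨?_, hF.continuousOn, fun i t ht => ?_⟩
  · refine ContinuousOn.congr (Continuous.continuousOn ?_) hu
    have h1 := intervalIntegral.continuous_parametric_intervalIntegral_of_continuous
      (μ := volume) (a₀ := σ) hjoint continuous_id
    have h2 : Continuous fun t => heat b hν (t - σ) g :=
      (continuous_heat_apply b hν g).comp (by fun_prop)
    exact h2.add h1
  -- With `e^{-ν i t}` factored out, `t` occurs in the integral only as an endpoint, so no
  -- differentiation under the integral sign is needed.
  · have hform : ∀ t ∈ Icc σ τ, inner ℂ (b i) (u t) = ((Real.exp (-(ν i * t)) : ℝ) : ℂ) *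
        (((Real.exp (ν i * σ) : ℝ) : ℂ) * inner ℂ (b i) g
          + ∫ s in σ..t, ((Real.exp (ν i * s) : ℝ) : ℂ) * inner ℂ (b i) (F s)) := by
      intro t ht
      rw [hu t ht, inner_add_right, inner_heat_of_nonneg b hν (sub_nonneg.2 ht.1), mul_add]
      have hci : Continuous fun s => heat b hν (t - s) (F s) :=
        hjoint.comp (Continuous.prodMk continuous_const continuous_id)
      have e1 : inner ℂ (b i) (∫ s in σ..t, heat b hν (t - s) (F s))
          = ∫ s in σ..t, inner ℂ (b i) (heat b hν (t - s) (F s)) :=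
        inner_intervalIntegral _ (hci.intervalIntegrable _ _)
      rw [e1, ← intervalIntegral.integral_const_mul]
      congr 1
      · rw [← mul_assoc, ← Complex.ofReal_mul, ← Real.exp_add]
        ring_nf
      · refine intervalIntegral.integral_congr fun s hs => ?_
        rw [uIcc_of_le ht.1] at hs
        rw [inner_heat_of_nonneg b hν (sub_nonneg.2 hs.2), ← mul_assoc, ← Complex.ofReal_mul,
          ← Real.exp_add]
        ring_nf
    have hci : Continuous fun s => ((Real.exp (ν i * s) : ℝ) : ℂ) * inner ℂ (b i) (F s) := by
      have : Continuous fun s => inner ℂ (b i) (F s) := (innerSL ℂ (b i)).continuous.comp hF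
      fun_prop
    have hd1 : HasDerivAt (fun t : ℝ => ((Real.exp (-(ν i * t)) : ℝ) : ℂ))
        ((-(ν i) * Real.exp (-(ν i * t)) : ℝ) : ℂ) t := by
      have := (((hasDerivAt_id t).const_mul (ν i)).neg).exp.ofReal_comp
      refine this.congr_deriv ?_
      simp only [id, Pi.neg_apply]
      push_cast
      ring
    have hd2 : HasDerivAt (fun t => ((Real.exp (ν i * σ) : ℝ) : ℂ) * inner ℂ (b i) g
          + ∫ s in σ..t, ((Real.exp (ν i * s) : ℝ) : ℂ) * inner ℂ (b i) (F s))
          (((Real.exp (ν i * t) : ℝ) : ℂ) * inner ℂ (b i) (F t)) t :=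
      (intervalIntegral.integral_hasDerivAt_right (hci.intervalIntegrable _ _)
        (hci.stronglyMeasurableAtFilter _ _) hci.continuousAt).const_add _
    have hd := ((hd1.fun_mul hd2).hasDerivWithinAt (s := Icc σ τ)).congr hform (hform t ht)
    refine hd.congr_deriv ?_
    rw [hform t ht, ← mul_assoc ((Real.exp (-(ν i * t)) : ℝ) : ℂ) ((Real.exp (ν i * t) : ℝ) : ℂ),
      ← Complex.ofReal_mul (Real.exp (-(ν i * t))) (Real.exp (ν i * t)), ← Real.exp_add]
    simp
    ring

end Abstract

/-! ### Existence by Volterra iteration -/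

section Volterra

variable {H : Type*} [NormedAddCommGroup H] [InnerProductSpace ℂ H] [CompleteSpace H] {ι : Type*}

theorem continuous_comp_projIcc {X : Type*} [TopologicalSpace X] {σ τ : ℝ} (hst : σ ≤ τ) {f : ℝ → X}
    (hf : ContinuousOn f (Icc σ τ)) : Continuous fun s => f (projIcc σ τ hst s) :=
  Continuous.comp (g := (Icc σ τ).domRestrict f)
    (continuousOn_iff_continuous_domRestrict.1 hf) continuous_projIcc

theorem continuous_comp_projIcc_coe {X : Type*} [TopologicalSpace X] {σ τ : ℝ} (hst : σ ≤ τ)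
    (w : C(Icc σ τ, X)) : Continuous fun s => w (projIcc σ τ hst s) :=
  w.continuous.comp continuous_projIcc

theorem integral_exp_rate (K t σ : ℝ) :
    ∫ s in σ..t, K * Real.exp (-(K * (t - s))) = 1 - Real.exp (-(K * (t - σ))) := by
  have hd : ∀ s ∈ uIcc σ t, HasDerivAt (fun s => Real.exp (-(K * (t - s))))
      (K * Real.exp (-(K * (t - s)))) s := by
    intro s _
    have := ((((hasDerivAt_id s).const_sub t).const_mul K).neg).exp
    refine this.congr_deriv ?_
    simp only [id, Pi.neg_apply]
    ring
  rw [intervalIntegral.integral_eq_sub_of_hasDerivAt hd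
    (Continuous.intervalIntegrable (by fun_prop) _ _)]
  simp

/-- The Volterra equation `u(t) = e^{-(t-σ)Λ} g + ∫ e^{-(t-s)Λ} G(s, u(s)) ds` with a source of Lipschitz
constant not exceeding the decay rate of the semigroup is solvable, and its solution stays in every
family of closed sets preserved by the integral operator. -/
theorem exists_volterra (b : HilbertBasis ι ℂ H) {ν : ι → ℝ} (hν : ∀ i, 0 ≤ ν i) {K : ℝ}
    (hK : 0 < K) (hKν : ∀ i, K ≤ ν i) {σ τ : ℝ} (hst : σ ≤ τ) (g : H) {G : ℝ → H → H}
    (hG : Continuous fun p : ℝ × H => G p.1 p.2)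
    (hL : ∀ s ∈ Icc σ τ, ∀ x y, ‖G s x - G s y‖ ≤ K * ‖x - y‖)
    {C : ℝ → Set H} (hC : ∀ t ∈ Icc σ τ, IsClosed (C t))
    (u₀ : ℝ → H) (hu₀ : ContinuousOn u₀ (Icc σ τ)) (hu₀C : ∀ t ∈ Icc σ τ, u₀ t ∈ C t)
    (hinv : ∀ v : ℝ → H, Continuous v → (∀ t ∈ Icc σ τ, v t ∈ C t) → ∀ t ∈ Icc σ τ,
      heat b hν (t - σ) g + ∫ s in σ..t, heat b hν (t - s) (G s (v s)) ∈ C t) :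
    ∃ u : ℝ → H, LinSol b ν σ τ u (fun s => G s (u s)) ∧ u σ = g ∧ ∀ t ∈ Icc σ τ, u t ∈ C t := by
  let ext : C(Icc σ τ, H) → ℝ → H := fun w s => w (projIcc σ τ hst s)
  have hext : ∀ w, Continuous (ext w) := continuous_comp_projIcc_coe hst
  have hGc : ∀ v : ℝ → H, Continuous v → Continuous fun s => G s (v s) := fun v hv =>
    Continuous.comp (g := fun p : ℝ × H => G p.1 p.2) hG (continuous_id.prodMk hv)
  have hj : ∀ v : ℝ → H, Continuous v →
      Continuous (Function.uncurry fun t s : ℝ => heat b hν (t - s) (G s (v s))) := by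
    intro v hv
    rw [← continuousOn_univ]
    have := hGc v hv
    exact continuousOn_heat b hν (f := fun p : ℝ × ℝ => p.1 - p.2) (F := fun p => G p.2 (v p.2))
      (by fun_prop) (this.comp continuous_snd).continuousOn
  let Ψ : (ℝ → H) → ℝ → H := fun v t =>
    heat b hν (t - σ) g + ∫ s in σ..t, heat b hν (t - s) (G s (v s))
  have hΨ : ∀ v, Continuous v → Continuous (Ψ v) := by
    intro v hv
    have h1 := intervalIntegral.continuous_parametric_intervalIntegral_of_continuous
      (μ := volume) (a₀ := σ) (hj v hv) continuous_id
    have h2 : Continuous fun t => heat b hν (t - σ) g :=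
      (continuous_heat_apply b hν g).comp (by fun_prop)
    exact h2.add h1
  let Φ : C(Icc σ τ, H) → C(Icc σ τ, H) := fun w =>
    ⟨fun t => Ψ (ext w) t, (hΨ _ (hext w)).comp continuous_subtype_val⟩
  -- The Lipschitz constant `K` times `∫ e^{-K(t-s)} ds` is `1 - e^{-K(t-σ)}`, always below `1`. The
  -- contraction therefore works on the whole interval without cutting it into short pieces.
  let q : ℝ := 1 - Real.exp (-(K * (τ - σ)))
  have hq0 : 0 ≤ q := by
    have : Real.exp (-(K * (τ - σ))) ≤ 1 := by
      rw [Real.exp_le_one_iff]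
      have := mul_nonneg hK.le (sub_nonneg.2 hst)
      linarith
    simp only [q]; linarith
  have hq1 : q < 1 := by simp only [q]; linarith [Real.exp_pos (-(K * (τ - σ)))]
  have hcontr : ContractingWith ⟨q, hq0⟩ Φ := by
    refine ⟨by exact_mod_cast hq1, LipschitzWith.of_dist_le_mul fun w w' => ?_⟩
    rw [ContinuousMap.dist_le (by positivity)]
    rintro ⟨t, ht⟩
    rw [dist_eq_norm]
    have hint : ∀ w, IntervalIntegrable (fun s => heat b hν (t - s) (G s (ext w s))) volume σ t :=
      fun w => Continuous.intervalIntegrable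
        ((hj _ (hext w)).comp (Continuous.prodMk continuous_const continuous_id)) _ _
    have e : Φ w ⟨t, ht⟩ - Φ w' ⟨t, ht⟩
        = ∫ s in σ..t, (heat b hν (t - s) (G s (ext w s)) - heat b hν (t - s) (G s (ext w' s))) := by
      rw [intervalIntegral.integral_sub (hint w) (hint w')]
      exact add_sub_add_left_eq_sub _ _ _
    rw [e]
    calc ‖∫ s in σ..t, (heat b hν (t - s) (G s (ext w s)) - heat b hν (t - s) (G s (ext w' s)))‖
        ≤ ∫ s in σ..t, K * Real.exp (-(K * (t - s))) * dist w w' := by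
          refine intervalIntegral.norm_integral_le_of_norm_le ht.1 ?_
            (Continuous.intervalIntegrable (by fun_prop) _ _)
          refine Eventually.of_forall fun s hs => ?_
          rw [← map_sub]
          refine (norm_heat_le b hν hKν (sub_nonneg.2 hs.2) _).trans ?_
          have h1 := hL s ⟨hs.1.le, hs.2.trans ht.2⟩ (ext w s) (ext w' s)
          have h2 : ‖ext w s - ext w' s‖ ≤ dist w w' := by
            rw [← dist_eq_norm]
            exact ContinuousMap.dist_apply_le_dist _
          calc Real.exp (-(K * (t - s))) * ‖G s (ext w s) - G s (ext w' s)‖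
              ≤ Real.exp (-(K * (t - s))) * (K * dist w w') := by
                gcongr
                exact h1.trans (by gcongr)
            _ = _ := by ring
      _ = (1 - Real.exp (-(K * (t - σ)))) * dist w w' := by
          rw [intervalIntegral.integral_mul_const, integral_exp_rate]
      _ ≤ q * dist w w' := by
          have := ht.2
          simp only [q]
          gcongr
  have : Nonempty C(Icc σ τ, H) := ⟨0⟩
  let w : C(Icc σ τ, H) := hcontr.fixedPoint Φ
  have hw : Φ w = w := hcontr.fixedPoint_isFixedPt
  -- Iterating from a curve inside the sets `C t` keeps all iterates there, and closedness passes
  -- this on to the fixed point.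
  let w₀ : C(Icc σ τ, H) := ⟨fun t => u₀ t, continuousOn_iff_continuous_domRestrict.1 hu₀⟩
  have hextC : ∀ w : C(Icc σ τ, H), (∀ t : Icc σ τ, w t ∈ C t) → ∀ t ∈ Icc σ τ, ext w t ∈ C t := by
    intro w hw t ht
    have := hw ⟨t, ht⟩
    simpa [ext, projIcc_of_mem hst ht] using this
  have hiter : ∀ n : ℕ, ∀ t : Icc σ τ, (Φ^[n] w₀) t ∈ C t := by
    intro n
    induction n with
    | zero => exact fun t => hu₀C t t.2
    | succ n ih =>
      intro t
      rw [Function.iterate_succ_apply']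
      exact hinv _ (hext _) (hextC _ ih) t t.2
  have hwC : ∀ t : Icc σ τ, w t ∈ C t := by
    intro t
    have h1 := hcontr.tendsto_iterate_fixedPoint w₀
    have h2 : Tendsto (fun n => (Φ^[n] w₀) t) atTop (𝓝 (w t)) :=
      ((continuous_eval_const t).tendsto _).comp h1
    exact (hC t t.2).mem_of_tendsto h2 (Eventually.of_forall fun n => hiter n t)
  have heq : ∀ t ∈ Icc σ τ, ext w t = Ψ (ext w) t := by
    intro t ht
    have := congrArg (fun z : C(Icc σ τ, H) => z ⟨t, ht⟩) hw
    simp only [ext, projIcc_of_mem hst ht]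
    exact this.symm
  refine ⟨ext w, linSol_of_duhamel b hν g (hGc _ (hext w)) heq, ?_, hextC w hwC⟩
  rw [heq σ (left_mem_Icc.2 hst)]
  simp [Ψ, heat_of_nonpos b hν le_rfl]

/-- Existence for `u' = -Λ u - B(t) u` with bounded `B(t)`. -/
theorem exists_linSol (b : HilbertBasis ι ℂ H) {ν : ι → ℝ} {m : ℝ} (hm : ∀ i, -m ≤ ν i)
    {σ τ : ℝ} (hst : σ ≤ τ) (g : H) {B : ℝ → H →L[ℂ] H} (hB : Continuous B) :
    ∃ u : ℝ → H, LinSol b ν σ τ u (fun s => -(B s (u s))) ∧ u σ = g := by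
  obtain ⟨M, hM⟩ := (isCompact_Icc (a := σ) (b := τ)).exists_bound_of_continuousOn hB.continuousOn
  -- Adding `m + K` to the eigenvalues raises the decay rate to at least the Lipschitz constant of
  -- the source; the exponential rescaling below removes the shift again.
  let K : ℝ := |M| + 1
  have hK : 0 < K := by positivity
  have hKν : ∀ i, K ≤ ν i + (m + K) := fun i => by linarith [hm i]
  have hν : ∀ i, 0 ≤ ν i + (m + K) := fun i => hK.le.trans (hKν i)
  obtain ⟨u, hu, hug, -⟩ := exists_volterra b hν hK hKν hst g (G := fun s x => -(B s x))
    (by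
      have : Continuous fun p : ℝ × H => B p.1 p.2 := (hB.comp continuous_fst).clm_apply continuous_snd
      exact this.neg)
    (by
      intro s hs x y
      rw [← neg_add', norm_neg, ← sub_eq_add_neg, ← map_sub]
      refine ((B s).le_opNorm _).trans ?_
      gcongr
      exact (hM s hs).trans ((le_abs_self M).trans (by simp [K])))
    (C := fun _ => univ) (fun _ _ => isClosed_univ) (fun _ => 0) continuousOn_const
    (fun _ _ => mem_univ _) (fun _ _ _ _ _ => mem_univ _)
  refine ⟨fun t => ((Real.exp (-(-(m + K)) * (t - σ)) : ℝ) : ℂ) • u t, ?_, ?_⟩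
  · have h1 := hu.rescale (-(m + K)) σ
    have e : (fun i => ν i + (m + K) + -(m + K)) = ν := by funext i; ring
    rw [e] at h1
    refine h1.congr (fun _ _ => rfl) fun t _ => ?_
    rw [map_smul, smul_neg]
  · simp [hug]

end Volterra

/-! ### Comparison with the free evolution -/

section Domination

variable {H : Type*} [NormedAddCommGroup H] [InnerProductSpace ℂ H] [CompleteSpace H] {ι : Type*}

/-- A closed convex cone of pairs. -/
structure IsClosedCone (D : Set (H × H)) : Prop where
  closed : IsClosed D
  add : ∀ p ∈ D, ∀ q ∈ D, p + q ∈ D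
  smul : ∀ c : ℝ, 0 ≤ c → ∀ p ∈ D, ((c : ℂ) • p.1, (c : ℂ) • p.2) ∈ D

/-- A closed convex set contains averages, and the integral is the length of the interval times an
average. The degenerate interval is covered by `h0`. -/
theorem IsClosedCone.integral_mem {D : Set (H × H)} (hD : IsClosedCone D) {a c : ℝ} (hac : a ≤ c)
    {f g : ℝ → H} (hf : ContinuousOn f (Icc a c)) (hg : ContinuousOn g (Icc a c))
    (h : ∀ s ∈ Icc a c, (f s, g s) ∈ D) (h0 : (0, 0) ∈ D) :
    (∫ s in a..c, f s, ∫ s in a..c, g s) ∈ D := by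
  rcases hac.eq_or_lt with rfl | hac'
  · simpa using h0
  have hsm : ∀ c : ℝ, 0 ≤ c → ∀ p ∈ D, c • p ∈ D := by
    intro c hc p hp
    have := hD.smul c hc p hp
    simpa [Prod.smul_def] using this
  have hconv : Convex ℝ D := by
    intro p hp q hq s t hs ht _
    exact hD.add _ (hsm s hs p hp) _ (hsm t ht q hq)
  have hF : IntegrableOn (fun s => (f s, g s)) (Ioc a c) :=
    ((hf.prodMk hg).integrableOn_Icc).mono_set Ioc_subset_Icc_self
  have hav := hconv.set_average_mem hD.closed (μ := volume) (t := Ioc a c) (f := fun s => (f s, g s))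
    (by simp [hac']) (by simp) (by
      refine (ae_restrict_iff' measurableSet_Ioc).2 (Eventually.of_forall fun s hs => ?_)
      exact h s (Ioc_subset_Icc_self hs)) hF
  have h2 := hsm (c - a) (by linarith) _ hav
  rw [setAverage_eq, smul_smul] at h2
  have e : (c - a) * (volume.real (Ioc a c))⁻¹ = 1 := by
    rw [Real.volume_real_Ioc_of_le hac, mul_inv_cancel₀ (by linarith)]
  rw [e, one_smul] at h2
  have e1 : ∫ s in Ioc a c, (f s, g s) = (∫ s in a..c, f s, ∫ s in a..c, g s) := by
    rw [intervalIntegral.integral_of_le hac, intervalIntegral.integral_of_le hac]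
    exact integral_pair ((hf.integrableOn_Icc).mono_set Ioc_subset_Icc_self)
      ((hg.integrableOn_Icc).mono_set Ioc_subset_Icc_self)
  rwa [e1] at h2

/-- Comparison: a solution with nonnegative potential `V` is dominated by a solution without potential
as soon as the data and sources are. -/
theorem LinSol.dominated [Countable ι] {b : HilbertBasis ι ℂ H} {ν : ι → ℝ} (hν : ∀ i, 0 ≤ ν i)
    {σ τ : ℝ} (hst : σ ≤ τ) {D : Set (H × H)} (hD : IsClosedCone D) (h0 : ∀ x w, (x, w) ∈ D → (0, w) ∈ D)
    (hheat : ∀ t, 0 ≤ t → ∀ p ∈ D, (heat b hν t p.1, heat b hν t p.2) ∈ D)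
    {V : ℝ → H →L[ℂ] H} (hV : Continuous V) {K : ℝ}
    (hVpos : ∀ s ∈ Icc σ τ, ∀ x, 0 ≤ (inner ℂ x (V s x) : ℂ).re)
    (hVnorm : ∀ s ∈ Icc σ τ, ∀ x, ‖(K : ℂ) • x - V s x‖ ≤ K * ‖x‖)
    (hVD : ∀ s ∈ Icc σ τ, ∀ p ∈ D, ((K : ℂ) • p.1 - V s p.1, (K : ℂ) • p.2) ∈ D)
    (hK : 0 < K) {u w F G : ℝ → H}
    (hu : LinSol b ν σ τ u (fun s => -(V s (u s)) + F s)) (hF : ContinuousOn F (Icc σ τ))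
    (hw : LinSol b ν σ τ w G)
    (hinit : (u σ, w σ) ∈ D) (hsrc : ∀ s ∈ Icc σ τ, (F s, G s) ∈ D) :
    (u τ, w τ) ∈ D := by
  -- The equation is rewritten as `u' = -(Λ + K) u + (K - V) u + F`. Now the perturbation `K - V`
  -- preserves domination, and its norm is at most the decay rate `K` of the shifted semigroup.
  have hKν : ∀ i, K ≤ ν i + K := fun i => by linarith [hν i]
  have hν' : ∀ i, 0 ≤ ν i + K := fun i => hK.le.trans (hKν i)
  have hheatK : ∀ t, 0 ≤ t → ∀ p ∈ D, (heat b hν' t p.1, heat b hν' t p.2) ∈ D := by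
    intro t ht p hp
    have key : ∀ x, heat b hν' t x = ((Real.exp (-(K * t)) : ℝ) : ℂ) • heat b hν t x := by
      intro x
      refine hilbert_ext b fun i => ?_
      rw [inner_smul_right, inner_heat_of_nonneg b hν' ht, inner_heat_of_nonneg b hν ht, ← mul_assoc,
        ← Complex.ofReal_mul, ← Real.exp_add]
      ring_nf
    rw [key, key]
    exact hD.smul _ (Real.exp_pos _).le _ (hheat t ht p hp)
  have h00 : ((0 : H), (0 : H)) ∈ D := by
    have := hD.smul 0 le_rfl _ hinit
    simpa using this
  have hwK := hw.shift K
  let Fe : ℝ → H := fun s => F (projIcc σ τ hst s)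
  have hFe : Continuous Fe := continuous_comp_projIcc hst hF
  have hFF : ∀ s ∈ Icc σ τ, Fe s = F s := fun s hs => by simp [Fe, projIcc_of_mem hst hs]
  have hVc : Continuous fun p : ℝ × H => V p.1 p.2 :=
    (hV.comp continuous_fst).clm_apply continuous_snd
  -- Zero is dominated by `w` at all times, so the iteration may start from the zero curve.
  have hwD : ∀ t ∈ Icc σ τ, ((0 : H), w t) ∈ D := by
    intro t ht
    rw [(hw.mono le_rfl ht.2).duhamel hν ht.1]
    have hc : ContinuousOn (fun s => heat b hν (t - s) (G s)) (Icc σ t) :=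
      continuousOn_heat b hν (continuousOn_const.sub continuousOn_id)
        (hw.contF.mono (Icc_subset_Icc_right ht.2))
    have h1 := hD.integral_mem ht.1 (f := fun _ => 0) continuousOn_const hc
      (fun s hs => by
        have := hheat (t - s) (sub_nonneg.2 hs.2) _ (h0 _ _ (hsrc s ⟨hs.1, hs.2.trans ht.2⟩))
        simpa using this) h00
    have h2 := hheat (t - σ) (sub_nonneg.2 ht.1) _ (h0 _ _ hinit)
    have := hD.add _ h2 _ h1
    simpa using this
  obtain ⟨v, hv, hvg, hvC⟩ := exists_volterra b hν' hK hKν hst (u σ)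
    (G := fun s x => ((K : ℂ) • x - V s x) + Fe s)
    (((continuous_snd.const_smul _).sub hVc).add (hFe.comp continuous_fst))
    (by
      intro s hs x y
      have e : (K : ℂ) • x - V s x + Fe s - ((K : ℂ) • y - V s y + Fe s)
          = (K : ℂ) • (x - y) - V s (x - y) := by
        rw [map_sub, smul_sub]; abel
      rw [e]
      exact hVnorm s hs _)
    (C := fun t => {x | (x, w t) ∈ D})
    (fun t _ => hD.closed.preimage (Continuous.prodMk continuous_id continuous_const))
    (fun _ => 0) continuousOn_const hwD
    (by
      intro v hv hvC t ht
      simp only [mem_ofPred_eq]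
      rw [(hwK.mono le_rfl ht.2).duhamel hν' ht.1]
      have hc1 : ContinuousOn (fun s => (K : ℂ) • v s - V s (v s) + Fe s) (Icc σ t) :=
        (((hv.const_smul _).sub (hV.clm_apply hv)).add hFe).continuousOn
      have h1 := hD.integral_mem ht.1
        (continuousOn_heat b hν' (f := fun s => t - s) (continuousOn_const.sub continuousOn_id) hc1)
        (continuousOn_heat b hν' (f := fun s => t - s) (continuousOn_const.sub continuousOn_id)
          (hwK.contF.mono (Icc_subset_Icc_right ht.2)))
        (fun s hs => by
          have hs' : s ∈ Icc σ τ := ⟨hs.1, hs.2.trans ht.2⟩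
          refine hheatK (t - s) (sub_nonneg.2 hs.2) (_, _) ?_
          have h3 := hD.add _ (hVD s hs' _ (hvC s hs')) _ (hsrc s hs')
          rw [hFF s hs']
          simpa [add_comm] using h3) h00
      have h2 := hheatK (t - σ) (sub_nonneg.2 ht.1) _ hinit
      exact hD.add _ h2 _ h1)
  -- The iteration produces some solution in the cone; it solves the original equation, so by
  -- uniqueness it is `u`.
  have hv2 : LinSol b ν σ τ v (fun s => -(V s (v s)) + F s) := by
    have h1 := hv.shift (-K)
    have e : (fun i => ν i + K + -K) = ν := by funext i; ring
    rw [e] at h1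
    refine h1.congr (fun _ _ => rfl) fun s hs => ?_
    rw [hFF s hs]
    push_cast
    rw [neg_smul]
    abel
  have := LinSol.unique (m := 0) (fun i => by simpa using hν i) hVpos hu hv2 hvg.symm τ
    (right_mem_Icc.2 hst)
  rw [this]
  exact hvC τ (right_mem_Icc.2 hst)

end Domination

/-! ### Propagators -/

section Propagators

variable {H : Type*} [NormedAddCommGroup H] [InnerProductSpace ℂ H] {ι : Type*}

/-- The graph `A` is contained in `Λ + B` coordinatewise, and contains the basis vectors in its domain. -/
structure HasModes (b : HilbertBasis ι ℂ H) (ν : ι → ℝ) (B : H →L[ℂ] H) (A : Set (H × H)) : Prop where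
  basis : ∀ i, (b i, (ν i : ℂ) • b i + B (b i)) ∈ A
  coord : ∀ p ∈ A, ∀ i, inner ℂ (b i) p.2 = (ν i : ℂ) * inner ℂ (b i) p.1 + inner ℂ (b i) (B p.1)

/-- A bounded nonnegative symmetric operator. -/
structure IsPos (B : H →L[ℂ] H) : Prop where
  symm : ∀ x y, inner ℂ (B x) y = inner ℂ x (B y)
  nonneg : ∀ x, 0 ≤ (inner ℂ x (B x) : ℂ).re

/-- Basis vectors are admissible test vectors, and symmetry moves `B` to the solution. The weak
equation then becomes an integral equation for each coordinate, for an arbitrary propagator. -/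
theorem IsPropagator.linSol [CompleteSpace H] {b : HilbertBasis ι ℂ H} {ν : ι → ℝ}
    {B : ℝ → H →L[ℂ] H} {A : ℝ → Set (H × H)} {τ₀ : ℝ} {U : ℝ → ℝ → H →L[ℂ] H}
    (hU : IsPropagator A τ₀ U) (hB : Continuous B) (hpos : ∀ s, IsPos (B s))
    (hA : ∀ s ≥ τ₀, HasModes b ν (B s) (A s)) {σ τ : ℝ} (hσ : τ₀ ≤ σ) (g : H) :
    LinSol b ν σ τ (fun t => U t σ g) (fun s => -(B s (U s σ g))) := by
  have hc : ContinuousOn (fun t => U t σ g) (Icc σ τ) :=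
    (hU.continuousOn σ hσ g).mono Icc_subset_Ici_self
  have hBU : ContinuousOn (fun s => B s (U s σ g)) (Icc σ τ) := hB.continuousOn.clm_apply hc
  refine ⟨hc, hBU.neg, fun i t ht => ?_⟩
  have hw := hU.weak σ hσ g (b i) (fun s => (ν i : ℂ) • b i + B s (b i))
    (fun s hs => (hA s hs).basis i)
  have e : ∀ s, inner ℂ ((ν i : ℂ) • b i + B s (b i)) (U s σ g)
      = (ν i : ℂ) * inner ℂ (b i) (U s σ g) + inner ℂ (b i) (B s (U s σ g)) := by
    intro s
    rw [inner_add_left, inner_smul_left, Complex.conj_ofReal, (hpos s).symm]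
  simp only [e] at hw
  have hcf : ContinuousOn (fun s => -((ν i : ℂ) * inner ℂ (b i) (U s σ g)
      + inner ℂ (b i) (B s (U s σ g)))) (Icc σ τ) :=
    ((continuousOn_const.mul ((innerSL ℂ (b i)).continuous.comp_continuousOn hc)).add
      ((innerSL ℂ (b i)).continuous.comp_continuousOn hBU)).neg
  have := hasDerivWithinAt_of_eq_integral (y := fun s => inner ℂ (b i) (U s σ g))
    (y₀ := inner ℂ (b i) g) hcf (fun t ht => by
      rw [(hw t ht.1).2, intervalIntegral.integral_neg, sub_eq_add_neg]) ht
  refine this.congr_deriv ?_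
  rw [inner_neg_right]
  ring

/-- The vector `φ` is in the domain of `Λ` only in the sense that `φ'` has the coordinates of `Λ φ`.
The identity holds for finite sums of coordinates, and these are passed to the limit. -/
theorem LinSol.weak [Countable ι] [CompleteSpace H] {b : HilbertBasis ι ℂ H} {ν : ι → ℝ}
    {σ τ : ℝ} {u F : ℝ → H} (h : LinSol b ν σ τ u F) (hst : σ ≤ τ) {φ φ' : H}
    (hφ : ∀ i, inner ℂ (b i) φ' = (ν i : ℂ) * inner ℂ (b i) φ) :
    inner ℂ φ (u τ) = inner ℂ φ (u σ)
      + ∫ s in σ..τ, (-(inner ℂ φ' (u s)) + inner ℂ φ (F s)) := by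
  have hcu : ∀ x : H, ContinuousOn (fun s => inner ℂ x (u s)) (Icc σ τ) := fun x =>
    (innerSL ℂ x).continuous.comp_continuousOn h.cont
  have hcF : ∀ x : H, ContinuousOn (fun s => inner ℂ x (F s)) (Icc σ τ) := fun x =>
    (innerSL ℂ x).continuous.comp_continuousOn h.contF
  let f : Finset ι → ℝ → ℂ := fun J s =>
    -(∑ i ∈ J, inner ℂ φ' (b i) * inner ℂ (b i) (u s)) + ∑ i ∈ J, inner ℂ φ (b i) * inner ℂ (b i) (F s)
  have hfc : ∀ J, ContinuousOn (f J) (Icc σ τ) := fun J =>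
    (continuousOn_finsetSum _ fun i _ => continuousOn_const.mul (hcu (b i))).neg.add
      (continuousOn_finsetSum _ fun i _ => continuousOn_const.mul (hcF (b i)))
  have hJ : ∀ J : Finset ι, ∑ i ∈ J, inner ℂ φ (b i) * inner ℂ (b i) (u τ)
      - ∑ i ∈ J, inner ℂ φ (b i) * inner ℂ (b i) (u σ) = ∫ s in σ..τ, f J s := by
    intro J
    refine (integral_eq_of_hasDerivWithinAt hst
      (y := fun s => ∑ i ∈ J, inner ℂ φ (b i) * inner ℂ (b i) (u s)) (fun t ht => ?_) (hfc J)).symm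
    have := HasDerivWithinAt.fun_sum (u := J) fun i _ =>
      (h.deriv i t ht).const_mul (inner ℂ φ (b i))
    refine this.congr_deriv ?_
    simp only [f]
    rw [← Finset.sum_neg_distrib, ← Finset.sum_add_distrib]
    refine Finset.sum_congr rfl fun i _ => ?_
    rw [← inner_conj_symm φ' (b i), hφ, map_mul, Complex.conj_ofReal, inner_conj_symm]
    ring
  have hl := ((b.hasSum_inner_mul_inner φ (u τ)).sub (b.hasSum_inner_mul_inner φ (u σ)))
  have hl' : Tendsto (fun J : Finset ι => ∫ s in σ..τ, f J s) atTop
      (𝓝 (inner ℂ φ (u τ) - inner ℂ φ (u σ))) := by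
    refine Tendsto.congr (fun J => ?_) hl
    rw [← hJ, Finset.sum_sub_distrib]
  have hr : Tendsto (fun J : Finset ι => ∫ s in σ..τ, f J s) atTop
      (𝓝 (∫ s in σ..τ, (-(inner ℂ φ' (u s)) + inner ℂ φ (F s)))) := by
    refine intervalIntegral.tendsto_integral_filter_of_dominated_convergence
      (fun s => (‖φ'‖ ^ 2 + ‖u s‖ ^ 2) + (‖φ‖ ^ 2 + ‖F s‖ ^ 2)) ?_ ?_ ?_ ?_
    · refine Eventually.of_forall fun J => ?_
      rw [uIoc_of_le hst]
      exact ((hfc J).mono Ioc_subset_Icc_self).aestronglyMeasurable measurableSet_Ioc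
    · refine Eventually.of_forall fun J => Eventually.of_forall fun s _ => ?_
      refine (norm_add_le _ _).trans ?_
      rw [norm_neg]
      exact add_le_add (hilbert_partial_inner_le b J _ _) (hilbert_partial_inner_le b J _ _)
    · refine ContinuousOn.intervalIntegrable_of_Icc hst ?_
      exact (continuousOn_const.add (h.cont.norm.pow 2)).add
        (continuousOn_const.add (h.contF.norm.pow 2))
    · refine Eventually.of_forall fun s _ => ?_
      exact (b.hasSum_inner_mul_inner φ' (u s)).neg.add (b.hasSum_inner_mul_inner φ (F s)) |>.congr
        fun J => by simp [f, Finset.sum_add_distrib]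
  rw [← tendsto_nhds_unique hl' hr]
  ring

/-- Uniqueness yields linearity in the data and the evolution property; the energy estimate yields
boundedness. -/
theorem exists_isPropagator [Countable ι] [CompleteSpace H] (b : HilbertBasis ι ℂ H) {ν : ι → ℝ}
    {m : ℝ} (hm : ∀ i, -m ≤ ν i) {B : ℝ → H →L[ℂ] H} (hB : Continuous B) (hpos : ∀ s, IsPos (B s))
    {A : ℝ → Set (H × H)} {τ₀ : ℝ} (hA : ∀ s ≥ τ₀, HasModes b ν (B s) (A s)) :
    ∃ U : ℝ → ℝ → H →L[ℂ] H, IsPropagator A τ₀ U := by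
  choose! S hS hS0 using fun (σ τ : ℝ) (hst : σ ≤ τ) (g : H) => exists_linSol b hm hst g hB
  have huniq : ∀ {σ τ : ℝ}, σ ≤ τ → ∀ {u v : ℝ → H}, LinSol b ν σ τ u (fun s => -(B s (u s))) →
      LinSol b ν σ τ v (fun s => -(B s (v s))) → u σ = v σ → u τ = v τ := by
    intro σ τ hst u v hu hv h0
    exact LinSol.unique (F := fun _ => 0) hm (fun s _ => (hpos s).nonneg)
      (by simpa using hu) (by simpa using hv) h0 τ (right_mem_Icc.2 hst)
  have hval : ∀ {σ τ : ℝ} (hst : σ ≤ τ) (g : H) {t : ℝ}, t ∈ Icc σ τ → S σ τ g t = S σ t g t := by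
    intro σ τ hst g t ht
    exact huniq ht.1 ((hS σ τ hst g).mono le_rfl ht.2) (hS σ t ht.1 g)
      ((hS0 σ τ hst g).trans (hS0 σ t ht.1 g).symm)
  have hbound : ∀ {σ τ : ℝ} (hst : σ ≤ τ) (g : H),
      ‖S σ τ g τ‖ ≤ Real.exp (-(-m) * (τ - σ)) * ‖g‖ := by
    intro σ τ hst g
    have := (hS σ τ hst g).norm_le hst (-m) (fun _ _ i hi => absurd hi (not_lt.2 (hm i)))
      (fun s _ => by
        rw [inner_neg_right, Complex.neg_re]
        linarith [(hpos s).nonneg (S σ τ g s)])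
    rwa [hS0 σ τ hst g] at this
  let L : ∀ σ τ : ℝ, σ ≤ τ → H →L[ℂ] H := fun σ τ hst =>
    LinearMap.mkContinuous
      { toFun := fun g => S σ τ g τ
        map_add' := fun g g' => by
          refine huniq hst (v := fun t => S σ τ g t + S σ τ g' t) (hS σ τ hst (g + g')) ?_ ?_
          · refine ((hS σ τ hst g).add (hS σ τ hst g')).congr (fun _ _ => rfl) fun t _ => ?_
            rw [map_add]; abel
          · simp [hS0 σ τ hst]
        map_smul' := fun c g => by
          refine huniq hst (v := fun t => c • S σ τ g t) (hS σ τ hst (c • g)) ?_ ?_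
          · refine ((hS σ τ hst g).const_smul c).congr (fun _ _ => rfl) fun t _ => ?_
            rw [map_smul, smul_neg]
          · simp [hS0 σ τ hst] }
      (Real.exp (-(-m) * (τ - σ))) (hbound hst)
  classical
  -- The value `0` for `τ < σ` is arbitrary; only `σ ≤ τ` matters.
  let U : ℝ → ℝ → H →L[ℂ] H := fun τ σ => if h : σ ≤ τ then L σ τ h else 0
  have hU : ∀ {σ τ : ℝ} (_ : σ ≤ τ) (g : H), U τ σ g = S σ τ g τ := by
    intro σ τ h g
    simp only [U, dif_pos h]
    rfl
  have hUsol : ∀ {σ τ : ℝ} (_ : σ ≤ τ) (g : H),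
      LinSol b ν σ τ (fun t => U t σ g) (fun s => -(B s (U s σ g))) := by
    intro σ τ hst g
    have e : ∀ t ∈ Icc σ τ, U t σ g = S σ τ g t := fun t ht => by
      rw [hU ht.1, hval hst g ht]
    exact (hS σ τ hst g).congr e fun t ht => by rw [e t ht]
  refine ⟨U, ?_, ?_, ?_, ?_⟩
  · intro σ _
    ext g
    rw [hU le_rfl, hS0 σ σ le_rfl]
    rfl
  · intro σ _ s hs τ hτ
    ext g
    rw [ContinuousLinearMap.comp_apply]
    refine huniq hτ (hUsol hτ (U s σ g)) ((hUsol (hs.trans hτ) g).mono hs le_rfl) ?_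
    rw [hU le_rfl, hS0 s s le_rfl]
  · intro σ _ g t ht
    -- Solving slightly beyond `t` gives continuity at `t` from both sides within `[σ, ∞)`.
    have h1 : σ ≤ t + 1 := by linarith [mem_Ici.1 ht]
    have := (hUsol h1 g).cont t ⟨ht, by linarith⟩
    refine this.mono_of_mem_nhdsWithin ?_
    exact mem_nhdsWithin.2 ⟨Iio (t + 1), isOpen_Iio, by simp, fun s hs => ⟨hs.2, hs.1.le⟩⟩
  · intro σ hσ g φ Aφ hAφ τ hτ
    -- This is the unperturbed part `Λ φ`. Its coordinates do not depend on time, so it splits off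
    -- `Aφ s` for every `s` at once.
    let φ' : H := Aφ τ₀ - B τ₀ φ
    have hφ' : ∀ i, inner ℂ (b i) φ' = (ν i : ℂ) * inner ℂ (b i) φ := by
      intro i
      have := (hA τ₀ le_rfl).coord _ (hAφ τ₀ le_rfl) i
      simp only [φ', inner_sub_right]
      rw [this]
      ring
    have hAs : ∀ s ≥ τ₀, Aφ s = φ' + B s φ := by
      intro s hs
      refine hilbert_ext b fun i => ?_
      rw [inner_add_right, hφ']
      exact (hA s hs).coord _ (hAφ s hs) i
    have hin : ∀ s ∈ uIcc σ τ, inner ℂ (Aφ s) (U s σ g)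
        = inner ℂ φ' (U s σ g) + inner ℂ φ (B s (U s σ g)) := by
      intro s hs
      rw [uIcc_of_le hτ] at hs
      rw [hAs s (hσ.le.trans hs.1), inner_add_left, (hpos s).symm]
    have hsol := hUsol hτ g
    have hcont : ContinuousOn (fun s => inner ℂ φ' (U s σ g) + inner ℂ φ (B s (U s σ g)))
        (uIcc σ τ) := by
      rw [uIcc_of_le hτ]
      exact ((innerSL ℂ φ').continuous.comp_continuousOn hsol.cont).add
        ((innerSL ℂ φ).continuous.comp_continuousOn (hB.continuousOn.clm_apply hsol.cont))
    refine ⟨ContinuousOn.intervalIntegrable (hcont.congr hin), ?_⟩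
    rw [intervalIntegral.integral_congr hin, hsol.weak hτ hφ', hU le_rfl, hS0 σ σ le_rfl,
      sub_eq_add_neg, ← intervalIntegral.integral_neg]
    congr 1
    refine intervalIntegral.integral_congr fun s _ => ?_
    simp only [inner_neg_right]
    ring

end Propagators

/-! ### Diagonal projections and compressions -/

section Compression

variable {H : Type*} [NormedAddCommGroup H] [InnerProductSpace ℂ H] {ι : Type*}

/-- The orthogonal projection away from the basis vectors with index in `J`. -/
def modeProj (b : HilbertBasis ι ℂ H) (J : Finset ι) : H →L[ℂ] H :=
  ContinuousLinearMap.id ℂ H - ∑ i ∈ J, (innerSL ℂ (b i)).smulRight (b i)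

theorem modeProj_apply (b : HilbertBasis ι ℂ H) (J : Finset ι) (x : H) :
    modeProj b J x = x - ∑ i ∈ J, (inner ℂ (b i) x : ℂ) • b i := by
  simp [modeProj]

theorem inner_basis_sum (b : HilbertBasis ι ℂ H) (J : Finset ι) (c : ι → ℂ) (i : ι) [Decidable (i ∈ J)] :
    inner ℂ (b i) (∑ j ∈ J, c j • b j) = if i ∈ J then c i else 0 := by
  classical
  rw [inner_sum]
  simp_rw [inner_smul_right]
  have h := orthonormal_iff_ite.1 b.orthonormal
  simp only [h, mul_ite, mul_one, mul_zero, Finset.sum_ite_eq]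
  congr

theorem inner_modeProj (b : HilbertBasis ι ℂ H) (J : Finset ι) (x : H) (i : ι) [Decidable (i ∈ J)] :
    inner ℂ (b i) (modeProj b J x) = if i ∈ J then 0 else inner ℂ (b i) x := by
  rw [modeProj_apply, inner_sub_right, inner_basis_sum]
  split_ifs <;> simp

theorem modeProj_idem (b : HilbertBasis ι ℂ H) (J : Finset ι) (x : H) :
    modeProj b J (modeProj b J x) = modeProj b J x := by
  classical
  refine hilbert_ext b fun i => ?_
  simp only [inner_modeProj]
  split_ifs <;> rfl

theorem modeProj_symm (b : HilbertBasis ι ℂ H) (J : Finset ι) (x y : H) :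
    inner ℂ (modeProj b J x) y = inner ℂ x (modeProj b J y) := by
  rw [modeProj_apply, modeProj_apply, inner_sub_left, inner_sub_right, sum_inner, inner_sum]
  congr 1
  refine Finset.sum_congr rfl fun i _ => ?_
  rw [inner_smul_left, inner_smul_right, inner_conj_symm, mul_comm]

theorem modeProj_empty (b : HilbertBasis ι ℂ H) (x : H) : modeProj b ∅ x = x := by
  simp [modeProj_apply]

/-- The compression of `B` by the projection away from the modes in `J`. -/
def compressOp (b : HilbertBasis ι ℂ H) (J : Finset ι) (B : H →L[ℂ] H) : H →L[ℂ] H :=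
  ((modeProj b J).comp B).comp (modeProj b J)

theorem compressOp_apply (b : HilbertBasis ι ℂ H) (J : Finset ι) (B : H →L[ℂ] H) (x : H) :
    compressOp b J B x = modeProj b J (B (modeProj b J x)) := rfl

theorem IsPos.compressOp {B : H →L[ℂ] H} (hB : IsPos B) (b : HilbertBasis ι ℂ H) (J : Finset ι) :
    IsPos (compressOp b J B) := by
  refine ⟨fun x y => ?_, fun x => ?_⟩
  · simp only [compressOp_apply]
    rw [modeProj_symm, hB.symm, modeProj_symm]
  · simp only [compressOp_apply]
    rw [← modeProj_symm]
    exact hB.nonneg _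

theorem continuous_compressOp {B : ℝ → H →L[ℂ] H} (hB : Continuous B) (b : HilbertBasis ι ℂ H)
    (J : Finset ι) : Continuous fun s => compressOp b J (B s) :=
  (continuous_const.clm_comp hB).clm_comp continuous_const

/-- Eigenvalues of the compression. -/
def killRate (J : Finset ι) (ν : ι → ℝ) (i : ι) : ℝ := by
  classical exact if i ∈ J then 0 else ν i

theorem killRate_of_mem {J : Finset ι} {ν : ι → ℝ} {i : ι} (h : i ∈ J) : killRate J ν i = 0 := by
  simp [killRate, h]

theorem killRate_of_notMem {J : Finset ι} {ν : ι → ℝ} {i : ι} (h : i ∉ J) :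
    killRate J ν i = ν i := by
  simp [killRate, h]

/-- For `i ∈ J` the projection sends `b i` to `0`, and `h0` supplies the image `0`; this is why the
compression has eigenvalue `0` on `J`. Off `J` the basis vectors are fixed. -/
theorem HasModes.compression {b : HilbertBasis ι ℂ H} {ν : ι → ℝ} {B : H →L[ℂ] H} {A : Set (H × H)}
    (hA : HasModes b ν B A) (h0 : ((0 : H), (0 : H)) ∈ A) (J : Finset ι) :
    HasModes b (killRate J ν) (compressOp b J B) (compression (modeProj b J) A) := by
  classical
  have hJ : ∀ i ∈ J, modeProj b J (b i) = 0 := by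
    intro i hi
    refine hilbert_ext b fun j => ?_
    rw [inner_modeProj]
    split_ifs with h
    · simp
    · rw [b.orthonormal.2 (fun e : j = i => h (e ▸ hi)), inner_zero_right]
  have hJ' : ∀ i ∉ J, modeProj b J (b i) = b i := by
    intro i hi
    refine hilbert_ext b fun j => ?_
    rw [inner_modeProj]
    split_ifs with h
    · rw [b.orthonormal.2 (fun e : j = i => hi (e ▸ h))]
    · rfl
  refine ⟨fun i => ?_, ?_⟩
  · by_cases hi : i ∈ J
    · refine ⟨0, ?_, ?_⟩
      · simpa [hJ i hi] using h0
      · simp [compressOp_apply, hJ i hi, killRate_of_mem hi]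
    · refine ⟨(ν i : ℂ) • b i + B (b i), ?_, ?_⟩
      · simpa [hJ' i hi] using hA.basis i
      · simp [compressOp_apply, hJ' i hi, killRate_of_notMem hi]
  · rintro p ⟨h, hh, hp⟩ i
    have := hA.coord _ hh i
    rw [hp, compressOp_apply, inner_modeProj, inner_modeProj]
    by_cases hi : i ∈ J
    · simp [hi, killRate_of_mem hi]
    · simp only [hi, if_false, killRate_of_notMem hi]
      rw [this]
      simp [inner_modeProj, hi]

/-- Coordinates in `J` have zero derivative, because their eigenvalue is `0` and the source has no
component there. They stay zero if they start at zero, and then the eigenvalues on `J` may be put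
back and the inner projection omitted. -/
theorem LinSol.of_compressed {b : HilbertBasis ι ℂ H} {ν : ι → ℝ} {J : Finset ι} {B : ℝ → H →L[ℂ] H}
    {σ τ : ℝ} {u : ℝ → H}
    (hu : LinSol b (killRate J ν) σ τ u (fun s => -(compressOp b J (B s) (u s))))
    (h0 : modeProj b J (u σ) = u σ) :
    (∀ t ∈ Icc σ τ, modeProj b J (u t) = u t) ∧
      LinSol b ν σ τ u (fun s => -(modeProj b J (B s (u s)))) := by
  classical
  have hzero : ∀ i ∈ J, ∀ t ∈ Icc σ τ, inner ℂ (b i) (u t) = 0 := by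
    intro i hi t ht
    have hd : ∀ s ∈ Icc σ τ, HasDerivWithinAt (fun s => inner ℂ (b i) (u s)) 0 (Icc σ τ) s := by
      intro s hs
      refine (hu.deriv i s hs).congr_deriv ?_
      rw [killRate_of_mem hi, compressOp_apply, inner_neg_right, inner_modeProj]
      simp [hi]
    have h1 := integral_eq_of_hasDerivWithinAt ht.1
      (fun s hs => (hd s ⟨hs.1, hs.2.trans ht.2⟩).mono (Icc_subset_Icc_right ht.2)) continuousOn_const
    rw [intervalIntegral.integral_zero] at h1
    rw [sub_eq_zero.1 h1.symm, ← h0, inner_modeProj]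
    simp [hi]
  have hP : ∀ t ∈ Icc σ τ, modeProj b J (u t) = u t := by
    intro t ht
    refine hilbert_ext b fun i => ?_
    rw [inner_modeProj]
    split_ifs with h
    · rw [hzero i h t ht]
    · rfl
  refine ⟨hP, ?_⟩
  have hF : ∀ t ∈ Icc σ τ, -(modeProj b J (B t (u t))) = -(compressOp b J (B t) (u t)) := by
    intro t ht
    rw [compressOp_apply, hP t ht]
  refine ⟨hu.cont, hu.contF.congr hF, fun i t ht => ?_⟩
  rw [hF t ht]
  refine (hu.deriv i t ht).congr_deriv ?_
  by_cases hi : i ∈ J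
  · rw [hzero i hi t ht]; simp
  · rw [killRate_of_notMem hi]

/-- The hypotheses say that both families span the same space, so the projections onto the
orthogonal complements agree. -/
theorem projAway_eq_modeProj {X : Type*} [MeasurableSpace X] {μ : Measure X}
    (b : HilbertBasis ι ℂ (Lp ℂ 2 μ)) (J : Finset ι) {S : Set (X → ℝ)}
    (h1 : ∀ p ∈ S, ∀ f : Lp ℂ 2 μ, (f =ᵐ[μ] fun x => ((p x : ℝ) : ℂ)) →
      f ∈ Submodule.span ℂ (b '' J))
    (h2 : ∀ i ∈ J, b i ∈ Submodule.span ℂ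
      {f : Lp ℂ 2 μ | ∃ p ∈ S, f =ᵐ[μ] fun x => ((p x : ℝ) : ℂ)}) :
    projAway μ S = modeProj b J := by
  classical
  have hK : Submodule.span ℂ {f : Lp ℂ 2 μ | ∃ p ∈ S, f =ᵐ[μ] fun x => ((p x : ℝ) : ℂ)}
      = Submodule.span ℂ (b '' J) := by
    refine le_antisymm (Submodule.span_le.2 ?_) (Submodule.span_le.2 ?_)
    · rintro f ⟨p, hp, hf⟩
      exact h1 p hp f hf
    · rintro _ ⟨i, hi, rfl⟩
      exact h2 i hi
  ext1 x
  have hP : projAway μ S = (Submodule.span ℂ (b '' J))ᗮ.starProjection := by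
    simp only [projAway, hK]
  rw [hP]
  refine Submodule.eq_starProjection_of_mem_orthogonal'
    (z := ∑ i ∈ J, (inner ℂ (b i) x : ℂ) • b i) ?_ ?_ ?_
  · rw [Submodule.mem_orthogonal]
    intro y hy
    induction hy using Submodule.span_induction with
    | mem y hy =>
      obtain ⟨i, hi, rfl⟩ := hy
      rw [inner_modeProj, if_pos (by exact_mod_cast hi)]
    | zero => simp
    | add y z _ _ hy hz => rw [inner_add_left, hy, hz, add_zero]
    | smul c y _ hy => rw [inner_smul_left, hy, mul_zero]
  · refine Submodule.le_orthogonal_orthogonal _ ?_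
    refine Submodule.sum_mem _ fun i hi => Submodule.smul_mem _ _ (Submodule.subset_span ?_)
    exact ⟨i, hi, rfl⟩
  · rw [modeProj_apply]; abel

end Compression

/-! ### Domination in `L²` and multiplication operators -/

section Lattice

variable {X : Type*} [MeasurableSpace X] {μ : Measure X}

/-- Pairs `(u, w)` with `|u| ≤ Re w` almost everywhere. -/
def dominated (μ : Measure X) : Set (Lp ℂ 2 μ × Lp ℂ 2 μ) :=
  {p | ∀ᵐ x ∂μ, ‖p.1 x‖ ≤ (p.2 x).re}

theorem exists_subseq_ae {f : ℕ → Lp ℂ 2 μ} {g : Lp ℂ 2 μ} (h : Tendsto f atTop (𝓝 g)) :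
    ∃ ns : ℕ → ℕ, StrictMono ns ∧ ∀ᵐ x ∂μ, Tendsto (fun n => f (ns n) x) atTop (𝓝 (g x)) :=
  (tendstoInMeasure_of_tendsto_Lp h).exists_seq_tendsto_ae

/-- Closedness: an `L²` convergent sequence has an almost everywhere convergent subsequence. It is
extracted first for one component, then, along it, for the other. -/
theorem isClosedCone_dominated : IsClosedCone (dominated μ) := by
  refine ⟨?_, ?_, ?_⟩
  · refine IsSeqClosed.isClosed ?_
    intro p q hp hpq
    obtain ⟨ns, hns, h1⟩ := exists_subseq_ae ((continuous_fst.tendsto _).comp hpq)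
    have h2' : Tendsto (fun n => (p (ns n)).2) atTop (𝓝 q.2) :=
      ((continuous_snd.tendsto _).comp hpq).comp hns.tendsto_atTop
    obtain ⟨ms, hms, h2⟩ := exists_subseq_ae h2'
    have h3 : ∀ᵐ x ∂μ, ∀ n, ‖(p n).1 x‖ ≤ ((p n).2 x).re := ae_all_iff.2 hp
    filter_upwards [h1, h2, h3] with x hx1 hx2 hx3
    exact le_of_tendsto_of_tendsto' (hx1.comp hms.tendsto_atTop).norm
      ((Complex.continuous_re.tendsto _).comp hx2) fun n => hx3 _
  · intro p hp q hq
    filter_upwards [hp, hq, Lp.coeFn_add p.1 q.1, Lp.coeFn_add p.2 q.2] with x h1 h2 h3 h4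
    simp only [Prod.fst_add, Prod.snd_add, h3, h4, Pi.add_apply, Complex.add_re]
    exact (norm_add_le _ _).trans (add_le_add h1 h2)
  · intro c hc p hp
    filter_upwards [hp, Lp.coeFn_smul (c : ℂ) p.1, Lp.coeFn_smul (c : ℂ) p.2] with x h1 h3 h4
    simp only [h3, h4, Pi.smul_apply, smul_eq_mul, norm_mul, Complex.norm_real, Real.norm_eq_abs,
      abs_of_nonneg hc, Complex.re_ofReal_mul]
    gcongr

theorem zero_mem_dominated {u w : Lp ℂ 2 μ} (h : (u, w) ∈ dominated μ) :
    ((0 : Lp ℂ 2 μ), w) ∈ dominated μ := by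
  filter_upwards [h, Lp.coeFn_zero ℂ 2 μ] with x h1 h2
  simp only [h2, Pi.zero_apply, norm_zero]
  exact (norm_nonneg _).trans h1

theorem memLp_ofReal {f : X → ℝ} (hf : MemLp f 2 μ) : MemLp (fun x => (f x : ℂ)) 2 μ := hf.ofReal

/-- The absolute value of an `L²` function. -/
def absLp (u : Lp ℂ 2 μ) : Lp ℂ 2 μ := (memLp_ofReal (Lp.memLp u).norm).toLp _

theorem absLp_ae (u : Lp ℂ 2 μ) : absLp u =ᵐ[μ] fun x => ((‖u x‖ : ℝ) : ℂ) := MemLp.coeFn_toLp _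

theorem mem_dominated_abs (u : Lp ℂ 2 μ) : (u, absLp u) ∈ dominated μ := by
  filter_upwards [absLp_ae u] with x hx
  simp [hx]

theorem norm_absLp (u : Lp ℂ 2 μ) : ‖absLp u‖ = ‖u‖ := by
  refine le_antisymm (Lp.norm_le_norm_of_ae_le ?_) (Lp.norm_le_norm_of_ae_le ?_) <;>
  · filter_upwards [absLp_ae u] with x hx
    simp [hx]

theorem exists_mulOp (μ : Measure X) {f : X → ℝ} (hf : Measurable f) {K : ℝ} (hK : ∀ x, |f x| ≤ K) :
    ∃ T : Lp ℂ 2 μ →L[ℂ] Lp ℂ 2 μ, ∀ g, T g =ᵐ[μ] fun x => (f x : ℂ) * g x := by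
  have hle : ∀ (g : Lp ℂ 2 μ) x, ‖(f x : ℂ) * g x‖ ≤ K * ‖g x‖ := by
    intro g x
    rw [norm_mul, Complex.norm_real, Real.norm_eq_abs]
    gcongr
    exact hK x
  have hmem : ∀ g : Lp ℂ 2 μ, MemLp (fun x => (f x : ℂ) * g x) 2 μ := fun g =>
    (Lp.memLp g).of_le_mul
      ((Complex.measurable_ofReal.comp hf).aestronglyMeasurable.mul (Lp.aestronglyMeasurable g))
      (Eventually.of_forall (hle g))
  let L : Lp ℂ 2 μ →ₗ[ℂ] Lp ℂ 2 μ :=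
    { toFun := fun g => (hmem g).toLp _
      map_add' := fun g h => by
        refine Lp.ext ?_
        filter_upwards [(hmem (g + h)).coeFn_toLp, (hmem g).coeFn_toLp, (hmem h).coeFn_toLp,
          Lp.coeFn_add g h, Lp.coeFn_add ((hmem g).toLp _) ((hmem h).toLp _)] with x h1 h2 h3 h4 h5
        rw [h1, h5, Pi.add_apply, h2, h3, h4, Pi.add_apply, mul_add]
      map_smul' := fun c g => by
        refine Lp.ext ?_
        filter_upwards [(hmem (c • g)).coeFn_toLp, (hmem g).coeFn_toLp, Lp.coeFn_smul c g,
          Lp.coeFn_smul c ((hmem g).toLp _)] with x h1 h2 h3 h4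
        rw [h1, RingHom.id_apply, h4, Pi.smul_apply, h2, h3, Pi.smul_apply, smul_eq_mul, smul_eq_mul]
        ring }
  refine ⟨L.mkContinuous K fun g => ?_, fun g => (hmem g).coeFn_toLp⟩
  refine Lp.norm_le_mul_norm_of_ae_le_mul ?_
  filter_upwards [(hmem g).coeFn_toLp] with x hx
  change ‖((hmem g).toLp _ : X → ℂ) x‖ ≤ _
  rw [hx]
  exact hle g x

/-- A nonnegative potential, locally bounded and continuous for the supremum norm in time. -/
structure IsPotential (v : ℝ → X → ℝ) : Prop where
  meas : ∀ s, Measurable (v s)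
  nonneg : ∀ s x, 0 ≤ v s x
  bdd : ∀ T, ∃ K, ∀ s ≤ T, ∀ x, v s x ≤ K
  cont : ∀ s, ∀ δ > 0, ∀ᶠ s' in 𝓝 s, ∀ x, |v s' x - v s x| ≤ δ

theorem IsPotential.comp {v : ℝ → X → ℝ} (hv : IsPotential v) {Y : Type*} [MeasurableSpace Y]
    {f : Y → X} (hf : Measurable f) : IsPotential fun s y => v s (f y) :=
  ⟨fun s => (hv.meas s).comp hf, fun s _ => hv.nonneg s _,
    fun T => (hv.bdd T).imp fun _ hK s hs _ => hK s hs _,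
    fun s δ hδ => (hv.cont s δ hδ).mono fun _ h _ => h _⟩

theorem IsPotential.exists_abs_le {v : ℝ → X → ℝ} (hv : IsPotential v) (s : ℝ) :
    ∃ K, ∀ x, |v s x| ≤ K :=
  (hv.bdd s).imp fun _ hK x => by rw [abs_of_nonneg (hv.nonneg s x)]; exact hK s le_rfl x

/-- Multiplication by a potential. -/
def potOp (μ : Measure X) {v : ℝ → X → ℝ} (hv : IsPotential v) (s : ℝ) : Lp ℂ 2 μ →L[ℂ] Lp ℂ 2 μ :=
  (exists_mulOp μ (hv.meas s) (hv.exists_abs_le s).choose_spec).choose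

theorem potOp_ae {v : ℝ → X → ℝ} (hv : IsPotential v) (s : ℝ) (g : Lp ℂ 2 μ) :
    potOp μ hv s g =ᵐ[μ] fun x => (v s x : ℂ) * g x :=
  (exists_mulOp μ (hv.meas s) (hv.exists_abs_le s).choose_spec).choose_spec g

theorem continuous_potOp {v : ℝ → X → ℝ} (hv : IsPotential v) : Continuous (potOp μ hv) := by
  rw [continuous_iff_continuousAt]
  intro s
  rw [ContinuousAt, Metric.tendsto_nhds]
  intro δ hδ
  filter_upwards [hv.cont s (δ / 2) (by positivity)] with s' hs'
  rw [dist_eq_norm]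
  refine lt_of_le_of_lt (ContinuousLinearMap.opNorm_le_bound _ (by positivity) fun g => ?_)
    (half_lt_self hδ)
  refine Lp.norm_le_mul_norm_of_ae_le_mul ?_
  filter_upwards [potOp_ae hv s g, potOp_ae hv s' g, Lp.coeFn_sub (potOp μ hv s' g) (potOp μ hv s g)]
    with x h1 h2 h3
  rw [sub_apply, h3, Pi.sub_apply, h1, h2, ← sub_mul, ← Complex.ofReal_sub,
    norm_mul, Complex.norm_real, Real.norm_eq_abs]
  gcongr
  exact hs' x

theorem isPos_potOp {v : ℝ → X → ℝ} (hv : IsPotential v) (s : ℝ) : IsPos (potOp μ hv s) := by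
  refine ⟨fun f g => ?_, fun f => ?_⟩
  · rw [L2.inner_def, L2.inner_def]
    refine integral_congr_ae ?_
    filter_upwards [potOp_ae hv s f, potOp_ae hv s g] with x h1 h2
    rw [h1, h2]
    simp only [RCLike.inner_apply, map_mul, Complex.conj_ofReal]
    ring
  · rw [L2.inner_def]
    have : ∫ x, (inner ℂ (f x) (potOp μ hv s f x) : ℂ) ∂μ
        = ∫ x, ((v s x * ‖f x‖ ^ 2 : ℝ) : ℂ) ∂μ := by
      refine integral_congr_ae ?_
      filter_upwards [potOp_ae hv s f] with x h1
      rw [h1]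
      simp only [RCLike.inner_apply]
      rw [mul_assoc, Complex.mul_conj, Complex.normSq_eq_norm_sq]
      push_cast
      ring
    rw [this, integral_complex_ofReal, Complex.ofReal_re]
    exact integral_nonneg fun x => mul_nonneg (hv.nonneg s x) (by positivity)

/-- The function `K - v` takes values in `[0, K]`. This and the next lemma are the two properties of
`K - V` required by `LinSol.dominated`. -/
theorem norm_sub_potOp_le {v : ℝ → X → ℝ} (hv : IsPotential v) {s K : ℝ} (hK : ∀ x, v s x ≤ K)
    (g : Lp ℂ 2 μ) : ‖(K : ℂ) • g - potOp μ hv s g‖ ≤ K * ‖g‖ := by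
  refine Lp.norm_le_mul_norm_of_ae_le_mul ?_
  filter_upwards [potOp_ae hv s g, Lp.coeFn_smul (K : ℂ) g,
    Lp.coeFn_sub ((K : ℂ) • g) (potOp μ hv s g)] with x h1 h2 h3
  rw [h3, Pi.sub_apply, h1, h2, Pi.smul_apply, smul_eq_mul, ← sub_mul, ← Complex.ofReal_sub, norm_mul,
    Complex.norm_real, Real.norm_eq_abs, abs_of_nonneg (by linarith [hK x])]
  gcongr
  linarith [hv.nonneg s x]

theorem sub_potOp_dominated {v : ℝ → X → ℝ} (hv : IsPotential v) {s K : ℝ} (hK : ∀ x, v s x ≤ K)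
    {p : Lp ℂ 2 μ × Lp ℂ 2 μ} (hp : p ∈ dominated μ) :
    ((K : ℂ) • p.1 - potOp μ hv s p.1, (K : ℂ) • p.2) ∈ dominated μ := by
  filter_upwards [hp, potOp_ae hv s p.1, Lp.coeFn_smul (K : ℂ) p.1, Lp.coeFn_smul (K : ℂ) p.2,
    Lp.coeFn_sub ((K : ℂ) • p.1) (potOp μ hv s p.1)] with x h0 h1 h2 h4 h3
  rw [h3, Pi.sub_apply, h1, h2, h4, Pi.smul_apply, Pi.smul_apply, smul_eq_mul, smul_eq_mul, ← sub_mul,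
    ← Complex.ofReal_sub, norm_mul, Complex.norm_real, Real.norm_eq_abs,
    abs_of_nonneg (by linarith [hK x]), Complex.re_ofReal_mul]
  have := hv.nonneg s x
  have := hK x
  refine mul_le_mul (by linarith) h0 (norm_nonneg _) (by linarith)

/-! ### Heat kernels -/

/-- `k` is a nonnegative integral kernel of `e^{-tΛ}`, checked on the representatives `e` of the basis
vectors. -/
structure IsHeatKernel {ι : Type*} (b : HilbertBasis ι ℂ (Lp ℂ 2 μ)) (ν : ι → ℝ) (t : ℝ)
    (k : X → X → ℝ) : Prop where
  nonneg : ∀ x y, 0 ≤ k x y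
  memLp : ∀ x, MemLp (k x) 2 μ
  eigen : ∀ i, ∀ᵐ x ∂μ, ∫ y, (k x y : ℂ) * b i y ∂μ = (Real.exp (-(ν i * t)) : ℝ) * b i x

variable {ι : Type*} {b : HilbertBasis ι ℂ (Lp ℂ 2 μ)} {ν : ι → ℝ} {t : ℝ} {k : X → X → ℝ}

theorem IsHeatKernel.integrable (hk : IsHeatKernel b ν t k) (x : X) (g : Lp ℂ 2 μ) :
    Integrable (fun y => (k x y : ℂ) * g y) μ :=
  (hk.memLp x).ofReal.integrable_mul (Lp.memLp g)

/-- The formula holds for finite combinations of basis vectors, with countably many exceptional null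
sets. Along partial sums tending to `g`, the left side converges almost everywhere for a
subsequence, and the right side converges at every `x` because `k x` is square integrable. -/
theorem IsHeatKernel.heat_ae [Countable ι] (hk : IsHeatKernel b ν t k) (hν : ∀ i, 0 ≤ ν i)
    (ht : 0 ≤ t) (g : Lp ℂ 2 μ) : heat b hν t g =ᵐ[μ] fun x => ∫ y, (k x y : ℂ) * g y ∂μ := by
  let κ : X → Lp ℂ 2 μ := fun x => (memLp_ofReal (hk.memLp x)).toLp _
  have hκ : ∀ x (f : Lp ℂ 2 μ), inner ℂ (κ x) f = ∫ y, (k x y : ℂ) * f y ∂μ := by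
    intro x f
    rw [L2.inner_def]
    refine integral_congr_ae ?_
    filter_upwards [(memLp_ofReal (hk.memLp x)).coeFn_toLp] with y hy
    simp only [κ]
    rw [hy]
    simp [mul_comm]
  obtain ⟨Js, hJs⟩ := exists_seq_tendsto (atTop : Filter (Finset ι))
  let gn : ℕ → Lp ℂ 2 μ := fun n => ∑ i ∈ Js n, (inner ℂ (b i) g : ℂ) • b i
  have hgn : Tendsto gn atTop (𝓝 g) := by
    have := (b.hasSum_repr g : Tendsto _ _ _)
    simp only [b.repr_apply_apply] at this
    exact this.comp hJs
  obtain ⟨ns, hns, hae⟩ := exists_subseq_ae (((heat b hν t).continuous.tendsto g).comp hgn)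
  have heig : ∀ᵐ x ∂μ, ∀ i, inner ℂ (κ x) (b i) = (Real.exp (-(ν i * t)) : ℝ) * b i x := by
    refine ae_all_iff.2 fun i => ?_
    filter_upwards [hk.eigen i] with x hx
    rw [hκ, hx]
  have hfin : ∀ J : Finset ι, ∀ᵐ x ∂μ,
      (∑ i ∈ J, (inner ℂ (b i) g * (Real.exp (-(ν i * t)) : ℝ) : ℂ) • b i : Lp ℂ 2 μ) x
        = ∑ i ∈ J, (inner ℂ (b i) g * (Real.exp (-(ν i * t)) : ℝ) : ℂ) * b i x := by
    intro J
    classical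
    induction J using Finset.induction_on with
    | empty =>
      filter_upwards [Lp.coeFn_zero ℂ 2 μ] with x hx
      simpa using hx
    | insert i J hi ih =>
      rw [Finset.sum_insert hi]
      filter_upwards [ih, Lp.coeFn_add ((inner ℂ (b i) g * (Real.exp (-(ν i * t)) : ℝ) : ℂ) • b i)
        (∑ i ∈ J, (inner ℂ (b i) g * (Real.exp (-(ν i * t)) : ℝ) : ℂ) • b i : Lp ℂ 2 μ),
        Lp.coeFn_smul (inner ℂ (b i) g * (Real.exp (-(ν i * t)) : ℝ) : ℂ) (b i)] with x h1 h2 h3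
      rw [h2, Pi.add_apply, h1, h3, Finset.sum_insert hi, Pi.smul_apply, smul_eq_mul]
  have hheat : ∀ n, heat b hν t (gn n)
      = ∑ i ∈ Js n, (inner ℂ (b i) g * (Real.exp (-(ν i * t)) : ℝ) : ℂ) • b i := by
    intro n
    simp only [gn, map_sum, map_smul, heat_basis b hν ht, smul_smul]
  filter_upwards [hae, heig, ae_all_iff.2 fun n => hfin (Js n)] with x h1 h2 h3
  have h4 : Tendsto (fun n => inner ℂ (κ x) (gn (ns n))) atTop (𝓝 (inner ℂ (κ x) g)) :=
    (((innerSL ℂ (κ x)).continuous.tendsto g).comp hgn).comp hns.tendsto_atTop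
  rw [← hκ]
  refine tendsto_nhds_unique h1 (h4.congr fun n => ?_)
  simp only [Function.comp, hheat]
  rw [h3, inner_sum]
  refine Finset.sum_congr rfl fun i _ => ?_
  rw [inner_smul_right, h2]
  ring

/-- Positivity of the kernel: `|∫ k u| ≤ ∫ k |u| ≤ ∫ k Re w`. -/
theorem IsHeatKernel.dominated [Countable ι] (hk : IsHeatKernel b ν t k) (hν : ∀ i, 0 ≤ ν i)
    (ht : 0 ≤ t) {p : Lp ℂ 2 μ × Lp ℂ 2 μ} (hp : p ∈ dominated μ) :
    (heat b hν t p.1, heat b hν t p.2) ∈ dominated μ := by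
  filter_upwards [hk.heat_ae hν ht p.1, hk.heat_ae hν ht p.2] with x h1 h2
  rw [h1, h2]
  have e : (∫ y, (k x y : ℂ) * p.2 y ∂μ).re = ∫ y, k x y * (p.2 y).re ∂μ := by
    have := integral_re (𝕜 := ℂ) (hk.integrable x p.2)
    simp only [RCLike.re_eq_complex_re, Complex.re_ofReal_mul] at this
    exact this.symm
  rw [e]
  refine norm_integral_le_of_norm_le ?_ ?_
  · have := (hk.integrable x p.2).re
    simpa using this
  · filter_upwards [hp] with y hy
    rw [norm_mul, Complex.norm_real, Real.norm_eq_abs, abs_of_nonneg (hk.nonneg x y)]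
    exact mul_le_mul_of_nonneg_left hy (hk.nonneg x y)

/-- A pointwise bound for `e^{-tΛ} u` from the kernel. -/
theorem IsHeatKernel.norm_heat_le [Countable ι] (hk : IsHeatKernel b ν t k) (hν : ∀ i, 0 ≤ ν i)
    (ht : 0 ≤ t) {u : Lp ℂ 2 μ} {W W' : X → ℝ} (hu : ∀ᵐ x ∂μ, ‖u x‖ ≤ W x)
    (hint : ∀ x, Integrable (fun y => k x y * W y) μ)
    (hW : ∀ x, ∫ y, k x y * W y ∂μ ≤ W' x) : ∀ᵐ x ∂μ, ‖heat b hν t u x‖ ≤ W' x := by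
  filter_upwards [hk.heat_ae hν ht u] with x h1
  rw [h1]
  refine le_trans (norm_integral_le_of_norm_le (hint x) ?_) (hW x)
  filter_upwards [hu] with y hy
  rw [norm_mul, Complex.norm_real, Real.norm_eq_abs, abs_of_nonneg (hk.nonneg x y)]
  exact mul_le_mul_of_nonneg_left hy (hk.nonneg x y)

/-- The `L²`–`L^∞` bound from the kernel. -/
theorem IsHeatKernel.norm_heat_le_norm [Countable ι] (hk : IsHeatKernel b ν t k) (hν : ∀ i, 0 ≤ ν i)
    (ht : 0 ≤ t) (u : Lp ℂ 2 μ) : ∀ᵐ x ∂μ, ‖heat b hν t u x‖ ≤ ‖(hk.memLp x).toLp (k x)‖ * ‖u‖ := by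
  filter_upwards [hk.heat_ae hν ht u] with x h1
  rw [h1]
  have e : ∫ y, (k x y : ℂ) * u y ∂μ
      = inner ℂ ((memLp_ofReal (hk.memLp x)).toLp _) u := by
    rw [L2.inner_def]
    refine integral_congr_ae ?_
    filter_upwards [(memLp_ofReal (hk.memLp x)).coeFn_toLp] with y hy
    rw [hy]
    simp [mul_comm]
  rw [e]
  refine (norm_inner_le_norm _ _).trans (le_of_eq ?_)
  congr 1
  rw [Lp.norm_toLp, Lp.norm_toLp]
  congr 1
  refine eLpNorm_congr_norm_ae (Eventually.of_forall fun y => ?_)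
  simp

end Lattice

end CylinderPropagator

end

noncomputable section

namespace CylinderPropagator

open Polynomial

/-! ### Hermite polynomials for the weight `e^{-y²/4}` -/

/-- The Hermite polynomials orthogonal for the weight `e^{-y²/4}`. -/
def herm : ℕ → ℝ[X]
  | 0 => 1
  | n + 1 => X * herm n - 2 * derivative (herm n)

theorem herm_succ (n : ℕ) : herm (n + 1) = X * herm n - 2 * derivative (herm n) := rfl

/-- The two identities are proved together: the differential equation in degree `n + 1` follows from
the derivative formula for `herm (n + 1)`, and it is what is needed to differentiate the recursion
for `herm (n + 2)`. -/
theorem herm_deriv (n : ℕ) : derivative (herm (n + 1)) = ((n : ℝ[X]) + 1) * herm n ∧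
    2 * derivative (derivative (herm n)) = X * derivative (herm n) - (n : ℝ[X]) * herm n := by
  induction n with
  | zero => simp [herm]
  | succ n ih =>
    have h2 : 2 * derivative (derivative (herm (n + 1)))
        = X * derivative (herm (n + 1)) - ((n + 1 : ℕ) : ℝ[X]) * herm (n + 1) := by
      have e : derivative (((n : ℝ[X]) + 1) * herm n) = ((n : ℝ[X]) + 1) * derivative (herm n) := by
        rw [derivative_mul]; simp
      rw [ih.1, e, herm_succ]
      push_cast
      ring
    refine ⟨?_, h2⟩
    have e2 : derivative ((2 : ℝ[X]) * derivative (herm (n + 1)))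
        = 2 * derivative (derivative (herm (n + 1))) := by
      rw [derivative_mul]; simp
    rw [herm_succ (n + 1), derivative_sub, derivative_mul, derivative_X, e2, h2]
    push_cast
    ring

theorem derivative_herm_succ (n : ℕ) : derivative (herm (n + 1)) = ((n : ℝ[X]) + 1) * herm n :=
  (herm_deriv n).1

theorem herm_succ_succ (n : ℕ) :
    herm (n + 2) = X * herm (n + 1) - 2 * ((n : ℝ[X]) + 1) * herm n := by
  rw [herm_succ, derivative_herm_succ]; ring

/-- Polynomial growth of the Hermite polynomials. -/
theorem exists_abs_herm_le (n : ℕ) :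
    ∃ C : ℝ, 0 ≤ C ∧ ∀ s : ℝ, |(herm n).eval s| ≤ C * Real.sqrt (1 + s ^ 2) ^ n := by
  suffices h : (∃ C : ℝ, 0 ≤ C ∧ ∀ s : ℝ, |(herm n).eval s| ≤ C * Real.sqrt (1 + s ^ 2) ^ n) ∧
      ∃ C : ℝ, 0 ≤ C ∧ ∀ s : ℝ, |(herm (n + 1)).eval s| ≤ C * Real.sqrt (1 + s ^ 2) ^ (n + 1) from h.1
  have hJ : ∀ s : ℝ, |s| ≤ Real.sqrt (1 + s ^ 2) ∧ 1 ≤ Real.sqrt (1 + s ^ 2) := by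
    intro s
    exact ⟨Real.abs_le_sqrt (by linarith), Real.one_le_sqrt.2 (by nlinarith)⟩
  induction n with
  | zero =>
    refine ⟨⟨1, zero_le_one, fun s => by simp [herm]⟩, ⟨1, zero_le_one, fun s => ?_⟩⟩
    simpa [herm] using (hJ s).1
  | succ n ih =>
    obtain ⟨⟨C, hC0, hC⟩, ⟨D, hD0, hD⟩⟩ := ih
    refine ⟨⟨D, hD0, hD⟩, ⟨D + 2 * (n + 1) * C, by positivity, fun s => ?_⟩⟩
    obtain ⟨h1, h2⟩ := hJ s
    have hev : (herm (n + 2)).eval s = s * (herm (n + 1)).eval s - 2 * (n + 1) * (herm n).eval s := by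
      rw [herm_succ_succ]; simp
    rw [hev]
    calc |s * (herm (n + 1)).eval s - 2 * (n + 1) * (herm n).eval s|
        ≤ |s| * |(herm (n + 1)).eval s| + 2 * (n + 1) * |(herm n).eval s| := by
          refine (abs_sub _ _).trans (le_of_eq ?_)
          rw [abs_mul, abs_mul, abs_of_nonneg (by positivity : (0 : ℝ) ≤ 2 * (n + 1))]
      _ ≤ Real.sqrt (1 + s ^ 2) * (D * Real.sqrt (1 + s ^ 2) ^ (n + 1))
          + 2 * (n + 1) * (C * Real.sqrt (1 + s ^ 2) ^ (n + 2)) := by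
          have h3 : Real.sqrt (1 + s ^ 2) ^ n ≤ Real.sqrt (1 + s ^ 2) ^ (n + 2) :=
            pow_le_pow_right₀ h2 (by omega)
          gcongr
          · exact hD s
          · exact (hC s).trans (by gcongr)
      _ = _ := by ring

/-! ### One-dimensional Gaussian integrals -/

theorem integrable_poly_gauss (p : ℝ[X]) {a : ℝ} (ha : 0 < a) (c : ℝ) :
    Integrable fun y : ℝ => p.eval y * Real.exp (-a * (y - c) ^ 2) := by
  have h0 : ∀ q : ℝ[X], Integrable fun y : ℝ => q.eval y * Real.exp (-a * y ^ 2) := by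
    intro q
    induction q using Polynomial.induction_on' with
    | add p q hp hq =>
      refine (hp.add hq).congr (Eventually.of_forall fun y => ?_)
      simp [add_mul]
    | monomial n r =>
      have h := integrable_rpow_mul_exp_neg_mul_sq ha (s := (n : ℝ)) (by
        have : (0 : ℝ) ≤ n := by positivity
        linarith)
      refine (h.const_mul r).congr (Eventually.of_forall fun y => ?_)
      simp [mul_assoc]
  refine ((h0 (p.comp (X + C c))).comp_sub_right c).congr (Eventually.of_forall fun y => ?_)
  simp

theorem integral_stein (p : ℝ[X]) {a : ℝ} (ha : 0 < a) (c : ℝ) :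
    ∫ y : ℝ, (derivative p - C (2 * a) * (X - C c) * p).eval y * Real.exp (-a * (y - c) ^ 2) = 0 := by
  refine integral_eq_zero_of_hasDerivAt_of_integrable
    (f := fun y => p.eval y * Real.exp (-a * (y - c) ^ 2)) (fun y => ?_)
    (integrable_poly_gauss _ ha c) (integrable_poly_gauss _ ha c)
  have h1 := p.hasDerivAt y
  have h2 : HasDerivAt (fun y : ℝ => Real.exp (-a * (y - c) ^ 2))
      (Real.exp (-a * (y - c) ^ 2) * (-a * (2 * (y - c)))) y := by
    have := ((((hasDerivAt_id y).sub_const c).pow 2).const_mul (-a)).exp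
    refine this.congr_deriv ?_
    simp
  refine (h1.fun_mul h2).congr_deriv ?_
  simp
  ring

/-- Integration against `e^{-a (y-c)²}`. -/
def gint (a c : ℝ) (p : ℝ[X]) : ℝ := ∫ y : ℝ, p.eval y * Real.exp (-a * (y - c) ^ 2)

theorem gint_add {a : ℝ} (ha : 0 < a) (c : ℝ) (p q : ℝ[X]) :
    gint a c (p + q) = gint a c p + gint a c q := by
  rw [gint, gint, gint, ← integral_add (integrable_poly_gauss p ha c) (integrable_poly_gauss q ha c)]
  simp [add_mul]

theorem gint_C_mul (a c r : ℝ) (p : ℝ[X]) : gint a c (C r * p) = r * gint a c p := by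
  rw [gint, gint, ← integral_const_mul]
  simp [mul_assoc]

/-- Gaussian integration by parts. It determines all moments recursively and underlies both
orthogonality and Mehler's formula. -/
theorem gint_stein {a : ℝ} (ha : 0 < a) (c : ℝ) (p : ℝ[X]) :
    gint a c (X * p) = c * gint a c p + (2 * a)⁻¹ * gint a c (derivative p) := by
  have h := integral_stein p ha c
  change gint a c _ = 0 at h
  have e : X * p = C c * p + C ((2 * a)⁻¹) * derivative p
      + C (-(2 * a)⁻¹) * (derivative p - C (2 * a) * (X - C c) * p) := by
    have : C ((2 * a)⁻¹) * C (2 * a) = (1 : ℝ[X]) := by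
      rw [← C_mul, inv_mul_cancel₀ (by positivity), C_1]
    rw [C_neg]
    linear_combination (-(X - C c) * p) * this
  rw [e, gint_add ha, gint_add ha, gint_C_mul, gint_C_mul, gint_C_mul, h]
  ring

theorem gint_one_pos {a : ℝ} (ha : 0 < a) (c : ℝ) : 0 < gint a c 1 := by
  have : gint a c 1 = ∫ y : ℝ, Real.exp (-a * y ^ 2) := by
    rw [gint, ← integral_sub_right_eq_self (fun y : ℝ => Real.exp (-a * y ^ 2)) c]
    simp
  rw [this, integral_gaussian]
  positivity

theorem gint_one (a c : ℝ) : gint a c 1 = Real.sqrt (Real.pi / a) := by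
  have : gint a c 1 = ∫ y : ℝ, Real.exp (-a * y ^ 2) := by
    rw [gint, ← integral_sub_right_eq_self (fun y : ℝ => Real.exp (-a * y ^ 2)) c]
    simp
  rw [this, integral_gaussian]

/-- For the weight `e^{-y²/4}` the operator `X - 2 d/dX` is the adjoint of `2 d/dX`. Both degrees
can thus be lowered together until one of them is zero. -/
theorem gint_herm_succ_mul (n : ℕ) (q : ℝ[X]) :
    gint (1 / 4) 0 (herm (n + 1) * q) = 2 * gint (1 / 4) 0 (herm n * derivative q) := by
  have h := gint_stein (a := 1 / 4) (by norm_num) 0 (herm n * q)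
  have e : herm (n + 1) * q = X * (herm n * q) + C (-2) * derivative (herm n * q)
      + C 2 * (herm n * derivative q) := by
    have h2 : (C 2 : ℝ[X]) = 2 := map_ofNat C 2
    have : (C (-2) : ℝ[X]) = -2 := by rw [C_neg, h2]
    rw [herm_succ, derivative_mul, this, h2]
    ring
  rw [e, gint_add (by norm_num), gint_add (by norm_num), gint_C_mul, gint_C_mul, h]
  norm_num

theorem gint_herm_mul_herm_of_ne : ∀ m n : ℕ, m ≠ n → gint (1 / 4) 0 (herm m * herm n) = 0
  | 0, 0, h => absurd rfl h
  | m + 1, 0, _ => by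
    rw [gint_herm_succ_mul]
    simp [herm, gint]
  | 0, n + 1, _ => by
    rw [mul_comm, gint_herm_succ_mul]
    simp [herm, gint]
  | m + 1, n + 1, h => by
    have e : herm m * derivative (herm (n + 1)) = C ((n : ℝ) + 1) * (herm m * herm n) := by
      rw [derivative_herm_succ]; simp; ring
    rw [gint_herm_succ_mul, e, gint_C_mul, gint_herm_mul_herm_of_ne m n (by omega)]
    simp

theorem gint_herm_sq_pos (n : ℕ) : 0 < gint (1 / 4) 0 (herm n * herm n) := by
  induction n with
  | zero => simpa [herm] using gint_one_pos (a := 1 / 4) (by norm_num) 0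
  | succ n ih =>
    have e : herm n * derivative (herm (n + 1)) = C ((n : ℝ) + 1) * (herm n * herm n) := by
      rw [derivative_herm_succ]; simp; ring
    rw [gint_herm_succ_mul, e, gint_C_mul]
    positivity

/-- Mehler's formula in one variable. -/
theorem gint_mehler {m : ℝ} (hm : 0 < 1 - m ^ 2) (y : ℝ) (n : ℕ) :
    gint (1 / (4 * (1 - m ^ 2))) (m * y) (herm n)
      = m ^ n * (herm n).eval y * gint (1 / (4 * (1 - m ^ 2))) (m * y) 1 := by
  have ha : 0 < 1 / (4 * (1 - m ^ 2)) := by positivity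
  set a := 1 / (4 * (1 - m ^ 2)) with hadef
  -- Two consecutive degrees are carried along because the recursion has three terms.
  suffices h : ∀ n, gint a (m * y) (herm n) = m ^ n * (herm n).eval y * gint a (m * y) 1 ∧
      gint a (m * y) (herm (n + 1)) = m ^ (n + 1) * (herm (n + 1)).eval y * gint a (m * y) 1 from
    (h n).1
  intro n
  induction n with
  | zero =>
    have h := gint_stein ha (m * y) 1
    have e : herm 1 = X := by simp [herm]
    rw [zero_add, e]
    refine ⟨by simp [herm], ?_⟩
    rw [mul_one] at h
    rw [h]
    simp [gint]
  | succ n ih =>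
    refine ⟨ih.2, ?_⟩
    have e : herm (n + 2) = X * herm (n + 1) + C (-(2 * ((n : ℝ) + 1))) * herm n := by
      rw [herm_succ_succ]; simp [map_ofNat C 2]; ring
    have e2 : derivative (herm (n + 1)) = C ((n : ℝ) + 1) * herm n := by
      rw [derivative_herm_succ]; simp
    -- Twice the variance-type factor `1 - m²`: its part `2` cancels the lower-order term of the
    -- recursion, and `-2 m²` supplies that term for the degree `n + 2` with the correct power of
    -- `m`.
    have e3 : (2 * a)⁻¹ = 2 * (1 - m ^ 2) := by
      rw [hadef]; field_simp
      ring
    rw [show n + 1 + 1 = n + 2 from rfl, e, gint_add ha, gint_stein ha, e2, gint_C_mul, gint_C_mul,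
      ih.1, ih.2, e3]
    simp
    ring

/-! ### Hermite functions on `ℝ³` -/

theorem norm_sq_E (y : E) : ‖y‖ ^ 2 = ∑ i, y i ^ 2 := by
  simp [EuclideanSpace.norm_sq_eq]

theorem gauss_eq_prod (y : E) : gauss y = ∏ i, Real.exp (-(y i ^ 2) / 8) := by
  rw [gauss, ← Real.exp_sum, norm_sq_E, ← Finset.sum_neg_distrib, Finset.sum_div]

theorem gauss_pos (y : E) : 0 < gauss y := Real.exp_pos _

theorem integral_E_prod {𝕜 : Type*} [RCLike 𝕜] (f : Fin 3 → ℝ → 𝕜) :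
    ∫ y : E, ∏ i, f i (y i) = ∏ i, ∫ s, f i s := by
  rw [← integral_fintype_prod_volume_eq_prod]
  exact (PiLp.volume_preserving_ofLp (Fin 3)).integral_comp
    (MeasurableEquiv.toLp 2 (Fin 3 → ℝ)).symm.measurableEmbedding (fun z => ∏ i, f i (z i))

theorem integrable_E_prod {𝕜 : Type*} [RCLike 𝕜] {f : Fin 3 → ℝ → 𝕜} (hf : ∀ i, Integrable (f i)) :
    Integrable fun y : E => ∏ i, f i (y i) :=
  ((PiLp.volume_preserving_ofLp (Fin 3)).integrable_comp_emb
    (MeasurableEquiv.toLp 2 (Fin 3 → ℝ)).symm.measurableEmbedding).2 (Integrable.fintype_prod hf)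

theorem exists_pow_mul_gauss_le (n : ℕ) {a : ℝ} (ha : 0 < a) :
    ∃ C : ℝ, ∀ r : ℝ, 0 ≤ r → (1 + r) ^ n * Real.exp (-a * r ^ 2) ≤ C := by
  have hlim : Tendsto (fun r : ℝ => (1 + r) ^ n * Real.exp (-(1 + r))) atTop (𝓝 0) :=
    (Real.tendsto_pow_mul_exp_neg_atTop_nhds_zero n).comp (tendsto_atTop_add_const_left _ 1 tendsto_id)
  have hexp : ∃ D : ℝ, 0 ≤ D ∧ ∀ x : ℝ, 0 ≤ x → x ^ n * Real.exp (-x) ≤ D := by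
    refine ⟨n.factorial, by positivity, fun x hx => ?_⟩
    have := Real.pow_div_factorial_le_exp x hx n
    rw [Real.exp_neg, ← div_eq_mul_inv, div_le_iff₀ (Real.exp_pos x)]
    rwa [div_le_iff₀ (by positivity), mul_comm] at this
  obtain ⟨D, hD0, hD⟩ := hexp
  -- The exponent `1 + 1/(4a)` is the maximum of `1 + r - a r²`.
  refine ⟨D * Real.exp (1 + 1 / (4 * a)), fun r hr => ?_⟩
  have h1 := hD (1 + r) (by linarith)
  calc (1 + r) ^ n * Real.exp (-a * r ^ 2)
      = (1 + r) ^ n * Real.exp (-(1 + r)) * Real.exp (1 + r - a * r ^ 2) := by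
        rw [mul_assoc, ← Real.exp_add]; ring_nf
    _ ≤ D * Real.exp (1 + 1 / (4 * a)) := by
        gcongr
        have : 0 ≤ a * (r - 1 / (2 * a)) ^ 2 := by positivity
        have e : a * (r - 1 / (2 * a)) ^ 2 = a * r ^ 2 - r + 1 / (4 * a) := by
          field_simp
          ring
        linarith

theorem contDiff_gauss : ContDiff ℝ ∞ gauss := by
  unfold gauss
  exact (((contDiff_norm_sq ℝ).neg).div_const 8).exp

/-- The Gaussian as a Schwartz function. -/
def gaussSchwartz : 𝓢(E, ℂ) where
  toFun y := (gauss y : ℂ)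
  smooth' := Complex.ofRealCLM.contDiff.comp contDiff_gauss
  decay' := by
    intro k n
    obtain ⟨C, hC⟩ := exists_pow_mul_gauss_le (k + n) (a := 1 / 8) (by norm_num)
    refine ⟨n.factorial * C, fun y => ?_⟩
    have hn : ‖iteratedFDeriv ℝ n (fun y => (gauss y : ℂ)) y‖ = ‖iteratedFDeriv ℝ n gauss y‖ := by
      have := (Complex.ofRealLI).norm_iteratedFDeriv_comp_left (f := gauss) (x := y)
        contDiff_gauss.contDiffAt (i := n) (by exact_mod_cast le_top)
      exact this
    -- Bounds of the form `(1 + ‖y‖)^i` on the derivatives of the exponent are the input for the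
    -- composition estimate below, which costs the factor `n!`.
    have hD : ∀ i : ℕ, 1 ≤ i → i ≤ n →
        ‖iteratedFDeriv ℝ i (fun y : E => -(‖y‖ ^ 2) / 8) y‖ ≤ (1 + ‖y‖) ^ i := by
      intro i hi _
      have hsmooth : ContDiff ℝ ∞ fun y : E => ‖y‖ ^ 2 := contDiff_norm_sq ℝ
      have e1 : (fun y : E => -(‖y‖ ^ 2) / 8) = (-1 / 8 : ℝ) • fun y : E => ‖y‖ ^ 2 := by
        funext z; simp; ring
      have hfd : fderiv ℝ (fun y : E => ‖y‖ ^ 2) = fun x : E => (2 : ℝ) • (innerSL ℝ x) := by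
        funext x
        rw [(hasStrictFDerivAt_norm_sq x).hasFDerivAt.fderiv]
        ext z; simp
      have hval : ‖iteratedFDeriv ℝ i (fun y : E => ‖y‖ ^ 2) y‖ ≤ 2 * (1 + ‖y‖) ^ i := by
        obtain ⟨j, rfl⟩ : ∃ j, i = j + 1 := ⟨i - 1, by omega⟩
        rw [← norm_iteratedFDeriv_fderiv, hfd]
        have hpos : (1 : ℝ) ≤ 1 + ‖y‖ := by linarith [norm_nonneg y]
        have hlin : (fun x : E => (2 : ℝ) • (innerSL ℝ x))
            = ⇑((2 : ℝ) • (innerSL ℝ : E →L[ℝ] E →L[ℝ] ℝ)) := by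
          funext x; rfl
        have hnl : ‖(2 : ℝ) • (innerSL ℝ : E →L[ℝ] E →L[ℝ] ℝ)‖ ≤ 2 := by
          refine ContinuousLinearMap.opNorm_le_bound _ (by norm_num) fun x => ?_
          refine ContinuousLinearMap.opNorm_le_bound _ (by positivity) fun z => ?_
          change ‖(2 : ℝ) * inner ℝ x z‖ ≤ _
          rw [norm_mul, Real.norm_ofNat, mul_assoc]
          gcongr
          exact norm_inner_le_norm x z
        rw [hlin]
        rcases j with _ | _ | j
        · rw [norm_iteratedFDeriv_zero]
          refine (ContinuousLinearMap.le_opNorm _ _).trans ?_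
          simp only [zero_add, pow_one]
          have := norm_nonneg y
          nlinarith
        · rw [← norm_iteratedFDeriv_fderiv, norm_iteratedFDeriv_zero, ContinuousLinearMap.fderiv]
          have : (1 : ℝ) ≤ (1 + ‖y‖) ^ (0 + 1 + 1) := one_le_pow₀ hpos
          linarith
        · rw [← norm_iteratedFDeriv_fderiv]
          have : fderiv ℝ ⇑((2 : ℝ) • (innerSL ℝ : E →L[ℝ] E →L[ℝ] ℝ))
              = fun _ => ((2 : ℝ) • (innerSL ℝ : E →L[ℝ] E →L[ℝ] ℝ)) := by
            funext x
            exact ContinuousLinearMap.fderiv _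
          rw [this, iteratedFDeriv_const_of_ne (by omega)]
          simp
          positivity
      rw [e1, iteratedFDeriv_const_smul_apply (hsmooth.of_le (by exact_mod_cast le_top)).contDiffAt,
        norm_smul]
      have : (0 : ℝ) ≤ (1 + ‖y‖) ^ i := by positivity
      norm_num
      linarith
    have hexp : ∀ i ≤ n, ‖iteratedFDeriv ℝ i Real.exp (-(‖y‖ ^ 2) / 8)‖ ≤ gauss y := by
      intro i _
      rw [norm_iteratedFDeriv_eq_norm_iteratedDeriv, iteratedDeriv_eq_iterate, Real.iter_deriv_exp]
      rw [Real.norm_eq_abs, abs_of_pos (Real.exp_pos _)]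
      rfl
    have hmain := norm_iteratedFDeriv_comp_le (𝕜 := ℝ) (g := Real.exp)
      (f := fun y : E => -(‖y‖ ^ 2) / 8) (n := n) (N := ∞) Real.contDiff_exp
      (((contDiff_norm_sq ℝ).neg).div_const 8) (by exact_mod_cast le_top) y hexp hD
    rw [hn]
    have e2 : (Real.exp ∘ fun y : E => -(‖y‖ ^ 2) / 8) = gauss := rfl
    rw [e2] at hmain
    have h3 := hC ‖y‖ (norm_nonneg y)
    have e4 : Real.exp (-(1 / 8) * ‖y‖ ^ 2) = gauss y := by rw [gauss]; ring_nf
    rw [e4] at h3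
    have h5 : ‖y‖ ^ k ≤ (1 + ‖y‖) ^ k := by gcongr; linarith
    calc ‖y‖ ^ k * ‖iteratedFDeriv ℝ n gauss y‖
        ≤ (1 + ‖y‖) ^ k * (n.factorial * gauss y * (1 + ‖y‖) ^ n) := by gcongr
      _ = n.factorial * ((1 + ‖y‖) ^ (k + n) * gauss y) := by rw [pow_add]; ring
      _ ≤ n.factorial * C := by gcongr

theorem gaussSchwartz_apply (y : E) : gaussSchwartz y = (gauss y : ℂ) := rfl

theorem hasTemperateGrowth_coord (i : Fin 3) : (fun y : E => ((y i : ℝ) : ℂ)).HasTemperateGrowth :=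
  Function.HasTemperateGrowth.comp Function.Complex.hasTemperateGrowth_ofReal
    (EuclideanSpace.proj (𝕜 := ℝ) i).hasTemperateGrowth

theorem hasTemperateGrowth_mvPoly (q : MvPolynomial (Fin 3) ℝ) :
    (fun y : E => ((MvPolynomial.eval (fun i => y i) q : ℝ) : ℂ)).HasTemperateGrowth := by
  induction q using MvPolynomial.induction_on with
  | C a => simp [Function.HasTemperateGrowth.const]
  | add p q hp hq =>
    have := hp.add hq
    simpa [Pi.add_def] using this
  | mul_X p i hp =>
    have := hp.mul (hasTemperateGrowth_coord i)
    simpa using! this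

/-- A polynomial times the Gaussian, as a Schwartz function. -/
def polySchwartz (q : MvPolynomial (Fin 3) ℝ) : 𝓢(E, ℂ) :=
  SchwartzMap.smulLeftCLM ℂ (fun y : E => ((MvPolynomial.eval (fun i => y i) q : ℝ) : ℂ)) gaussSchwartz

theorem polySchwartz_apply (q : MvPolynomial (Fin 3) ℝ) (y : E) :
    polySchwartz q y = ((MvPolynomial.eval (fun i => y i) q * gauss y : ℝ) : ℂ) := by
  rw [polySchwartz, SchwartzMap.smulLeftCLM_apply_apply (hasTemperateGrowth_mvPoly q),
    gaussSchwartz_apply]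
  simp

/-- The product Hermite polynomial of multi-index `α`. -/
def hermPoly (α : Fin 3 → ℕ) : MvPolynomial (Fin 3) ℝ :=
  ∏ i, aeval (MvPolynomial.X i : MvPolynomial (Fin 3) ℝ) (herm (α i))

theorem eval_aeval_X (y : Fin 3 → ℝ) (i : Fin 3) (p : ℝ[X]) :
    MvPolynomial.eval y (aeval (MvPolynomial.X i : MvPolynomial (Fin 3) ℝ) p) = p.eval (y i) := by
  induction p using Polynomial.induction_on' with
  | add p q hp hq => simp [hp, hq]
  | monomial n r => simp [aeval_monomial]

theorem eval_hermPoly (α : Fin 3 → ℕ) (y : Fin 3 → ℝ) :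
    MvPolynomial.eval y (hermPoly α) = ∏ i, (herm (α i)).eval (y i) := by
  simp [hermPoly, eval_aeval_X]

/-- The Hermite function in one variable. -/
def herm1 (n : ℕ) (s : ℝ) : ℝ := (herm n).eval s * Real.exp (-(s ^ 2) / 8)

/-- The Hermite function on `ℝ³`. -/
def hermFun (α : Fin 3 → ℕ) (y : E) : ℝ := ∏ i, herm1 (α i) (y i)

theorem hermFun_eq (α : Fin 3 → ℕ) (y : E) :
    hermFun α y = (∏ i, (herm (α i)).eval (y i)) * gauss y := by
  simp only [hermFun, herm1, gauss_eq_prod, Finset.prod_mul_distrib]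

/-- The Hermite function as a Schwartz function. -/
def hermSchwartz (α : Fin 3 → ℕ) : 𝓢(E, ℂ) := polySchwartz (hermPoly α)

theorem hermSchwartz_apply (α : Fin 3 → ℕ) (y : E) : hermSchwartz α y = (hermFun α y : ℂ) := by
  rw [hermSchwartz, polySchwartz_apply, eval_hermPoly, hermFun_eq]

end CylinderPropagator

end

noncomputable section

namespace CylinderPropagator

open Polynomial

/-! ### The eigenvalue equation -/

/-- Reduces the Laplacian of a product function to derivatives along coordinate lines, that is, to
one-variable calculus. -/
theorem laplacian_eq_sum_partials {f : E → ℂ} (hf : ContDiff ℝ 2 f) {g k : Fin 3 → E → ℂ}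
    (hg : ∀ i y, HasDerivAt (fun t : ℝ => f (y + t • EuclideanSpace.single i (1 : ℝ))) (g i y) 0)
    (hk : ∀ i y, HasDerivAt (fun t : ℝ => g i (y + t • EuclideanSpace.single i (1 : ℝ))) (k i y) 0)
    (y : E) : Laplacian.laplacian f y = ∑ i, k i y := by
  rw [InnerProductSpace.laplacian_eq_iteratedFDeriv_orthonormalBasis f
    (EuclideanSpace.basisFun (Fin 3) ℝ)]
  refine Finset.sum_congr rfl fun i _ => ?_
  rw [iteratedFDeriv_two_apply]
  simp only [EuclideanSpace.basisFun_apply, Matrix.cons_val_zero, Matrix.cons_val_one]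
  set v : E := EuclideanSpace.single i (1 : ℝ)
  have h1 : ∀ z, fderiv ℝ f z v = g i z := fun z =>
    ((hf.differentiable (by norm_num) z).hasFDerivAt.hasLineDerivAt v).unique (hg i z)
  have hd : DifferentiableAt ℝ (fderiv ℝ f) y :=
    (hf.fderiv_right (m := 1) (by norm_num)).differentiable (by norm_num) y
  have h2 := (hd.hasFDerivAt.clm_apply (hasFDerivAt_const v y)).hasLineDerivAt v
  simp only [h1] at h2
  have h3 := h2.unique (hk i y)
  simpa using h3

/-- First and second derivatives of the Hermite functions. -/
def herm1' (n : ℕ) (s : ℝ) : ℝ :=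
  ((derivative (herm n)).eval s - s / 4 * (herm n).eval s) * Real.exp (-(s ^ 2) / 8)

theorem hasDerivAt_expsq (s : ℝ) :
    HasDerivAt (fun s : ℝ => Real.exp (-(s ^ 2) / 8)) (-(s / 4) * Real.exp (-(s ^ 2) / 8)) s := by
  have := ((((hasDerivAt_id s).pow 2).neg).div_const 8).exp
  refine this.congr_deriv ?_
  simp
  ring

theorem hasDerivAt_herm1 (n : ℕ) (s : ℝ) : HasDerivAt (herm1 n) (herm1' n s) s := by
  refine (((herm n).hasDerivAt s).fun_mul (hasDerivAt_expsq s)).congr_deriv ?_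
  rw [herm1']; ring

/-- Hermite's differential equation removes the derivatives. Summed over three coordinates, the
constants give the eigenvalue `3/4` plus half the degree. -/
theorem hasDerivAt_herm1' (n : ℕ) (s : ℝ) :
    HasDerivAt (herm1' n) ((s ^ 2 / 16 - 1 / 4 - n / 2) * herm1 n s) s := by
  have h1 := ((derivative (herm n)).hasDerivAt s).fun_sub
    (((hasDerivAt_id s).div_const 4).fun_mul ((herm n).hasDerivAt s))
  refine (h1.fun_mul (hasDerivAt_expsq s)).congr_deriv ?_
  have h2 := congrArg (Polynomial.eval s) (herm_deriv n).2
  simp at h2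
  simp only [herm1, id]
  linear_combination (1 / 2 * Real.exp (-(s ^ 2) / 8)) * h2

theorem prod_coord_line (F : Fin 3 → ℝ → ℝ) (i : Fin 3) (y : E) (t : ℝ) :
    ∏ j, F j ((y + t • EuclideanSpace.single i (1 : ℝ)) j)
      = F i (y i + t) * ∏ j ∈ Finset.univ.erase i, F j (y j) := by
  rw [← Finset.mul_prod_erase _ _ (Finset.mem_univ i)]
  congr 1
  · simp
  · refine Finset.prod_congr rfl fun j hj => ?_
    have : j ≠ i := (Finset.mem_erase.1 hj).1
    simp [this]

theorem hasDerivAt_prod_coord (F : Fin 3 → ℝ → ℝ) (i : Fin 3) (y : E) {F' : ℝ}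
    (hF : HasDerivAt (F i) F' (y i)) :
    HasDerivAt (fun t : ℝ => ((∏ j, F j ((y + t • EuclideanSpace.single i (1 : ℝ)) j) : ℝ) : ℂ))
      ((F' * ∏ j ∈ Finset.univ.erase i, F j (y j) : ℝ) : ℂ) 0 := by
  simp only [prod_coord_line F i y]
  refine HasDerivAt.ofReal_comp (f := fun t => F i (y i + t) * ∏ j ∈ Finset.univ.erase i, F j (y j)) ?_
  refine HasDerivAt.mul_const ?_ _
  have : HasDerivAt (F i) F' (y i + 0) := by simpa using hF
  exact HasDerivAt.comp_const_add (y i) 0 this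

theorem coe_hermSchwartz (α : Fin 3 → ℕ) :
    (hermSchwartz α : E → ℂ) = fun z => (hermFun α z : ℂ) := by
  funext z
  exact hermSchwartz_apply α z

theorem contDiff_hermFun (α : Fin 3 → ℕ) : ContDiff ℝ 2 fun z : E => (hermFun α z : ℂ) := by
  rw [← coe_hermSchwartz]
  exact (hermSchwartz α).smooth 2

theorem laplacian_hermFun (α : Fin 3 → ℕ) (y : E) :
    Laplacian.laplacian (fun z : E => (hermFun α z : ℂ)) y
      = ((‖y‖ ^ 2 / 16 - 3 / 4 - (∑ i, (α i : ℝ)) / 2 : ℝ) : ℂ) * hermFun α y := by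
  let G : Fin 3 → E → ℂ := fun i z =>
    ((∏ j, (Function.update (fun j => herm1 (α j)) i (herm1' (α i))) j (z j) : ℝ) : ℂ)
  let K : Fin 3 → E → ℂ := fun i z =>
    ((((z i) ^ 2 / 16 - 1 / 4 - α i / 2) * hermFun α z : ℝ) : ℂ)
  have key := laplacian_eq_sum_partials (contDiff_hermFun α) (g := G) (k := K) ?_ ?_ y
  · rw [key]
    simp only [K, ← Complex.ofReal_sum, ← Complex.ofReal_mul]
    congr 1
    rw [← Finset.sum_mul, norm_sq_E]
    congr 1
    simp only [Fin.sum_univ_three]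
    ring
  · intro i z
    have h := hasDerivAt_prod_coord (fun j => herm1 (α j)) i z (hasDerivAt_herm1 (α i) (z i))
    refine h.congr_deriv ?_
    simp only [G]
    congr 1
    rw [← Finset.mul_prod_erase _ _ (Finset.mem_univ i)]
    congr 1
    · simp
    · refine Finset.prod_congr rfl fun j hj => ?_
      have : j ≠ i := (Finset.mem_erase.1 hj).1
      simp [this]
  · intro i z
    have h := hasDerivAt_prod_coord (Function.update (fun j => herm1 (α j)) i (herm1' (α i))) i z
      (F' := ((z i) ^ 2 / 16 - 1 / 4 - α i / 2) * herm1 (α i) (z i)) (by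
        simpa using hasDerivAt_herm1' (α i) (z i))
    refine h.congr_deriv ?_
    simp only [K]
    congr 1
    rw [hermFun, ← Finset.mul_prod_erase _ _ (Finset.mem_univ i), mul_assoc]
    congr 2
    refine Finset.prod_congr rfl fun j hj => ?_
    have : j ≠ i := (Finset.mem_erase.1 hj).1
    simp [this]

/-! ### The Hermite basis -/

theorem integral_hermFun_mul (α β : Fin 3 → ℕ) :
    ∫ y, hermFun α y * hermFun β y = ∏ i, gint (1 / 4) 0 (herm (α i) * herm (β i)) := by
  simp only [gint]
  rw [← integral_E_prod]
  refine integral_congr_ae (Eventually.of_forall fun y => ?_)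
  simp only [hermFun]
  rw [← Finset.prod_mul_distrib]
  refine Finset.prod_congr rfl fun i _ => ?_
  simp only [herm1, eval_mul, sub_zero]
  have : Real.exp (-(1 / 4) * (y i) ^ 2) = Real.exp (-((y i) ^ 2) / 8) * Real.exp (-((y i) ^ 2) / 8) := by
    rw [← Real.exp_add]; ring_nf
  rw [this]
  ring

/-- The squared norm of a Hermite function. -/
def hermSq (α : Fin 3 → ℕ) : ℝ := ∫ y, hermFun α y * hermFun α y

theorem hermSq_pos (α : Fin 3 → ℕ) : 0 < hermSq α := by
  rw [hermSq, integral_hermFun_mul]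
  exact Finset.prod_pos fun i _ => gint_herm_sq_pos _

/-- The normalized Hermite function. -/
def hermN (α : Fin 3 → ℕ) (y : E) : ℝ := (Real.sqrt (hermSq α))⁻¹ * hermFun α y

/-- The normalized Hermite function in `L²`. -/
def hermVec (α : Fin 3 → ℕ) : HE :=
  (((Real.sqrt (hermSq α))⁻¹ : ℝ) : ℂ) • (hermSchwartz α).toLp 2 volume

theorem hermSchwartz_toLp_ae (α : Fin 3 → ℕ) :
    (hermSchwartz α).toLp 2 =ᵐ[volume] fun y => (hermFun α y : ℂ) := by
  filter_upwards [(hermSchwartz α).coeFn_toLp 2 volume] with y hy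
  rw [hy, hermSchwartz_apply]

theorem hermVec_ae (α : Fin 3 → ℕ) : hermVec α =ᵐ[volume] fun y => (hermN α y : ℂ) := by
  filter_upwards [hermSchwartz_toLp_ae α,
    Lp.coeFn_smul (((Real.sqrt (hermSq α))⁻¹ : ℝ) : ℂ) ((hermSchwartz α).toLp 2)] with y h1 h2
  rw [hermVec, h2, Pi.smul_apply, h1, hermN]
  simp

theorem inner_hermSchwartz (α : Fin 3 → ℕ) (f : HE) :
    inner ℂ ((hermSchwartz α).toLp 2 : HE) f = ∫ y, (hermFun α y : ℂ) * f y := by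
  rw [L2.inner_def]
  refine integral_congr_ae ?_
  filter_upwards [hermSchwartz_toLp_ae α] with y hy
  rw [hy]
  simp [mul_comm]

theorem orthonormal_hermVec : Orthonormal ℂ hermVec := by
  rw [orthonormal_iff_ite]
  intro α β
  have hf : inner ℂ ((hermSchwartz α).toLp 2 : HE) ((hermSchwartz β).toLp 2)
      = ((∫ y, hermFun α y * hermFun β y : ℝ) : ℂ) := by
    rw [inner_hermSchwartz, ← integral_complex_ofReal]
    refine integral_congr_ae ?_
    filter_upwards [hermSchwartz_toLp_ae β] with y hy
    rw [hy]; push_cast; rfl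
  rw [hermVec, hermVec, inner_smul_left, inner_smul_right, hf, Complex.conj_ofReal]
  split_ifs with h
  · subst h
    change _ * (_ * ((hermSq α : ℝ) : ℂ)) = 1
    rw [← Complex.ofReal_mul, ← Complex.ofReal_mul]
    have : (Real.sqrt (hermSq α))⁻¹ * ((Real.sqrt (hermSq α))⁻¹ * hermSq α) = 1 := by
      rw [← mul_assoc, ← mul_inv, Real.mul_self_sqrt (hermSq_pos α).le,
        inv_mul_cancel₀ (hermSq_pos α).ne']
    rw [this]
    simp
  · obtain ⟨i, hi⟩ : ∃ i, α i ≠ β i := by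
      by_contra hcon
      push Not at hcon
      exact h (funext hcon)
    rw [integral_hermFun_mul, Finset.prod_eq_zero (Finset.mem_univ i)
      (gint_herm_mul_herm_of_ne _ _ hi)]
    simp

/-- For `n = 0` the index `n - 1` is `0`, but the coefficient is then `0` too. -/
theorem X_mul_herm (n : ℕ) : ∃ c : ℝ, X * herm n = herm (n + 1) + C c * herm (n - 1) := by
  cases n with
  | zero => exact ⟨0, by simp [herm]⟩
  | succ n =>
    refine ⟨2 * (n + 1), ?_⟩
    rw [herm_succ_succ]
    simp [map_ofNat C 2]

theorem hermPoly_update (α : Fin 3 → ℕ) (i : Fin 3) (n : ℕ) :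
    hermPoly (Function.update α i n) = aeval (MvPolynomial.X i : MvPolynomial (Fin 3) ℝ) (herm n)
      * ∏ j ∈ Finset.univ.erase i, aeval (MvPolynomial.X j : MvPolynomial (Fin 3) ℝ) (herm (α j)) := by
  rw [hermPoly, ← Finset.mul_prod_erase _ _ (Finset.mem_univ i)]
  congr 1
  · simp
  · refine Finset.prod_congr rfl fun j hj => ?_
    have : j ≠ i := (Finset.mem_erase.1 hj).1
    simp [this]

/-- By the three-term recursion the span is stable under multiplication by each coordinate, and it
contains the constants. -/
theorem mem_span_hermPoly (q : MvPolynomial (Fin 3) ℝ) :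
    q ∈ Submodule.span ℝ (range hermPoly) := by
  induction q using MvPolynomial.induction_on with
  | C a =>
    have : MvPolynomial.C a = a • hermPoly 0 := by
      simp [hermPoly, herm, MvPolynomial.smul_eq_C_mul]
    rw [this]
    exact Submodule.smul_mem _ _ (Submodule.subset_span ⟨0, rfl⟩)
  | add p q hp hq => exact Submodule.add_mem _ hp hq
  | mul_X p i hp =>
    induction hp using Submodule.span_induction with
    | mem x hx =>
      obtain ⟨α, rfl⟩ := hx
      obtain ⟨c, hc⟩ := X_mul_herm (α i)
      have e : hermPoly α * MvPolynomial.X i = hermPoly (Function.update α i (α i + 1))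
          + c • hermPoly (Function.update α i (α i - 1)) := by
        rw [hermPoly_update, hermPoly_update]
        have h1 : hermPoly α = hermPoly (Function.update α i (α i)) := by simp
        rw [h1, hermPoly_update]
        have h2 := congrArg (aeval (MvPolynomial.X i : MvPolynomial (Fin 3) ℝ)) hc
        simp only [map_mul, map_add, aeval_X, aeval_C, MvPolynomial.algebraMap_eq] at h2
        rw [MvPolynomial.smul_eq_C_mul]
        linear_combination (∏ j ∈ Finset.univ.erase i,
          aeval (MvPolynomial.X j : MvPolynomial (Fin 3) ℝ) (herm (α j))) * h2
      rw [e]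
      exact Submodule.add_mem _ (Submodule.subset_span ⟨_, rfl⟩)
        (Submodule.smul_mem _ _ (Submodule.subset_span ⟨_, rfl⟩))
    | zero => simp
    | add x y _ _ hx hy => rw [add_mul]; exact Submodule.add_mem _ hx hy
    | smul a x _ hx => rw [smul_mul_assoc]; exact Submodule.smul_mem _ _ hx

/-! ### Completeness of the Hermite functions -/

theorem integrable_polySchwartz_mul (q : MvPolynomial (Fin 3) ℝ) (f : HE) :
    Integrable fun y => polySchwartz q y * f y :=
  ((polySchwartz q).memLp 2).integrable_mul (Lp.memLp f)

theorem integral_poly_mul_eq_zero {f : HE}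
    (hf : ∀ α, inner ℂ ((hermSchwartz α).toLp 2 : HE) f = 0) (q : MvPolynomial (Fin 3) ℝ) :
    ∫ y, polySchwartz q y * f y = 0 := by
  have hq := mem_span_hermPoly q
  induction hq using Submodule.span_induction with
  | mem x hx =>
    obtain ⟨α, rfl⟩ := hx
    rw [← hf α, inner_hermSchwartz]
    refine integral_congr_ae (Eventually.of_forall fun y => ?_)
    simp only
    rw [← hermSchwartz_apply]; rfl
  | zero => simp [polySchwartz_apply]
  | add x y _ _ hx hy =>
    have e : ∀ z, polySchwartz (x + y) z * f z = polySchwartz x z * f z + polySchwartz y z * f z := by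
      intro z
      simp only [polySchwartz_apply, map_add]
      push_cast
      ring
    simp only [e]
    rw [integral_add (integrable_polySchwartz_mul x f) (integrable_polySchwartz_mul y f), hx, hy,
      add_zero]
  | smul a x _ hx =>
    have e : ∀ z, polySchwartz (a • x) z * f z = (a : ℂ) * (polySchwartz x z * f z) := by
      intro z
      simp only [polySchwartz_apply, MvPolynomial.smul_eval]
      push_cast
      ring
    simp only [e]
    rw [integral_const_mul, hx, mul_zero]

theorem exp_mul_gauss_le (c : ℝ) (y : E) :
    Real.exp (c * ‖y‖) * gauss y ≤ Real.exp (4 * c ^ 2) * Real.exp (-(1 / 16) * ‖y‖ ^ 2) := by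
  rw [gauss, ← Real.exp_add, ← Real.exp_add]
  refine Real.exp_le_exp.2 ?_
  nlinarith [sq_nonneg (‖y‖ / 4 - 2 * c)]

theorem memLp_exp_neg_sq {a : ℝ} (ha : 0 < a) :
    MemLp (fun y : E => Real.exp (-a * ‖y‖ ^ 2)) 2 := by
  rw [memLp_two_iff_integrable_sq]
  · have h : Integrable fun y : E => ∏ i, Real.exp (-(2 * a) * (y i) ^ 2) :=
      integrable_E_prod (𝕜 := ℝ) (f := fun _ s => Real.exp (-(2 * a) * s ^ 2))
        (fun _ => integrable_exp_neg_mul_sq (by positivity))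
    refine h.congr (Eventually.of_forall fun y => ?_)
    simp only
    rw [← Real.exp_sum, ← Finset.mul_sum, ← norm_sq_E, ← Real.exp_nat_mul]
    push_cast
    ring_nf
  · exact (Continuous.aestronglyMeasurable (by fun_prop))

theorem integrable_exp_mul_gauss_mul (c : ℝ) (f : HE) :
    Integrable fun y : E => Real.exp (c * ‖y‖) * gauss y * ‖f y‖ := by
  have h1 : MemLp (fun y : E => Real.exp (c * ‖y‖) * gauss y) 2 := by
    refine (memLp_exp_neg_sq (a := 1 / 16) (by norm_num)).of_le_mul (c := Real.exp (4 * c ^ 2)) ?_ ?_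
    · have : Continuous gauss := contDiff_gauss.continuous
      exact Continuous.aestronglyMeasurable (by fun_prop)
    · refine Eventually.of_forall fun y => ?_
      have := gauss_pos y
      rw [Real.norm_eq_abs, Real.norm_eq_abs, abs_of_pos (by positivity), abs_of_pos (by positivity)]
      exact exp_mul_gauss_le c y
  exact h1.integrable_mul (Lp.memLp f).norm

/-- Expand the exponential: every term is a polynomial moment of `gauss · f`, which vanishes. The
series is dominated by `e^{|c||ξ||y|} gauss |f|`, integrable because the Gaussian beats the
exponential. -/
theorem integral_exp_mul_eq_zero {f : HE}
    (hf : ∀ α, inner ℂ ((hermSchwartz α).toLp 2 : HE) f = 0) (ξ : E) (c : ℂ) :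
    ∫ y, Complex.exp (c * (inner ℝ y ξ : ℝ)) * ((gauss y : ℂ) * f y) = 0 := by
  let q : MvPolynomial (Fin 3) ℝ := ∑ i, MvPolynomial.C (ξ i) * MvPolynomial.X i
  have hq : ∀ y : E, MvPolynomial.eval (fun i => y i) q = inner ℝ y ξ := by
    intro y
    simp [q, PiLp.inner_apply]
  let F : ℕ → E → ℂ := fun n y => (c ^ n / n.factorial) * (polySchwartz (q ^ n) y * f y)
  have hF : ∀ n y, F n y = (c * (inner ℝ y ξ : ℝ)) ^ n / n.factorial * ((gauss y : ℂ) * f y) := by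
    intro n y
    simp only [F, polySchwartz_apply, map_pow, hq]
    push_cast
    ring
  have hsum := hasSum_integral_of_dominated_convergence
    (F := F) (f := fun y => Complex.exp (c * (inner ℝ y ξ : ℝ)) * ((gauss y : ℂ) * f y))
    (μ := (volume : Measure E))
    (fun n y => (‖c‖ * ‖ξ‖ * ‖y‖) ^ n / n.factorial * (gauss y * ‖f y‖)) ?_ ?_ ?_ ?_ ?_
  · have h0 : ∀ n, ∫ y, F n y = 0 := fun n => by
      simp only [F]
      rw [integral_const_mul, integral_poly_mul_eq_zero hf, mul_zero]
    simp only [h0] at hsum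
    exact hsum.unique hasSum_zero
  · intro n
    exact ((integrable_polySchwartz_mul (q ^ n) f).aestronglyMeasurable).const_mul _
  · intro n
    refine Eventually.of_forall fun y => ?_
    rw [hF, norm_mul, norm_mul, norm_div, norm_pow, norm_mul, Complex.norm_real, Complex.norm_real,
      Real.norm_eq_abs (gauss y), abs_of_pos (gauss_pos y), Complex.norm_natCast]
    have := gauss_pos y
    have hb : ‖c‖ * ‖(inner ℝ y ξ : ℝ)‖ ≤ ‖c‖ * ‖ξ‖ * ‖y‖ := by
      rw [mul_assoc, mul_comm ‖ξ‖]
      exact mul_le_mul_of_nonneg_left (norm_inner_le_norm y ξ) (norm_nonneg c)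
    exact mul_le_mul_of_nonneg_right (div_le_div_of_nonneg_right
      (pow_le_pow_left₀ (by positivity) hb n) (by positivity)) (by positivity)
  · refine Eventually.of_forall fun y => ?_
    exact (Real.summable_pow_div_factorial _).mul_right _
  · refine (integrable_exp_mul_gauss_mul (‖c‖ * ‖ξ‖) f).congr (Eventually.of_forall fun y => ?_)
    simp only
    rw [tsum_mul_right, Real.exp_eq_exp_ℝ, NormedSpace.exp_eq_tsum_div]
    simp only [mul_assoc]
  · refine Eventually.of_forall fun y => ?_
    simp only [hF]
    refine HasSum.mul_right _ ?_
    have := NormedSpace.expSeries_div_hasSum_exp (c * (inner ℝ y ξ : ℝ))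
    rwa [← Complex.exp_eq_exp_ℂ] at this

open FourierTransform in
-- The preceding lemma with an imaginary constant says that the Fourier transform of `gauss · f`
-- vanishes. Writing a test function as the transform of a Schwartz function and shifting the
-- transform to `gauss · f` shows that this product integrates to zero against every test function.
theorem eq_zero_of_inner_hermSchwartz {f : HE}
    (hf : ∀ α, inner ℂ ((hermSchwartz α).toLp 2 : HE) f = 0) : f = 0 := by
  let G : E → ℂ := fun y => (gauss y : ℂ) * f y
  have hG : Integrable G := by
    have := integrable_polySchwartz_mul 1 f
    refine this.congr (Eventually.of_forall fun y => ?_)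
    simp [polySchwartz_apply, G]
  have hFG : ∀ ξ, 𝓕 G ξ = 0 := by
    intro ξ
    rw [Real.fourier_eq' G ξ]
    rw [← integral_exp_mul_eq_zero hf ξ (-2 * Real.pi * Complex.I)]
    refine integral_congr_ae (Eventually.of_forall fun y => ?_)
    simp only [G, smul_eq_mul]
    congr 2
    push_cast
    ring
  have hzero : ∀ᵐ y, G y = 0 := by
    refine ae_eq_zero_of_integral_contDiff_smul_eq_zero hG.locallyIntegrable ?_
    intro g g_smooth g_cpt
    have hg₁ : HasCompactSupport (Complex.ofRealCLM ∘ g) := g_cpt.comp_left rfl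
    have hg₂ : ContDiff ℝ ∞ (Complex.ofRealCLM ∘ g) := by fun_prop
    let φ : 𝓢(E, ℂ) := hg₁.toSchwartzMap hg₂
    let ψ : 𝓢(E, ℂ) := 𝓕⁻ φ
    have hφ : 𝓕 ψ = φ := FourierTransform.fourier_fourierInv_eq φ
    have h1 : ∫ ξ, 𝓕 (ψ : E → ℂ) ξ • G ξ = ∫ y, ψ y • 𝓕 G y := by
      simpa using! VectorFourier.integral_fourierIntegral_smul_eq_flip (L := innerₗ E)
        Real.continuous_fourierChar continuous_inner ψ.integrable hG
    simp only [hFG, smul_zero, integral_zero] at h1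
    rw [← h1]
    refine integral_congr_ae (Eventually.of_forall fun y => ?_)
    have e : 𝓕 (ψ : E → ℂ) y = (g y : ℂ) := by
      rw [← SchwartzMap.fourier_coe, hφ]
      rfl
    simp only [e]
    rw [Complex.real_smul, smul_eq_mul]
  rw [Lp.eq_zero_iff_ae_eq_zero]
  filter_upwards [hzero] with y hy
  have : (gauss y : ℂ) ≠ 0 := by exact_mod_cast (gauss_pos y).ne'
  exact (mul_eq_zero.1 hy).resolve_left this

/-- The Hermite basis of `L²(ℝ³)`. -/
def hermBasis : HilbertBasis (Fin 3 → ℕ) ℂ HE :=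
  HilbertBasis.mkOfOrthogonalEqBot orthonormal_hermVec (by
    rw [Submodule.eq_bot_iff]
    intro f hf
    refine eq_zero_of_inner_hermSchwartz fun α => ?_
    have h1 := (Submodule.mem_orthogonal _ f).1 hf (hermVec α)
      (Submodule.subset_span ⟨α, rfl⟩)
    rw [hermVec, inner_smul_left] at h1
    refine (mul_eq_zero.1 h1).resolve_left ?_
    rw [Complex.conj_ofReal]
    exact_mod_cast (inv_pos.2 (Real.sqrt_pos.2 (hermSq_pos α))).ne')

theorem hermBasis_apply (α : Fin 3 → ℕ) : hermBasis α = hermVec α := by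
  simp [hermBasis]

/-- The degree of a Hermite function. -/
def deg (α : Fin 3 → ℕ) : ℕ := ∑ i, α i

/-- The eigenvalue of `-Δ + |y|²/16 - 3/4`. -/
def rate (α : Fin 3 → ℕ) : ℝ := (deg α : ℝ) / 2

theorem rate_nonneg (α : Fin 3 → ℕ) : 0 ≤ rate α := by unfold rate; positivity

/-! ### The oscillator in the Hermite basis -/

/-- The eigenvalue equation gives the images of the basis vectors; integration by parts against a
Hermite function gives the coordinates of an arbitrary element of the graph. -/
theorem hasModes_oscillator (c : ℝ) {v : ℝ → E → ℝ} (hv : IsPotential v) (s : ℝ) :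
    HasModes hermBasis (fun α => rate α + (3 / 4 - c)) (potOp volume hv s) (oscillator c (v s)) := by
  refine ⟨fun α => ?_, ?_⟩
  · rw [hermBasis_apply]
    refine ⟨(((Real.sqrt (hermSq α))⁻¹ : ℝ) : ℂ) • hermSchwartz α, ?_, ?_⟩
    · filter_upwards [hermVec_ae α] with y hy
      simp only [hy, smul_apply, hermSchwartz_apply, hermN]
      simp
    · have hL : ∀ y, Laplacian.laplacian
          (fun z : E => ((((Real.sqrt (hermSq α))⁻¹ : ℝ) : ℂ) • hermSchwartz α) z) y
          = (((Real.sqrt (hermSq α))⁻¹ : ℝ) : ℂ) *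
            (((‖y‖ ^ 2 / 16 - 3 / 4 - (∑ i, (α i : ℝ)) / 2 : ℝ) : ℂ) * hermFun α y) := by
        intro y
        rw [← laplacian_hermFun]
        have e : (fun z : E => ((((Real.sqrt (hermSq α))⁻¹ : ℝ) : ℂ) • hermSchwartz α) z)
            = (Real.sqrt (hermSq α))⁻¹ • fun z => (hermFun α z : ℂ) := by
          funext z
          simp [hermSchwartz_apply]
        rw [e, InnerProductSpace.laplacian_smul _ (contDiff_hermFun α).contDiffAt]
        simp
      filter_upwards [hermVec_ae α, potOp_ae hv s (hermVec α),
        Lp.coeFn_smul ((rate α + (3 / 4 - c) : ℝ) : ℂ) (hermVec α),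
        Lp.coeFn_add (((rate α + (3 / 4 - c) : ℝ) : ℂ) • hermVec α) (potOp volume hv s (hermVec α))]
        with y h1 h2 h3 h4
      rw [hL]
      rw [h4, Pi.add_apply, h3, Pi.smul_apply, h2, h1]
      simp only [smul_apply, hermSchwartz_apply, hermN, rate, deg, smul_eq_mul]
      push_cast
      ring
  · rintro p ⟨ψ, hp1, hp2⟩ α
    rw [hermBasis_apply]
    set κ : ℂ := (((Real.sqrt (hermSq α))⁻¹ : ℝ) : ℂ) with hκ
    have hin : ∀ f : HE, inner ℂ (hermVec α) f = κ * ∫ y, hermSchwartz α y * f y := by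
      intro f
      rw [hermVec, inner_smul_left, Complex.conj_ofReal, inner_hermSchwartz]
      simp only [hermSchwartz_apply]
      rfl
    rw [hin, hin, hin, mul_left_comm, ← mul_add]
    congr 1
    let h := hermSchwartz α
    -- Adding back the Laplacian leaves the multiplication part of the operator, now known to be in
    -- `L²`, so every integral below converges separately.
    let R : HE := p.2 + (Laplacian.laplacian ψ).toLp 2 volume
    have hR : R =ᵐ[volume] fun y => ((‖y‖ ^ 2 / 16 - c + v s y : ℝ) : ℂ) * ψ y := by
      filter_upwards [hp2, (Laplacian.laplacian ψ).coeFn_toLp 2 volume,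
        Lp.coeFn_add p.2 ((Laplacian.laplacian ψ).toLp 2)] with y h1 h2 h3
      simp only [R]
      rw [h3, Pi.add_apply, h1, h2, SchwartzMap.laplacian_apply]
      ring
    have hi : ∀ (φ : 𝓢(E, ℂ)) (f : HE), Integrable fun y => φ y * f y := fun φ f =>
      (φ.memLp 2).integrable_mul (Lp.memLp f)
    have hi2 : ∀ φ φ' : 𝓢(E, ℂ), Integrable fun y => φ y * φ' y := fun φ φ' =>
      (φ.memLp 2).integrable_mul (φ'.memLp 2)
    have e1 : ∫ y, h y * p.2 y = (∫ y, h y * R y) - ∫ y, h y * (Laplacian.laplacian ψ) y := by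
      rw [← integral_sub (hi h R) (hi2 h _)]
      refine integral_congr_ae ?_
      filter_upwards [(Laplacian.laplacian ψ).coeFn_toLp 2 volume,
        Lp.coeFn_add p.2 ((Laplacian.laplacian ψ).toLp 2)] with y h2 h3
      simp only [R]
      rw [h3, Pi.add_apply, h2]
      ring
    have e2 : ∫ y, h y * (Laplacian.laplacian ψ) y = ∫ y, (Laplacian.laplacian h) y * ψ y :=
      SchwartzMap.integral_mul_laplacian_right_eq_left h ψ
    change ∫ y, h y * p.2 y = ((rate α + (3 / 4 - c) : ℝ) : ℂ) * (∫ y, h y * p.1 y)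
      + ∫ y, h y * potOp volume hv s p.1 y
    rw [e1, e2, ← integral_sub (hi h R) (hi2 _ ψ), ← integral_const_mul,
      ← integral_add ((hi h p.1).const_mul _) (hi h _)]
    refine integral_congr_ae ?_
    filter_upwards [hR, hp1, potOp_ae hv s p.1] with y h1 h2 h3
    have h4 : (Laplacian.laplacian h) y
        = ((‖y‖ ^ 2 / 16 - 3 / 4 - (∑ i, (α i : ℝ)) / 2 : ℝ) : ℂ) * h y := by
      rw [SchwartzMap.laplacian_apply]
      have : (h : E → ℂ) = fun z => (hermFun α z : ℂ) := by
        funext z; exact hermSchwartz_apply α z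
      rw [this, laplacian_hermFun]
    rw [h1, h3, h2, h4, rate, deg]
    push_cast
    ring

theorem zero_mem_oscillator (c : ℝ) (V : E → ℝ) : ((0 : HE), (0 : HE)) ∈ oscillator c V := by
  refine ⟨0, ?_, ?_⟩
  · filter_upwards [Lp.coeFn_zero ℂ 2 (volume : Measure E)] with y hy
    simp
  · filter_upwards [Lp.coeFn_zero ℂ 2 (volume : Measure E)] with y hy
    simp [InnerProductSpace.laplacian_const]

end CylinderPropagator

end

noncomputable section

namespace CylinderPropagator

open Polynomial

/-! ### The Mehler kernel -/

/-- The Mehler kernel in one dimension, with parameter `m = e^{-t/2}`. -/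
def mehler1 (m s x : ℝ) : ℝ :=
  (Real.sqrt (Real.pi / (1 / (4 * (1 - m ^ 2)))))⁻¹ * Real.exp (-(1 / (4 * (1 - m ^ 2))) * (x - m * s) ^ 2)
    * Real.exp ((x ^ 2 - s ^ 2) / 8)

theorem mehler1_nonneg (m s x : ℝ) : 0 ≤ mehler1 m s x := by unfold mehler1; positivity

theorem mehler1_mul_herm1 (m s x : ℝ) (n : ℕ) : mehler1 m s x * herm1 n x
    = ((Real.sqrt (Real.pi / (1 / (4 * (1 - m ^ 2)))))⁻¹ * Real.exp (-(s ^ 2) / 8))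
      * ((herm n).eval x * Real.exp (-(1 / (4 * (1 - m ^ 2))) * (x - m * s) ^ 2)) := by
  have h : Real.exp ((x ^ 2 - s ^ 2) / 8) * Real.exp (-(x ^ 2) / 8) = Real.exp (-(s ^ 2) / 8) := by
    rw [← Real.exp_add]; ring_nf
  rw [mehler1, herm1, ← h]
  ring

/-- The factor `e^{(x²-s²)/8}` exchanges the half-density of the Hermite function in `x` for the one
in `s`; what remains is Mehler's formula for polynomials. -/
theorem integral_mehler1_mul_herm1 {m : ℝ} (hm : 0 < 1 - m ^ 2) (s : ℝ) (n : ℕ) :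
    ∫ x, mehler1 m s x * herm1 n x = m ^ n * herm1 n s := by
  simp only [mehler1_mul_herm1]
  rw [integral_const_mul]
  have h := gint_mehler hm s n
  rw [gint_one] at h
  rw [gint] at h
  rw [h, herm1]
  have : 0 < Real.sqrt (Real.pi / (1 / (4 * (1 - m ^ 2)))) := by
    have := Real.pi_pos
    positivity
  field_simp

/-- The integral kernel of the semigroup generated by `-Δ + |y|²/16 - 3/4`. -/
def mehler (t : ℝ) (y x : E) : ℝ := ∏ i, mehler1 (Real.exp (-(t / 2))) (y i) (x i)

theorem mehler_nonneg (t : ℝ) (y x : E) : 0 ≤ mehler t y x :=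
  Finset.prod_nonneg fun _ _ => mehler1_nonneg _ _ _

theorem one_sub_exp_sq_pos {t : ℝ} (ht : 0 < t) : 0 < 1 - Real.exp (-(t / 2)) ^ 2 := by
  rw [← Real.exp_nat_mul]
  have : Real.exp (((2 : ℕ) : ℝ) * -(t / 2)) < 1 := Real.exp_lt_one_iff.2 (by push_cast; linarith)
  linarith

/-- The rate of the Gaussian in the Mehler kernel. -/
def mehlerRate (t : ℝ) : ℝ := 1 / (4 * (1 - Real.exp (-(t / 2)) ^ 2))

theorem mehlerRate_ge {t : ℝ} (ht : 0 < t) : 1 / 4 ≤ mehlerRate t := by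
  have := one_sub_exp_sq_pos ht
  rw [mehlerRate, div_le_div_iff₀ (by norm_num) (by positivity)]
  nlinarith [sq_nonneg (Real.exp (-(t / 2)))]

theorem mehler_eq (t : ℝ) (y x : E) : mehler t y x
    = (Real.sqrt (Real.pi / mehlerRate t))⁻¹ ^ 3
      * Real.exp (-mehlerRate t * ‖x - Real.exp (-(t / 2)) • y‖ ^ 2)
      * Real.exp ((‖x‖ ^ 2 - ‖y‖ ^ 2) / 8) := by
  have h1 : Real.exp (-mehlerRate t * ‖x - Real.exp (-(t / 2)) • y‖ ^ 2)
      = ∏ i, Real.exp (-mehlerRate t * (x i - Real.exp (-(t / 2)) * y i) ^ 2) := by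
    rw [← Real.exp_sum, norm_sq_E, Finset.mul_sum]
    simp
  have h2 : Real.exp ((‖x‖ ^ 2 - ‖y‖ ^ 2) / 8) = ∏ i, Real.exp (((x i) ^ 2 - (y i) ^ 2) / 8) := by
    rw [← Real.exp_sum, norm_sq_E, norm_sq_E, ← Finset.sum_sub_distrib, Finset.sum_div]
  rw [h1, h2]
  have h3 : 1 / (4 * (1 - Real.exp (-(t / 2)) ^ 2)) = mehlerRate t := rfl
  simp only [mehler, mehler1, Finset.prod_mul_distrib, h3, Finset.prod_const, Finset.card_univ,
    Fintype.card_fin]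

theorem continuous_mehler (t : ℝ) (y : E) : Continuous (mehler t y) := by
  have : mehler t y = fun x => (Real.sqrt (Real.pi / mehlerRate t))⁻¹ ^ 3
      * Real.exp (-mehlerRate t * ‖x - Real.exp (-(t / 2)) • y‖ ^ 2)
      * Real.exp ((‖x‖ ^ 2 - ‖y‖ ^ 2) / 8) := funext fun x => mehler_eq t y x
  rw [this]
  fun_prop

/-- A crude bound, wasteful in `y`, whose purpose is decay in `x`: it gives square integrability in
`x` with a norm that is locally bounded in `y`. -/
theorem mehler_le {t : ℝ} (ht : 0 < t) (y x : E) : mehler t y x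
    ≤ (Real.sqrt (Real.pi / mehlerRate t))⁻¹ ^ 3 * Real.exp (‖y‖ ^ 2)
      * Real.exp (-(1 / 16) * ‖x‖ ^ 2) := by
  rw [mehler_eq, mul_assoc, mul_assoc, ← Real.exp_add, ← Real.exp_add]
  refine mul_le_mul_of_nonneg_left (Real.exp_le_exp.2 ?_) (by positivity)
  set m := Real.exp (-(t / 2))
  have hm0 : 0 < m := Real.exp_pos _
  have hm1 : m ≤ 1 := Real.exp_le_one_iff.2 (by linarith)
  have h1 : ‖x‖ ≤ ‖x - m • y‖ + m * ‖y‖ := by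
    have := norm_add_le (x - m • y) (m • y)
    rwa [sub_add_cancel, norm_smul, Real.norm_eq_abs, abs_of_pos hm0] at this
  have h2 : ‖x‖ ≤ ‖x - m • y‖ + ‖y‖ := by
    have := mul_le_mul_of_nonneg_right hm1 (norm_nonneg y)
    linarith
  have h3 : ‖x‖ ^ 2 ≤ (‖x - m • y‖ + ‖y‖) ^ 2 := pow_le_pow_left₀ (norm_nonneg _) h2 2
  have h4 := mul_le_mul_of_nonneg_right (mehlerRate_ge ht) (sq_nonneg ‖x - m • y‖)
  -- The square gives `(D + Y)² ≤ (4/3) D² + 4 Y²`, and `3/16 · 4/3` is exactly the minimal rate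
  -- `1/4`.
  nlinarith [sq_nonneg (‖x - m • y‖ - 3 * ‖y‖), sq_nonneg ‖y‖]

theorem memLp_mehler {t : ℝ} (ht : 0 < t) (y : E) : MemLp (mehler t y) 2 := by
  refine (memLp_exp_neg_sq (a := 1 / 16) (by norm_num)).of_le_mul
    (c := (Real.sqrt (Real.pi / mehlerRate t))⁻¹ ^ 3 * Real.exp (‖y‖ ^ 2))
    (continuous_mehler t y).aestronglyMeasurable ?_
  refine Eventually.of_forall fun x => ?_
  rw [Real.norm_eq_abs, abs_of_nonneg (mehler_nonneg t y x), Real.norm_eq_abs, abs_of_pos (Real.exp_pos _)]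
  exact mehler_le ht y x

theorem isHeatKernel_mehler {t : ℝ} (ht : 0 < t) : IsHeatKernel hermBasis rate t (mehler t) := by
  refine ⟨mehler_nonneg t, memLp_mehler ht, fun α => ?_⟩
  filter_upwards [hermVec_ae α] with y hy
  rw [hermBasis_apply, hy]
  have h1 : ∫ x, (mehler t y x : ℂ) * hermVec α x = ((∫ x, mehler t y x * hermN α x : ℝ) : ℂ) := by
    rw [← integral_complex_ofReal]
    refine integral_congr_ae ?_
    filter_upwards [hermVec_ae α] with x hx
    rw [hx]; push_cast; rfl
  have h2 : ∫ x, mehler t y x * hermN α x = (Real.sqrt (hermSq α))⁻¹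
      * ∏ i, ∫ s, mehler1 (Real.exp (-(t / 2))) (y i) s * herm1 (α i) s := by
    rw [← integral_E_prod, ← integral_const_mul]
    refine integral_congr_ae (Eventually.of_forall fun x => ?_)
    simp only [mehler, hermN, hermFun, Finset.prod_mul_distrib]
    ring
  rw [h1, h2, ← Complex.ofReal_mul]
  congr 1
  simp only [integral_mehler1_mul_herm1 (one_sub_exp_sq_pos ht), Finset.prod_mul_distrib]
  rw [Finset.prod_pow_eq_pow_sum, ← Real.exp_nat_mul, hermN, hermFun, rate, deg]
  have : ((∑ i, α i : ℕ) : ℝ) * -(t / 2) = -(((∑ i, α i : ℕ) : ℝ) / 2 * t) := by ring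
  rw [this]
  ring

theorem integral_exp_neg_sq_E (b : ℝ) (z : E) :
    ∫ x : E, Real.exp (-b * ‖x - z‖ ^ 2) = Real.sqrt (Real.pi / b) ^ 3 := by
  have h : ∀ x : E, Real.exp (-b * ‖x - z‖ ^ 2) = ∏ i, Real.exp (-b * (x i - z i) ^ 2) := by
    intro x
    rw [← Real.exp_sum, norm_sq_E, Finset.mul_sum]
    simp
  simp only [h]
  rw [integral_E_prod (𝕜 := ℝ) (fun i s => Real.exp (-b * (s - z i) ^ 2))]
  have : ∀ c, ∫ s, Real.exp (-b * (s - c) ^ 2) = Real.sqrt (Real.pi / b) := by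
    intro c
    rw [← gint_one b c, gint]
    simp
  simp only [this, Finset.prod_const, Finset.card_univ, Fintype.card_fin]

theorem integrable_exp_neg_sq_E {b : ℝ} (hb : 0 < b) (z : E) :
    Integrable fun x : E => Real.exp (-b * ‖x - z‖ ^ 2) := by
  have h : ∀ x : E, Real.exp (-b * ‖x - z‖ ^ 2) = ∏ i, Real.exp (-b * (x i - z i) ^ 2) := by
    intro x
    rw [← Real.exp_sum, norm_sq_E, Finset.mul_sum]
    simp
  simp only [h]
  refine integrable_E_prod (𝕜 := ℝ) (f := fun i s => Real.exp (-b * (s - z i) ^ 2)) fun i => ?_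
  simpa using integrable_poly_gauss 1 hb (z i)

/-! ### Weights -/

/-- `⟨y⟩ = (1 + |y|²)^{1/2}`. -/
def jap (y : E) : ℝ := Real.sqrt (1 + ‖y‖ ^ 2)

theorem one_le_jap (y : E) : 1 ≤ jap y := by
  rw [jap, Real.one_le_sqrt]; nlinarith [norm_nonneg y]

theorem jap_pos (y : E) : 0 < jap y := lt_of_lt_of_le one_pos (one_le_jap y)

theorem norm_le_jap (y : E) : ‖y‖ ≤ jap y := Real.le_sqrt_of_sq_le (by linarith)

theorem jap_sq (y : E) : jap y ^ 2 = 1 + ‖y‖ ^ 2 := Real.sq_sqrt (by positivity)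

theorem jap_le_one_add (y : E) : jap y ≤ 1 + ‖y‖ := by
  refine Real.sqrt_le_iff.2 ⟨by positivity, by nlinarith [norm_nonneg y]⟩

theorem continuous_jap : Continuous jap := by unfold jap; fun_prop

theorem jap_add_le (x y : E) : jap (x + y) ≤ ‖x‖ + jap y := by
  refine Real.sqrt_le_iff.2 ⟨add_nonneg (norm_nonneg _) (jap_pos y).le, ?_⟩
  have h1 := norm_add_le x y
  have h2 : ‖x + y‖ ^ 2 ≤ (‖x‖ + ‖y‖) ^ 2 := pow_le_pow_left₀ (norm_nonneg _) h1 2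
  have h3 := mul_le_mul_of_nonneg_left (norm_le_jap y) (norm_nonneg x)
  nlinarith [jap_sq y]

/-- The exponent `1/8` is chosen below the minimal Mehler rate `1/4`, so that a Gaussian factor
survives. The constant is `16²`. -/
theorem jap_pow_le {k : ℕ} (hk : k ≤ 3) (y : E) : jap y ^ k ≤ 256 * Real.exp (‖y‖ ^ 2 / 8) := by
  have h1 : jap y ^ k ≤ jap y ^ 4 := pow_le_pow_right₀ (one_le_jap y) (by omega)
  have h2 : jap y ^ 4 = (1 + ‖y‖ ^ 2) ^ 2 := by rw [← jap_sq]; ring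
  have h3 : 1 + ‖y‖ ^ 2 ≤ 16 * Real.exp (‖y‖ ^ 2 / 16) := by
    have := Real.add_one_le_exp (‖y‖ ^ 2 / 16)
    nlinarith [sq_nonneg ‖y‖]
  have h4 : (1 + ‖y‖ ^ 2) ^ 2 ≤ (16 * Real.exp (‖y‖ ^ 2 / 16)) ^ 2 :=
    pow_le_pow_left₀ (by positivity) h3 2
  rw [mul_pow, ← Real.exp_nat_mul] at h4
  have h5 : ((2 : ℕ) : ℝ) * (‖y‖ ^ 2 / 16) = ‖y‖ ^ 2 / 8 := by push_cast; ring
  rw [h5] at h4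
  linarith

/-- The weight `e^{-|y|²/8} ⟨y⟩^k`. -/
def wt (k : ℕ) (y : E) : ℝ := gauss y * jap y ^ k

theorem wt_pos (k : ℕ) (y : E) : 0 < wt k y := mul_pos (gauss_pos y) (pow_pos (jap_pos y) k)

theorem gauss_le_wt (k : ℕ) (y : E) : gauss y ≤ wt k y :=
  le_mul_of_one_le_right (gauss_pos y).le (one_le_pow₀ (one_le_jap y))

theorem wt_mono {j k : ℕ} (h : j ≤ k) (y : E) : wt j y ≤ wt k y :=
  mul_le_mul_of_nonneg_left (pow_le_pow_right₀ (one_le_jap y) h) (gauss_pos y).le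

theorem continuous_wt (k : ℕ) : Continuous (wt k) :=
  contDiff_gauss.continuous.mul (continuous_jap.pow k)

theorem exists_wt_le (k : ℕ) : ∃ C : ℝ, ∀ y : E, wt k y ≤ C * Real.exp (-(1 / 16) * ‖y‖ ^ 2) := by
  obtain ⟨C, hC⟩ := exists_pow_mul_gauss_le k (a := 1 / 16) (by norm_num)
  refine ⟨C, fun y => ?_⟩
  have h1 : jap y ^ k ≤ (1 + ‖y‖) ^ k := pow_le_pow_left₀ (jap_pos y).le (jap_le_one_add y) k
  have h2 := hC ‖y‖ (norm_nonneg y)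
  have h3 : gauss y = Real.exp (-(1 / 16) * ‖y‖ ^ 2) * Real.exp (-(1 / 16) * ‖y‖ ^ 2) := by
    rw [gauss, ← Real.exp_add]; ring_nf
  rw [wt, h3]
  calc _ ≤ Real.exp (-(1 / 16) * ‖y‖ ^ 2) * Real.exp (-(1 / 16) * ‖y‖ ^ 2) * (1 + ‖y‖) ^ k := by gcongr
    _ = ((1 + ‖y‖) ^ k * Real.exp (-(1 / 16) * ‖y‖ ^ 2)) * Real.exp (-(1 / 16) * ‖y‖ ^ 2) := by ring
    _ ≤ _ := by gcongr

theorem memLp_wt (k : ℕ) : MemLp (wt k) 2 := by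
  obtain ⟨C, hC⟩ := exists_wt_le k
  refine (memLp_exp_neg_sq (a := 1 / 16) (by norm_num)).of_le_mul (c := C)
    (continuous_wt k).aestronglyMeasurable (Eventually.of_forall fun x => ?_)
  rw [Real.norm_eq_abs, abs_of_pos (wt_pos k x), Real.norm_eq_abs, abs_of_pos (Real.exp_pos _)]
  exact hC x

/-- The weight as a vector of `L²`. -/
def wtVec (k : ℕ) : HE := (memLp_ofReal (memLp_wt k)).toLp _

theorem wtVec_ae (k : ℕ) : wtVec k =ᵐ[volume] fun y => (wt k y : ℂ) := MemLp.coeFn_toLp _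

theorem gauss_mul_mehler (t : ℝ) (y x : E) : mehler t y x * gauss x
    = gauss y * ((Real.sqrt (Real.pi / mehlerRate t))⁻¹ ^ 3
      * Real.exp (-mehlerRate t * ‖x - Real.exp (-(t / 2)) • y‖ ^ 2)) := by
  have h : Real.exp ((‖x‖ ^ 2 - ‖y‖ ^ 2) / 8) * gauss x = gauss y := by
    rw [gauss, gauss, ← Real.exp_add]; ring_nf
  rw [mehler_eq, ← h]
  ring

/-- Split according to whether `b ≤ η a`. The point is that the coefficient of `a^k` can be taken as
close to `1` as desired, which a genuine contraction requires. -/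
theorem pow_add_le {a b η : ℝ} (ha : 0 ≤ a) (hb : 0 ≤ b) (hη : 0 < η) (k : ℕ) :
    (a + b) ^ k ≤ ((1 + η) * a) ^ k + (1 + η⁻¹) ^ k * b ^ k := by
  rcases le_total b (η * a) with h | h
  · have : (a + b) ^ k ≤ ((1 + η) * a) ^ k := pow_le_pow_left₀ (by positivity) (by linarith) k
    have : 0 ≤ (1 + η⁻¹) ^ k * b ^ k := by positivity
    linarith
  · have h' : a ≤ η⁻¹ * b := by
      rw [inv_mul_eq_div, le_div_iff₀ hη]; linarith
    have : (a + b) ^ k ≤ ((1 + η⁻¹) * b) ^ k := pow_le_pow_left₀ (by positivity) (by linarith) k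
    rw [mul_pow (1 + η⁻¹)] at this
    have : 0 ≤ ((1 + η) * a) ^ k := by positivity
    linarith

theorem integrable_mehler_mul_wt {t : ℝ} (ht : 0 < t) (k : ℕ) (y : E) :
    Integrable fun x => mehler t y x * wt k x :=
  (memLp_mehler ht y).integrable_mul (memLp_wt k)

/-- With the factor `gauss y` removed, the kernel is a probability density centred at `e^{-t/2} y`,
so the mean of `⟨x⟩^k` is about `(e^{-t/2}|y|)^k` plus a constant. The constant `2048` is `256 · 8`,
the `8` bounding the change of normalization when the rate drops by `1/8`. -/
theorem integral_mehler_mul_wt_le {t : ℝ} (ht : 0 < t) {k : ℕ} (hk : k ≤ 3) {η : ℝ} (hη : 0 < η) (y : E) :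
    ∫ x, mehler t y x * wt k x
      ≤ gauss y * (((1 + η) * (Real.exp (-(t / 2)) * ‖y‖)) ^ k + 2048 * (1 + η⁻¹) ^ k) := by
  set m := Real.exp (-(t / 2))
  set a := mehlerRate t with ha
  have ha4 : 1 / 4 ≤ a := mehlerRate_ge ht
  have hap : 0 < a := by linarith
  have hap' : 0 < a - 1 / 8 := by linarith
  set c := (Real.sqrt (Real.pi / a))⁻¹ ^ 3 with hc
  have hc0 : 0 ≤ c := by positivity
  set A := ((1 + η) * (m * ‖y‖)) ^ k
  set B := (1 + η⁻¹) ^ k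
  have hA : 0 ≤ A := by positivity
  have hB : 0 ≤ B := by positivity
  have hpt : ∀ x, mehler t y x * wt k x ≤ gauss y * (A * (c * Real.exp (-a * ‖x - m • y‖ ^ 2))
      + 256 * B * (c * Real.exp (-(a - 1 / 8) * ‖x - m • y‖ ^ 2))) := by
    intro x
    have h1 : jap x ≤ m * ‖y‖ + jap (x - m • y) := by
      have := jap_add_le (m • y) (x - m • y)
      rwa [add_sub_cancel, norm_smul, Real.norm_eq_abs, abs_of_pos (Real.exp_pos _)] at this
    have h2 : jap x ^ k ≤ A + B * (256 * Real.exp (‖x - m • y‖ ^ 2 / 8)) := by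
      refine (pow_le_pow_left₀ (jap_pos x).le h1 k).trans ?_
      refine (pow_add_le (by positivity) (jap_pos _).le hη k).trans ?_
      gcongr
      exact jap_pow_le hk _
    have h3 : Real.exp (-(a - 1 / 8) * ‖x - m • y‖ ^ 2)
        = Real.exp (-a * ‖x - m • y‖ ^ 2) * Real.exp (‖x - m • y‖ ^ 2 / 8) := by
      rw [← Real.exp_add]; ring_nf
    rw [wt, ← mul_assoc, gauss_mul_mehler, h3]
    have := gauss_pos y
    calc _ ≤ gauss y * (c * Real.exp (-a * ‖x - m • y‖ ^ 2))
          * (A + B * (256 * Real.exp (‖x - m • y‖ ^ 2 / 8))) := by gcongr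
      _ = _ := by ring
  have i1 := (integrable_exp_neg_sq_E hap (m • y)).const_mul c
  have i2 := (integrable_exp_neg_sq_E hap' (m • y)).const_mul c
  have hint : Integrable fun x => gauss y * (A * (c * Real.exp (-a * ‖x - m • y‖ ^ 2))
      + 256 * B * (c * Real.exp (-(a - 1 / 8) * ‖x - m • y‖ ^ 2))) :=
    ((i1.const_mul A).add (i2.const_mul (256 * B))).const_mul (gauss y)
  refine (integral_mono (integrable_mehler_mul_wt ht k y) hint hpt).trans ?_
  rw [integral_const_mul, integral_add (i1.const_mul A) (i2.const_mul (256 * B)),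
    integral_const_mul, integral_const_mul, integral_const_mul, integral_const_mul,
    integral_exp_neg_sq_E, integral_exp_neg_sq_E]
  have hsp : 0 < Real.sqrt (Real.pi / a) := Real.sqrt_pos.2 (by have := Real.pi_pos; positivity)
  have e1 : c * Real.sqrt (Real.pi / a) ^ 3 = 1 := by
    rw [hc, ← mul_pow, inv_mul_cancel₀ hsp.ne', one_pow]
  -- Since `a ≥ 1/4`, one has `a - 1/8 ≥ a/2`; the factor `2` is more than enough, and its cube is
  -- the `8` below.
  have e2 : Real.sqrt (Real.pi / (a - 1 / 8)) ≤ 2 * Real.sqrt (Real.pi / a) := by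
    refine Real.sqrt_le_iff.2 ⟨by positivity, ?_⟩
    rw [mul_pow, Real.sq_sqrt (by have := Real.pi_pos; positivity), div_le_iff₀ hap']
    have := Real.pi_pos
    rw [mul_div_assoc', div_mul_eq_mul_div, le_div_iff₀ hap]
    nlinarith
  have e3 : c * Real.sqrt (Real.pi / (a - 1 / 8)) ^ 3 ≤ 8 := by
    calc _ ≤ c * (2 * Real.sqrt (Real.pi / a)) ^ 3 := by gcongr
      _ = 8 * (c * Real.sqrt (Real.pi / a) ^ 3) := by ring
      _ = 8 := by rw [e1, mul_one]
  rw [e1]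
  refine mul_le_mul_of_nonneg_left ?_ (gauss_pos y).le
  nlinarith

end CylinderPropagator

end

noncomputable section

namespace CylinderPropagator

/-! ### Weighted bounds in one time step -/

section Step

variable {X : Type*} [MeasurableSpace X] {μ : Measure X} {ι : Type*}
  {b : HilbertBasis ι ℂ (Lp ℂ 2 μ)} {ν : ι → ℝ} {hν : ∀ i, 0 ≤ ν i}

theorem dominated_iff {w : Lp ℂ 2 μ} {W : X → ℝ} (hw : w =ᵐ[μ] fun x => (W x : ℂ)) (u : Lp ℂ 2 μ)
    (β : ℝ) : (u, (β : ℂ) • w) ∈ dominated μ ↔ ∀ᵐ x ∂μ, ‖u x‖ ≤ β * W x := by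
  have h : ∀ᵐ x ∂μ, (((β : ℂ) • w : Lp ℂ 2 μ) x).re = β * W x := by
    filter_upwards [hw, Lp.coeFn_smul (β : ℂ) w] with x h1 h2
    rw [h2, Pi.smul_apply, h1, smul_eq_mul, ← Complex.ofReal_mul, Complex.ofReal_re]
  constructor
  · intro h'
    filter_upwards [h, h'] with x h1 h2
    exact h2.trans h1.le
  · intro h'
    filter_upwards [h, h'] with x h1 h2
    exact h2.trans h1.ge

theorem mem_dominated {u w : Lp ℂ 2 μ} : (u, w) ∈ dominated μ ↔ ∀ᵐ x ∂μ, ‖u x‖ ≤ (w x).re := Iff.rfl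

theorem dominated_trans {u w w' : Lp ℂ 2 μ} (h : (u, w) ∈ dominated μ) (h' : (w, w') ∈ dominated μ) :
    (u, w') ∈ dominated μ := by
  rw [mem_dominated] at *
  filter_upwards [h, h'] with x h1 h2
  exact h1.trans ((Complex.re_le_norm _).trans h2)

theorem dominated_smul {u w : Lp ℂ 2 μ} (h : (u, w) ∈ dominated μ) (c : ℂ) :
    (c • u, ((‖c‖ : ℝ) : ℂ) • w) ∈ dominated μ := by
  rw [mem_dominated] at *
  filter_upwards [h, Lp.coeFn_smul c u, Lp.coeFn_smul ((‖c‖ : ℝ) : ℂ) w] with x h1 h2 h3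
  rw [h2, h3, Pi.smul_apply, Pi.smul_apply, norm_smul, smul_eq_mul, Complex.re_ofReal_mul]
  exact mul_le_mul_of_nonneg_left h1 (norm_nonneg c)

theorem dominated_smul_mono {u w : Lp ℂ 2 μ} (hw : ((0 : Lp ℂ 2 μ), w) ∈ dominated μ) {c c' : ℝ}
    (hc : c ≤ c') (h : (u, (c : ℂ) • w) ∈ dominated μ) : (u, (c' : ℂ) • w) ∈ dominated μ := by
  rw [mem_dominated] at *
  filter_upwards [h, hw, Lp.coeFn_zero ℂ 2 μ, Lp.coeFn_smul (c : ℂ) w, Lp.coeFn_smul (c' : ℂ) w]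
    with x h1 h2 h3 h4 h5
  rw [h4, Pi.smul_apply, smul_eq_mul, Complex.re_ofReal_mul] at h1
  rw [h5, Pi.smul_apply, smul_eq_mul, Complex.re_ofReal_mul]
  rw [h3, Pi.zero_apply, norm_zero] at h2
  exact h1.trans (mul_le_mul_of_nonneg_right hc h2)

theorem zero_zero_mem_dominated : ((0 : Lp ℂ 2 μ), (0 : Lp ℂ 2 μ)) ∈ dominated μ := by
  rw [mem_dominated]
  filter_upwards [Lp.coeFn_zero ℂ 2 μ] with x hx
  rw [hx]; simp

theorem dominated_sum {κ : Type*} (J : Finset κ) {u w : κ → Lp ℂ 2 μ}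
    (h : ∀ i ∈ J, (u i, w i) ∈ dominated μ) : (∑ i ∈ J, u i, ∑ i ∈ J, w i) ∈ dominated μ := by
  classical
  induction J using Finset.induction_on with
  | empty => simpa using zero_zero_mem_dominated
  | insert i J hi ih =>
    rw [Finset.sum_insert hi, Finset.sum_insert hi]
    exact isClosedCone_dominated.add (u i, w i) (h i (Finset.mem_insert_self i J)) (_, _)
      (ih fun j hj => h j (Finset.mem_insert_of_mem hj))

theorem dominated_add {u w u' w' : Lp ℂ 2 μ} (h : (u, w) ∈ dominated μ) (h' : (u', w') ∈ dominated μ) :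
    (u + u', w + w') ∈ dominated μ :=
  isClosedCone_dominated.add (u, w) h (u', w') h'

theorem dominated_ofReal_smul {u w : Lp ℂ 2 μ} (h : (u, w) ∈ dominated μ) {β : ℝ} (hβ : 0 ≤ β) :
    ((β : ℂ) • u, (β : ℂ) • w) ∈ dominated μ :=
  isClosedCone_dominated.smul β hβ (u, w) h

theorem dominated_add_smul {u u' w : Lp ℂ 2 μ} {c c' : ℝ} (h : (u, (c : ℂ) • w) ∈ dominated μ)
    (h' : (u', (c' : ℂ) • w) ∈ dominated μ) : (u + u', ((c + c' : ℝ) : ℂ) • w) ∈ dominated μ := by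
  have := dominated_add h h'
  rwa [← add_smul, ← Complex.ofReal_add] at this

theorem dominated_norm_smul {u w : Lp ℂ 2 μ} {c : ℝ} (h : (u, (c : ℂ) • w) ∈ dominated μ) (a : ℂ) :
    (a • u, ((‖a‖ * c : ℝ) : ℂ) • w) ∈ dominated μ := by
  have := dominated_smul h a
  rwa [smul_smul, ← Complex.ofReal_mul] at this

theorem norm_le_of_dominated {u w : Lp ℂ 2 μ} {c : ℝ} (hc : 0 ≤ c)
    (h : (u, (c : ℂ) • w) ∈ dominated μ) : ‖u‖ ≤ c * ‖w‖ := by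
  refine Lp.norm_le_mul_norm_of_ae_le_mul ?_
  rw [mem_dominated] at h
  filter_upwards [h, Lp.coeFn_smul (c : ℂ) w] with x h1 h2
  rw [h2, Pi.smul_apply, smul_eq_mul, Complex.re_ofReal_mul] at h1
  exact h1.trans (mul_le_mul_of_nonneg_left (Complex.re_le_norm _) hc)

/-- The semigroup is positive, and moves the weight `w` to at most `c w`. -/
structure HeatWeight (b : HilbertBasis ι ℂ (Lp ℂ 2 μ)) (hν : ∀ i, 0 ≤ ν i) (w : Lp ℂ 2 μ) (c : ℝ) :
    Prop where
  pos : ∀ t, 0 ≤ t → ∀ p ∈ dominated μ, (heat b hν t p.1, heat b hν t p.2) ∈ dominated μ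
  self : (w, w) ∈ dominated μ
  bound : ∀ t, 0 ≤ t → (heat b hν t w, (c : ℂ) • w) ∈ dominated μ

theorem HeatWeight.zero_mem {w : Lp ℂ 2 μ} {c : ℝ} (hw : HeatWeight b hν w c) :
    ((0 : Lp ℂ 2 μ), w) ∈ dominated μ := zero_mem_dominated hw.self

theorem HeatWeight.heat_le {w : Lp ℂ 2 μ} {c : ℝ} (hw : HeatWeight b hν w c) {t : ℝ} (ht : 0 ≤ t)
    {u : Lp ℂ 2 μ} {β : ℝ} (hβ : 0 ≤ β) (hu : (u, (β : ℂ) • w) ∈ dominated μ) :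
    (heat b hν t u, ((β * c : ℝ) : ℂ) • w) ∈ dominated μ := by
  have h1 := hw.pos t ht _ hu
  have h2 := dominated_ofReal_smul (hw.bound t ht) hβ
  simp only [map_smul] at h1
  rw [smul_smul, ← Complex.ofReal_mul] at h2
  exact dominated_trans h1 h2

theorem absLp_dominated {u w : Lp ℂ 2 μ} (h : (u, w) ∈ dominated μ) : (absLp u, w) ∈ dominated μ := by
  rw [mem_dominated] at *
  filter_upwards [h, absLp_ae u] with x h1 h2
  rw [h2, Complex.norm_real, norm_norm]
  exact h1

/-- The majorant is the free evolution of `|u σ|` with constant source `a w`. Its Duhamel integral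
is at most `(τ - σ) a c w`, since the semigroup enlarges `w` at most by `c`. -/
theorem dominated_step [Countable ι] {w : Lp ℂ 2 μ} {c : ℝ} (hw : HeatWeight b hν w c)
    {v : ℝ → X → ℝ} (hv : IsPotential v) {σ τ : ℝ} (hst : σ ≤ τ) {u F : ℝ → Lp ℂ 2 μ}
    (hu : LinSol b ν σ τ u (fun s => -(potOp μ hv s (u s)) + F s)) (hF : ContinuousOn F (Icc σ τ))
    {a : ℝ} (ha : 0 ≤ a) (hFw : ∀ s ∈ Icc σ τ, (F s, (a : ℂ) • w) ∈ dominated μ) :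
    (u τ, heat b hν (τ - σ) (absLp (u σ)) + (((τ - σ) * (a * c) : ℝ) : ℂ) • w) ∈ dominated μ := by
  obtain ⟨K, hK⟩ := hv.bdd τ
  let W : ℝ → Lp ℂ 2 μ := fun t => heat b hν (t - σ) (absLp (u σ))
    + ∫ s in σ..t, heat b hν (t - s) ((a : ℂ) • w)
  have hW : LinSol b ν σ τ W (fun _ => (a : ℂ) • w) :=
    linSol_of_duhamel b hν (absLp (u σ)) continuous_const fun t _ => rfl
  -- The maximum with `1` keeps the shift strictly positive when the potential vanishes.
  have hKp : ∀ s ∈ Icc σ τ, ∀ x, v s x ≤ max K 1 := fun s hs x => (hK s hs.2 x).trans (le_max_left _ _)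
  have h1 : (u τ, W τ) ∈ dominated μ := by
    refine LinSol.dominated (K := max K 1) hν hst isClosedCone_dominated
      (fun x w h => zero_mem_dominated h) hw.pos (continuous_potOp hv)
      (fun s _ x => (isPos_potOp hv s).nonneg x)
      (fun s hs x => norm_sub_potOp_le hv (hKp s hs) x)
      (fun s hs p hp => sub_potOp_dominated hv (hKp s hs) hp)
      (lt_of_lt_of_le one_pos (le_max_right _ _)) hu hF hW ?_ hFw
    simp only [W, intervalIntegral.integral_same, sub_self, add_zero,
      heat_of_nonpos b hν le_rfl]
    exact mem_dominated_abs _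
  have h2 : (∫ s in σ..τ, heat b hν (τ - s) ((a : ℂ) • w), ∫ _ in σ..τ, ((a * c : ℝ) : ℂ) • w)
      ∈ dominated μ := by
    refine isClosedCone_dominated.integral_mem hst ?_ continuousOn_const (fun s hs => ?_)
      zero_zero_mem_dominated
    · exact ((continuous_heat_apply b hν ((a : ℂ) • w)).comp
        (g := fun t => heat b hν t ((a : ℂ) • w)) (continuous_const.sub continuous_id)).continuousOn
    · exact hw.heat_le (sub_nonneg.2 hs.2) ha (dominated_ofReal_smul hw.self ha)
  rw [intervalIntegral.integral_const] at h2
  rw [mem_dominated] at *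
  filter_upwards [h1, h2, Lp.coeFn_add (heat b hν (τ - σ) (absLp (u σ)))
      (∫ s in σ..τ, heat b hν (τ - s) ((a : ℂ) • w)),
    Lp.coeFn_add (heat b hν (τ - σ) (absLp (u σ))) ((((τ - σ) * (a * c) : ℝ) : ℂ) • w)]
    with x k1 k2 k3 k4
  simp only [W] at k1
  rw [k3, Pi.add_apply, Complex.add_re] at k1
  rw [k4, Pi.add_apply, Complex.add_re]
  have e : ((τ - σ) • ((a * c : ℝ) : ℂ) • w : Lp ℂ 2 μ) = (((τ - σ) * (a * c) : ℝ) : ℂ) • w := by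
    rw [Complex.ofReal_mul (τ - σ), mul_smul]
    rfl
  rw [e] at k2
  linarith [Complex.re_le_norm ((∫ s in σ..τ, heat b hν (τ - s) ((a : ℂ) • w) : Lp ℂ 2 μ) x)]

/-- The part of `V u` in the modes of `J` is bounded by the weight. -/
theorem lowModes_dominated {w : Lp ℂ 2 μ} {J : Finset ι} {c c' : ℝ} (hc : 0 ≤ c)
    (hself : (w, w) ∈ dominated μ)
    (hb : ∀ i ∈ J, (b i, (c : ℂ) • w) ∈ dominated μ) {V : Lp ℂ 2 μ →L[ℂ] Lp ℂ 2 μ} (hV : IsPos V)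
    (hVb : ∀ i ∈ J, ‖V (b i)‖ ≤ c') {u : Lp ℂ 2 μ} {a : ℝ} (hu : ‖u‖ ≤ a) :
    (V u - modeProj b J (V u), ((J.card * (c' * a * c) : ℝ) : ℂ) • w) ∈ dominated μ := by
  have e1 : V u - modeProj b J (V u) = ∑ i ∈ J, (inner ℂ (b i) (V u) : ℂ) • b i := by
    rw [modeProj_apply, sub_sub_cancel]
  have e2 : ((J.card * (c' * a * c) : ℝ) : ℂ) • w = ∑ _i ∈ J, ((c' * a * c : ℝ) : ℂ) • w := by
    rw [Finset.sum_const, Complex.ofReal_mul, mul_smul, Complex.ofReal_natCast, Nat.cast_smul_eq_nsmul]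
  rw [e1, e2]
  refine dominated_sum J fun i hi => ?_
  refine dominated_smul_mono (zero_mem_dominated hself) ?_ (dominated_norm_smul (hb i hi) _)
  refine mul_le_mul_of_nonneg_right ?_ hc
  -- Moving the potential onto the basis vector means that only the norm of `V (b i)` enters, never
  -- the supremum of `V`, which grows with time.
  rw [← hV.symm]
  exact (norm_inner_le_norm _ _).trans
    (mul_le_mul (hVb i hi) hu (norm_nonneg _) ((norm_nonneg _).trans (hVb i hi)))

/-- Since `-P V u = -V u + (V u - P V u)`, the comparison principle applies with a source in the
span of the modes of `J`, controlled by the `L²` norm of `u`. -/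
theorem dominated_projected_step [Countable ι] {w : Lp ℂ 2 μ} {c : ℝ} (hw : HeatWeight b hν w c)
    {v : ℝ → X → ℝ} (hv : IsPotential v) {J : Finset ι} {cb cV : ℝ} (hcb : 0 ≤ cb) (hcV : 0 ≤ cV)
    (hb : ∀ i ∈ J, (b i, (cb : ℂ) • w) ∈ dominated μ) (hVb : ∀ i ∈ J, ∀ s, ‖potOp μ hv s (b i)‖ ≤ cV)
    {σ τ : ℝ} (hst : σ ≤ τ) {u : ℝ → Lp ℂ 2 μ}
    (hu : LinSol b ν σ τ u (fun s => -(modeProj b J (potOp μ hv s (u s)))))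
    {a : ℝ} (ha : 0 ≤ a) (hua : ∀ s ∈ Icc σ τ, ‖u s‖ ≤ a) :
    (u τ, heat b hν (τ - σ) (absLp (u σ)) + (((τ - σ) * (J.card * (cV * a * cb) * c) : ℝ) : ℂ) • w)
      ∈ dominated μ := by
  have hVu : ContinuousOn (fun s => potOp μ hv s (u s)) (Icc σ τ) :=
    (continuous_potOp hv).continuousOn.clm_apply hu.cont
  refine dominated_step hw hv hst
    (F := fun s => potOp μ hv s (u s) - modeProj b J (potOp μ hv s (u s))) ?_ ?_ (by positivity)
    fun s hs => lowModes_dominated hcb hw.self hb (isPos_potOp hv s) (fun i hi => hVb i hi s) (hua s hs)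
  · exact hu.congr (fun _ _ => rfl) fun s _ => by abel
  · exact hVu.sub ((modeProj b J).continuous.comp_continuousOn hVu)

/-- As `P u = u`, the inner product of `u` with `P V u` equals that with `V u`, whose real part is
nonnegative. The surviving modes all have eigenvalue at least `γ`. -/
theorem norm_le_of_projected [Countable ι] {v : ℝ → X → ℝ} (hv : IsPotential v) {J : Finset ι}
    {σ τ γ : ℝ} (hst : σ ≤ τ) {u : ℝ → Lp ℂ 2 μ}
    (hu : LinSol b ν σ τ u (fun s => -(modeProj b J (potOp μ hv s (u s)))))
    (hP : ∀ t ∈ Icc σ τ, modeProj b J (u t) = u t) (hγ : ∀ i, ν i < γ → i ∈ J) :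
    ‖u τ‖ ≤ Real.exp (-γ * (τ - σ)) * ‖u σ‖ := by
  classical
  refine hu.norm_le hst γ (fun t ht i hi => ?_) fun t ht => ?_
  · rw [← hP t ht, inner_modeProj, if_pos (hγ i hi)]
  · rw [inner_neg_right, ← modeProj_symm, hP t ht, Complex.neg_re]
    linarith [(isPos_potOp (μ := μ) hv t).nonneg (u t)]

end Step

/-! ### Weighted decay on `ℝ³` -/

theorem wtVec_dominated_iff (k : ℕ) (u : HE) (β : ℝ) :
    (u, (β : ℂ) • wtVec k) ∈ dominated volume ↔ ∀ᵐ y, ‖u y‖ ≤ β * wt k y :=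
  dominated_iff (wtVec_ae k) u β

theorem heat_wtVec_le {k : ℕ} (hk : k ≤ 3) {t : ℝ} (ht : 0 < t) {u : HE} {β : ℝ} (hβ : 0 ≤ β)
    (hu : ∀ᵐ y, ‖u y‖ ≤ β * wt k y) {η : ℝ} (hη : 0 < η) :
    ∀ᵐ y, ‖heat hermBasis rate_nonneg t u y‖ ≤
      β * (gauss y * (((1 + η) * (Real.exp (-(t / 2)) * ‖y‖)) ^ k + 2048 * (1 + η⁻¹) ^ k)) := by
  refine (isHeatKernel_mehler ht).norm_heat_le rate_nonneg ht.le hu (fun y => ?_) fun y => ?_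
  · refine ((integrable_mehler_mul_wt ht k y).const_mul β).congr (Eventually.of_forall fun x => ?_)
    ring
  · have : ∀ x, mehler t y x * (β * wt k x) = β * (mehler t y x * wt k x) := fun x => by ring
    simp only [this]
    rw [integral_const_mul]
    exact mul_le_mul_of_nonneg_left (integral_mehler_mul_wt_le ht hk hη y) hβ

/-- Take `η = 1` in the weight estimate: the constant is `8 + 2048 · 8`, using `2^k ≤ 8`. -/
theorem heatWeight_wtVec {k : ℕ} (hk : k ≤ 3) :
    HeatWeight hermBasis rate_nonneg (wtVec k) 16392 := by
  have hself : (wtVec k, wtVec k) ∈ dominated volume := by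
    rw [mem_dominated]
    filter_upwards [wtVec_ae k] with y hy
    rw [hy, Complex.norm_real, Complex.ofReal_re, Real.norm_eq_abs, abs_of_pos (wt_pos k y)]
  refine ⟨fun t ht p hp => ?_, hself, fun t ht => ?_⟩
  · rcases ht.eq_or_lt with rfl | ht
    · simpa [heat_of_nonpos hermBasis rate_nonneg le_rfl] using hp
    · exact (isHeatKernel_mehler ht).dominated rate_nonneg ht.le hp
  · rcases ht.eq_or_lt with rfl | ht
    · rw [heat_of_nonpos hermBasis rate_nonneg le_rfl]
      refine dominated_smul_mono (c := 1) (zero_mem_dominated hself) (by norm_num) ?_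
      simpa using hself
    · rw [wtVec_dominated_iff]
      have h1 : ∀ᵐ y, ‖wtVec k y‖ ≤ 1 * wt k y := by
        filter_upwards [wtVec_ae k] with y hy
        rw [hy, Complex.norm_real, Real.norm_eq_abs, abs_of_pos (wt_pos k y), one_mul]
      filter_upwards [heat_wtVec_le hk ht zero_le_one h1 one_pos] with y hy
      refine hy.trans ?_
      have hm1 : Real.exp (-(t / 2)) ≤ 1 := Real.exp_le_one_iff.2 (by linarith)
      have h2 : Real.exp (-(t / 2)) * ‖y‖ ≤ jap y :=
        (mul_le_of_le_one_left (norm_nonneg y) hm1).trans (norm_le_jap y)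
      have h3 : ((1 + 1) * (Real.exp (-(t / 2)) * ‖y‖)) ^ k ≤ 2 ^ k * jap y ^ k := by
        rw [← mul_pow]
        refine pow_le_pow_left₀ (by positivity) ?_ k
        linarith
      have h4 : (2 : ℝ) ^ k ≤ 8 := by
        calc (2 : ℝ) ^ k ≤ 2 ^ 3 := pow_le_pow_right₀ (by norm_num) hk
          _ = 8 := by norm_num
      have h5 : 1 ≤ jap y ^ k := one_le_pow₀ (one_le_jap y)
      rw [wt]
      have := gauss_pos y
      have h6 : ((1 + 1) * (Real.exp (-(t / 2)) * ‖y‖)) ^ k + 2048 * (1 + (1 : ℝ)⁻¹) ^ k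
          ≤ 16392 * jap y ^ k := by
        have : (1 + (1 : ℝ)⁻¹) = 2 := by norm_num
        rw [this]
        nlinarith
      calc _ ≤ 1 * (gauss y * (16392 * jap y ^ k)) := by gcongr
        _ = _ := by ring

/-- The growth in `y` is harmless, as this `L²`–`L^∞` bound is applied only on a bounded set of `y`.
-/
theorem norm_mehler_le (t : ℝ) (ht : 0 < t) : ∃ C : ℝ, 0 ≤ C ∧ ∀ y,
    ‖(memLp_mehler ht y).toLp (mehler t y)‖ ≤ C * Real.exp (‖y‖ ^ 2) := by
  let g := (memLp_exp_neg_sq (a := 1 / 16) (by norm_num)).toLp _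
  set c := (Real.sqrt (Real.pi / mehlerRate t))⁻¹ ^ 3
  have hc : 0 ≤ c := by positivity
  refine ⟨c * ‖g‖, by positivity, fun y => ?_⟩
  have : ‖(memLp_mehler ht y).toLp (mehler t y)‖ ≤ (c * Real.exp (‖y‖ ^ 2)) * ‖g‖ := by
    refine Lp.norm_le_mul_norm_of_ae_le_mul ?_
    filter_upwards [(memLp_mehler ht y).coeFn_toLp,
      (memLp_exp_neg_sq (a := 1 / 16) (by norm_num)).coeFn_toLp] with x h1 h2
    simp only [g]
    rw [h1, h2, Real.norm_eq_abs, abs_of_nonneg (mehler_nonneg t y x), Real.norm_eq_abs,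
      abs_of_pos (Real.exp_pos _)]
    exact mehler_le ht y x
  linarith

/-- One unit of time contracts the weighted norm, up to a multiple of the `L²` norm. -/
theorem exists_contraction {k : ℕ} (hk0 : 1 ≤ k) (hk : k ≤ 3) : ∃ C : ℝ, 0 ≤ C ∧
    ∀ (u : HE) (β : ℝ), 0 ≤ β → (u, (β : ℂ) • wtVec k) ∈ dominated volume →
      (heat hermBasis rate_nonneg 1 u,
        ((Real.exp (-(k / 2 - 1 / 20)) * β + C * ‖u‖ : ℝ) : ℂ) • wtVec k) ∈ dominated volume := by
  obtain ⟨N, hN0, hN⟩ := norm_mehler_le 1 one_pos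
  -- With this `η` and `k ≤ 3`, the factor `(1 + η)^k` is at most `e^{3/100}`, which is less than
  -- the permitted loss `e^{1/20}`.
  set η : ℝ := Real.exp (1 / 100) - 1 with hηdef
  have hη : 0 < η := by
    have := Real.add_one_lt_exp (x := 1 / 100) (by norm_num)
    linarith
  set B : ℝ := 2048 * (1 + η⁻¹) ^ k with hB
  -- The room left between the losses `3/100` and `1/20`. The constant term `B` fits into it once
  -- `|y| ≥ B / δ`.
  set δ : ℝ := Real.exp (-(k / 2 - 1 / 20)) - Real.exp (-(k / 2 - 3 / 100)) with hδdef
  have hδ : 0 < δ := sub_pos.2 (Real.exp_lt_exp.2 (by linarith))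
  have hB0 : 0 ≤ B := by positivity
  set M : ℝ := B / δ with hM
  refine ⟨N * Real.exp (M ^ 2) * Real.exp (M ^ 2 / 8), by positivity, fun u β hβ hu => ?_⟩
  rw [wtVec_dominated_iff] at hu ⊢
  filter_upwards [heat_wtVec_le hk one_pos hβ hu hη,
    (isHeatKernel_mehler one_pos).norm_heat_le_norm rate_nonneg zero_le_one u] with y h1 h2
  have hg := gauss_pos y
  have hwt := wt_pos k y
  have hjap := jap_pos y
  -- Far away the weight contracts, `k ≥ 1` being needed to absorb `B`. On the remaining ball the
  -- weight is bounded below and the `L²` norm controls everything.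
  rcases le_total M ‖y‖ with hy | hy
  · have hk' : (1 + η) ^ k ≤ Real.exp (3 / 100) := by
      have : 1 + η = Real.exp (1 / 100) := by rw [hηdef]; ring
      rw [this, ← Real.exp_nat_mul]
      refine Real.exp_le_exp.2 ?_
      have : (k : ℝ) ≤ 3 := by exact_mod_cast hk
      linarith
    have e1 : ((1 + η) * (Real.exp (-(1 / 2)) * ‖y‖)) ^ k
        ≤ Real.exp (-(k / 2 - 3 / 100)) * jap y ^ k := by
      have e : Real.exp (-(k / 2 - 3 / 100)) = Real.exp (3 / 100) * Real.exp (-(1 / 2)) ^ k := by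
        rw [← Real.exp_nat_mul, ← Real.exp_add]; ring_nf
      rw [mul_pow, mul_pow, e, mul_assoc]
      have := norm_le_jap y
      gcongr
    have e2 : B ≤ δ * jap y ^ k := by
      have : B ≤ δ * ‖y‖ := by
        rw [hM, div_le_iff₀ hδ] at hy; linarith
      have h3 : ‖y‖ ≤ jap y ^ k :=
        (norm_le_jap y).trans (le_self_pow₀ (one_le_jap y) (by omega))
      exact this.trans (mul_le_mul_of_nonneg_left h3 hδ.le)
    have e3 : ((1 + η) * (Real.exp (-(1 / 2)) * ‖y‖)) ^ k + B
        ≤ Real.exp (-(k / 2 - 1 / 20)) * jap y ^ k := by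
      have : Real.exp (-(k / 2 - 1 / 20)) = Real.exp (-(k / 2 - 3 / 100)) + δ := by rw [hδdef]; ring
      calc _ ≤ Real.exp (-(k / 2 - 3 / 100)) * jap y ^ k + δ * jap y ^ k := add_le_add e1 e2
        _ = _ := by rw [this]; ring
    have e4 : β * (gauss y * (((1 + η) * (Real.exp (-(1 / 2)) * ‖y‖)) ^ k + B))
        ≤ Real.exp (-(k / 2 - 1 / 20)) * β * wt k y := by
      calc _ ≤ β * (gauss y * (Real.exp (-(k / 2 - 1 / 20)) * jap y ^ k)) := by gcongr
        _ = _ := by rw [wt]; ring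
    refine h1.trans (e4.trans ?_)
    refine mul_le_mul_of_nonneg_right ?_ hwt.le
    have : 0 ≤ N * Real.exp (M ^ 2) * Real.exp (M ^ 2 / 8) * ‖u‖ := by positivity
    linarith
  · have hyM : ‖y‖ ^ 2 ≤ M ^ 2 := pow_le_pow_left₀ (norm_nonneg y) hy 2
    have e1 : 1 ≤ Real.exp (M ^ 2 / 8) * wt k y := by
      have h3 : Real.exp (M ^ 2 / 8) * gauss y ≥ 1 := by
        rw [gauss, ← Real.exp_add]
        exact Real.one_le_exp (by linarith)
      exact h3.le.trans (mul_le_mul_of_nonneg_left (gauss_le_wt k y) (Real.exp_pos _).le)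
    have e2 : ‖(memLp_mehler one_pos y).toLp (mehler 1 y)‖ * ‖u‖
        ≤ N * Real.exp (M ^ 2) * ‖u‖ := by
      refine mul_le_mul_of_nonneg_right ((hN y).trans ?_) (norm_nonneg u)
      gcongr
    refine h2.trans (e2.trans ?_)
    have e3 : N * Real.exp (M ^ 2) * ‖u‖ ≤
        N * Real.exp (M ^ 2) * ‖u‖ * (Real.exp (M ^ 2 / 8) * wt k y) :=
      le_mul_of_one_le_right (by positivity) e1
    have : 0 ≤ Real.exp (-(k / 2 - 1 / 20)) * β * wt k y := by positivity
    rw [add_mul]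
    linarith

/-! ### The low modes -/

/-- The multi-indices of degree less than `d`. -/
def lowModes (d : ℕ) : Finset (Fin 3 → ℕ) :=
  (Fintype.piFinset fun _ => Finset.range d).filter fun α => deg α < d

theorem mem_lowModes {d : ℕ} {α : Fin 3 → ℕ} : α ∈ lowModes d ↔ deg α < d := by
  simp only [lowModes, Finset.mem_filter, Fintype.mem_piFinset, Finset.mem_range, and_iff_right_iff_imp]
  intro h i
  exact lt_of_le_of_lt (Finset.single_le_sum (f := α) (fun _ _ => Nat.zero_le _) (Finset.mem_univ i)) h

theorem lowModes_zero : lowModes 0 = ∅ := by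
  ext α; simp [mem_lowModes]

theorem abs_coord_le_norm (y : E) (i : Fin 3) : |y i| ≤ ‖y‖ := by
  simpa using PiLp.norm_apply_le y i

theorem exists_abs_hermN_le (α : Fin 3 → ℕ) : ∃ C : ℝ, 0 ≤ C ∧ ∀ y, |hermN α y| ≤ C * wt (deg α) y := by
  choose c hc0 hc using exists_abs_herm_le
  refine ⟨(Real.sqrt (hermSq α))⁻¹ * ∏ i, c (α i),
    mul_nonneg (by positivity) (Finset.prod_nonneg fun i _ => hc0 _), fun y => ?_⟩
  rw [hermN, hermFun_eq, abs_mul, abs_mul, abs_of_pos (gauss_pos y), abs_of_nonneg (by positivity),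
    Finset.abs_prod, mul_assoc]
  refine mul_le_mul_of_nonneg_left ?_ (by positivity)
  have : ∏ i, |(herm (α i)).eval (y i)| ≤ ∏ i, (c (α i) * jap y ^ (α i)) := by
    refine Finset.prod_le_prod (fun i _ => abs_nonneg _) fun i _ => (hc _ _).trans ?_
    refine mul_le_mul_of_nonneg_left (pow_le_pow_left₀ (Real.sqrt_nonneg _) ?_ _) (hc0 _)
    refine Real.sqrt_le_sqrt ?_
    have := pow_le_pow_left₀ (abs_nonneg _) (abs_coord_le_norm y i) 2
    rw [sq_abs] at this
    linarith
  rw [Finset.prod_mul_distrib, Finset.prod_pow_eq_pow_sum] at this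
  calc _ ≤ ((∏ i, c (α i)) * jap y ^ deg α) * gauss y :=
        mul_le_mul_of_nonneg_right this (gauss_pos y).le
    _ = _ := by rw [wt]; ring

/-- Multiplication by `V ≤ |y|` costs one more power of the weight, which is still square
integrable. The constant does not depend on `V`. -/
theorem exists_mode_bounds (α : Fin 3 → ℕ) : ∃ C : ℝ, 0 ≤ C ∧
    (∀ k, deg α ≤ k → ∀ y, |hermN α y| ≤ C * wt k y) ∧
    ∀ (v : ℝ → E → ℝ) (hv : IsPotential v), (∀ s y, v s y ≤ ‖y‖) → ∀ s,
      ‖potOp volume hv s (hermVec α)‖ ≤ C := by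
  obtain ⟨c, hc0, hc⟩ := exists_abs_hermN_le α
  refine ⟨c + c * ‖wtVec (deg α + 1)‖, by positivity, fun k hk y => ?_, fun v hv hvy s => ?_⟩
  · refine (hc y).trans ?_
    have h1 := wt_mono hk y
    have h2 := wt_pos (deg α) y
    have : 0 ≤ c * ‖wtVec (deg α + 1)‖ := by positivity
    exact mul_le_mul (by linarith) h1 h2.le (by positivity)
  · have : ‖potOp volume hv s (hermVec α)‖ ≤ c * ‖wtVec (deg α + 1)‖ := by
      refine Lp.norm_le_mul_norm_of_ae_le_mul ?_
      filter_upwards [potOp_ae hv s (hermVec α), hermVec_ae α, wtVec_ae (deg α + 1)] with y h1 h2 h3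
      rw [h1, h2, h3, norm_mul, Complex.norm_real, Complex.norm_real, Complex.norm_real,
        Real.norm_eq_abs, Real.norm_eq_abs, Real.norm_eq_abs, abs_of_pos (wt_pos _ y),
        abs_of_nonneg (hv.nonneg s y)]
      calc v s y * |hermN α y| ≤ jap y * (c * wt (deg α) y) :=
            mul_le_mul ((hvy s y).trans (norm_le_jap y)) (hc y) (abs_nonneg _) (jap_pos y).le
        _ = c * wt (deg α + 1) y := by rw [wt, wt, pow_succ]; ring
    linarith

/-- The decay rate obtained after removing the modes of degree less than `d`. -/
def decay (d : ℕ) : ℝ := if d = 0 then 0 else (d : ℝ) / 2 - 1 / 10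

theorem exists_mode_const (d : ℕ) : ∃ C : ℝ, 0 ≤ C ∧
    (∀ α ∈ lowModes d, ∀ k, d ≤ k → ∀ y, |hermN α y| ≤ C * wt k y) ∧
    ∀ (v : ℝ → E → ℝ) (hv : IsPotential v), (∀ s y, v s y ≤ ‖y‖) → ∀ α ∈ lowModes d, ∀ s,
      ‖potOp volume hv s (hermVec α)‖ ≤ C := by
  choose c hc0 hc1 hc2 using exists_mode_bounds
  have hle : ∀ α ∈ lowModes d, c α ≤ ∑ β ∈ lowModes d, c β := fun α hα =>
    Finset.single_le_sum (fun β _ => hc0 β) hα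
  refine ⟨∑ β ∈ lowModes d, c β, Finset.sum_nonneg fun β _ => hc0 β, fun α hα k hk y => ?_,
    fun v hv hvy α hα s => (hc2 α v hv hvy s).trans (hle α hα)⟩
  exact (hc1 α k ((mem_lowModes.1 hα).le.trans hk) y).trans
    (mul_le_mul_of_nonneg_right (hle α hα) (wt_pos k y).le)

theorem hermVec_dominated {k : ℕ} {C : ℝ} {α : Fin 3 → ℕ}
    (h : ∀ y, |hermN α y| ≤ C * wt k y) : (hermBasis α, (C : ℂ) • wtVec k) ∈ dominated volume := by
  rw [wtVec_dominated_iff, hermBasis_apply]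
  filter_upwards [hermVec_ae α] with y hy
  rw [hy, Complex.norm_real, Real.norm_eq_abs]
  exact h y

/-- Geometric iteration of a contraction with an exponentially decaying error. -/
theorem geometric_bound {ρ r A : ℝ} (hA : 0 ≤ A) (hρ : ρ = r + 1 / 20) :
    ∃ K : ℝ, 1 ≤ K ∧ ∀ n : ℕ, Real.exp (-ρ) * (K * Real.exp (-r * n)) + A * Real.exp (-r * n)
      ≤ K * Real.exp (-r * (n + 1)) := by
  have hδ : 0 < 1 - Real.exp (-(1 / 20)) := by
    have : Real.exp (-(1 / 20)) < 1 := Real.exp_lt_one_iff.2 (by norm_num)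
    linarith
  -- Chosen so that `A e^r ≤ K (1 - e^{-1/20})`: the gap `1/20` between the two rates pays for the
  -- error.
  refine ⟨1 + A * Real.exp r / (1 - Real.exp (-(1 / 20))), ?_, fun n => ?_⟩
  · have : 0 ≤ A * Real.exp r / (1 - Real.exp (-(1 / 20))) := by positivity
    linarith
  set K := 1 + A * Real.exp r / (1 - Real.exp (-(1 / 20)))
  have hK : A * Real.exp r ≤ K * (1 - Real.exp (-(1 / 20))) := by
    have : K * (1 - Real.exp (-(1 / 20))) = (1 - Real.exp (-(1 / 20))) + A * Real.exp r := by
      simp only [K]; field_simp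
    linarith
  have e1 : Real.exp (-r * (n + 1)) = Real.exp (-r) * Real.exp (-r * n) := by
    rw [← Real.exp_add]; ring_nf
  have e2 : Real.exp (-ρ) = Real.exp (-r) * Real.exp (-(1 / 20)) := by
    rw [hρ, ← Real.exp_add]; ring_nf
  have e3 : A = Real.exp (-r) * (A * Real.exp r) := by
    rw [mul_left_comm, ← Real.exp_add]; simp
  have h4 := mul_le_mul_of_nonneg_left hK (mul_nonneg (Real.exp_pos (-r)).le (Real.exp_pos (-r * n)).le)
  have e5 : A * Real.exp (-r * n) = Real.exp (-r) * Real.exp (-r * n) * (A * Real.exp r) := by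
    conv_lhs => rw [e3]
    ring
  rw [e1, e2, e5]
  nlinarith

theorem dominated_trans_add {X : Type*} [MeasurableSpace X] {μ : Measure X} {u x w : Lp ℂ 2 μ}
    {c c' : ℝ} (hself : (w, w) ∈ dominated μ) (hc : 0 ≤ c')
    (h : (u, x + (c' : ℂ) • w) ∈ dominated μ) (hx : (x, (c : ℂ) • w) ∈ dominated μ) :
    (u, ((c + c' : ℝ) : ℂ) • w) ∈ dominated μ :=
  dominated_trans h (dominated_add_smul hx (dominated_ofReal_smul hself hc))

/-- Weighted decay for the evolution away from the modes of degree less than `d`. -/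
theorem exists_weighted_decay {d k : ℕ} (hdk : d ≤ k) (hk : k ≤ 3) : ∃ C : ℝ, 0 ≤ C ∧
    ∀ (v : ℝ → E → ℝ) (hv : IsPotential v), (∀ s y, v s y ≤ ‖y‖) → ∀ σ τ : ℝ, σ ≤ τ → ∀ u : ℝ → HE,
      LinSol hermBasis rate σ τ u
        (fun s => -(modeProj hermBasis (lowModes d) (potOp volume hv s (u s)))) →
      (∀ t ∈ Icc σ τ, modeProj hermBasis (lowModes d) (u t) = u t) → ∀ β : ℝ, 0 ≤ β →
      (u σ, (β : ℂ) • wtVec k) ∈ dominated volume →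
      (u τ, ((C * Real.exp (-decay d * (τ - σ)) * β : ℝ) : ℂ) • wtVec k) ∈ dominated volume := by
  have hw := heatWeight_wtVec hk
  rcases Nat.eq_zero_or_pos d with rfl | hd
  -- Without projection there is no error term, and comparison with the free semigroup suffices. The
  -- contraction is not available here, as `k` may be `0`.
  · refine ⟨16392, by norm_num, fun v hv hvy σ τ hst u hu hP β hβ hi => ?_⟩
    have h1 := dominated_step hw hv hst (F := fun _ => 0) (a := 0)
      (hu.congr (fun _ _ => rfl) fun s _ => by
        rw [lowModes_zero, modeProj_empty, add_zero]) continuousOn_const le_rfl fun s _ => by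
          simpa using zero_zero_mem_dominated
    have h2 := hw.heat_le (sub_nonneg.2 hst) hβ (absLp_dominated hi)
    have h3 := dominated_trans h1 (w' := ((16392 * β : ℝ) : ℂ) • wtVec k) (by
      simpa [mul_comm] using h2)
    simpa [decay] using h3
  obtain ⟨c, hc0, hcb, hcV⟩ := exists_mode_const d
  obtain ⟨N, hN0, hN⟩ := exists_contraction (hd.trans_le hdk) hk
  set W := ‖wtVec k‖
  set S : ℝ := (lowModes d).card * (c * 1 * c) * 16392 with hS
  have hS0 : 0 ≤ S := by positivity
  set r := (d : ℝ) / 2 - 1 / 10 with hr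
  have hdecay : decay d = r := by rw [decay, if_neg (by omega)]
  have hr0 : 0 ≤ r := by
    have : (1 : ℝ) ≤ d := by exact_mod_cast hd
    rw [hr]; linarith
  obtain ⟨K, hK1, hK⟩ := geometric_bound (ρ := (d : ℝ) / 2 - 1 / 20) (r := r)
    (A := (N + S) * W) (by positivity) (by rw [hr]; ring)
  refine ⟨(16392 * K + S * W) * Real.exp r, by positivity, fun v hv hvy σ τ hst u hu hP β hβ hi => ?_⟩
  -- The energy estimate gives the better rate `d/2`; it is weakened to `r`, the rate at which the
  -- iteration runs.
  have hL2 : ∀ t ∈ Icc σ τ, ‖u t‖ ≤ Real.exp (-r * (t - σ)) * (β * W) := by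
    intro t ht
    have h1 := norm_le_of_projected hv ht.1 (hu.mono le_rfl ht.2)
      (fun s hs => hP s ⟨hs.1, hs.2.trans ht.2⟩) (γ := (d : ℝ) / 2) (fun α hα => by
        rw [mem_lowModes]
        rw [rate] at hα
        have : (deg α : ℝ) < d := by linarith
        exact_mod_cast this)
    refine h1.trans ?_
    have h2 : Real.exp (-((d : ℝ) / 2) * (t - σ)) ≤ Real.exp (-r * (t - σ)) := by
      refine Real.exp_le_exp.2 ?_
      have := sub_nonneg.2 ht.1
      rw [hr]; nlinarith
    exact mul_le_mul h2 (norm_le_of_dominated hβ hi) (norm_nonneg _) (Real.exp_pos _).le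
  -- A step of length at most `1`: free evolution plus an error from the low modes, of the size of
  -- the `L²` norm at the start of the step.
  have hstep : ∀ a ∈ Icc σ τ, ∀ e ∈ Icc σ τ, a ≤ e → e ≤ a + 1 →
      (u e, heat hermBasis rate_nonneg (e - a) (absLp (u a))
        + ((S * (Real.exp (-r * (a - σ)) * (β * W)) : ℝ) : ℂ) • wtVec k) ∈ dominated volume := by
    intro a ha e he hae hea
    have hmono : ∀ s ∈ Icc a e, ‖u s‖ ≤ Real.exp (-r * (a - σ)) * (β * W) := fun s hs => by
      refine (hL2 s ⟨ha.1.trans hs.1, hs.2.trans he.2⟩).trans ?_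
      refine mul_le_mul_of_nonneg_right (Real.exp_le_exp.2 ?_) (by positivity)
      nlinarith [hs.1]
    have h1 := dominated_projected_step hw hv hc0 hc0 (J := lowModes d)
      (fun α hα => hermVec_dominated (hcb α hα k hdk))
      (fun α hα s => by rw [hermBasis_apply]; exact hcV v hv hvy α hα s) hae
      (hu.mono ha.1 he.2) (a := Real.exp (-r * (a - σ)) * (β * W)) (by positivity) hmono
    refine dominated_trans h1 (dominated_add ?_ ?_)
    · exact hw.pos _ (sub_nonneg.2 hae) (absLp (u a), absLp (u a)) (absLp_dominated (mem_dominated_abs _))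
    · refine dominated_smul_mono hw.zero_mem ?_ (dominated_ofReal_smul hw.self ?_)
      · have h2 : 0 ≤ (lowModes d).card * (c * (Real.exp (-r * (a - σ)) * (β * W)) * c) * 16392 := by
          positivity
        calc _ ≤ 1 * ((lowModes d).card * (c * (Real.exp (-r * (a - σ)) * (β * W)) * c) * 16392) :=
              mul_le_mul_of_nonneg_right (by linarith) h2
          _ = _ := by rw [hS]; ring
      · have := sub_nonneg.2 hae
        positivity
  have hind : ∀ n : ℕ, σ + n ≤ τ →
      (u (σ + n), ((K * Real.exp (-r * n) * β : ℝ) : ℂ) • wtVec k) ∈ dominated volume := by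
    intro n
    induction n with
    | zero =>
      intro _
      refine dominated_smul_mono (c := β) hw.zero_mem ?_ (by simpa using hi)
      simpa using le_mul_of_one_le_left hβ hK1
    | succ n ih =>
      intro hn
      rw [Nat.cast_succ] at hn ⊢
      have ha : σ + n ∈ Icc σ τ := ⟨by linarith [Nat.cast_nonneg (α := ℝ) n], by linarith⟩
      have he : σ + (n + 1) ∈ Icc σ τ := ⟨by linarith [ha.1], hn⟩
      have h1 := hstep _ ha _ he (by linarith) (by linarith)
      have h2 := hN (absLp (u (σ + n))) (K * Real.exp (-r * n) * β) (by positivity)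
        (absLp_dominated (ih (by linarith)))
      rw [show σ + ((n : ℝ) + 1) - (σ + n) = 1 by ring] at h1
      have hp : 0 ≤ S * (Real.exp (-r * (σ + n - σ)) * (β * W)) := by positivity
      have h3 := dominated_trans_add hw.self hp h1 h2
      refine dominated_smul_mono hw.zero_mem ?_ h3
      rw [norm_absLp, show σ + (n : ℝ) - σ = n by ring]
      have h4 := hL2 _ ha
      rw [show σ + (n : ℝ) - σ = n by ring] at h4
      -- The weight contracts at least as fast as required because `d ≤ k`; this is where the weight
      -- has to be strong enough for the number of modes removed.
      have h5 : Real.exp (-((k : ℝ) / 2 - 1 / 20)) ≤ Real.exp (-((d : ℝ) / 2 - 1 / 20)) := by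
        refine Real.exp_le_exp.2 ?_
        have : (d : ℝ) ≤ k := by exact_mod_cast hdk
        linarith
      calc _ ≤ Real.exp (-((d : ℝ) / 2 - 1 / 20)) * (K * Real.exp (-r * n) * β)
            + N * (Real.exp (-r * n) * (β * W)) + S * (Real.exp (-r * n) * (β * W)) := by gcongr
        _ = (Real.exp (-((d : ℝ) / 2 - 1 / 20)) * (K * Real.exp (-r * n))
            + (N + S) * W * Real.exp (-r * n)) * β := by ring
        _ ≤ K * Real.exp (-r * (n + 1)) * β := mul_le_mul_of_nonneg_right (hK n) hβ
  -- After the whole units of time, one incomplete step costs the constant `16392`, and rounding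
  -- down the time costs `e^r`.
  set n := ⌊τ - σ⌋₊
  have hn1 : (n : ℝ) ≤ τ - σ := Nat.floor_le (sub_nonneg.2 hst)
  have hn2 : τ - σ < n + 1 := Nat.lt_floor_add_one _
  have ha : σ + n ∈ Icc σ τ := ⟨by linarith [Nat.cast_nonneg (α := ℝ) n], by linarith⟩
  have h1 := hstep _ ha τ (right_mem_Icc.2 hst) (by linarith) (by linarith)
  have hp : 0 ≤ S * (Real.exp (-r * (σ + n - σ)) * (β * W)) := by positivity
  have hp' : 0 ≤ K * Real.exp (-r * n) * β := by positivity
  have ht' : 0 ≤ τ - (σ + n) := sub_nonneg.2 ha.2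
  have h2 := hw.heat_le ht' hp' (absLp_dominated (hind n ha.2))
  have h3 := dominated_trans_add hw.self hp h1 h2
  refine dominated_smul_mono hw.zero_mem ?_ h3
  rw [show σ + (n : ℝ) - σ = n by ring, hdecay]
  have h4 : Real.exp (-r * n) ≤ Real.exp r * Real.exp (-r * (τ - σ)) := by
    rw [← Real.exp_add]
    refine Real.exp_le_exp.2 ?_
    nlinarith
  calc _ = (16392 * K + S * W) * β * Real.exp (-r * n) := by ring
    _ ≤ (16392 * K + S * W) * β * (Real.exp r * Real.exp (-r * (τ - σ))) := by gcongr
    _ = _ := by ring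

/-! ### Fourier modes in the angle -/

/-- The measure `dθ` on the fundamental domain of the circle. -/
def circMeasure : Measure ℝ := (volume : Measure ℝ).restrict (Ioc 0 (2 * Real.pi))

instance : IsFiniteMeasure circMeasure := by
  unfold circMeasure
  infer_instance

theorem cylMeasure_eq : cylMeasure = (volume : Measure E).prod circMeasure := rfl

/-- The normalized Fourier modes. -/
def em (n : ℤ) (θ : ℝ) : ℂ := (((Real.sqrt (2 * Real.pi))⁻¹ : ℝ) : ℂ) * Complex.exp (Complex.I * n * θ)

theorem sqrt_two_pi_pos : 0 < Real.sqrt (2 * Real.pi) := Real.sqrt_pos.2 (by have := Real.pi_pos; positivity)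

theorem contDiff_em (n : ℤ) : ContDiff ℝ ∞ (em n) := by
  have : ContDiff ℝ ∞ fun θ : ℝ => (θ : ℂ) := Complex.ofRealCLM.contDiff
  unfold em
  fun_prop

theorem continuous_em (n : ℤ) : Continuous (em n) := (contDiff_em n).continuous

theorem norm_em (n : ℤ) (θ : ℝ) : ‖em n θ‖ = (Real.sqrt (2 * Real.pi))⁻¹ := by
  have : Complex.I * n * θ = ((n * θ : ℝ) : ℂ) * Complex.I := by push_cast; ring
  rw [em, this, norm_mul, Complex.norm_exp_ofReal_mul_I, mul_one, Complex.norm_real, Real.norm_eq_abs,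
    abs_of_pos (inv_pos.2 sqrt_two_pi_pos)]

theorem conj_em (n : ℤ) (θ : ℝ) : (starRingEnd ℂ) (em n θ) = em (-n) θ := by
  rw [em, em, map_mul, Complex.conj_ofReal, ← Complex.exp_conj]
  simp

theorem em_mul_em (m n : ℤ) (θ : ℝ) : em m θ * em n θ
    = (((2 * Real.pi)⁻¹ : ℝ) : ℂ) * Complex.exp (Complex.I * ((m + n : ℤ) : ℂ) * θ) := by
  have h : (((Real.sqrt (2 * Real.pi))⁻¹ : ℝ) : ℂ) * (((Real.sqrt (2 * Real.pi))⁻¹ : ℝ) : ℂ)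
      = (((2 * Real.pi)⁻¹ : ℝ) : ℂ) := by
    rw [← Complex.ofReal_mul, ← mul_inv, Real.mul_self_sqrt (by have := Real.pi_pos; positivity)]
  rw [em, em, mul_mul_mul_comm, h, ← Complex.exp_add]
  congr 2
  push_cast
  ring

theorem integral_circ (f : ℝ → ℂ) : ∫ θ, f θ ∂circMeasure = ∫ θ in (0 : ℝ)..(2 * Real.pi), f θ := by
  rw [intervalIntegral.integral_of_le (by have := Real.pi_pos; positivity), circMeasure]

theorem integral_exp_circ (n : ℤ) :
    ∫ θ, Complex.exp (Complex.I * n * (θ : ℝ)) ∂circMeasure = if n = 0 then ((2 * Real.pi : ℝ) : ℂ) else 0 := by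
  rw [integral_circ]
  split_ifs with h
  · subst h
    simp
  · have hc : Complex.I * n ≠ 0 := mul_ne_zero Complex.I_ne_zero (by exact_mod_cast h)
    rw [integral_exp_mul_complex hc]
    have : Complex.I * n * ((2 * Real.pi : ℝ) : ℂ) = n * (2 * Real.pi * Complex.I) := by
      push_cast; ring
    rw [this, Complex.exp_int_mul_two_pi_mul_I]
    simp

theorem integral_em_mul_em (m n : ℤ) :
    ∫ θ, em m θ * em n θ ∂circMeasure = if m + n = 0 then 1 else 0 := by
  simp only [em_mul_em]
  rw [integral_const_mul, integral_exp_circ]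
  split_ifs
  · rw [← Complex.ofReal_mul, inv_mul_cancel₀ (by have := Real.pi_pos; positivity)]
    simp
  · simp

theorem memLp_lift (n : ℤ) (f : HE) : MemLp (fun x : Cyl => f x.1 * em n x.2) 2 cylMeasure := by
  refine ((Lp.memLp f).comp_fst circMeasure).of_le_mul (c := (Real.sqrt (2 * Real.pi))⁻¹) ?_ ?_
  · exact (Lp.aestronglyMeasurable f).comp_fst.mul
      ((continuous_em n).comp continuous_snd).aestronglyMeasurable
  · refine Eventually.of_forall fun x => ?_
    rw [norm_mul, norm_em, mul_comm]

theorem inner_liftFun (m n : ℤ) (f g : HE) :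
    inner ℂ ((memLp_lift m f).toLp _) ((memLp_lift n g).toLp _) = if m = n then inner ℂ f g else 0 := by
  rw [L2.inner_def]
  have h : ∫ x, inner ℂ ((memLp_lift m f).toLp _ x) ((memLp_lift n g).toLp _ x) ∂cylMeasure
      = ∫ x : Cyl, (inner ℂ (f x.1) (g x.1) : ℂ) * (em (-m) x.2 * em n x.2)
        ∂((volume : Measure E).prod circMeasure) := by
    refine integral_congr_ae ?_
    filter_upwards [(memLp_lift m f).coeFn_toLp, (memLp_lift n g).coeFn_toLp] with x h1 h2
    rw [h1, h2]
    simp only [RCLike.inner_apply, map_mul, conj_em]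
    ring
  rw [h, integral_prod_mul (fun y => (inner ℂ (f y) (g y) : ℂ)) (fun θ => em (-m) θ * em n θ),
    integral_em_mul_em, L2.inner_def]
  simp only [neg_add_eq_zero]
  split_ifs <;> simp

/-- `f ↦ f ⊗ e^{inθ} / √(2π)`. -/
def lift (n : ℤ) : HE →ₗᵢ[ℂ] HC where
  toFun f := (memLp_lift n f).toLp _
  map_add' f g := by
    refine Lp.ext ?_
    filter_upwards [(memLp_lift n (f + g)).coeFn_toLp, (memLp_lift n f).coeFn_toLp,
      (memLp_lift n g).coeFn_toLp, Lp.coeFn_add ((memLp_lift n f).toLp _) ((memLp_lift n g).toLp _),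
      Measure.quasiMeasurePreserving_fst.ae (Lp.coeFn_add f g)] with x h1 h2 h3 h4 h5
    rw [h1, h4, Pi.add_apply, h2, h3, h5, Pi.add_apply, add_mul]
  map_smul' c f := by
    refine Lp.ext ?_
    filter_upwards [(memLp_lift n (c • f)).coeFn_toLp, (memLp_lift n f).coeFn_toLp,
      Lp.coeFn_smul c ((memLp_lift n f).toLp _),
      Measure.quasiMeasurePreserving_fst.ae (Lp.coeFn_smul c f)] with x h1 h2 h4 h5
    rw [h1, RingHom.id_apply, h4, Pi.smul_apply, h2, h5, Pi.smul_apply, smul_mul_assoc]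
  norm_map' f := by
    have h := inner_liftFun n n f f
    rw [if_pos rfl, inner_self_eq_norm_sq_to_K, inner_self_eq_norm_sq_to_K] at h
    have h' : ‖(memLp_lift n f).toLp _‖ ^ 2 = ‖f‖ ^ 2 := by exact_mod_cast h
    exact (pow_left_inj₀ (norm_nonneg _) (norm_nonneg _) two_ne_zero).1 h'

theorem lift_ae (n : ℤ) (f : HE) : lift n f =ᵐ[cylMeasure] fun x => f x.1 * em n x.2 :=
  (memLp_lift n f).coeFn_toLp

theorem inner_lift (m n : ℤ) (f g : HE) :
    inner ℂ (lift m f) (lift n g) = if m = n then inner ℂ f g else 0 := inner_liftFun m n f g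

/-- The Fourier coefficients in the angle. -/
def coef (n : ℤ) : HC →L[ℂ] HE := ContinuousLinearMap.adjoint (lift n).toContinuousLinearMap

theorem inner_coef (n : ℤ) (f : HE) (g : HC) : inner ℂ f (coef n g) = inner ℂ (lift n f) g := by
  rw [coef, ContinuousLinearMap.adjoint_inner_right]; rfl

theorem inner_lift_eq (n : ℤ) (f : HE) (g : HC) : inner ℂ (lift n f) g
    = ∫ y, (starRingEnd ℂ) (f y) * ∫ θ, em (-n) θ * g (y, θ) ∂circMeasure := by
  have hint : Integrable (fun x : Cyl => (starRingEnd ℂ) (f x.1 * em n x.2) * g x)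
      ((volume : Measure E).prod circMeasure) :=
    (memLp_lift n f).star.integrable_mul (Lp.memLp g)
  rw [L2.inner_def]
  have h : ∫ x, inner ℂ (lift n f x) (g x) ∂cylMeasure
      = ∫ x : Cyl, (starRingEnd ℂ) (f x.1 * em n x.2) * g x ∂((volume : Measure E).prod circMeasure) := by
    refine integral_congr_ae ?_
    filter_upwards [lift_ae n f] with x h1
    rw [h1, RCLike.inner_apply, mul_comm]
  rw [h, integral_prod _ hint]
  refine integral_congr_ae (Eventually.of_forall fun y => ?_)
  simp only [map_mul, conj_em, mul_assoc]
  rw [integral_const_mul]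

/-- Cauchy–Schwarz on the circle, `em (-n)` being a unit vector there. -/
theorem norm_integral_mul_sq_le {g : ℝ → ℂ} (hg : MemLp g 2 circMeasure) (n : ℤ) :
    ‖∫ θ, em n θ * g θ ∂circMeasure‖ ^ 2 ≤ ∫ θ, ‖g θ‖ ^ 2 ∂circMeasure := by
  have he : MemLp (em (-n)) 2 circMeasure :=
    MemLp.of_bound (continuous_em _).aestronglyMeasurable _ (Eventually.of_forall fun θ => (norm_em _ θ).le)
  have h1 : ∫ θ, em n θ * g θ ∂circMeasure = inner ℂ (he.toLp _) (hg.toLp _) := by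
    rw [L2.inner_def]
    refine integral_congr_ae ?_
    filter_upwards [he.coeFn_toLp, hg.coeFn_toLp] with θ h1 h2
    rw [h1, h2, RCLike.inner_apply, conj_em, neg_neg, mul_comm]
  have h2 : inner ℂ (he.toLp _) (he.toLp _) = (1 : ℂ) := by
    rw [L2.inner_def, ← (show ∫ θ, em n θ * em (-n) θ ∂circMeasure = 1 by
      rw [integral_em_mul_em, if_pos (by ring)])]
    refine integral_congr_ae ?_
    filter_upwards [he.coeFn_toLp] with θ h1
    rw [h1, RCLike.inner_apply, conj_em, neg_neg, mul_comm]
  have h3 : ‖he.toLp _‖ ^ 2 = 1 := by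
    rw [← inner_self_eq_norm_sq (𝕜 := ℂ), h2]
    simp
  have h4 : ‖hg.toLp _‖ ^ 2 = ∫ θ, ‖g θ‖ ^ 2 ∂circMeasure := by
    have h5 : inner ℂ (hg.toLp _) (hg.toLp _) = ((∫ θ, ‖g θ‖ ^ 2 ∂circMeasure : ℝ) : ℂ) := by
      rw [L2.inner_def, ← integral_complex_ofReal]
      refine integral_congr_ae ?_
      filter_upwards [hg.coeFn_toLp] with θ h1
      rw [h1, inner_self_eq_norm_sq_to_K]
      push_cast
      rfl
    rw [← inner_self_eq_norm_sq (𝕜 := ℂ), h5]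
    simp
  rw [h1, ← h4]
  have h5 := norm_inner_le_norm (𝕜 := ℂ) (he.toLp _) (hg.toLp _)
  calc _ ≤ (‖he.toLp _‖ * ‖hg.toLp _‖) ^ 2 := pow_le_pow_left₀ (norm_nonneg _) h5 2
    _ = _ := by rw [mul_pow, h3, one_mul]

theorem integrable_normSq (g : HC) :
    Integrable (fun x : Cyl => ‖g x‖ ^ 2) ((volume : Measure E).prod circMeasure) :=
  (Lp.memLp g).integrable_norm_pow (p := 2) two_ne_zero

theorem ae_memLp_slice (g : HC) : ∀ᵐ y : E, MemLp (fun θ => g (y, θ)) 2 circMeasure := by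
  have h1 := (integrable_normSq g).prod_right_ae
  have h2 : ∀ᵐ y : E, AEStronglyMeasurable (fun θ => g (y, θ)) circMeasure :=
    (Lp.aestronglyMeasurable g).prodMk_left
  filter_upwards [h1, h2] with y k1 k2
  exact (memLp_two_iff_integrable_sq_norm k2).2 k1

theorem aestronglyMeasurable_coef (n : ℤ) (g : HC) :
    AEStronglyMeasurable (fun y : E => ∫ θ, em n θ * g (y, θ) ∂circMeasure) volume := by
  have : AEStronglyMeasurable (fun x : Cyl => em n x.2 * g x) ((volume : Measure E).prod circMeasure) :=
    ((continuous_em n).comp continuous_snd).aestronglyMeasurable.mul (Lp.aestronglyMeasurable g)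
  exact this.integral_prod_right'

theorem memLp_coef (n : ℤ) (g : HC) :
    MemLp (fun y : E => ∫ θ, em n θ * g (y, θ) ∂circMeasure) 2 volume := by
  rw [memLp_two_iff_integrable_sq_norm (aestronglyMeasurable_coef n g)]
  refine (integrable_normSq g).integral_prod_left.mono
    ((aestronglyMeasurable_coef n g).norm.pow 2) ?_
  filter_upwards [ae_memLp_slice g] with y hy
  rw [Real.norm_eq_abs, abs_of_nonneg (by positivity), Real.norm_eq_abs,
    abs_of_nonneg (integral_nonneg fun θ => by positivity)]
  exact norm_integral_mul_sq_le hy n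

theorem coef_ae (n : ℤ) (g : HC) :
    coef n g =ᵐ[volume] fun y => ∫ θ, em (-n) θ * g (y, θ) ∂circMeasure := by
  have : coef n g = (memLp_coef (-n) g).toLp _ := by
    refine ext_inner_left ℂ fun f => ?_
    rw [inner_coef, inner_lift_eq, L2.inner_def]
    refine integral_congr_ae ?_
    filter_upwards [(memLp_coef (-n) g).coeFn_toLp] with y hy
    rw [hy, RCLike.inner_apply, mul_comm]
  rw [this]
  exact MemLp.coeFn_toLp _

theorem fourier_eq_em (n : ℤ) (θ : ℝ) :
    (fourier n (θ : AddCircle (2 * Real.pi - 0)) : ℂ) = ((Real.sqrt (2 * Real.pi) : ℝ) : ℂ) * em n θ := by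
  have h0 : ((Real.sqrt (2 * Real.pi) : ℝ) : ℂ) * (((Real.sqrt (2 * Real.pi))⁻¹ : ℝ) : ℂ) = 1 := by
    rw [← Complex.ofReal_mul, mul_inv_cancel₀ sqrt_two_pi_pos.ne']; simp
  rw [fourier_coe_apply, em, ← mul_assoc, h0, one_mul]
  congr 1
  have : (Real.pi : ℂ) ≠ 0 := by exact_mod_cast Real.pi_ne_zero
  push_cast
  field_simp
  ring

theorem ae_eq_zero_of_fourier {g : ℝ → ℂ} (hg : MemLp g 2 circMeasure)
    (h : ∀ n : ℤ, ∫ θ, em n θ * g θ ∂circMeasure = 0) : g =ᵐ[circMeasure] 0 := by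
  have hp : (0 : ℝ) < 2 * Real.pi := by have := Real.pi_pos; positivity
  have hs := hasSum_sq_fourierCoeffOn hp hg
  have hc : ∀ n, fourierCoeffOn hp g n = 0 := by
    intro n
    rw [fourierCoeffOn_eq_integral]
    have : ∫ θ in (0 : ℝ)..(2 * Real.pi), fourier (-n) (θ : AddCircle (2 * Real.pi - 0)) • g θ
        = ((Real.sqrt (2 * Real.pi) : ℝ) : ℂ) * ∫ θ, em (-n) θ * g θ ∂circMeasure := by
      rw [integral_circ, ← intervalIntegral.integral_const_mul]
      refine intervalIntegral.integral_congr fun θ _ => ?_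
      simp only [fourier_eq_em, smul_eq_mul, mul_assoc]
    rw [this, h, mul_zero, smul_zero]
  simp only [hc, norm_zero, ne_eq, OfNat.ofNat_ne_zero, not_false_eq_true, zero_pow] at hs
  have h0 := hs.unique hasSum_zero
  rw [smul_eq_mul, mul_eq_zero, or_iff_right (by simp),
    intervalIntegral.integral_of_le hp.le] at h0
  have hi : Integrable (fun θ => ‖g θ‖ ^ 2) circMeasure := hg.integrable_norm_pow (p := 2) two_ne_zero
  have := (integral_eq_zero_iff_of_nonneg (fun θ => by positivity) hi).1 h0
  filter_upwards [this] with θ hθ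
  simpa using hθ

/-- By Fubini almost every slice in `θ` has vanishing Fourier coefficients, hence vanishes. -/
theorem eq_zero_of_coef {g : HC} (h : ∀ n, coef n g = 0) : g = 0 := by
  rw [Lp.eq_zero_iff_ae_eq_zero]
  have h1 : ∀ᵐ y : E, ∀ n : ℤ, ∫ θ, em n θ * g (y, θ) ∂circMeasure = 0 := by
    refine ae_all_iff.2 fun n => ?_
    filter_upwards [coef_ae (-n) g, Lp.coeFn_zero ℂ 2 (volume : Measure E)] with y k1 k2
    rw [h, k2, neg_neg] at k1
    exact k1.symm
  have h2 : ∀ᵐ y : E, ∀ᵐ θ ∂circMeasure, g (y, θ) = 0 := by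
    filter_upwards [h1, ae_memLp_slice g] with y k1 k2
    exact ae_eq_zero_of_fourier k2 k1
  have hm : AEStronglyMeasurable g cylMeasure := Lp.aestronglyMeasurable g
  -- Passing from slices back to the product measure needs a measurable zero set, so a strongly
  -- measurable representative replaces `g`.
  have h3 : ∀ᵐ y : E, ∀ᵐ θ ∂circMeasure, hm.mk g (y, θ) = 0 := by
    filter_upwards [h2, Measure.ae_ae_of_ae_prod hm.ae_eq_mk] with y k1 k2
    filter_upwards [k1, k2] with θ j1 j2
    rw [← j2, j1]
  have h4 : ∀ᵐ x ∂cylMeasure, hm.mk g x = 0 := by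
    refine (Measure.ae_prod_iff_ae_ae ?_).2 h3
    exact hm.stronglyMeasurable_mk.measurable (measurableSet_singleton 0)
  filter_upwards [h4, hm.ae_eq_mk] with x k1 k2
  rw [k2, k1]
  rfl

/-! ### The product basis on the cylinder -/

/-- The functions `h_α ⊗ e^{inθ}`. -/
def cylVec (p : ℤ × (Fin 3 → ℕ)) : HC := lift p.1 (hermBasis p.2)

theorem orthonormal_cylVec : Orthonormal ℂ cylVec := by
  rw [orthonormal_iff_ite]
  rintro ⟨m, α⟩ ⟨n, β⟩
  simp only [cylVec]
  rw [inner_lift, orthonormal_iff_ite.1 hermBasis.orthonormal]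
  by_cases h1 : m = n <;> by_cases h2 : α = β <;> simp [h1, h2]

/-- The basis of `L²(ℝ³ × 𝕋)` of Hermite functions times Fourier modes. -/
def cylBasis : HilbertBasis (ℤ × (Fin 3 → ℕ)) ℂ HC :=
  HilbertBasis.mkOfOrthogonalEqBot orthonormal_cylVec (by
    rw [Submodule.eq_bot_iff]
    intro g hg
    refine eq_zero_of_coef fun n => hilbert_ext hermBasis fun α => ?_
    rw [inner_coef, inner_zero_right]
    exact (Submodule.mem_orthogonal _ g).1 hg (cylVec (n, α)) (Submodule.subset_span ⟨(n, α), rfl⟩))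

theorem cylBasis_apply (p : ℤ × (Fin 3 → ℕ)) : cylBasis p = lift p.1 (hermBasis p.2) := by
  simp [cylBasis, cylVec]

theorem inner_hermBasis_coef (n : ℤ) (α : Fin 3 → ℕ) (g : HC) :
    inner ℂ (hermBasis α) (coef n g) = inner ℂ (cylBasis (n, α)) g := by
  rw [inner_coef, cylBasis_apply]

/-- The eigenvalue of `-Δ + |y|²/16 - 3/4 - ½ ∂_θ²`. -/
def cylRate (p : ℤ × (Fin 3 → ℕ)) : ℝ := rate p.2 + (p.1 : ℝ) ^ 2 / 2

theorem cylRate_nonneg (p : ℤ × (Fin 3 → ℕ)) : 0 ≤ cylRate p :=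
  add_nonneg (rate_nonneg _) (by positivity)

theorem cylVec_ae (p : ℤ × (Fin 3 → ℕ)) :
    cylBasis p =ᵐ[cylMeasure] fun x => (hermN p.2 x.1 : ℂ) * em p.1 x.2 := by
  rw [cylBasis_apply, hermBasis_apply]
  filter_upwards [lift_ae p.1 (hermVec p.2),
    Measure.quasiMeasurePreserving_fst.ae (hermVec_ae p.2)] with x h1 h2
  rw [h1, h2]

/-- Group the expansion in the product basis by the Fourier index; the inner sums are the Hermite
expansions of the coefficients. -/
theorem hasSum_lift_coef (g : HC) : HasSum (fun n : ℤ => lift n (coef n g)) g := by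
  have h := cylBasis.hasSum_repr g
  refine h.prod_fiberwise fun n => ?_
  have h2 := (hermBasis.hasSum_repr (coef n g)).mapL (lift n).toContinuousLinearMap
  refine h2.congr_fun ?_
  intro α
  simp only [map_smul, HilbertBasis.repr_apply_apply, inner_hermBasis_coef]
  rw [cylBasis_apply]
  rfl

/-! ### Test functions on the cylinder -/

/-- Slices of a test function are compositions with affine maps whose linear parts have norm at most
`1`, so they inherit all derivative bounds. -/
theorem iteratedFDeriv_comp_affine {F G : Type*} [NormedAddCommGroup F] [NormedSpace ℝ F]
    [NormedAddCommGroup G] [NormedSpace ℝ G] {ψ : G → ℂ} (hψ : ContDiff ℝ ∞ ψ) (L : F →L[ℝ] G) (a : G)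
    (n : ℕ) (z : F) : iteratedFDeriv ℝ n (fun z => ψ (L z + a)) z
      = (iteratedFDeriv ℝ n ψ (L z + a)).compContinuousLinearMap fun _ => L := by
  have h1 : ContDiff ℝ ∞ fun x => ψ (x + a) := hψ.comp (contDiff_id.add contDiff_const)
  have h2 := L.iteratedFDeriv_comp_right h1 z (i := n) (by exact_mod_cast le_top)
  rw [iteratedFDeriv_comp_add_right] at h2
  exact h2

theorem norm_iteratedFDeriv_comp_affine_le {F G : Type*} [NormedAddCommGroup F] [NormedSpace ℝ F]
    [NormedAddCommGroup G] [NormedSpace ℝ G] {ψ : G → ℂ} (hψ : ContDiff ℝ ∞ ψ) {L : F →L[ℝ] G}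
    (hL : ‖L‖ ≤ 1) (a : G) (n : ℕ) (z : F) :
    ‖iteratedFDeriv ℝ n (fun z => ψ (L z + a)) z‖ ≤ ‖iteratedFDeriv ℝ n ψ (L z + a)‖ := by
  rw [iteratedFDeriv_comp_affine hψ]
  refine (ContinuousMultilinearMap.norm_compContinuousLinearMap_le _ _).trans ?_
  refine mul_le_of_le_one_right (norm_nonneg _) ?_
  exact Finset.prod_le_one (fun _ _ => norm_nonneg _) fun _ _ => hL

theorem deriv_em (n : ℤ) (θ : ℝ) : HasDerivAt (em n) (Complex.I * n * em n θ) θ := by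
  have h := (((Complex.ofRealCLM.hasDerivAt (x := θ)).const_mul (Complex.I * n)).cexp).const_mul
    (((Real.sqrt (2 * Real.pi))⁻¹ : ℝ) : ℂ)
  refine h.congr_deriv ?_
  simp only [em, Complex.ofRealCLM_apply, Complex.ofReal_one]
  ring

theorem iteratedDeriv_em (n : ℤ) (j : ℕ) (c : ℂ) :
    iteratedDeriv j (fun θ => c * em n θ) = fun θ => (Complex.I * n) ^ j * (c * em n θ) := by
  induction j with
  | zero => simp
  | succ j ih =>
    rw [iteratedDeriv_succ, ih]
    funext θ
    have := ((deriv_em n θ).const_mul c).const_mul ((Complex.I * n) ^ j)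
    rw [this.deriv]
    ring

theorem em_periodic (n : ℤ) (θ : ℝ) : em n (θ + 2 * Real.pi) = em n θ := by
  rw [em, em]
  congr 1
  have : Complex.I * n * ((θ + 2 * Real.pi : ℝ) : ℂ)
      = Complex.I * n * θ + n * (2 * Real.pi * Complex.I) := by push_cast; ring
  rw [this, Complex.exp_add, Complex.exp_int_mul_two_pi_mul_I, mul_one]

theorem isCylTest_mul (φ : 𝓢(E, ℂ)) (n : ℤ) : IsCylTest fun x => φ x.1 * em n x.2 := by
  have h1 : ContDiff ℝ ∞ fun x : Cyl => φ x.1 := (φ.smooth ⊤).comp contDiff_fst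
  have h2 : ContDiff ℝ ∞ fun x : Cyl => em n x.2 := (contDiff_em n).comp contDiff_snd
  refine ⟨h1.mul h2, fun y θ => by rw [em_periodic], fun k m => ?_⟩
  choose C hC using fun i : ℕ => φ.decay' k i
  refine ⟨∑ i ∈ Finset.range (m + 1), (m.choose i : ℝ) * C i *
    (‖Complex.I * n‖ ^ (m - i) * (Real.sqrt (2 * Real.pi))⁻¹), fun x => ?_⟩
  have h3 := norm_iteratedFDeriv_mul_le (h1.of_le (m := m) (by exact_mod_cast le_top))
    (h2.of_le (m := m) (by exact_mod_cast le_top)) x (n := m) le_rfl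
  refine (mul_le_mul_of_nonneg_left h3 (by positivity)).trans ?_
  rw [Finset.mul_sum]
  refine Finset.sum_le_sum fun i _ => ?_
  have h4 : ‖iteratedFDeriv ℝ i (fun x : Cyl => φ x.1) x‖ ≤ ‖iteratedFDeriv ℝ i φ x.1‖ := by
    have := norm_iteratedFDeriv_comp_affine_le (φ.smooth ⊤)
      (ContinuousLinearMap.norm_fst_le ℝ E ℝ) 0 i x
    simpa using this
  have h5 : ‖iteratedFDeriv ℝ (m - i) (fun x : Cyl => em n x.2) x‖
      ≤ ‖Complex.I * n‖ ^ (m - i) * (Real.sqrt (2 * Real.pi))⁻¹ := by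
    have := norm_iteratedFDeriv_comp_affine_le (contDiff_em n)
      (ContinuousLinearMap.norm_snd_le ℝ E ℝ) 0 (m - i) x
    have e := iteratedDeriv_em n (m - i) 1
    simp only [one_mul] at e
    simp only [add_zero, ContinuousLinearMap.coe_snd'] at this
    refine this.trans ?_
    rw [norm_iteratedFDeriv_eq_norm_iteratedDeriv, e, norm_mul, norm_pow, norm_em]
  calc _ = (m.choose i : ℝ) * (‖x.1‖ ^ k * ‖iteratedFDeriv ℝ i (fun x : Cyl => φ x.1) x‖)
        * ‖iteratedFDeriv ℝ (m - i) (fun x : Cyl => em n x.2) x‖ := by ring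
    _ ≤ (m.choose i : ℝ) * C i * (‖Complex.I * n‖ ^ (m - i) * (Real.sqrt (2 * Real.pi))⁻¹) := by
      refine mul_le_mul (mul_le_mul_of_nonneg_left ?_ (by positivity)) h5 (norm_nonneg _) ?_
      · exact (mul_le_mul_of_nonneg_left h4 (by positivity)).trans (hC i x.1)
      · exact mul_nonneg (by positivity) ((by positivity : (0 : ℝ) ≤ _).trans (hC i x.1))

theorem slice_eq (ψ : Cyl → ℂ) (θ : ℝ) : (fun z : E => ψ (z, θ))
    = fun z => ψ (ContinuousLinearMap.inl ℝ E ℝ z + ((0 : E), θ)) := by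
  funext z; simp

theorem slice_eq' (ψ : Cyl → ℂ) (y : E) : (fun θ : ℝ => ψ (y, θ))
    = fun θ => ψ (ContinuousLinearMap.inr ℝ E ℝ θ + (y, (0 : ℝ))) := by
  funext z; simp

/-- A slice of a test function. -/
def slice {ψ : Cyl → ℂ} (hψ : IsCylTest ψ) (θ : ℝ) : 𝓢(E, ℂ) where
  toFun z := ψ (z, θ)
  smooth' := hψ.smooth.comp (contDiff_id.prodMk contDiff_const)
  decay' k n := by
    obtain ⟨C, hC⟩ := hψ.decay k n
    refine ⟨C, fun z => ?_⟩
    rw [slice_eq]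
    have := norm_iteratedFDeriv_comp_affine_le hψ.smooth
      (ContinuousLinearMap.norm_inl_le_one ℝ E ℝ) ((0 : E), θ) n z
    refine (mul_le_mul_of_nonneg_left this (by positivity)).trans ?_
    simpa using hC (z, θ)

theorem slice_apply {ψ : Cyl → ℂ} (hψ : IsCylTest ψ) (θ : ℝ) (z : E) : slice hψ θ z = ψ (z, θ) := rfl

theorem laplacian_slice {ψ : Cyl → ℂ} (hψ : IsCylTest ψ) (x : Cyl) :
    Laplacian.laplacian (fun z : E => ψ (z, x.2)) x.1
      = ∑ i, iteratedFDeriv ℝ 2 ψ x fun _ => ((EuclideanSpace.single i (1 : ℝ) : E), (0 : ℝ)) := by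
  rw [InnerProductSpace.laplacian_eq_iteratedFDeriv_orthonormalBasis _
    (EuclideanSpace.basisFun (Fin 3) ℝ)]
  refine Finset.sum_congr rfl fun i _ => ?_
  rw [slice_eq, iteratedFDeriv_comp_affine hψ.smooth]
  simp only [ContinuousMultilinearMap.compContinuousLinearMap_apply, ContinuousLinearMap.inl_apply,
    Prod.mk_add_mk, add_zero, zero_add]
  congr 1
  funext j
  fin_cases j <;> simp

theorem iteratedDeriv_slice {ψ : Cyl → ℂ} (hψ : IsCylTest ψ) (x : Cyl) :
    iteratedDeriv 2 (fun θ : ℝ => ψ (x.1, θ)) x.2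
      = iteratedFDeriv ℝ 2 ψ x fun _ => ((0 : E), (1 : ℝ)) := by
  rw [iteratedDeriv_eq_iteratedFDeriv, slice_eq', iteratedFDeriv_comp_affine hψ.smooth]
  simp only [ContinuousMultilinearMap.compContinuousLinearMap_apply, ContinuousLinearMap.inr_apply,
    Prod.mk_add_mk, add_zero, zero_add]

theorem exists_bound_second {ψ : Cyl → ℂ} (hψ : IsCylTest ψ) (m : Fin 2 → Cyl) :
    Continuous (fun x => iteratedFDeriv ℝ 2 ψ x m) ∧ ∃ C, ∀ x, ‖iteratedFDeriv ℝ 2 ψ x m‖ ≤ C := by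
  obtain ⟨C, hC⟩ := hψ.decay 0 2
  refine ⟨?_, C * ∏ i, ‖m i‖, fun x => ?_⟩
  · have := hψ.smooth.continuous_iteratedFDeriv (m := 2) (by norm_cast)
    fun_prop
  · refine (ContinuousMultilinearMap.le_opNorm _ _).trans ?_
    refine mul_le_mul_of_nonneg_right ?_ (by positivity)
    simpa using hC x

theorem exists_bound_laplacian {ψ : Cyl → ℂ} (hψ : IsCylTest ψ) :
    Continuous (fun x : Cyl => Laplacian.laplacian (fun z : E => ψ (z, x.2)) x.1) ∧
      ∃ C, ∀ x : Cyl, ‖Laplacian.laplacian (fun z : E => ψ (z, x.2)) x.1‖ ≤ C := by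
  simp only [laplacian_slice hψ]
  refine ⟨continuous_finsetSum _ fun i _ => (exists_bound_second hψ _).1, ?_⟩
  choose C hC using fun i : Fin 3 =>
    (exists_bound_second hψ fun _ => ((EuclideanSpace.single i (1 : ℝ) : E), (0 : ℝ))).2
  exact ⟨∑ i, C i, fun x => (norm_sum_le _ _).trans (Finset.sum_le_sum fun i _ => hC i x)⟩

theorem exists_bound_iteratedDeriv {ψ : Cyl → ℂ} (hψ : IsCylTest ψ) :
    Continuous (fun x : Cyl => iteratedDeriv 2 (fun θ : ℝ => ψ (x.1, θ)) x.2) ∧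
      ∃ C, ∀ x : Cyl, ‖iteratedDeriv 2 (fun θ : ℝ => ψ (x.1, θ)) x.2‖ ≤ C := by
  simp only [iteratedDeriv_slice hψ]
  exact exists_bound_second hψ _

theorem integrable_mode_mul (h : 𝓢(E, ℂ)) (n : ℤ) {F : Cyl → ℂ} (hF : Continuous F) {C : ℝ}
    (hC : ∀ x, ‖F x‖ ≤ C) :
    Integrable (fun x : Cyl => h x.1 * em n x.2 * F x) ((volume : Measure E).prod circMeasure) := by
  have he : Integrable (em n) circMeasure :=
    Integrable.of_bound (continuous_em n).aestronglyMeasurable _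
      (Eventually.of_forall fun θ => (norm_em n θ).le)
  have h1 := (h.integrable (μ := volume)).mul_prod he
  exact h1.mul_bdd hF.aestronglyMeasurable (Eventually.of_forall hC)

/-- Fubini with the angle outside: each slice is a Schwartz function, for which the Laplacian is
symmetric. -/
theorem integral_mode_mul_laplacian (h : 𝓢(E, ℂ)) (n : ℤ) {ψ : Cyl → ℂ} (hψ : IsCylTest ψ) :
    ∫ x, h x.1 * em n x.2 * Laplacian.laplacian (fun z : E => ψ (z, x.2)) x.1 ∂cylMeasure
      = ∫ x, (Laplacian.laplacian h) x.1 * em n x.2 * ψ x ∂cylMeasure := by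
  obtain ⟨C, hC⟩ := (exists_bound_laplacian hψ).2
  obtain ⟨C', hC'⟩ := hψ.decay 0 0
  have h1 := integrable_mode_mul h n (exists_bound_laplacian hψ).1 hC
  have h2 := integrable_mode_mul (Laplacian.laplacian h) n hψ.smooth.continuous (C := C')
    fun x => by simpa using hC' x
  rw [cylMeasure_eq, integral_prod_symm _ h1, integral_prod_symm _ h2]
  refine integral_congr_ae (Eventually.of_forall fun θ => ?_)
  simp only
  have e1 : ∀ y : E, h y * em n θ * Laplacian.laplacian (fun z : E => ψ (z, θ)) y
      = em n θ * (h y * (Laplacian.laplacian (slice hψ θ)) y) := by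
    intro y
    rw [SchwartzMap.laplacian_apply]
    change h y * em n θ * Laplacian.laplacian (fun z : E => ψ (z, θ)) y
      = em n θ * (h y * Laplacian.laplacian (fun z : E => ψ (z, θ)) y)
    ring
  have e2 : ∀ y : E, (Laplacian.laplacian h) y * em n θ * ψ (y, θ)
      = em n θ * ((Laplacian.laplacian h) y * slice hψ θ y) := by
    intro y
    rw [slice_apply]; ring
  simp only [e1, e2]
  rw [integral_const_mul, integral_const_mul, SchwartzMap.integral_mul_laplacian_right_eq_left]

/-- Two integrations by parts, carried out at once through the primitive `e g' - e' g`; its boundary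
values cancel by periodicity. -/
theorem integral_em_mul_iteratedDeriv (n : ℤ) {g : ℝ → ℂ} (hg : ContDiff ℝ ∞ g)
    (hp : ∀ θ, g (θ + 2 * Real.pi) = g θ) :
    ∫ θ, em n θ * iteratedDeriv 2 g θ ∂circMeasure = -(n : ℂ) ^ 2 * ∫ θ, em n θ * g θ ∂circMeasure := by
  have hd : ∀ θ, HasDerivAt g (deriv g θ) θ := fun θ =>
    (hg.differentiable (by simp) θ).hasDerivAt
  have hd1 : ContDiff ℝ ∞ (deriv g) := ((contDiff_infty_iff_deriv).1 hg).2
  have hd2 : ∀ θ, HasDerivAt (deriv g) (iteratedDeriv 2 g θ) θ := fun θ => by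
    rw [iteratedDeriv_succ, iteratedDeriv_one]
    exact (hd1.differentiable (by simp) θ).hasDerivAt
  have hp' : ∀ θ, deriv g (θ + 2 * Real.pi) = deriv g θ := by
    intro θ
    rw [← deriv_comp_add_const]
    simp only [hp]
  have hderiv : ∀ θ, HasDerivAt (fun θ => em n θ * deriv g θ - Complex.I * n * em n θ * g θ)
      (em n θ * iteratedDeriv 2 g θ + (n : ℂ) ^ 2 * (em n θ * g θ)) θ := by
    intro θ
    have h1 := ((deriv_em n θ).fun_mul (hd2 θ)).fun_sub
      (((deriv_em n θ).const_mul (Complex.I * n)).fun_mul (hd θ))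
    refine h1.congr_deriv ?_
    linear_combination (-(n : ℂ) ^ 2 * em n θ * g θ) * Complex.I_sq
  have hc2 : Continuous (iteratedDeriv 2 g) := hg.continuous_iteratedDeriv 2 (by norm_cast)
  have hc1 : Continuous fun θ => em n θ * iteratedDeriv 2 g θ := (continuous_em n).mul hc2
  have hc0 : Continuous fun θ => (n : ℂ) ^ 2 * (em n θ * g θ) :=
    continuous_const.mul ((continuous_em n).mul hg.continuous)
  have h := intervalIntegral.integral_eq_sub_of_hasDerivAt (a := 0) (b := 2 * Real.pi)
    (fun θ _ => hderiv θ) ((hc1.add hc0).intervalIntegrable _ _)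
  rw [intervalIntegral.integral_add (hc1.intervalIntegrable _ _) (hc0.intervalIntegrable _ _),
    intervalIntegral.integral_const_mul] at h
  have e1 := em_periodic n 0
  have e2 := hp 0
  have e3 := hp' 0
  rw [zero_add] at e1 e2 e3
  rw [e1, e2, e3, sub_self] at h
  rw [integral_circ, integral_circ]
  linear_combination h

theorem integral_mode_mul_iteratedDeriv (h : 𝓢(E, ℂ)) (n : ℤ) {ψ : Cyl → ℂ} (hψ : IsCylTest ψ) :
    ∫ x, h x.1 * em n x.2 * iteratedDeriv 2 (fun θ : ℝ => ψ (x.1, θ)) x.2 ∂cylMeasure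
      = -(n : ℂ) ^ 2 * ∫ x, h x.1 * em n x.2 * ψ x ∂cylMeasure := by
  obtain ⟨C, hC⟩ := (exists_bound_iteratedDeriv hψ).2
  obtain ⟨C', hC'⟩ := hψ.decay 0 0
  have h1 := integrable_mode_mul h n (exists_bound_iteratedDeriv hψ).1 hC
  have h2 := integrable_mode_mul h n hψ.smooth.continuous (C := C') fun x => by simpa using hC' x
  rw [cylMeasure_eq, integral_prod _ h1, integral_prod _ h2, ← integral_const_mul]
  refine integral_congr_ae (Eventually.of_forall fun y => ?_)
  simp only [mul_assoc]
  have hs : ContDiff ℝ ∞ fun θ => ψ (y, θ) := hψ.smooth.comp (contDiff_const.prodMk contDiff_id)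
  rw [integral_const_mul, integral_const_mul,
    integral_em_mul_iteratedDeriv n hs (hψ.periodic y)]
  ring

theorem inner_cylBasis (n : ℤ) (α : Fin 3 → ℕ) (f : HC) : inner ℂ (cylBasis (n, α)) f
    = (((Real.sqrt (hermSq α))⁻¹ : ℝ) : ℂ) * ∫ x, hermSchwartz α x.1 * em (-n) x.2 * f x ∂cylMeasure := by
  rw [L2.inner_def, ← integral_const_mul]
  refine integral_congr_ae ?_
  filter_upwards [cylVec_ae (n, α)] with x hx
  rw [hx, RCLike.inner_apply, map_mul, Complex.conj_ofReal, conj_em, hermSchwartz_apply, hermN]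
  push_cast
  ring

theorem integral_combination {X : Type*} [MeasurableSpace X] {μ : Measure X} {f₁ f₂ f₃ f₄ f₅ : X → ℂ}
    (h₁ : Integrable f₁ μ) (h₂ : Integrable f₂ μ) (h₃ : Integrable f₃ μ) (h₄ : Integrable f₄ μ)
    (h₅ : Integrable f₅ μ) {a b : ℂ} :
    ∫ x, (f₁ x - f₂ x - a * f₃ x + b * f₄ x + f₅ x) ∂μ
      = (∫ x, f₁ x ∂μ) - (∫ x, f₂ x ∂μ) - a * (∫ x, f₃ x ∂μ) + b * (∫ x, f₄ x ∂μ) + ∫ x, f₅ x ∂μ := by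
  rw [integral_add (f := fun x => f₁ x - f₂ x - a * f₃ x + b * f₄ x)
      (((h₁.sub h₂).sub (h₃.const_mul a)).add (h₄.const_mul b)) h₅,
    integral_add (f := fun x => f₁ x - f₂ x - a * f₃ x) ((h₁.sub h₂).sub (h₃.const_mul a))
      (h₄.const_mul b),
    integral_sub (f := fun x => f₁ x - f₂ x) (h₁.sub h₂) (h₃.const_mul a), integral_sub h₁ h₂,
    integral_const_mul, integral_const_mul]

/-- As on `ℝ³`, with the angular derivative contributing `n²/2` to the eigenvalue. -/
theorem hasModes_cylOscillator (c : ℝ) {v : ℝ → E → ℝ} (hv : IsPotential v) (s : ℝ) :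
    HasModes cylBasis (fun p => cylRate p + (3 / 4 - c))
      (potOp cylMeasure (hv.comp (f := Prod.fst) measurable_fst) s) (cylOscillator c (v s)) := by
  have hv' : IsPotential fun s (x : Cyl) => v s x.1 := hv.comp measurable_fst
  refine ⟨fun p => ?_, ?_⟩
  · obtain ⟨n, α⟩ := p
    refine ⟨fun x => ((((Real.sqrt (hermSq α))⁻¹ : ℝ) : ℂ) • hermSchwartz α) x.1 * em n x.2,
      isCylTest_mul _ n, ?_, ?_⟩
    · filter_upwards [cylVec_ae (n, α)] with x hx
      simp only [hx, smul_apply, hermSchwartz_apply, hermN]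
      simp
    · have hL : ∀ x : Cyl, Laplacian.laplacian
          (fun z : E => ((((Real.sqrt (hermSq α))⁻¹ : ℝ) : ℂ) • hermSchwartz α) z * em n x.2) x.1
          = (((‖x.1‖ ^ 2 / 16 - 3 / 4 - (∑ i, (α i : ℝ)) / 2 : ℝ) : ℂ) * (hermN α x.1 * em n x.2)) := by
        intro x
        have e : (fun z : E => ((((Real.sqrt (hermSq α))⁻¹ : ℝ) : ℂ) • hermSchwartz α) z * em n x.2)
            = ((((Real.sqrt (hermSq α))⁻¹ : ℝ) : ℂ) * em n x.2) • fun z => (hermFun α z : ℂ) := by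
          funext z
          simp only [smul_apply, hermSchwartz_apply, Pi.smul_apply, smul_eq_mul]
          ring
        rw [e, InnerProductSpace.laplacian_smul _ (contDiff_hermFun α).contDiffAt, laplacian_hermFun,
          smul_eq_mul, hermN]
        push_cast
        ring
      filter_upwards [cylVec_ae (n, α), potOp_ae hv' s (cylBasis (n, α)),
        Lp.coeFn_smul ((cylRate (n, α) + (3 / 4 - c) : ℝ) : ℂ) (cylBasis (n, α)),
        Lp.coeFn_add (((cylRate (n, α) + (3 / 4 - c) : ℝ) : ℂ) • cylBasis (n, α))
          (potOp cylMeasure hv' s (cylBasis (n, α)))] with x h1 h2 h3 h4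
      rw [hL, iteratedDeriv_em]
      refine h4.trans ?_
      rw [Pi.add_apply, h3, Pi.smul_apply, h2, h1]
      simp only [smul_apply, hermSchwartz_apply, hermN, cylRate, rate, deg, smul_eq_mul]
      push_cast
      linear_combination (1 / 2 * (n : ℂ) ^ 2 * ((Real.sqrt (hermSq α) : ℂ)⁻¹ * hermFun α x.1 * em n x.2))
        * Complex.I_sq
  · rintro p ⟨ψ, hψ, hp1, hp2⟩ ⟨n, α⟩
    rw [inner_cylBasis, inner_cylBasis, inner_cylBasis, mul_left_comm, ← mul_add]
    congr 1
    set h := hermSchwartz α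
    obtain ⟨C0, hC0⟩ := hψ.decay 0 0
    have hb0 : ∀ x, ‖ψ x‖ ≤ C0 := fun x => by simpa using hC0 x
    obtain ⟨C1, hC1⟩ := (exists_bound_laplacian hψ).2
    obtain ⟨C2, hC2⟩ := (exists_bound_iteratedDeriv hψ).2
    have hi0 : Integrable _ cylMeasure := integrable_mode_mul h (-n) hψ.smooth.continuous hb0
    have hi1 : Integrable _ cylMeasure := integrable_mode_mul h (-n) (exists_bound_laplacian hψ).1 hC1
    have hi2 : Integrable _ cylMeasure := integrable_mode_mul h (-n) (exists_bound_iteratedDeriv hψ).1 hC2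
    have hiL : Integrable _ cylMeasure := integrable_mode_mul (Laplacian.laplacian h) (-n) hψ.smooth.continuous hb0
    have hmem : MemLp (fun x : Cyl => h x.1 * em (-n) x.2) 2 cylMeasure := by
      refine (memLp_lift (-n) (h.toLp 2 volume)).ae_eq ?_
      filter_upwards [Measure.quasiMeasurePreserving_fst.ae (h.coeFn_toLp 2 volume)] with x hx
      rw [hx]
    have hiV : Integrable (fun x : Cyl => h x.1 * em (-n) x.2 * potOp cylMeasure hv' s p.1 x) cylMeasure :=
      hmem.integrable_mul (Lp.memLp _)
    have hLh : ∀ y, (Laplacian.laplacian h) y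
        = ((‖y‖ ^ 2 / 16 - 3 / 4 - (∑ i, (α i : ℝ)) / 2 : ℝ) : ℂ) * h y := by
      intro y
      rw [SchwartzMap.laplacian_apply]
      simp only [h]
      rw [coe_hermSchwartz, laplacian_hermFun]
    -- The eigenvalue equation trades `|y|² h / 16` for `Δ h` and a constant, so every integral
    -- pairs a Schwartz mode with a bounded function or with an `L²` function.
    have hsum : ∫ x, h x.1 * em (-n) x.2 * p.2 x ∂cylMeasure
        = (∫ x, (Laplacian.laplacian h) x.1 * em (-n) x.2 * ψ x ∂cylMeasure)
          - (∫ x, h x.1 * em (-n) x.2 * Laplacian.laplacian (fun z : E => ψ (z, x.2)) x.1 ∂cylMeasure)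
          - (1 / 2 : ℂ) * (∫ x, h x.1 * em (-n) x.2
              * iteratedDeriv 2 (fun θ : ℝ => ψ (x.1, θ)) x.2 ∂cylMeasure)
          + ((rate α + (3 / 4 - c) : ℝ) : ℂ) * (∫ x, h x.1 * em (-n) x.2 * ψ x ∂cylMeasure)
          + ∫ x, h x.1 * em (-n) x.2 * potOp cylMeasure hv' s p.1 x ∂cylMeasure := by
      rw [← integral_combination hiL hi1 hi2 hi0 hiV]
      refine integral_congr_ae ?_
      filter_upwards [hp1, hp2, potOp_ae hv' s p.1] with x k1 k2 k3
      rw [k2, k3, k1, hLh, rate, deg]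
      push_cast
      ring
    have hpsi : ∫ x, h x.1 * em (-n) x.2 * p.1 x ∂cylMeasure
        = ∫ x, h x.1 * em (-n) x.2 * ψ x ∂cylMeasure := by
      refine integral_congr_ae ?_
      filter_upwards [hp1] with x k1
      rw [k1]
    rw [hsum, hpsi, integral_mode_mul_laplacian h (-n) hψ, integral_mode_mul_iteratedDeriv h (-n) hψ,
      cylRate]
    push_cast
    ring

theorem zero_mem_cylOscillator (c : ℝ) (V : E → ℝ) : ((0 : HC), (0 : HC)) ∈ cylOscillator c V := by
  refine ⟨fun x => (0 : 𝓢(E, ℂ)) x.1 * em 0 x.2, isCylTest_mul 0 0, ?_, ?_⟩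
  · filter_upwards [Lp.coeFn_zero ℂ 2 cylMeasure] with y hy
    rw [hy]; simp
  · filter_upwards [Lp.coeFn_zero ℂ 2 cylMeasure] with y hy
    refine hy.trans ?_
    simp [InnerProductSpace.laplacian_const]

/-! ### The heat kernel on the cylinder -/

/-- The heat kernel of `½ ∂_θ²` on the circle. -/
def circKernel (t φ : ℝ) : ℝ :=
  (2 * Real.pi)⁻¹ * HurwitzZeta.cosKernel ((φ / (2 * Real.pi) : ℝ) : UnitAddCircle) (t / (2 * Real.pi))

/-- The cosine series shows no sign by itself. The functional equation, that is, Poisson summation,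
turns it into a positive multiple of a sum of Gaussians. -/
theorem cosKernel_nonneg (a : ℝ) {x : ℝ} (hx : 0 < x) : 0 ≤ HurwitzZeta.cosKernel (a : UnitAddCircle) x := by
  have h1 := HurwitzZeta.evenKernel_functional_equation (a : UnitAddCircle) (1 / x)
  have h2 : 0 ≤ HurwitzZeta.evenKernel (a : UnitAddCircle) (1 / x) :=
    (HurwitzZeta.hasSum_int_evenKernel a (one_div_pos.2 hx)).nonneg fun n => (Real.exp_pos _).le
  rw [h1, one_div_one_div] at h2
  exact nonneg_of_mul_nonneg_right h2 (by positivity)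

theorem circKernel_nonneg {t : ℝ} (ht : 0 < t) (φ : ℝ) : 0 ≤ circKernel t φ := by
  have := Real.pi_pos
  exact mul_nonneg (by positivity) (cosKernel_nonneg _ (by positivity))

/-- The scalings by `2π` in the angle and in the time translate the theta series on the unit circle
into the eigenvalues `m²/2` on the circle of length `2π`. -/
theorem hasSum_circKernel {t : ℝ} (ht : 0 < t) (θ θ' : ℝ) :
    HasSum (fun m : ℤ => ((Real.exp (-((m : ℝ) ^ 2 / 2 * t)) : ℝ) : ℂ) * (em m θ * em (-m) θ'))
      ((circKernel t (θ - θ') : ℝ) : ℂ) := by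
  have hp := Real.pi_pos
  have h := (HurwitzZeta.hasSum_int_cosKernel ((θ - θ') / (2 * Real.pi))
    (t := t / (2 * Real.pi)) (by positivity)).mul_left ((((2 * Real.pi)⁻¹ : ℝ)) : ℂ)
  rw [circKernel, Complex.ofReal_mul]
  refine h.congr_fun fun m => ?_
  have hpc : (Real.pi : ℂ) ≠ 0 := by exact_mod_cast hp.ne'
  have e1 : em m θ * em (-m) θ' = (((2 * Real.pi)⁻¹ : ℝ) : ℂ) * Complex.exp (Complex.I * m * (θ - θ')) := by
    have h0 : (((Real.sqrt (2 * Real.pi))⁻¹ : ℝ) : ℂ) * (((Real.sqrt (2 * Real.pi))⁻¹ : ℝ) : ℂ)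
        = (((2 * Real.pi)⁻¹ : ℝ) : ℂ) := by
      rw [← Complex.ofReal_mul, ← mul_inv, Real.mul_self_sqrt (by positivity)]
    rw [em, em, mul_mul_mul_comm, h0, ← Complex.exp_add]
    congr 2
    push_cast
    ring
  have e2 : 2 * (Real.pi : ℂ) * Complex.I * (((θ - θ') / (2 * Real.pi) : ℝ) : ℂ) * m
      = Complex.I * m * (θ - θ') := by
    push_cast
    field_simp
  have e3 : -Real.pi * (m : ℝ) ^ 2 * (t / (2 * Real.pi)) = -((m : ℝ) ^ 2 / 2 * t) := by
    field_simp
  rw [e1, e2, e3]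
  ring

theorem summable_exp_sq {t : ℝ} (ht : 0 < t) : Summable fun m : ℤ => Real.exp (-((m : ℝ) ^ 2 / 2 * t)) := by
  have hp := Real.pi_pos
  have h := (HurwitzZeta.hasSum_int_evenKernel 0 (t := t / (2 * Real.pi)) (by positivity)).summable
  refine h.congr fun m => ?_
  congr 1
  field_simp
  ring

theorem norm_em_mul (m n : ℤ) (θ θ' : ℝ) : ‖em m θ * em n θ'‖ = (2 * Real.pi)⁻¹ := by
  rw [norm_mul, norm_em, norm_em, ← mul_inv, Real.mul_self_sqrt (by have := Real.pi_pos; positivity)]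

theorem exists_circKernel_le {t : ℝ} (ht : 0 < t) : ∃ C, ∀ φ, circKernel t φ ≤ C := by
  refine ⟨∑' m : ℤ, Real.exp (-((m : ℝ) ^ 2 / 2 * t)) * (2 * Real.pi)⁻¹, fun φ => ?_⟩
  have h := hasSum_circKernel ht φ 0
  have h2 := tsum_of_norm_bounded ((summable_exp_sq ht).mul_right (2 * Real.pi)⁻¹).hasSum
    (f := fun m : ℤ => ((Real.exp (-((m : ℝ) ^ 2 / 2 * t)) : ℝ) : ℂ) * (em m φ * em (-m) 0)) fun m => by
      rw [norm_mul, norm_em_mul, Complex.norm_real, Real.norm_eq_abs, abs_of_pos (Real.exp_pos _)]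
  rw [h.tsum_eq, sub_zero, Complex.norm_real] at h2
  exact (le_abs_self _).trans h2

theorem continuous_circKernel {t : ℝ} (ht : 0 < t) : Continuous (circKernel t) := by
  have h : Continuous fun φ => ∑' m : ℤ, ((Real.exp (-((m : ℝ) ^ 2 / 2 * t)) : ℝ) : ℂ)
      * (em m φ * em (-m) 0) := by
    refine continuous_tsum (fun m => ?_) ((summable_exp_sq ht).mul_right (2 * Real.pi)⁻¹) fun m φ => ?_
    · exact continuous_const.mul ((continuous_em m).mul continuous_const)
    · rw [norm_mul, norm_em_mul, Complex.norm_real, Real.norm_eq_abs, abs_of_pos (Real.exp_pos _)]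
  have h2 : circKernel t = fun φ => (∑' m : ℤ, ((Real.exp (-((m : ℝ) ^ 2 / 2 * t)) : ℝ) : ℂ)
      * (em m φ * em (-m) 0)).re := by
    funext φ
    rw [(hasSum_circKernel ht φ 0).tsum_eq, sub_zero, Complex.ofReal_re]
  rw [h2]
  exact Complex.continuous_re.comp h

theorem integral_circKernel_mul_em {t : ℝ} (ht : 0 < t) (n : ℤ) (θ : ℝ) :
    ∫ θ', (circKernel t (θ - θ') : ℂ) * em n θ' ∂circMeasure
      = ((Real.exp (-((n : ℝ) ^ 2 / 2 * t)) : ℝ) : ℂ) * em n θ := by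
  let F : ℤ → ℝ → ℂ := fun m θ' =>
    ((Real.exp (-((m : ℝ) ^ 2 / 2 * t)) : ℝ) : ℂ) * (em m θ * em (-m) θ') * em n θ'
  have hsum := hasSum_integral_of_dominated_convergence (F := F)
    (f := fun θ' => (circKernel t (θ - θ') : ℂ) * em n θ') (μ := circMeasure)
    (fun m _ => Real.exp (-((m : ℝ) ^ 2 / 2 * t)) * ((2 * Real.pi)⁻¹ * (Real.sqrt (2 * Real.pi))⁻¹))
    (fun m => ?_) (fun m => Eventually.of_forall fun θ' => ?_)
    (Eventually.of_forall fun θ' => (summable_exp_sq ht).mul_right _) (integrable_const _)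
    (Eventually.of_forall fun θ' => (hasSum_circKernel ht θ θ').mul_right (em n θ'))
  · refine hsum.unique ?_
    have h1 : ∀ m, ∫ θ', F m θ' ∂circMeasure
        = if m = n then ((Real.exp (-((n : ℝ) ^ 2 / 2 * t)) : ℝ) : ℂ) * em n θ else 0 := by
      intro m
      have e : ∀ θ', F m θ' = ((Real.exp (-((m : ℝ) ^ 2 / 2 * t)) : ℝ) : ℂ) * em m θ
          * (em (-m) θ' * em n θ') := fun θ' => by simp only [F]; ring
      simp only [e]
      rw [integral_const_mul, integral_em_mul_em]
      by_cases hmn : m = n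
      · subst hmn; simp
      · rw [if_neg hmn, if_neg (by omega), mul_zero]
    simp only [h1]
    exact hasSum_ite_eq n _
  · exact ((continuous_const.mul (continuous_const.mul (continuous_em _))).mul
      (continuous_em n)).aestronglyMeasurable
  · simp only [F]
    rw [norm_mul, norm_mul, norm_em_mul, norm_em, Complex.norm_real, Real.norm_eq_abs,
      abs_of_pos (Real.exp_pos _), mul_assoc]

/-- The heat kernel of the cylinder. -/
def cylKernel (t : ℝ) (x x' : Cyl) : ℝ := mehler t x.1 x'.1 * circKernel t (x.2 - x'.2)

theorem isHeatKernel_cylKernel {t : ℝ} (ht : 0 < t) :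
    IsHeatKernel cylBasis cylRate t (cylKernel t) := by
  refine ⟨fun x x' => mul_nonneg (mehler_nonneg _ _ _) (circKernel_nonneg ht _), fun x => ?_, ?_⟩
  · obtain ⟨C, hC⟩ := exists_circKernel_le ht
    refine ((memLp_mehler ht x.1).comp_fst circMeasure).of_le_mul (c := C) ?_ ?_
    · have := continuous_circKernel ht
      have := continuous_mehler t x.1
      refine Continuous.aestronglyMeasurable ?_
      unfold cylKernel
      fun_prop
    · refine Eventually.of_forall fun x' => ?_
      rw [cylKernel, norm_mul, mul_comm, Real.norm_eq_abs, abs_of_nonneg (circKernel_nonneg ht _)]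
      exact mul_le_mul_of_nonneg_right (hC _) (norm_nonneg _)
  · rintro ⟨n, α⟩
    have hE := Measure.quasiMeasurePreserving_fst (ν := circMeasure) |>.ae
      ((isHeatKernel_mehler ht).eigen α)
    filter_upwards [cylVec_ae (n, α), hE,
      Measure.quasiMeasurePreserving_fst (ν := circMeasure) |>.ae (hermVec_ae α)] with x h1 h2 h3
    rw [h1]
    have e1 : ∫ x', (cylKernel t x x' : ℂ) * cylBasis (n, α) x' ∂cylMeasure
        = ∫ x' : Cyl, ((mehler t x.1 x'.1 : ℂ) * hermN α x'.1)
            * ((circKernel t (x.2 - x'.2) : ℂ) * em n x'.2) ∂((volume : Measure E).prod circMeasure) := by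
      refine integral_congr_ae ?_
      filter_upwards [cylVec_ae (n, α)] with x' hx'
      rw [hx', cylKernel]
      push_cast
      ring
    have e2 : ∫ y, (mehler t x.1 y : ℂ) * hermN α y
        = ∫ y, (mehler t x.1 y : ℂ) * hermBasis α y := by
      refine integral_congr_ae ?_
      filter_upwards [hermVec_ae α] with y hy
      rw [hermBasis_apply, hy]
    rw [e1, integral_prod_mul (fun y => (mehler t x.1 y : ℂ) * hermN α y)
      (fun θ' => (circKernel t (x.2 - θ') : ℂ) * em n θ'), e2, h2, integral_circKernel_mul_em ht,
      hermBasis_apply, h3, cylRate]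
    have e3 : Real.exp (-((rate α + (n : ℝ) ^ 2 / 2) * t))
        = Real.exp (-(rate α * t)) * Real.exp (-((n : ℝ) ^ 2 / 2 * t)) := by
      rw [← Real.exp_add]; ring_nf
    rw [e3]
    push_cast
    ring

/-! ### Weights on the cylinder -/

theorem em_zero (θ : ℝ) : em 0 θ = (((Real.sqrt (2 * Real.pi))⁻¹ : ℝ) : ℂ) := by simp [em]

theorem lift_dominated {f w : HE} (h : (f, w) ∈ dominated volume) (n : ℤ) :
    (lift n f, lift 0 w) ∈ dominated cylMeasure := by
  rw [mem_dominated] at *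
  filter_upwards [lift_ae n f, lift_ae 0 w, Measure.quasiMeasurePreserving_fst.ae h] with x h1 h2 h3
  rw [h1, h2, norm_mul, norm_em, em_zero, mul_comm (w x.1), Complex.re_ofReal_mul, mul_comm]
  exact mul_le_mul_of_nonneg_left h3 (inv_nonneg.2 sqrt_two_pi_pos.le)

/-- The weight as a function on the cylinder. -/
def cylWt (k : ℕ) : HC := ((Real.sqrt (2 * Real.pi) : ℝ) : ℂ) • lift 0 (wtVec k)

theorem cylWt_ae (k : ℕ) : cylWt k =ᵐ[cylMeasure] fun x => ((wt k x.1 : ℝ) : ℂ) := by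
  filter_upwards [lift_ae 0 (wtVec k), Measure.quasiMeasurePreserving_fst.ae (wtVec_ae k),
    Lp.coeFn_smul ((Real.sqrt (2 * Real.pi) : ℝ) : ℂ) (lift 0 (wtVec k))] with x h1 h2 h3
  have h0 : ((Real.sqrt (2 * Real.pi) : ℝ) : ℂ) * (((Real.sqrt (2 * Real.pi))⁻¹ : ℝ) : ℂ) = 1 := by
    rw [← Complex.ofReal_mul, mul_inv_cancel₀ sqrt_two_pi_pos.ne']; simp
  rw [cylWt, h3, Pi.smul_apply, h1, h2, em_zero, smul_eq_mul, mul_left_comm, h0, mul_one]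

theorem cylWt_dominated_iff (k : ℕ) (u : HC) (β : ℝ) :
    (u, (β : ℂ) • cylWt k) ∈ dominated cylMeasure ↔ ∀ᵐ x ∂cylMeasure, ‖u x‖ ≤ β * wt k x.1 :=
  dominated_iff (cylWt_ae k) u β

theorem heat_lift_zero {t : ℝ} (ht : 0 ≤ t) (f : HE) :
    heat cylBasis cylRate_nonneg t (lift 0 f) = lift 0 (heat hermBasis rate_nonneg t f) := by
  refine hilbert_ext cylBasis ?_
  rintro ⟨n, α⟩
  rw [inner_heat_of_nonneg _ _ ht, cylBasis_apply, inner_lift, inner_lift]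
  simp only
  split_ifs with h
  · subst h
    rw [inner_heat_of_nonneg _ _ ht, cylRate]
    simp
  · simp

/-- The weight does not depend on `θ`, so its evolution is that on `ℝ³`. The kernel of the cylinder
is needed only for positivity. -/
theorem heatWeight_cylWt {k : ℕ} (hk : k ≤ 3) :
    HeatWeight cylBasis cylRate_nonneg (cylWt k) 16392 := by
  have hE := heatWeight_wtVec hk
  refine ⟨fun t ht p hp => ?_, ?_, fun t ht => ?_⟩
  · rcases ht.eq_or_lt with rfl | ht
    · simpa [heat_of_nonpos cylBasis cylRate_nonneg le_rfl] using hp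
    · exact (isHeatKernel_cylKernel ht).dominated cylRate_nonneg ht.le hp
  · exact dominated_ofReal_smul (lift_dominated hE.self 0) (Real.sqrt_nonneg _)
  · rw [cylWt, map_smul, heat_lift_zero ht, smul_comm]
    have := lift_dominated (hE.bound t ht) 0
    rw [map_smul] at this
    exact dominated_ofReal_smul this (Real.sqrt_nonneg _)

/-! ### Decay on the cylinder -/

section Fibres

variable {v : ℝ → E → ℝ} (hv : IsPotential v)

theorem lift_potOp (n : ℤ) (s : ℝ) (f : HE) :
    potOp cylMeasure (hv.comp (f := Prod.fst) measurable_fst) s (lift n f) = lift n (potOp volume hv s f) := by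
  refine Lp.ext ?_
  filter_upwards [potOp_ae (hv.comp (f := (Prod.fst : Cyl → E)) measurable_fst) s (lift n f), lift_ae n f,
    lift_ae n (potOp volume hv s f), Measure.quasiMeasurePreserving_fst.ae (potOp_ae hv s f)]
    with x h1 h2 h3 h4
  rw [h1, h2, h3, h4, mul_assoc]

theorem coef_potOp (n : ℤ) (s : ℝ) (g : HC) :
    coef n (potOp cylMeasure (hv.comp (f := Prod.fst) measurable_fst) s g)
      = potOp volume hv s (coef n g) := by
  refine ext_inner_left ℂ fun f => ?_
  rw [inner_coef, ← (isPos_potOp (hv.comp (f := (Prod.fst : Cyl → E)) measurable_fst) s).symm, lift_potOp hv,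
    ← inner_coef, (isPos_potOp hv s).symm]

end Fibres

/-- `J` consists of the modes of degree less than `d n` in the `n`-th Fourier component. -/
def IsLowSet (J : Finset (ℤ × (Fin 3 → ℕ))) (d : ℤ → ℕ) : Prop :=
  ∀ n α, (n, α) ∈ J ↔ deg α < d n

theorem coef_modeProj {J : Finset (ℤ × (Fin 3 → ℕ))} {d : ℤ → ℕ} (hJ : IsLowSet J d) (n : ℤ) (g : HC) :
    coef n (modeProj cylBasis J g) = modeProj hermBasis (lowModes (d n)) (coef n g) := by
  classical
  refine hilbert_ext hermBasis fun α => ?_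
  rw [inner_hermBasis_coef, inner_modeProj, inner_modeProj, inner_hermBasis_coef]
  simp only [hJ n α, mem_lowModes]

/-- Taking a Fourier coefficient commutes with the `θ`-independent potential and turns the
projection into the one of degree `d n`. The rescaling removes the extra eigenvalue `n²/2`. -/
theorem linSol_coef {v : ℝ → E → ℝ} (hv : IsPotential v) {J : Finset (ℤ × (Fin 3 → ℕ))} {d : ℤ → ℕ}
    (hJ : IsLowSet J d) {σ τ : ℝ} {u : ℝ → HC}
    (hu : LinSol cylBasis cylRate σ τ u (fun s => -(modeProj cylBasis J
      (potOp cylMeasure (hv.comp (f := Prod.fst) measurable_fst) s (u s))))) (n : ℤ) :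
    LinSol hermBasis rate σ τ
      (fun s => ((Real.exp ((n : ℝ) ^ 2 / 2 * (s - σ)) : ℝ) : ℂ) • coef n (u s))
      (fun s => -(modeProj hermBasis (lowModes (d n)) (potOp volume hv s
        (((Real.exp ((n : ℝ) ^ 2 / 2 * (s - σ)) : ℝ) : ℂ) • coef n (u s))))) := by
  have h1 := hu.map (b' := hermBasis) (ν' := fun α => rate α + (n : ℝ) ^ 2 / 2) (coef n)
    (fun α => (n, α)) (fun x α => inner_hermBasis_coef n α x) fun α => rfl
  have h2 := h1.rescale (-((n : ℝ) ^ 2 / 2)) σ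
  simp only [add_neg_cancel_right, neg_neg] at h2
  refine h2.congr (fun _ _ => rfl) fun s _ => ?_
  rw [map_neg, coef_modeProj hJ, coef_potOp, map_smul, map_smul, smul_neg]

theorem modeProj_coef {J : Finset (ℤ × (Fin 3 → ℕ))} {d : ℤ → ℕ}
    (hJ : IsLowSet J d) {g : HC} (hg : modeProj cylBasis J g = g) (n : ℤ) (c : ℂ) :
    modeProj hermBasis (lowModes (d n)) (c • coef n g) = c • coef n g := by
  rw [map_smul, ← coef_modeProj hJ, hg]

/-- The circle has length `2π` and the modes have modulus `1/√(2π)`, whence the factor `√(2π)`. -/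
theorem coef_dominated {g : HC} {k : ℕ} {β : ℝ} (hg : (g, (β : ℂ) • cylWt k) ∈ dominated cylMeasure)
    (n : ℤ) : (coef n g, ((Real.sqrt (2 * Real.pi) * β : ℝ) : ℂ) • wtVec k) ∈ dominated volume := by
  rw [wtVec_dominated_iff]
  rw [cylWt_dominated_iff] at hg
  have h1 : ∀ᵐ y : E, ∀ᵐ θ ∂circMeasure, ‖g (y, θ)‖ ≤ β * wt k y := Measure.ae_ae_of_ae_prod hg
  filter_upwards [h1, coef_ae n g] with y h2 h3
  rw [h3]
  have hp := sqrt_two_pi_pos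
  have h4 : ∀ᵐ θ ∂circMeasure, ‖em (-n) θ * g (y, θ)‖ ≤ (Real.sqrt (2 * Real.pi))⁻¹ * (β * wt k y) := by
    filter_upwards [h2] with θ h5
    rw [norm_mul, norm_em]
    exact mul_le_mul_of_nonneg_left h5 (inv_pos.2 hp).le
  refine (norm_integral_le_of_norm_le_const h4).trans_eq ?_
  have h6 : circMeasure.real univ = Real.sqrt (2 * Real.pi) * Real.sqrt (2 * Real.pi) := by
    rw [Real.mul_self_sqrt (by have := Real.pi_pos; positivity), circMeasure, measureReal_restrict_apply_univ,
      Real.volume_real_Ioc_of_le (by have := Real.pi_pos; positivity), sub_zero]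
  rw [h6]
  field_simp

/-- Only finitely many degrees `d ≤ k` occur, so one constant serves all Fourier indices; summation
over `n` requires this. -/
theorem exists_uniform_decay {k : ℕ} (hk : k ≤ 3) : ∃ C : ℝ, 0 ≤ C ∧ ∀ d ≤ k,
    ∀ (v : ℝ → E → ℝ) (hv : IsPotential v), (∀ s y, v s y ≤ ‖y‖) → ∀ σ τ : ℝ, σ ≤ τ → ∀ u : ℝ → HE,
      LinSol hermBasis rate σ τ u
        (fun s => -(modeProj hermBasis (lowModes d) (potOp volume hv s (u s)))) →
      (∀ t ∈ Icc σ τ, modeProj hermBasis (lowModes d) (u t) = u t) → ∀ β : ℝ, 0 ≤ β →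
      (u σ, (β : ℂ) • wtVec k) ∈ dominated volume →
      (u τ, ((C * Real.exp (-decay d * (τ - σ)) * β : ℝ) : ℂ) • wtVec k) ∈ dominated volume := by
  choose c hc0 hc using fun d : Fin (k + 1) =>
    exists_weighted_decay (d := d) (k := k) (Nat.lt_succ_iff.1 d.2) hk
  refine ⟨∑ d, c d, Finset.sum_nonneg fun d _ => hc0 d, fun d hd v hv hvy σ τ hst u hu hP β hβ hi => ?_⟩
  let d' : Fin (k + 1) := ⟨d, Nat.lt_succ_iff.2 hd⟩
  have hle : c d' ≤ ∑ d, c d := Finset.single_le_sum (fun d _ => hc0 d) (Finset.mem_univ d')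
  refine dominated_smul_mono (heatWeight_wtVec hk).zero_mem ?_ (hc d' v hv hvy σ τ hst u hu hP β hβ hi)
  exact mul_le_mul_of_nonneg_right (mul_le_mul_of_nonneg_right hle (Real.exp_pos _).le) hβ

/-- The coefficient solves a closed equation of its own, whose `L²` norm does not grow. -/
theorem coef_eq_zero_of_initial {v : ℝ → E → ℝ} (hv : IsPotential v) {J : Finset (ℤ × (Fin 3 → ℕ))}
    {d : ℤ → ℕ} (hJ : IsLowSet J d) {σ τ : ℝ} (hst : σ ≤ τ) {u : ℝ → HC}
    (hu : LinSol cylBasis cylRate σ τ u (fun s => -(modeProj cylBasis J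
      (potOp cylMeasure (hv.comp (f := Prod.fst) measurable_fst) s (u s)))))
    (hP : ∀ t ∈ Icc σ τ, modeProj cylBasis J (u t) = u t) {n : ℤ} (h0 : coef n (u σ) = 0) :
    coef n (u τ) = 0 := by
  have h1 := norm_le_of_projected hv hst (linSol_coef hv hJ hu n) (fun t ht => modeProj_coef hJ (hP t ht) n _)
    (γ := 0) fun i hi => absurd hi (not_lt.2 (rate_nonneg i))
  rw [h0, smul_zero, norm_zero, mul_zero, norm_le_zero_iff] at h1
  exact (smul_eq_zero.1 h1).resolve_left (by exact_mod_cast (Real.exp_pos _).ne')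

theorem lift_coef_dominated {k : ℕ} (hk : k ≤ 3) : ∃ C : ℝ, 0 ≤ C ∧
    ∀ (J : Finset (ℤ × (Fin 3 → ℕ))) (d : ℤ → ℕ), IsLowSet J d →
    ∀ (v : ℝ → E → ℝ) (hv : IsPotential v), (∀ s y, v s y ≤ ‖y‖) → ∀ σ τ : ℝ, σ ≤ τ → ∀ u : ℝ → HC,
      LinSol cylBasis cylRate σ τ u (fun s => -(modeProj cylBasis J
        (potOp cylMeasure (hv.comp (f := Prod.fst) measurable_fst) s (u s)))) →
      (∀ t ∈ Icc σ τ, modeProj cylBasis J (u t) = u t) → ∀ β : ℝ, 0 ≤ β →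
      (u σ, (β : ℂ) • cylWt k) ∈ dominated cylMeasure → ∀ n : ℤ, d n ≤ k →
      (lift n (coef n (u τ)),
        ((C * Real.exp (-(decay (d n) + (n : ℝ) ^ 2 / 2) * (τ - σ)) * β : ℝ) : ℂ) • cylWt k)
          ∈ dominated cylMeasure := by
  obtain ⟨C, hC0, hC⟩ := exists_uniform_decay hk
  refine ⟨C, hC0, fun J d hJ v hv hvy σ τ hst u hu hP β hβ hi n hn => ?_⟩
  have hp := sqrt_two_pi_pos
  have h1 := hC (d n) hn v hv hvy σ τ hst _ (linSol_coef hv hJ hu n)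
    (fun t ht => modeProj_coef hJ (hP t ht) n _) (Real.sqrt (2 * Real.pi) * β) (by positivity) (by
      simpa using coef_dominated hi n)
  have h2 := dominated_ofReal_smul h1 (Real.exp_pos (-((n : ℝ) ^ 2 / 2 * (τ - σ)))).le
  rw [smul_smul, smul_smul, ← Complex.ofReal_mul, ← Complex.ofReal_mul, ← Real.exp_add, neg_add_cancel,
    Real.exp_zero, Complex.ofReal_one, one_smul] at h2
  have h3 := lift_dominated h2 n
  rw [map_smul] at h3
  rw [cylWt, smul_smul, ← Complex.ofReal_mul]
  convert h3 using 4
  rw [neg_mul, add_mul, neg_add, Real.exp_add, neg_mul]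
  ring

theorem cyl_modes_bound {J : Finset (ℤ × (Fin 3 → ℕ))} {k : ℕ} (hJ : ∀ p ∈ J, deg p.2 ≤ k) :
    ∃ C : ℝ, 0 ≤ C ∧ (∀ p ∈ J, (cylBasis p, (C : ℂ) • cylWt k) ∈ dominated cylMeasure) ∧
    ∀ (v : ℝ → E → ℝ) (hv : IsPotential v), (∀ s y, v s y ≤ ‖y‖) → ∀ p ∈ J, ∀ s,
      ‖potOp cylMeasure (hv.comp (f := Prod.fst) measurable_fst) s (cylBasis p)‖ ≤ C := by
  choose c hc0 hc1 hc2 using exists_mode_bounds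
  have hle : ∀ p ∈ J, c p.2 ≤ ∑ q ∈ J, c q.2 := fun p hp =>
    Finset.single_le_sum (f := fun q : ℤ × (Fin 3 → ℕ) => c q.2) (fun q _ => hc0 q.2) hp
  have hp := sqrt_two_pi_pos
  have hp1 : (Real.sqrt (2 * Real.pi))⁻¹ ≤ 1 := by
    refine inv_le_one_of_one_le₀ (Real.one_le_sqrt.2 ?_)
    have := Real.pi_gt_three
    linarith
  refine ⟨∑ q ∈ J, c q.2, Finset.sum_nonneg fun q _ => hc0 q.2, fun p hpJ => ?_, fun v hv hvy p hpJ s => ?_⟩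
  · rw [cylWt_dominated_iff]
    filter_upwards [cylVec_ae p] with x hx
    rw [hx, norm_mul, norm_em, Complex.norm_real, Real.norm_eq_abs]
    have h1 := hc1 p.2 k (hJ p hpJ) x.1
    have h2 := mul_le_mul_of_nonneg_right (hle p hpJ) (wt_pos k x.1).le
    calc |hermN p.2 x.1| * (Real.sqrt (2 * Real.pi))⁻¹ ≤ |hermN p.2 x.1| * 1 :=
          mul_le_mul_of_nonneg_left hp1 (abs_nonneg _)
      _ ≤ _ := by rw [mul_one]; exact h1.trans h2
  · rw [cylBasis_apply, lift_potOp, LinearIsometry.norm_map, hermBasis_apply]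
    exact (hc2 p.2 v hv hvy s).trans (hle p hpJ)

/-- For short times the factors `e^{-n²t/2}` do not sum uniformly, so the positive kernel of the
cylinder is used without Fourier decomposition. No decay is claimed, hence degrees up to `k` in `J`
suffice. -/
theorem cyl_short_time {J : Finset (ℤ × (Fin 3 → ℕ))} {k : ℕ} (hk : k ≤ 3) (hJ : ∀ p ∈ J, deg p.2 ≤ k) :
    ∃ C : ℝ, 0 ≤ C ∧
    ∀ (v : ℝ → E → ℝ) (hv : IsPotential v), (∀ s y, v s y ≤ ‖y‖) → ∀ σ τ : ℝ, σ ≤ τ → τ - σ ≤ 1 →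
      ∀ u : ℝ → HC, LinSol cylBasis cylRate σ τ u (fun s => -(modeProj cylBasis J
        (potOp cylMeasure (hv.comp (f := Prod.fst) measurable_fst) s (u s)))) →
      (∀ t ∈ Icc σ τ, modeProj cylBasis J (u t) = u t) → ∀ β : ℝ, 0 ≤ β →
      (u σ, (β : ℂ) • cylWt k) ∈ dominated cylMeasure →
      (u τ, ((C * β : ℝ) : ℂ) • cylWt k) ∈ dominated cylMeasure := by
  have hw := heatWeight_cylWt hk
  obtain ⟨c, hc0, hcb, hcV⟩ := cyl_modes_bound hJ
  set W := ‖cylWt k‖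
  refine ⟨16392 + J.card * (c * W * c) * 16392, by positivity,
    fun v hv hvy σ τ hst h1 u hu hP β hβ hi => ?_⟩
  have hL2 : ∀ t ∈ Icc σ τ, ‖u t‖ ≤ β * W := by
    intro t ht
    have h2 := norm_le_of_projected (hv.comp (f := (Prod.fst : Cyl → E)) measurable_fst) ht.1
      (hu.mono le_rfl ht.2) (fun s hs => hP s ⟨hs.1, hs.2.trans ht.2⟩) (γ := 0)
      fun p hp => absurd hp (not_lt.2 (cylRate_nonneg p))
    refine h2.trans ?_
    rw [neg_zero, zero_mul, Real.exp_zero, one_mul]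
    exact norm_le_of_dominated hβ hi
  have h2 := dominated_projected_step hw (hv.comp (f := (Prod.fst : Cyl → E)) measurable_fst) hc0 hc0 hcb
    (hcV v hv hvy) hst hu (a := β * W) (by positivity) hL2
  have h3 := hw.heat_le (sub_nonneg.2 hst) hβ (absLp_dominated hi)
  have hp : 0 ≤ (τ - σ) * (J.card * (c * (β * W) * c) * 16392) :=
    mul_nonneg (sub_nonneg.2 hst) (by positivity)
  have h4 := dominated_trans_add hw.self hp h2 h3
  refine dominated_smul_mono hw.zero_mem ?_ h4
  have h5 : (τ - σ) * (J.card * (c * (β * W) * c) * 16392) ≤ 1 * (J.card * (c * (β * W) * c) * 16392) :=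
    mul_le_mul_of_nonneg_right h1 (by positivity)
  linarith [show (16392 + J.card * (c * W * c) * 16392) * β
    = β * 16392 + 1 * (J.card * (c * (β * W) * c) * 16392) by ring]

/-- Fourier modes are estimated separately and summed. The weight `k` must accommodate the degree `d
n` only for coefficients that do not vanish; `d n = k + 1` is allowed for those that do, which the
estimate for `∂_θ g` exploits. -/
theorem exists_cyl_decay {J : Finset (ℤ × (Fin 3 → ℕ))} {d : ℤ → ℕ} (hJ : IsLowSet J d) {k : ℕ}
    (hk : k ≤ 3) (hd : ∀ n, d n ≤ k + 1) {r : ℝ} (hr : 0 ≤ r) : ∃ C : ℝ, 0 ≤ C ∧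
    ∀ (v : ℝ → E → ℝ) (hv : IsPotential v), (∀ s y, v s y ≤ ‖y‖) → ∀ σ τ : ℝ, σ ≤ τ → ∀ u : ℝ → HC,
      LinSol cylBasis cylRate σ τ u (fun s => -(modeProj cylBasis J
        (potOp cylMeasure (hv.comp (f := Prod.fst) measurable_fst) s (u s)))) →
      (∀ t ∈ Icc σ τ, modeProj cylBasis J (u t) = u t) →
      (∀ n : ℤ, d n ≤ k ∧ r ≤ decay (d n) + (n : ℝ) ^ 2 / 2 ∨ coef n (u σ) = 0) → ∀ β : ℝ, 0 ≤ β →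
      (u σ, (β : ℂ) • cylWt k) ∈ dominated cylMeasure →
      (u τ, ((C * Real.exp (-r * (τ - σ)) * β : ℝ) : ℂ) • cylWt k) ∈ dominated cylMeasure := by
  have hw := heatWeight_cylWt hk
  obtain ⟨C₁, hC₁0, hC₁⟩ := lift_coef_dominated hk
  obtain ⟨C₂, hC₂0, hC₂⟩ := cyl_short_time (J := J) hk fun p hp => by
    have := (hJ p.1 p.2).1 hp
    have := hd p.1
    omega
  have hsum := summable_exp_sq one_pos
  have hS0 : 0 ≤ ∑' m : ℤ, Real.exp (-((m : ℝ) ^ 2 / 2 * 1)) := tsum_nonneg fun m => (Real.exp_pos _).le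
  set S := ∑' m : ℤ, Real.exp (-((m : ℝ) ^ 2 / 2 * 1)) with hS
  refine ⟨(C₂ + C₁ * S) * Real.exp r, by positivity, fun v hv hvy σ τ hst u hu hP hn β hβ hi => ?_⟩
  rcases le_total (τ - σ) 1 with h1 | h1
  · refine dominated_smul_mono hw.zero_mem ?_ (hC₂ v hv hvy σ τ hst h1 u hu hP β hβ hi)
    refine mul_le_mul_of_nonneg_right ?_ hβ
    have h2 : 1 ≤ Real.exp r * Real.exp (-r * (τ - σ)) := by
      rw [← Real.exp_add]
      exact Real.one_le_exp (by nlinarith)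
    calc C₂ ≤ C₂ + C₁ * S := le_add_of_nonneg_right (by positivity)
      _ ≤ (C₂ + C₁ * S) * (Real.exp r * Real.exp (-r * (τ - σ))) := le_mul_of_one_le_right (by positivity) h2
      _ = _ := by ring
  have hmode : ∀ n : ℤ, (lift n (coef n (u τ)),
      ((C₁ * (Real.exp r * Real.exp (-r * (τ - σ))) * β * Real.exp (-((n : ℝ) ^ 2 / 2 * 1)) : ℝ) : ℂ)
        • cylWt k) ∈ dominated cylMeasure := by
    intro n
    rcases hn n with ⟨h2, h3⟩ | h2
    · refine dominated_smul_mono hw.zero_mem ?_ (hC₁ J d hJ v hv hvy σ τ hst u hu hP β hβ hi n h2)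
      -- Of the elapsed time, at least `1`, one unit is spent on the summable factor `e^{-n²/2}` and
      -- the rest on decay with rate `r`; this costs `e^r`.
      have h4 : Real.exp (-(decay (d n) + (n : ℝ) ^ 2 / 2) * (τ - σ))
          ≤ Real.exp r * Real.exp (-r * (τ - σ)) * Real.exp (-((n : ℝ) ^ 2 / 2 * 1)) := by
        rw [← Real.exp_add, ← Real.exp_add]
        refine Real.exp_le_exp.2 ?_
        have h5 : 0 ≤ decay (d n) := by
          unfold decay
          split_ifs with h6
          · exact le_rfl
          · have : (1 : ℝ) ≤ d n := by exact_mod_cast Nat.one_le_iff_ne_zero.2 h6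
            linarith
        nlinarith
      calc _ ≤ C₁ * (Real.exp r * Real.exp (-r * (τ - σ)) * Real.exp (-((n : ℝ) ^ 2 / 2 * 1))) * β := by
            gcongr
        _ = _ := by ring
    · rw [coef_eq_zero_of_initial hv hJ hst hu hP h2, map_zero]
      have h3 := dominated_ofReal_smul hw.zero_mem
        (β := C₁ * (Real.exp r * Real.exp (-r * (τ - σ))) * β * Real.exp (-((n : ℝ) ^ 2 / 2 * 1)))
        (by positivity)
      rwa [smul_zero] at h3
  have hsw : HasSum (fun n : ℤ =>
      ((C₁ * (Real.exp r * Real.exp (-r * (τ - σ))) * β * Real.exp (-((n : ℝ) ^ 2 / 2 * 1)) : ℝ) : ℂ)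
        • cylWt k) (((C₁ * (Real.exp r * Real.exp (-r * (τ - σ))) * β * S : ℝ) : ℂ) • cylWt k) :=
    (Complex.hasSum_ofReal.2 (hsum.hasSum.mul_left _)).smul_const (cylWt k)
  have hlim := (hasSum_lift_coef (u τ)).prodMk_nhds hsw
  -- Finite sums are dominated by finite sums of the bounds, and domination is closed under limits
  -- in `L²`.
  have h6 := isClosedCone_dominated.closed.mem_of_tendsto hlim
    (Eventually.of_forall fun F => dominated_sum F fun n _ => hmode n)
  refine dominated_smul_mono hw.zero_mem ?_ h6
  have h7 : 0 ≤ C₂ * Real.exp r * Real.exp (-r * (τ - σ)) * β := by positivity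
  linarith [show (C₂ + C₁ * S) * Real.exp r * Real.exp (-r * (τ - σ)) * β
    = C₂ * Real.exp r * Real.exp (-r * (τ - σ)) * β
      + C₁ * (Real.exp r * Real.exp (-r * (τ - σ))) * β * S by ring]

/-! ### The potential of the cutoff functions -/

section Cutoff

variable {ε : ℝ} {χ : ℝ → ℝ}

theorem IsCutoff.nonneg (hχ : IsCutoff ε χ) (s : ℝ) : 0 ≤ χ s := by
  rw [← hχ.eq_zero (max s (1 + ε)) (le_max_right _ _)]
  exact hχ.antitone (le_max_left _ _)

theorem IsCutoff.differentiable (hχ : IsCutoff ε χ) : Differentiable ℝ χ :=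
  hχ.contDiff.differentiable (by norm_num)

theorem IsCutoff.continuous_deriv (hχ : IsCutoff ε χ) : Continuous (deriv χ) :=
  hχ.contDiff.continuous_deriv (by norm_num)

/-- Behaviour of a cutoff function to the left of the edge `1 + ε`. -/
theorem IsCutoff.exists_edge (hχ : IsCutoff ε χ) : ∃ l < 1 + ε, ∃ K : ℝ, 0 ≤ K ∧
    ∀ s, l < s → s < 1 + ε → 0 < χ s ∧ (1 + ε - s) * |deriv χ s| ≤ K * χ s := by
  obtain ⟨M, hM0, hM⟩ := hχ.edge
  obtain ⟨c₀, hc₀⟩ := (hM 0 (by norm_num)).bound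
  obtain ⟨c₁, hc₁⟩ := (hM 1 (by norm_num)).bound
  obtain ⟨l, hl, hsub⟩ := mem_nhdsLE_iff_exists_Ioc_subset.1 (hc₀.and hc₁)
  have hm : 0 < |M 0| := abs_pos.2 hM0
  -- Within distance `δ` of the edge the error is at most half of the leading term of `χ`, so `χ ≥ 5
  -- |M 0| x^20` while `|χ'|` is at most a multiple of `x^19`.
  set δ : ℝ := min 1 (5 * |M 0| / (|c₀| + 1)) with hδ
  have hδ0 : 0 < δ := lt_min one_pos (by positivity)
  refine ⟨max l (1 + ε - δ), max_lt hl (by linarith), (10 * |M 1| + |c₁|) / (5 * |M 0|), by positivity,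
    fun s hs hs1 => ?_⟩
  obtain ⟨h0, h1⟩ := hsub ⟨(le_max_left _ _).trans_lt hs, hs1.le⟩
  have hsδ : 1 + ε - s < δ := by linarith [(le_max_right l (1 + ε - δ)).trans_lt hs]
  obtain ⟨x, hx⟩ : ∃ x, x = 1 + ε - s := ⟨_, rfl⟩
  rw [← hx] at hsδ ⊢
  have hx0 : 0 < x := by linarith
  have hx1 : x ≤ 1 := hsδ.le.trans (min_le_left _ _)
  have hx2 : (|c₀| + 1) * x ≤ 5 * |M 0| := by
    have := hsδ.le.trans (min_le_right _ _)
    rwa [le_div_iff₀' (by positivity)] at this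
  have ha : |s - 1 - ε| = x := by
    rw [show s - 1 - ε = -x by rw [hx]; ring, abs_neg, abs_of_pos hx0]
  simp only [iteratedDeriv_zero, iteratedDeriv_one, Real.norm_eq_abs, abs_pow, ha, Nat.sub_zero] at h0 h1
  norm_num at h0 h1
  have hlow : 5 * |M 0| * x ^ 20 ≤ χ s := by
    have h2 : |10 * M 0 * (s - 1 - ε) ^ 20| = 10 * |M 0| * x ^ 20 := by
      rw [abs_mul, abs_mul, abs_pow, ha, abs_of_pos (by norm_num : (0 : ℝ) < 10)]
    have h3 := abs_sub_abs_le_abs_sub (10 * M 0 * (s - 1 - ε) ^ 20) (χ s)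
    rw [abs_sub_comm, h2, abs_of_nonneg (hχ.nonneg s)] at h3
    have h4 : c₀ * x ^ 21 ≤ 5 * |M 0| * x ^ 20 := by
      calc c₀ * x ^ 21 ≤ (|c₀| + 1) * x ^ 21 :=
            mul_le_mul_of_nonneg_right ((le_abs_self _).trans (by linarith)) (by positivity)
        _ = (|c₀| + 1) * x * x ^ 20 := by ring
        _ ≤ _ := mul_le_mul_of_nonneg_right hx2 (by positivity)
    linarith
  have hup : |deriv χ s| ≤ (10 * |M 1| + |c₁|) * x ^ 19 := by
    have h2 : |10 * M 1 * (s - 1 - ε) ^ 19| = 10 * |M 1| * x ^ 19 := by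
      rw [abs_mul, abs_mul, abs_pow, ha, abs_of_pos (by norm_num : (0 : ℝ) < 10)]
    have h3 := abs_sub_abs_le_abs_sub (deriv χ s) (10 * M 1 * (s - 1 - ε) ^ 19)
    rw [h2] at h3
    have h4 : c₁ * x ^ 20 ≤ |c₁| * x ^ 19 := by
      calc c₁ * x ^ 20 ≤ |c₁| * x ^ 20 := mul_le_mul_of_nonneg_right (le_abs_self _) (by positivity)
        _ ≤ |c₁| * x ^ 19 :=
          mul_le_mul_of_nonneg_left (pow_le_pow_of_le_one hx0.le hx1 (by norm_num)) (abs_nonneg _)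
    linarith
  refine ⟨lt_of_lt_of_le (by positivity) hlow, ?_⟩
  rw [div_mul_eq_mul_div, le_div_iff₀ (by positivity)]
  have hB : 0 ≤ 10 * |M 1| + |c₁| := by positivity
  have hm' : 0 ≤ 5 * |M 0| := by positivity
  revert hlow hup hB hm'
  generalize |deriv χ s| = D
  generalize 10 * |M 1| + |c₁| = B
  generalize 5 * |M 0| = m
  intro hlow hup hB hm'
  calc x * D * m ≤ x * (B * x ^ 19) * m := by gcongr
    _ = B * (m * x ^ 20) := by rw [pow_succ x 19]; ring
    _ ≤ _ := mul_le_mul_of_nonneg_left hlow hB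

theorem IsCutoff.pos (hχ : IsCutoff ε χ) {s : ℝ} (hs : s < 1 + ε) : 0 < χ s := by
  obtain ⟨l, hl, K, -, hK⟩ := hχ.exists_edge
  have h : max s ((l + (1 + ε)) / 2) < 1 + ε := max_lt hs (by linarith)
  exact (hK _ (lt_max_of_lt_right (by linarith)) h).1.trans_le (hχ.antitone (le_max_left _ _))

/-- Near the edge this is the vanishing order; on the remaining compact interval monotonicity bounds
`χ` below by a positive constant. -/
theorem IsCutoff.exists_ratio (hχ : IsCutoff ε χ) (hε : 0 < ε) : ∃ K : ℝ, 0 ≤ K ∧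
    ∀ s, 0 ≤ s → s < 1 + ε → (1 + ε - s) * |deriv χ s| ≤ K * χ s := by
  obtain ⟨l, hl, K, hK0, hK⟩ := hχ.exists_edge
  obtain ⟨D, hD⟩ := (isCompact_Icc (a := (0 : ℝ)) (b := 1 + ε)).exists_bound_of_continuousOn
    hχ.continuous_deriv.continuousOn
  have hm := hχ.pos hl
  have hD0 : 0 ≤ D := (norm_nonneg _).trans (hD 0 ⟨le_rfl, by linarith⟩)
  refine ⟨max K ((1 + ε) * D / χ l), hK0.trans (le_max_left _ _), fun s hs hs1 => ?_⟩
  rcases lt_or_ge l s with h | h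
  · exact (hK s h hs1).2.trans (mul_le_mul_of_nonneg_right (le_max_left _ _) (hχ.nonneg s))
  · have h1 : |deriv χ s| ≤ D := hD s ⟨hs, hs1.le⟩
    have h2 : χ l ≤ χ s := hχ.antitone h
    calc (1 + ε - s) * |deriv χ s| ≤ (1 + ε) * D := by gcongr; linarith
      _ = (1 + ε) * D / χ l * χ l := by field_simp
      _ ≤ (1 + ε) * D / χ l * χ s := by gcongr
      _ ≤ _ := mul_le_mul_of_nonneg_right (le_max_right _ _) (hχ.nonneg s)

theorem IsCutoff.deriv_eq_zero (hχ : IsCutoff ε χ) {s : ℝ} (hs : s < 1) : deriv χ s = 0 := by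
  have : χ =ᶠ[𝓝 s] fun _ => 1 := by
    filter_upwards [Iio_mem_nhds hs] with t ht using hχ.eq_one t (le_of_lt ht)
  rw [this.deriv_eq, deriv_const]

/-- Differentiate along the ray `t ↦ (1 + t) y`. The origin, where the norm is not differentiable,
is separate and trivial. -/
theorem IsCutoff.fderiv_scaled (hχ : IsCutoff ε χ) (r : ℝ) (y : E) :
    fderiv ℝ (scaledCutoff χ r) y y = ‖y‖ / r * deriv χ (‖y‖ / r) := by
  rcases eq_or_ne y 0 with rfl | hy
  · simp
  have h1 : DifferentiableAt ℝ (scaledCutoff χ r) y := by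
    have h3 : DifferentiableAt ℝ (fun z : E => ‖z‖) y :=
      (contDiffAt_norm ℝ hy).differentiableAt one_ne_zero
    have h2 : DifferentiableAt ℝ (fun z : E => ‖z‖ / r) y := by
      simpa only [div_eq_mul_inv] using h3.mul_const r⁻¹
    exact (hχ.differentiable _).comp y h2
  have hline : HasDerivAt (fun t : ℝ => y + t • y) y 0 := by
    simpa using ((hasDerivAt_id (0 : ℝ)).smul_const y).const_add y
  have h3 : HasDerivAt (fun t : ℝ => scaledCutoff χ r (y + t • y)) (fderiv ℝ (scaledCutoff χ r) y y) 0 := by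
    have h4 : HasFDerivAt (scaledCutoff χ r) (fderiv ℝ (scaledCutoff χ r) y) (y + (0 : ℝ) • y) := by
      simpa using h1.hasFDerivAt
    exact h4.comp_hasDerivAt (0 : ℝ) hline
  have h5 : HasDerivAt (fun t : ℝ => χ ((1 + t) * ‖y‖ / r)) (deriv χ (‖y‖ / r) * (‖y‖ / r)) 0 := by
    have h6 : HasDerivAt (fun t : ℝ => (1 + t) * ‖y‖ / r) (‖y‖ / r) 0 := by
      simpa using ((((hasDerivAt_id (0 : ℝ)).const_add 1).mul_const ‖y‖).div_const r)
    have h7 : HasDerivAt χ (deriv χ (‖y‖ / r)) ((1 + 0) * ‖y‖ / r) := by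
      simpa using (hχ.differentiable (‖y‖ / r)).hasDerivAt
    exact h7.comp (0 : ℝ) h6
  have h8 : (fun t : ℝ => scaledCutoff χ r (y + t • y)) =ᶠ[𝓝 0] fun t : ℝ => χ ((1 + t) * ‖y‖ / r) := by
    filter_upwards [Ioi_mem_nhds (show (-1 : ℝ) < 0 by norm_num)] with t ht
    have h9 : 0 ≤ 1 + t := by have : -1 < t := ht; linarith
    rw [scaledCutoff, show y + t • y = (1 + t) • y by rw [add_smul, one_smul], norm_smul, Real.norm_eq_abs,
      abs_of_nonneg h9]
  rw [(h5.congr_of_eventuallyEq h8).unique h3 |>.symm, mul_comm]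

end Cutoff

section Potential

variable {ε : ℝ} {χ : ℝ → ℝ} {χt : ℝ → E → ℝ}

theorem potentialAt_eq (hχ : IsCutoff ε χ) (r : ℝ) (y : E) :
    potentialAt χ χt r y = |χt r y * (‖y‖ / r * deriv χ (‖y‖ / r)) / χ (‖y‖ / r)| := by
  rw [potentialAt, hχ.fderiv_scaled r, scaledCutoff]

/-- The potential is supported in an annulus, bounded by `|y|`, and jointly continuous. -/
theorem exists_potentialAt_bounds (hε : 0 < ε) (hχ : IsCutoff ε χ) (hχt : IsInnerCutoff ε χt) :
    ∃ r₁ : ℝ, 0 < r₁ ∧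
      ContinuousOn (fun p : ℝ × E => potentialAt χ χt p.1 p.2) (Ici r₁ ×ˢ univ) ∧
      ∀ r ≥ r₁, ∀ y : E, potentialAt χ χt r y ≤ ‖y‖ ∧ (r * (1 + ε) ≤ ‖y‖ → potentialAt χ χt r y = 0) := by
  obtain ⟨c, r₀, hr₀, hcont, hb⟩ := hχt.exists_bounds
  obtain ⟨K, hK0, hK⟩ := hχ.exists_ratio hε
  -- The constant in the final bound `V ≤ A √r`; the threshold `r ≥ A²` turns this into `V ≤ r`.
  set A : ℝ := (1 + ε) * |c| * ((1 + ε) * K) with hA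
  refine ⟨max r₀ (max 1 (A ^ 2)), lt_max_of_lt_left hr₀, ?_, fun r hr y => ?_⟩
  · intro p hp
    have hp0 : r₀ ≤ p.1 := (le_max_left _ _).trans hp.1
    have hpos : 0 < p.1 := hr₀.trans_le hp0
    have hsub : Ici (max r₀ (max 1 (A ^ 2))) ×ˢ (univ : Set E) ⊆ Ici r₀ ×ˢ univ :=
      prod_mono (Ici_subset_Ici.2 (le_max_left _ _)) Subset.rfl
    have hq : ContinuousAt (fun p : ℝ × E => ‖p.2‖ / p.1) p :=
      continuous_snd.norm.continuousAt.div continuous_fst.continuousAt hpos.ne'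
    -- Inside the support of `χ` the quotient is continuous as it stands. At or beyond the edge `χ̃`
    -- vanishes in a whole neighbourhood, so the potential is locally zero.
    rcases lt_or_ge (‖p.2‖ / p.1) (1 + ε) with h | h
    · have h1 : ContinuousWithinAt (fun p : ℝ × E =>
          |χt p.1 p.2 * (‖p.2‖ / p.1 * deriv χ (‖p.2‖ / p.1)) / χ (‖p.2‖ / p.1)|)
          (Ici (max r₀ (max 1 (A ^ 2))) ×ˢ univ) p := by
        refine ContinuousWithinAt.abs (ContinuousWithinAt.div ?_ ?_ (hχ.pos h).ne')
        · refine ((hcont p ⟨hp0, mem_univ _⟩).mono hsub).mul ?_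
          exact (hq.mul (hχ.continuous_deriv.continuousAt.comp hq)).continuousWithinAt
        · exact (hχ.contDiff.continuous.continuousAt.comp hq).continuousWithinAt
      refine h1.congr (fun q _ => ?_) ?_
      · exact potentialAt_eq hχ q.1 q.2
      · exact potentialAt_eq hχ p.1 p.2
    · have hz : ∀ q : ℝ × E, r₀ ≤ q.1 → q.1 * (1 + ε - q.1 ^ (-(1 / 4) : ℝ)) ≤ ‖q.2‖ →
          potentialAt χ χt q.1 q.2 = 0 := by
        intro q hq0 hq
        rw [potentialAt, (hb q.1 hq0).2.2.2.1 q.2 hq]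
        simp
      have hlt : p.1 * (1 + ε - p.1 ^ (-(1 / 4) : ℝ)) < ‖p.2‖ := by
        rw [le_div_iff₀ hpos] at h
        have : 0 < p.1 * p.1 ^ (-(1 / 4) : ℝ) := by positivity
        nlinarith
      have hc : ContinuousAt (fun q : ℝ × E => q.1 * (1 + ε - q.1 ^ (-(1 / 4) : ℝ))) p := by
        refine continuous_fst.continuousAt.mul (continuousAt_const.sub ?_)
        exact continuous_fst.continuousAt.rpow_const (Or.inl hpos.ne')
      have hev : ∀ᶠ q in 𝓝[Ici (max r₀ (max 1 (A ^ 2))) ×ˢ univ] p,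
          potentialAt χ χt q.1 q.2 = 0 := by
        filter_upwards [self_mem_nhdsWithin,
          nhdsWithin_le_nhds (hc.eventually_lt continuous_snd.norm.continuousAt hlt)] with q h1 h2
        exact hz q ((le_max_left _ _).trans h1.1) h2.le
      refine (continuousWithinAt_const (b := (0 : ℝ))).congr_of_eventuallyEq hev (hz p hp0 hlt.le)
  · have hr0 : r₀ ≤ r := (le_max_left _ _).trans hr
    have hr1 : 1 ≤ r := ((le_max_left _ _).trans (le_max_right _ _)).trans hr
    have hrA : A ^ 2 ≤ r := ((le_max_right _ _).trans (le_max_right _ _)).trans hr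
    have hpos : 0 < r := hr₀.trans_le hr0
    obtain ⟨hsm, hnn, -, hzero, hder⟩ := hb r hr0
    have hq4 : 0 < r ^ (-(1 / 4) : ℝ) := by positivity
    have hout : r * (1 + ε - r ^ (-(1 / 4) : ℝ)) ≤ ‖y‖ → potentialAt χ χt r y = 0 := by
      intro h
      rw [potentialAt, hzero y h]
      simp
    refine ⟨?_, fun h => hout (le_trans (by nlinarith) h)⟩
    rcases le_or_gt (r * (1 + ε - r ^ (-(1 / 4) : ℝ))) ‖y‖ with h | h
    · rw [hout h]; exact norm_nonneg y
    rw [potentialAt_eq hχ r]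
    rcases lt_or_ge ‖y‖ r with h1 | h1
    · rw [hχ.deriv_eq_zero ((div_lt_one hpos).2 h1)]
      simp
    have hy0 : 0 < ‖y‖ := hpos.trans_le h1
    have hs : ‖y‖ / r < 1 + ε - r ^ (-(1 / 4) : ℝ) := by rwa [div_lt_iff₀' hpos]
    have hyr : ‖y‖ ≤ (1 + ε) * r := by nlinarith
    -- Mean value theorem along the ray, starting from radius `(1 + ε) r`, where `χ̃` vanishes: the
    -- derivative bound gives growth of order `r^{1/4}` only. No upper bound on `χ̃` itself is
    -- assumed.
    have hχt1 : χt r y ≤ |c| * r ^ (-(3 / 4) : ℝ) * ((1 + ε) * r) := by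
      set z : E := ((1 + ε) * r / ‖y‖) • y with hz
      have hzn : ‖z‖ = (1 + ε) * r := by
        rw [hz, norm_smul, Real.norm_eq_abs, abs_of_nonneg (by positivity), div_mul_cancel₀ _ hy0.ne']
      have hz0 : χt r z = 0 := hzero z (by rw [hzn]; nlinarith)
      have hdist : ‖y - z‖ ≤ (1 + ε) * r := by
        have h2 : y - z = (1 - (1 + ε) * r / ‖y‖) • y := by rw [hz, sub_smul, one_smul]
        have h3 : 1 ≤ (1 + ε) * r / ‖y‖ := (one_le_div hy0).2 hyr
        rw [h2, norm_smul, Real.norm_eq_abs, abs_of_nonpos (by linarith), neg_sub, sub_mul,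
          div_mul_cancel₀ _ hy0.ne']
        linarith
      have h4 := Convex.norm_image_sub_le_of_norm_fderiv_le (𝕜 := ℝ) (f := χt r) (s := univ)
        (C := |c| * r ^ (-(3 / 4) : ℝ)) (x := z) (y := y)
        (fun w _ => hsm.differentiable (by simp) w) (fun w _ => by
          have h5 := hder 1 (Or.inl rfl) w
          rw [norm_iteratedFDeriv_one, Nat.cast_one, mul_one] at h5
          exact h5.trans (mul_le_mul_of_nonneg_right (le_abs_self c) (by positivity)))
        convex_univ (mem_univ _) (mem_univ _)
      rw [hz0, sub_zero] at h4
      exact (Real.le_norm_self _).trans (h4.trans (mul_le_mul_of_nonneg_left hdist (by positivity)))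
    -- On the support of `χ̃` the distance to the edge exceeds `r^{-1/4}`, so the logarithmic
    -- derivative is at most `K r^{1/4}`.
    have hratio : |deriv χ (‖y‖ / r)| / χ (‖y‖ / r) ≤ K * r ^ (1 / 4 : ℝ) := by
      have hlt : ‖y‖ / r < 1 + ε := by linarith
      have h2 := hK (‖y‖ / r) (by positivity) hlt
      have h3 : r ^ (-(1 / 4) : ℝ) * |deriv χ (‖y‖ / r)| ≤ K * χ (‖y‖ / r) :=
        (mul_le_mul_of_nonneg_right (by linarith) (abs_nonneg _)).trans h2
      rw [div_le_iff₀ (hχ.pos hlt)]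
      have h4 : r ^ (1 / 4 : ℝ) * r ^ (-(1 / 4) : ℝ) = 1 := by
        rw [← Real.rpow_add hpos]; norm_num
      calc |deriv χ (‖y‖ / r)| = r ^ (1 / 4 : ℝ) * (r ^ (-(1 / 4) : ℝ) * |deriv χ (‖y‖ / r)|) := by
            rw [← mul_assoc, h4, one_mul]
        _ ≤ r ^ (1 / 4 : ℝ) * (K * χ (‖y‖ / r)) := by gcongr
        _ = _ := by ring
    have h2 : |χt r y * (‖y‖ / r * deriv χ (‖y‖ / r)) / χ (‖y‖ / r)|
        = χt r y * (‖y‖ / r * (|deriv χ (‖y‖ / r)| / χ (‖y‖ / r))) := by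
      rw [abs_div, abs_mul, abs_mul, abs_of_nonneg (hnn y), abs_of_nonneg (hχ.nonneg _),
        abs_of_nonneg (by positivity : 0 ≤ ‖y‖ / r)]
      ring
    rw [h2]
    have hpow : r ^ (-(3 / 4) : ℝ) * r * r ^ (1 / 4 : ℝ) = Real.sqrt r := by
      rw [Real.sqrt_eq_rpow]
      nth_rewrite 2 [← Real.rpow_one r]
      rw [← Real.rpow_add hpos, ← Real.rpow_add hpos]
      norm_num
    have hAr : A * Real.sqrt r ≤ r := by
      have h3 : A ≤ Real.sqrt r := Real.le_sqrt_of_sq_le hrA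
      calc A * Real.sqrt r ≤ Real.sqrt r * Real.sqrt r := by gcongr
        _ = r := Real.mul_self_sqrt hpos.le
    have hquot : ‖y‖ / r ≤ 1 + ε := by rw [div_le_iff₀ hpos]; exact hyr
    have hdiv0 : 0 ≤ |deriv χ (‖y‖ / r)| / χ (‖y‖ / r) := div_nonneg (abs_nonneg _) (hχ.nonneg _)
    calc _ ≤ |c| * r ^ (-(3 / 4) : ℝ) * ((1 + ε) * r) * ((1 + ε) * (K * r ^ (1 / 4 : ℝ))) := by
          gcongr
      _ = A * (r ^ (-(3 / 4) : ℝ) * r * r ^ (1 / 4 : ℝ)) := by rw [hA]; ring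
      _ ≤ r := by rw [hpow]; exact hAr
      _ ≤ ‖y‖ := h1

/-- Time is frozen before `τ₀`, so that the potential is defined and continuous on the whole line.
-/
theorem continuous_radius_max {τ₀ : ℝ} (h : 1 ≤ τ₀) : Continuous fun s => radius τ₀ (max s τ₀) := by
  have h1 : Continuous fun s : ℝ => max s τ₀ := by fun_prop
  unfold radius
  have h2 : Continuous fun s : ℝ => 1 + max s τ₀ - τ₀ := by fun_prop
  have h3 : ∀ s : ℝ, max s τ₀ ≠ 0 := fun s => by
    have := le_max_right s τ₀
    exact (show 0 < max s τ₀ by linarith).ne'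
  have h4 : ∀ s : ℝ, 1 + max s τ₀ - τ₀ ≠ 0 := fun s => by
    have := le_max_right s τ₀
    exact (show 0 < 1 + max s τ₀ - τ₀ by linarith).ne'
  exact (((h1.log h3).const_mul (26 / 5)).add ((h2.log h4).const_mul 100)).sqrt

theorem le_radius {r τ₀ τ : ℝ} (h0 : Real.exp (r ^ 2) ≤ τ₀) (hτ : τ₀ ≤ τ) : r ≤ radius τ₀ τ := by
  have h1 : r ^ 2 ≤ Real.log τ := by
    rw [Real.le_log_iff_exp_le ((Real.exp_pos _).trans_le (h0.trans hτ))]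
    exact h0.trans hτ
  have h2 : 0 ≤ Real.log (1 + τ - τ₀) := Real.log_nonneg (by linarith)
  exact Real.le_sqrt_of_sq_le (by nlinarith [sq_nonneg r])

/-- The threshold makes `ln τ ≥ r₁²`, hence `R(τ) ≥ r₁`. This is the only place where `τ₀` has to be
large. -/
theorem exists_isPotential (hε : 0 < ε) (hχ : IsCutoff ε χ) (hχt : IsInnerCutoff ε χt) :
    ∃ τmin : ℝ, 0 < τmin ∧ ∀ τ₀ : ℝ, τmin ≤ τ₀ →
      IsPotential (fun s => potential χ χt τ₀ (max s τ₀)) ∧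
      ∀ s y, potential χ χt τ₀ (max s τ₀) y ≤ ‖y‖ := by
  obtain ⟨r₁, hr₁, hcont, hb⟩ := exists_potentialAt_bounds hε hχ hχt
  refine ⟨Real.exp (r₁ ^ 2), Real.exp_pos _, fun τ₀ hτ₀ => ?_⟩
  have h1 : 1 ≤ τ₀ := (Real.one_le_exp (sq_nonneg _)).trans hτ₀
  set ρ : ℝ → ℝ := fun s => radius τ₀ (max s τ₀) with hρ
  have hρc : Continuous ρ := continuous_radius_max h1
  have hρr : ∀ s, r₁ ≤ ρ s := fun s => le_radius hτ₀ (le_max_right _ _)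
  have hV : (fun s => potential χ χt τ₀ (max s τ₀)) = fun s => potentialAt χ χt (ρ s) := rfl
  have hVc : Continuous fun p : ℝ × E => potentialAt χ χt (ρ p.1) p.2 :=
    hcont.comp_continuous ((hρc.comp continuous_fst).prodMk continuous_snd)
      fun p => ⟨hρr p.1, mem_univ _⟩
  refine ⟨?_, fun s y => (hb _ (hρr s) y).1⟩
  rw [hV]
  refine ⟨fun s => (hVc.comp (Continuous.prodMk_right s)).measurable, fun s y => abs_nonneg _, fun T => ?_,
    fun s δ hδ => ?_⟩
  · obtain ⟨L, hL⟩ := (isCompact_Icc (a := τ₀) (b := max T τ₀)).exists_bound_of_continuousOn hρc.continuousOn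
    refine ⟨L * (1 + ε), fun s hs y => ?_⟩
    have h2 : ρ s ≤ L := by
      have h3 := hL (max s τ₀) ⟨le_max_right _ _, max_le_max hs le_rfl⟩
      rw [show ρ (max s τ₀) = ρ s by simp [hρ]] at h3
      exact (Real.le_norm_self _).trans h3
    rcases le_total (ρ s * (1 + ε)) ‖y‖ with h | h
    · rw [(hb _ (hρr s) y).2 h]
      have := hr₁.trans_le ((hρr s).trans h2)
      positivity
    · exact (hb _ (hρr s) y).1.trans (h.trans (mul_le_mul_of_nonneg_right h2 (by linarith)))
  -- For nearby times all supports lie in one ball, and there joint continuity is uniform by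
  -- compactness.
  · have hk : IsCompact (Metric.closedBall (0 : E) ((ρ s + 1) * (1 + ε))) := isCompact_closedBall _ _
    obtain ⟨w, hw, hwu⟩ := hk.mem_uniformity_of_prod (s := univ) (q := s)
      (f := fun s y => potentialAt χ χt (ρ s) y) hVc.continuousOn (mem_univ s) (Metric.dist_mem_uniformity hδ)
    rw [nhdsWithin_univ] at hw
    filter_upwards [hw, hρc.continuousAt.eventually (Iio_mem_nhds (lt_add_one (ρ s)))] with s' h2 h3 y
    rcases le_total ((ρ s + 1) * (1 + ε)) ‖y‖ with h | h
    · have h3' : ρ s' < ρ s + 1 := h3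
      rw [(hb _ (hρr s) y).2 (by nlinarith), (hb _ (hρr s') y).2 (by nlinarith)]
      simpa using hδ.le
    · have h4 := hwu s' h2 y (by simpa using h)
      exact le_of_lt h4

end Potential

/-! ### From propagators to evolution equations -/

section Reduction

variable {H : Type*} [NormedAddCommGroup H] [InnerProductSpace ℂ H] {ι : Type*}
  {b : HilbertBasis ι ℂ H} {ν : ι → ℝ} {c : ℝ} {B : ℝ → H →L[ℂ] H} {A : ℝ → Set (H × H)} {τ₀ : ℝ}

/-- Rescaling removes a constant from the projected equation. -/
theorem rescale_projected {J : Finset ι} {σ τ : ℝ} {u : ℝ → H}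
    (hP : ∀ t ∈ Icc σ τ, modeProj b J (u t) = u t)
    (hu : LinSol b (fun i => ν i + c) σ τ u (fun s => -(modeProj b J (B s (u s))))) :
    (∀ t ∈ Icc σ τ, modeProj b J (((Real.exp (c * (t - σ)) : ℝ) : ℂ) • u t)
      = ((Real.exp (c * (t - σ)) : ℝ) : ℂ) • u t) ∧
    LinSol b ν σ τ (fun s => ((Real.exp (c * (s - σ)) : ℝ) : ℂ) • u s)
      (fun s => -(modeProj b J (B s (((Real.exp (c * (s - σ)) : ℝ) : ℂ) • u s)))) := by
  refine ⟨fun t ht => by rw [map_smul, hP t ht], ?_⟩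
  have h := hu.rescale (-c) σ
  simp only [add_neg_cancel_right, neg_neg] at h
  refine h.congr (fun _ _ => rfl) fun s _ => ?_
  rw [map_smul, map_smul, smul_neg]

variable [CompleteSpace H]

theorem exists_compressed_propagator [Countable ι] (hν : ∀ i, 0 ≤ ν i) (hB : Continuous B)
    (hpos : ∀ s, IsPos (B s)) (hA : ∀ s ≥ τ₀, HasModes b (fun i => ν i + c) (B s) (A s))
    (h0 : ∀ s ≥ τ₀, ((0 : H), (0 : H)) ∈ A s) (J : Finset ι) :
    ∃ U, IsPropagator (fun s => compression (modeProj b J) (A s)) τ₀ U := by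
  refine exists_isPropagator b (ν := killRate J fun i => ν i + c) (m := |c|) (fun i => ?_)
    (continuous_compressOp hB b J) (fun s => (hpos s).compressOp b J)
    fun s hs => (hA s hs).compression (h0 s hs) J
  have h1 := neg_abs_le c
  by_cases hi : i ∈ J
  · rw [killRate_of_mem hi]; linarith [abs_nonneg c]
  · rw [killRate_of_notMem hi]; linarith [hν i]

theorem exists_propagator [Countable ι] (hν : ∀ i, 0 ≤ ν i) (hB : Continuous B)
    (hpos : ∀ s, IsPos (B s)) (hA : ∀ s ≥ τ₀, HasModes b (fun i => ν i + c) (B s) (A s)) :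
    ∃ U, IsPropagator A τ₀ U :=
  exists_isPropagator b (m := |c|) (fun i => by linarith [neg_abs_le c, hν i]) hB hpos hA

/-- Data in the range of the projection stay there, so the compressed generator may be replaced by
the diagonal operator and a source projected on the outside only. -/
theorem compressed_linSol {J : Finset ι} (hB : Continuous B)
    (hpos : ∀ s, IsPos (B s)) (hA : ∀ s ≥ τ₀, HasModes b (fun i => ν i + c) (B s) (A s))
    (h0 : ∀ s ≥ τ₀, ((0 : H), (0 : H)) ∈ A s) {U : ℝ → ℝ → H →L[ℂ] H}
    (hU : IsPropagator (fun s => compression (modeProj b J) (A s)) τ₀ U) {σ τ : ℝ} (hσ : τ₀ ≤ σ)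
    {g : H} (hg : modeProj b J g = g) :
    (∀ t ∈ Icc σ τ, modeProj b J (U t σ g) = U t σ g) ∧
      LinSol b (fun i => ν i + c) σ τ (fun s => U s σ g) (fun s => -(modeProj b J (B s (U s σ g)))) := by
  refine LinSol.of_compressed (hU.linSol (continuous_compressOp hB b J) (fun s => (hpos s).compressOp b J)
    (fun s hs => (hA s hs).compression (h0 s hs) J) hσ g) ?_
  rw [hU.self σ hσ]
  exact hg

theorem free_linSol (hB : Continuous B) (hpos : ∀ s, IsPos (B s))
    (hA : ∀ s ≥ τ₀, HasModes b (fun i => ν i + c) (B s) (A s)) {U : ℝ → ℝ → H →L[ℂ] H}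
    (hU : IsPropagator A τ₀ U) {σ τ : ℝ} (hσ : τ₀ ≤ σ) (g : H) :
    (∀ t ∈ Icc σ τ, modeProj b ∅ (U t σ g) = U t σ g) ∧
      LinSol b (fun i => ν i + c) σ τ (fun s => U s σ g) (fun s => -(modeProj b ∅ (B s (U s σ g)))) := by
  refine ⟨fun t _ => modeProj_empty b _, ?_⟩
  simp only [modeProj_empty]
  exact hU.linSol hB hpos hA hσ g

end Reduction

section Projection

variable {X : Type*} [MeasurableSpace X] {μ : Measure X} {ι : Type*}

/-- The projection subtracts finitely many modes, each bounded by the weight, with coefficients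
bounded by the `L²` norm of `g`. -/
theorem modeProj_dominated {b : HilbertBasis ι ℂ (Lp ℂ 2 μ)} {J : Finset ι} {w : Lp ℂ 2 μ} {c : ℝ}
    (hb : ∀ i ∈ J, (b i, (c : ℂ) • w) ∈ dominated μ) (hw : ((0 : Lp ℂ 2 μ), w) ∈ dominated μ) (hc : 0 ≤ c)
    {β : ℝ} (hβ : 0 ≤ β) {g : Lp ℂ 2 μ} (hg : (g, (β : ℂ) • w) ∈ dominated μ) :
    (modeProj b J g, (((1 + J.card * (‖w‖ * c)) * β : ℝ) : ℂ) • w) ∈ dominated μ := by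
  have h1 : (∑ i ∈ J, (inner ℂ (b i) g : ℂ) • b i, ∑ i ∈ J, ((β * ‖w‖ * c : ℝ) : ℂ) • w) ∈ dominated μ := by
    refine dominated_sum J fun i hi => ?_
    refine dominated_smul_mono hw ?_ (dominated_norm_smul (hb i hi) (inner ℂ (b i) g))
    refine mul_le_mul_of_nonneg_right ?_ hc
    refine (norm_inner_le_norm _ _).trans ?_
    rw [b.orthonormal.1 i, one_mul]
    exact norm_le_of_dominated hβ hg
  have h2 := dominated_norm_smul (c := J.card * (β * ‖w‖ * c)) (w := w)
    (u := ∑ i ∈ J, (inner ℂ (b i) g : ℂ) • b i) (by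
      rw [Finset.sum_const, ← Nat.cast_smul_eq_nsmul ℂ, smul_smul] at h1
      rw [Complex.ofReal_mul, Complex.ofReal_natCast]
      exact h1) (-1)
  have h3 := dominated_add_smul hg h2
  rw [modeProj_apply, sub_eq_add_neg, ← neg_one_smul ℂ]
  refine dominated_smul_mono hw (le_of_eq ?_) h3
  simp only [norm_neg, norm_one]
  ring

end Projection

/-! ### Weighted norms -/

theorem weight_mul_wt (k : ℕ) (y : E) : weight k y * wt k y = 1 := by
  have h1 : (0 : ℝ) < 1 + ‖y‖ ^ 2 := by positivity
  have h2 : jap y ^ k = (1 + ‖y‖ ^ 2) ^ ((k : ℝ) / 2) := by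
    rw [jap, Real.sqrt_eq_rpow, ← Real.rpow_natCast, ← Real.rpow_mul h1.le]
    congr 1; ring
  rw [weight, wt, gauss, h2]
  have h3 : Real.exp (‖y‖ ^ 2 / 8) * Real.exp (-(‖y‖ ^ 2) / 8) = 1 := by
    rw [← Real.exp_add, ← Real.exp_zero]; congr 1; ring
  have h4 : (1 + ‖y‖ ^ 2) ^ (-((k : ℝ) / 2)) * (1 + ‖y‖ ^ 2) ^ ((k : ℝ) / 2) = 1 := by
    rw [← Real.rpow_add h1, neg_add_cancel, Real.rpow_zero]
  calc _ = (1 + ‖y‖ ^ 2) ^ (-((k : ℝ) / 2)) * (1 + ‖y‖ ^ 2) ^ ((k : ℝ) / 2)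
      * (Real.exp (‖y‖ ^ 2 / 8) * Real.exp (-(‖y‖ ^ 2) / 8)) := by ring
    _ = 1 := by rw [h3, h4, one_mul]

theorem norm_le_mul_wt_iff (k : ℕ) (y : E) (z : ℂ) (β : ℝ) :
    ‖((weight k y : ℝ) : ℂ) * z‖ ≤ β ↔ ‖z‖ ≤ β * wt k y := by
  have h1 := weight_mul_wt k y
  have h2 := wt_pos k y
  have h3 : weight k y = (wt k y)⁻¹ := eq_inv_of_mul_eq_one_left h1
  rw [norm_mul, Complex.norm_real, Real.norm_eq_abs, h3, abs_of_pos (inv_pos.2 h2), inv_mul_le_iff₀ h2,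
    mul_comm]

/-- If the norm of `g` is infinite, `A > 0` makes the right side infinite; otherwise that norm
itself is an admissible `β`. -/
theorem eLpNorm_weight_le {X : Type*} [MeasurableSpace X] {μ : Measure X} {p : X → E} {k : ℕ} {x g : X → ℂ}
    {A : ℝ} (hA : 0 < A)
    (h : ∀ β : ℝ, 0 ≤ β → (∀ᵐ z ∂μ, ‖g z‖ ≤ β * wt k (p z)) → ∀ᵐ z ∂μ, ‖x z‖ ≤ A * β * wt k (p z)) :
    eLpNorm (fun z => ((weight k (p z) : ℝ) : ℂ) * x z) ∞ μ
      ≤ ENNReal.ofReal A * eLpNorm (fun z => ((weight k (p z) : ℝ) : ℂ) * g z) ∞ μ := by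
  rcases eq_or_ne (eLpNorm (fun z => ((weight k (p z) : ℝ) : ℂ) * g z) ∞ μ) ⊤ with h1 | h1
  · rw [h1, ENNReal.mul_top (by simpa using hA)]
    exact le_top
  rw [← ENNReal.ofReal_toReal h1, ← ENNReal.ofReal_mul hA.le]
  set β := (eLpNorm (fun z => ((weight k (p z) : ℝ) : ℂ) * g z) ∞ μ).toReal with hβ
  have hβ0 : 0 ≤ β := ENNReal.toReal_nonneg
  have h2 : ∀ᵐ z ∂μ, ‖g z‖ ≤ β * wt k (p z) := by
    filter_upwards [ae_le_eLpNormEssSup (f := fun z => ((weight k (p z) : ℝ) : ℂ) * g z) (μ := μ)] with z hz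
    rw [← norm_le_mul_wt_iff]
    rw [← eLpNorm_exponent_top] at hz
    rw [← toReal_enorm]
    exact ENNReal.toReal_mono h1 hz
  rw [eLpNorm_exponent_top]
  refine eLpNormEssSup_le_of_ae_bound ?_
  filter_upwards [h β hβ0 h2] with z hz
  rwa [norm_le_mul_wt_iff]

theorem normE_le_of_dominated {k : ℕ} {x g : HE} {A : ℝ} (hA : 0 < A)
    (h : ∀ β : ℝ, 0 ≤ β → (g, (β : ℂ) • wtVec k) ∈ dominated volume →
      (x, ((A * β : ℝ) : ℂ) • wtVec k) ∈ dominated volume) :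
    normE k x ≤ ENNReal.ofReal A * normE k g :=
  eLpNorm_weight_le (p := fun y => y) hA fun β hβ hg =>
    (wtVec_dominated_iff k x _).1 (h β hβ ((wtVec_dominated_iff k g β).2 hg))

theorem normC_le_of_dominated {k : ℕ} {x g : HC} {A : ℝ} (hA : 0 < A)
    (h : ∀ β : ℝ, 0 ≤ β → (g, (β : ℂ) • cylWt k) ∈ dominated cylMeasure →
      (x, ((A * β : ℝ) : ℂ) • cylWt k) ∈ dominated cylMeasure) :
    normC k x ≤ ENNReal.ofReal A * normC k g :=
  eLpNorm_weight_le (p := Prod.fst) hA fun β hβ hg =>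
    (cylWt_dominated_iff k x _).1 (h β hβ ((cylWt_dominated_iff k g β).2 hg))

/-! ### Weighted bounds for propagators -/

/-- An exponential bound for the rescaled equation gives one for the equation itself. -/
theorem dominated_of_rescaled {X : Type*} [MeasurableSpace X] {μ : Measure X} {u w : Lp ℂ 2 μ}
    {c r t C β : ℝ}
    (h : (((Real.exp (c * t) : ℝ) : ℂ) • u, ((C * Real.exp (-r * t) * β : ℝ) : ℂ) • w) ∈ dominated μ) :
    (u, ((C * Real.exp (-(r + c) * t) * β : ℝ) : ℂ) • w) ∈ dominated μ := by
  have h1 := dominated_ofReal_smul h (Real.exp_pos (-(c * t))).le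
  rw [smul_smul, smul_smul, ← Complex.ofReal_mul, ← Complex.ofReal_mul, ← Real.exp_add, neg_add_cancel,
    Real.exp_zero, Complex.ofReal_one, one_smul] at h1
  convert h1 using 4
  rw [show -(r + c) * t = -(c * t) + -r * t by ring, Real.exp_add]
  ring

theorem exists_decay_projected {d k : ℕ} (hdk : d ≤ k) (hk : k ≤ 3) : ∃ C : ℝ, 0 < C ∧
    ∀ (v : ℝ → E → ℝ) (hv : IsPotential v), (∀ s y, v s y ≤ ‖y‖) → ∀ (c σ τ : ℝ), σ ≤ τ → ∀ (u : ℝ → HE) (g : HE),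
      LinSol hermBasis (fun α => rate α + c) σ τ u
        (fun s => -(modeProj hermBasis (lowModes d) (potOp volume hv s (u s)))) →
      (∀ t ∈ Icc σ τ, modeProj hermBasis (lowModes d) (u t) = u t) →
      u σ = modeProj hermBasis (lowModes d) g →
      normE k (u τ) ≤ ENNReal.ofReal (C * Real.exp (-(decay d + c) * (τ - σ))) * normE k g := by
  obtain ⟨C, hC0, hC⟩ := exists_weighted_decay hdk hk
  obtain ⟨c', hc0, hcb, -⟩ := exists_mode_const d
  have hw := heatWeight_wtVec hk
  -- The summand `1` makes the constant strictly positive, as needed when the right side is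
  -- infinite.
  refine ⟨C * (1 + (lowModes d).card * (‖wtVec k‖ * c')) + 1, by positivity,
    fun v hv hvy c σ τ hst u g hu hP h0 => normE_le_of_dominated (by positivity) fun β hβ hg => ?_⟩
  obtain ⟨h1, h2⟩ := rescale_projected hP hu
  have h3 := modeProj_dominated (fun α hα => hermVec_dominated (hcb α hα k hdk)) hw.zero_mem hc0 hβ hg
  have h4 := hC v hv hvy σ τ hst _ h2 h1 ((1 + (lowModes d).card * (‖wtVec k‖ * c')) * β) (by positivity) (by
    simpa [h0] using h3)
  have h5 := dominated_of_rescaled h4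
  refine dominated_smul_mono hw.zero_mem ?_ h5
  have h6 : 0 ≤ Real.exp (-(decay d + c) * (τ - σ)) * β := by positivity
  linarith [show (C * (1 + (lowModes d).card * (‖wtVec k‖ * c')) + 1) * Real.exp (-(decay d + c) * (τ - σ)) * β
    = C * Real.exp (-(decay d + c) * (τ - σ)) * ((1 + (lowModes d).card * (‖wtVec k‖ * c')) * β)
      + Real.exp (-(decay d + c) * (τ - σ)) * β by ring]

theorem exists_cyl_decay_projected {J : Finset (ℤ × (Fin 3 → ℕ))} {d : ℤ → ℕ} (hJ : IsLowSet J d) {k : ℕ}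
    (hk : k ≤ 3) (hd : ∀ n, d n ≤ k + 1) {r : ℝ} (hr : 0 ≤ r) : ∃ C : ℝ, 0 < C ∧
    ∀ (v : ℝ → E → ℝ) (hv : IsPotential v), (∀ s y, v s y ≤ ‖y‖) → ∀ (c σ τ : ℝ), σ ≤ τ → ∀ (u : ℝ → HC) (g : HC),
      LinSol cylBasis (fun p => cylRate p + c) σ τ u (fun s => -(modeProj cylBasis J
        (potOp cylMeasure (hv.comp (f := Prod.fst) measurable_fst) s (u s)))) →
      (∀ t ∈ Icc σ τ, modeProj cylBasis J (u t) = u t) →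
      u σ = modeProj cylBasis J g →
      (∀ n : ℤ, d n ≤ k ∧ r ≤ decay (d n) + (n : ℝ) ^ 2 / 2 ∨ coef n g = 0) →
      normC k (u τ) ≤ ENNReal.ofReal (C * Real.exp (-(r + c) * (τ - σ))) * normC k g := by
  obtain ⟨C, hC0, hC⟩ := exists_cyl_decay hJ hk hd hr
  obtain ⟨c', hc0, hcb, -⟩ := cyl_modes_bound (J := J) (k := k) fun p hp => by
    have := (hJ p.1 p.2).1 hp
    have := hd p.1
    omega
  have hw := heatWeight_cylWt hk
  refine ⟨C * (1 + J.card * (‖cylWt k‖ * c')) + 1, by positivity,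
    fun v hv hvy c σ τ hst u g hu hP h0 hn => normC_le_of_dominated (by positivity) fun β hβ hg => ?_⟩
  obtain ⟨h1, h2⟩ := rescale_projected hP hu
  have h3 := modeProj_dominated hcb hw.zero_mem hc0 hβ hg
  have h4 := hC v hv hvy σ τ hst _ h2 h1 (fun n => (hn n).imp_right fun h => by
    simp [h0, coef_modeProj hJ, h]) ((1 + J.card * (‖cylWt k‖ * c')) * β) (by positivity) (by
    simpa [h0] using h3)
  have h5 := dominated_of_rescaled h4
  refine dominated_smul_mono hw.zero_mem ?_ h5
  have h6 : 0 ≤ Real.exp (-(r + c) * (τ - σ)) * β := by positivity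
  linarith [show (C * (1 + J.card * (‖cylWt k‖ * c')) + 1) * Real.exp (-(r + c) * (τ - σ)) * β
    = C * Real.exp (-(r + c) * (τ - σ)) * ((1 + J.card * (‖cylWt k‖ * c')) * β)
      + Real.exp (-(r + c) * (τ - σ)) * β by ring]

/-! ### The projections in the Hermite basis -/

/-- Up to nonzero factors, `S` consists of the Hermite functions of degree less than `d`. -/
structure IsModeSet (S : Set (E → ℝ)) (d : ℕ) : Prop where
  eq_mode : ∀ p ∈ S, ∃ α, deg α < d ∧ ∃ c : ℝ, ∀ y, p y = c * hermFun α y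
  exists_mode : ∀ α, deg α < d → ∃ p ∈ S, ∃ c : ℝ, c ≠ 0 ∧ ∀ y, p y = c * hermFun α y

theorem eval_herm_zero (s : ℝ) : (herm 0).eval s = 1 := by simp [herm]

theorem eval_herm_one (s : ℝ) : (herm 1).eval s = s := by simp [herm]

theorem eval_herm_two (s : ℝ) : (herm 2).eval s = s ^ 2 - 2 := by
  simp [herm]; ring

theorem hermFun_zero (y : E) : hermFun 0 y = gauss y := by
  simp [hermFun_eq, eval_herm_zero]

theorem hermFun_single_one (k : Fin 3) (y : E) : hermFun (Pi.single k 1) y = gauss y * y k := by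
  rw [hermFun_eq, Finset.prod_eq_single k (fun i _ hi => by simp [hi, eval_herm_zero]) (by simp),
    Pi.single_eq_same, eval_herm_one, mul_comm]

theorem hermFun_single_two (k : Fin 3) (y : E) : hermFun (Pi.single k 2) y = gauss y * (y k ^ 2 - 2) := by
  rw [hermFun_eq, Finset.prod_eq_single k (fun i _ hi => by simp [hi, eval_herm_zero]) (by simp),
    Pi.single_eq_same, eval_herm_two, mul_comm]

theorem hermFun_pair {m n : Fin 3} (hmn : m ≠ n) (y : E) :
    hermFun (Pi.single m 1 + Pi.single n 1) y = gauss y * (y m * y n) := by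
  rw [hermFun_eq, Finset.prod_eq_mul m n hmn (fun i _ hi => by simp [hi.1, hi.2, eval_herm_zero])
    (by simp) (by simp)]
  simp [hmn, hmn.symm, eval_herm_one, mul_comm]

theorem deg_single (k : Fin 3) (n : ℕ) : deg (Pi.single k n) = n := by
  simp [deg]

theorem deg_pair (m n : Fin 3) : deg (Pi.single m 1 + Pi.single n 1) = 2 := by
  simp [deg, Finset.sum_add_distrib]

theorem eq_zero_of_deg {α : Fin 3 → ℕ} (h : deg α < 1) : α = 0 := by
  have h1 : ∑ i, α i = 0 := Nat.lt_one_iff.1 h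
  funext i
  exact (Finset.sum_eq_zero_iff.1 h1) i (Finset.mem_univ i)

theorem exists_single_add {α : Fin 3 → ℕ} {n : ℕ} (h : deg α = n + 1) :
    ∃ k β, deg β = n ∧ α = Pi.single k 1 + β := by
  obtain ⟨k, hk⟩ : ∃ k, α k ≠ 0 := by
    by_contra! h1
    rw [deg, Finset.sum_eq_zero fun i _ => h1 i] at h
    omega
  have h2 : α = Pi.single k 1 + (α - Pi.single k 1) := by
    funext i
    rcases eq_or_ne i k with rfl | hi
    · simp; omega
    · simp [hi]
  refine ⟨k, α - Pi.single k 1, ?_, h2⟩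
  have h3 : deg α = deg (Pi.single k 1) + deg (α - Pi.single k 1) := by
    conv_lhs => rw [h2]
    simp only [deg, Pi.add_apply, Finset.sum_add_distrib]
  rw [deg_single] at h3
  omega

theorem eq_single_of_deg {α : Fin 3 → ℕ} (h : deg α = 1) : ∃ k, α = Pi.single k 1 := by
  obtain ⟨k, β, hβ, rfl⟩ := exists_single_add (n := 0) h
  exact ⟨k, by rw [eq_zero_of_deg (by omega : deg β < 1), add_zero]⟩

theorem eq_pair_of_deg {α : Fin 3 → ℕ} (h : deg α = 2) :
    (∃ k, α = Pi.single k 2) ∨ ∃ m n, m ≠ n ∧ α = Pi.single m 1 + Pi.single n 1 := by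
  obtain ⟨m, β, hβ, rfl⟩ := exists_single_add (n := 1) h
  obtain ⟨n, rfl⟩ := eq_single_of_deg hβ
  rcases eq_or_ne m n with rfl | hmn
  · exact Or.inl ⟨m, by rw [← Pi.single_add]⟩
  · exact Or.inr ⟨m, n, hmn, rfl⟩

theorem isModeSet_empty : IsModeSet ∅ 0 :=
  ⟨fun p hp => absurd hp (notMem_empty p), fun _ hα => absurd hα (Nat.not_lt_zero _)⟩

theorem isModeSet_gauss : IsModeSet {gauss} 1 := by
  refine ⟨?_, fun α hα => ⟨gauss, rfl, 1, one_ne_zero, fun y => ?_⟩⟩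
  · rintro _ rfl
    exact ⟨0, by simp [deg], 1, fun y => by rw [hermFun_zero, one_mul]⟩
  · rw [eq_zero_of_deg hα, hermFun_zero, one_mul]

theorem isModeSet_modes4 : IsModeSet modes4 2 := by
  refine ⟨?_, fun α hα => ?_⟩
  · rintro _ (rfl | ⟨k, rfl⟩)
    · exact ⟨0, by simp [deg], 1, fun y => by rw [hermFun_zero, one_mul]⟩
    · exact ⟨Pi.single k 1, by rw [deg_single]; norm_num, 1, fun y => by rw [hermFun_single_one, one_mul]⟩
  · rcases Nat.lt_or_ge (deg α) 1 with h | h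
    · exact ⟨gauss, Or.inl rfl, 1, one_ne_zero, fun y => by rw [eq_zero_of_deg h, hermFun_zero, one_mul]⟩
    · obtain ⟨k, rfl⟩ := eq_single_of_deg (by omega : deg α = 1)
      exact ⟨_, Or.inr ⟨k, rfl⟩, 1, one_ne_zero, fun y => by rw [hermFun_single_one, one_mul]⟩

theorem isModeSet_modes10 : IsModeSet modes10 3 := by
  refine ⟨?_, fun α hα => ?_⟩
  · rintro p ((hp | ⟨k, rfl⟩) | ⟨m, n, hmn, rfl⟩)
    · obtain ⟨α, hα, h⟩ := isModeSet_modes4.eq_mode p hp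
      exact ⟨α, by omega, h⟩
    · exact ⟨Pi.single k 2, by rw [deg_single]; norm_num, 1 / 2, fun y => by rw [hermFun_single_two]; ring⟩
    · exact ⟨Pi.single m 1 + Pi.single n 1, by rw [deg_pair]; norm_num, 1, fun y => by rw [hermFun_pair hmn, one_mul]⟩
  · rcases Nat.lt_or_ge (deg α) 2 with h | h
    · obtain ⟨p, hp, h1⟩ := isModeSet_modes4.exists_mode α h
      exact ⟨p, Or.inl (Or.inl hp), h1⟩
    · rcases eq_pair_of_deg (by omega : deg α = 2) with ⟨k, rfl⟩ | ⟨m, n, hmn, rfl⟩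
      · exact ⟨_, Or.inl (Or.inr ⟨k, rfl⟩), 1 / 2, by norm_num, fun y => by rw [hermFun_single_two]; ring⟩
      · exact ⟨_, Or.inr ⟨m, n, hmn, rfl⟩, 1, one_ne_zero, fun y => by rw [hermFun_pair hmn, one_mul]⟩

theorem sqrt_hermSq_pos (α : Fin 3 → ℕ) : 0 < Real.sqrt (hermSq α) := Real.sqrt_pos.2 (hermSq_pos α)

theorem hermFun_eq_hermN (α : Fin 3 → ℕ) (y : E) : hermFun α y = Real.sqrt (hermSq α) * hermN α y := by
  rw [hermN, mul_inv_cancel_left₀ (sqrt_hermSq_pos α).ne']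

theorem projAway_modes {S : Set (E → ℝ)} {d : ℕ} (hS : IsModeSet S d) :
    projAway volume S = modeProj hermBasis (lowModes d) := by
  have key : ∀ (α : Fin 3 → ℕ) (c : ℝ), (((c * Real.sqrt (hermSq α) : ℝ) : ℂ) • hermBasis α : HE)
      =ᵐ[volume] fun y => ((c * hermFun α y : ℝ) : ℂ) := by
    intro α c
    rw [hermBasis_apply]
    filter_upwards [hermVec_ae α, Lp.coeFn_smul ((c * Real.sqrt (hermSq α) : ℝ) : ℂ) (hermVec α)] with y h1 h2
    rw [h2, Pi.smul_apply, h1, smul_eq_mul, ← Complex.ofReal_mul, hermFun_eq_hermN, mul_assoc]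
  refine projAway_eq_modeProj hermBasis (lowModes d) (fun p hp f hf => ?_) fun α hα => ?_
  · obtain ⟨α, hα, c, hc⟩ := hS.eq_mode p hp
    have h1 : f = ((c * Real.sqrt (hermSq α) : ℝ) : ℂ) • hermBasis α := by
      refine Lp.ext (hf.trans ?_)
      simp only [hc]
      exact (key α c).symm
    rw [h1]
    exact Submodule.smul_mem _ _ (Submodule.subset_span ⟨α, by simpa [mem_lowModes] using hα, rfl⟩)
  · obtain ⟨p, hp, c, hc0, hc⟩ := hS.exists_mode α (mem_lowModes.1 hα)
    have h0 : ((c * Real.sqrt (hermSq α) : ℝ) : ℂ) ≠ 0 := by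
      exact_mod_cast mul_ne_zero hc0 (sqrt_hermSq_pos α).ne'
    rw [← inv_smul_smul₀ h0 (hermBasis α)]
    refine Submodule.smul_mem _ _ (Submodule.subset_span ⟨p, hp, ?_⟩)
    simp only [hc]
    exact key α c

theorem cos_eq_em (θ : ℝ) : ((Real.cos θ : ℝ) : ℂ)
    = ((Real.sqrt (2 * Real.pi) : ℝ) : ℂ) * (1 / 2) * (em 1 θ + em (-1) θ) := by
  have h0 : ((Real.sqrt (2 * Real.pi) : ℝ) : ℂ) ≠ 0 := by exact_mod_cast sqrt_two_pi_pos.ne'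
  rw [em, em, Complex.ofReal_cos, Complex.cos, Complex.ofReal_inv]
  push_cast
  field_simp

theorem sin_eq_em (θ : ℝ) : ((Real.sin θ : ℝ) : ℂ)
    = ((Real.sqrt (2 * Real.pi) : ℝ) : ℂ) * (-Complex.I / 2) * (em 1 θ - em (-1) θ) := by
  have h0 : ((Real.sqrt (2 * Real.pi) : ℝ) : ℂ) ≠ 0 := by exact_mod_cast sqrt_two_pi_pos.ne'
  rw [em, em, Complex.ofReal_sin, Complex.sin, Complex.ofReal_inv]
  push_cast
  field_simp
  ring_nf

/-- The functions in `S₀`, and those in `S₁` times `cos θ` and times `sin θ`. -/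
def trigModes (S₀ S₁ : Set (E → ℝ)) : Set (Cyl → ℝ) :=
  {p | ∃ q ∈ S₀, p = fun x => q x.1} ∪ {p | ∃ q ∈ S₁, p = fun x => q x.1 * Real.cos x.2}
    ∪ {p | ∃ q ∈ S₁, p = fun x => q x.1 * Real.sin x.2}

/-- The number of low degrees in each Fourier component. -/
def lowDegree (d₀ d₁ : ℕ) (n : ℤ) : ℕ := if n = 0 then d₀ else if n = 1 ∨ n = -1 then d₁ else 0

/-- The corresponding modes on the cylinder. -/
def lowSet (d₀ d₁ : ℕ) : Finset (ℤ × (Fin 3 → ℕ)) :=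
  ({0} ×ˢ lowModes d₀) ∪ ({1, -1} ×ˢ lowModes d₁)

theorem isLowSet (d₀ d₁ : ℕ) : IsLowSet (lowSet d₀ d₁) (lowDegree d₀ d₁) := by
  intro n α
  simp only [lowSet, lowDegree, Finset.mem_union, Finset.mem_product, Finset.mem_singleton, Finset.mem_insert,
    mem_lowModes]
  split_ifs with h1 h2
  · subst h1; simp
  · simp [h1, h2]
  · simp [h1, h2]

/-- A common form for the angular factors `1`, `cos` and `sin`, each a combination of at most two
Fourier modes. -/
theorem cylBasis_comb_ae (α : Fin 3 → ℕ) (c : ℝ) {a : ℂ} {m n : ℤ} {a₁ a₂ : ℂ} {T : ℝ → ℝ}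
    (hT : ∀ θ, ((T θ : ℝ) : ℂ) = a * (a₁ * em m θ + a₂ * em n θ)) :
    ((((c * Real.sqrt (hermSq α) : ℝ) : ℂ) * a) • (a₁ • cylBasis (m, α) + a₂ • cylBasis (n, α)) : HC)
      =ᵐ[cylMeasure] fun x => ((c * hermFun α x.1 * T x.2 : ℝ) : ℂ) := by
  filter_upwards [cylVec_ae (m, α), cylVec_ae (n, α), Lp.coeFn_smul a₁ (cylBasis (m, α)),
    Lp.coeFn_smul a₂ (cylBasis (n, α)), Lp.coeFn_add (a₁ • cylBasis (m, α)) (a₂ • cylBasis (n, α)),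
    Lp.coeFn_smul (((c * Real.sqrt (hermSq α) : ℝ) : ℂ) * a)
      (a₁ • cylBasis (m, α) + a₂ • cylBasis (n, α))] with x h1 h2 h3 h4 h5 h6
  rw [h6, Pi.smul_apply, h5, Pi.add_apply, h3, h4, Pi.smul_apply, Pi.smul_apply, h1, h2, hermFun_eq_hermN]
  simp only [smul_eq_mul, Complex.ofReal_mul]
  rw [hT]
  ring

/-- In each degree `cos θ` and `sin θ` span the same space as `e^{iθ}` and `e^{-iθ}`, so both
families span the space of the modes in `lowSet d₀ d₁`. -/
theorem projAway_trigModes {S₀ S₁ : Set (E → ℝ)} {d₀ d₁ : ℕ} (h₀ : IsModeSet S₀ d₀) (h₁ : IsModeSet S₁ d₁) :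
    projAway cylMeasure (trigModes S₀ S₁) = modeProj cylBasis (lowSet d₀ d₁) := by
  set a : ℂ := ((Real.sqrt (2 * Real.pi) : ℝ) : ℂ) with ha
  have ha0 : a ≠ 0 := by rw [ha]; exact_mod_cast sqrt_two_pi_pos.ne'
  have hone : ∀ θ : ℝ, (((fun _ => 1 : ℝ → ℝ) θ : ℝ) : ℂ) = a * (1 * em 0 θ + 0 * em 0 θ) := by
    intro θ
    have h1 : a * (((Real.sqrt (2 * Real.pi))⁻¹ : ℝ) : ℂ) = 1 := by
      rw [ha, ← Complex.ofReal_mul, mul_inv_cancel₀ sqrt_two_pi_pos.ne', Complex.ofReal_one]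
    rw [em_zero, zero_mul, add_zero, one_mul, h1, Complex.ofReal_one]
  have hcos : ∀ θ, ((Real.cos θ : ℝ) : ℂ) = a * (1 / 2 * em 1 θ + 1 / 2 * em (-1) θ) := by
    intro θ; rw [cos_eq_em]; ring
  have hsin : ∀ θ, ((Real.sin θ : ℝ) : ℂ)
      = a * (-Complex.I / 2 * em 1 θ + Complex.I / 2 * em (-1) θ) := by
    intro θ; rw [sin_eq_em]; ring
  have hmem : ∀ n α, deg α < lowDegree d₀ d₁ n →
      cylBasis (n, α) ∈ Submodule.span ℂ (cylBasis '' (lowSet d₀ d₁ : Set (ℤ × (Fin 3 → ℕ)))) :=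
    fun n α h => Submodule.subset_span ⟨(n, α), by exact_mod_cast (isLowSet d₀ d₁ n α).2 h, rfl⟩
  have hspan : ∀ {α : Fin 3 → ℕ} {c : ℝ} {m n : ℤ} {a₁ a₂ : ℂ} {T : ℝ → ℝ},
      (∀ θ, ((T θ : ℝ) : ℂ) = a * (a₁ * em m θ + a₂ * em n θ)) → deg α < lowDegree d₀ d₁ m →
      deg α < lowDegree d₀ d₁ n → ∀ {p : Cyl → ℝ}, (∀ x, p x = c * hermFun α x.1 * T x.2) → ∀ {f : HC},
      (f =ᵐ[cylMeasure] fun x => ((p x : ℝ) : ℂ)) →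
      f ∈ Submodule.span ℂ (cylBasis '' (lowSet d₀ d₁ : Set (ℤ × (Fin 3 → ℕ)))) := by
    intro α c m n a₁ a₂ T hT hm hn p hp f hf
    have h1 : f = (((c * Real.sqrt (hermSq α) : ℝ) : ℂ) * a)
        • (a₁ • cylBasis (m, α) + a₂ • cylBasis (n, α)) := by
      refine Lp.ext (hf.trans ?_)
      simp only [hp]
      exact (cylBasis_comb_ae α c hT).symm
    rw [h1]
    exact Submodule.smul_mem _ _ (Submodule.add_mem _ (Submodule.smul_mem _ _ (hmem m α hm))
      (Submodule.smul_mem _ _ (hmem n α hn)))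
  have hset : ∀ {α : Fin 3 → ℕ} {c : ℝ} {m n : ℤ} {a₁ a₂ : ℂ} {T : ℝ → ℝ}, c ≠ 0 →
      (∀ θ, ((T θ : ℝ) : ℂ) = a * (a₁ * em m θ + a₂ * em n θ)) → ∀ {p : Cyl → ℝ},
      p ∈ trigModes S₀ S₁ → (∀ x, p x = c * hermFun α x.1 * T x.2) →
      a₁ • cylBasis (m, α) + a₂ • cylBasis (n, α) ∈ Submodule.span ℂ
        {f : HC | ∃ p ∈ trigModes S₀ S₁, f =ᵐ[cylMeasure] fun x => ((p x : ℝ) : ℂ)} := by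
    intro α c m n a₁ a₂ T hc hT p hpS hp
    have h0 : ((c * Real.sqrt (hermSq α) : ℝ) : ℂ) * a ≠ 0 :=
      mul_ne_zero (by exact_mod_cast mul_ne_zero hc (sqrt_hermSq_pos α).ne') ha0
    rw [← inv_smul_smul₀ h0 (a₁ • cylBasis (m, α) + a₂ • cylBasis (n, α))]
    refine Submodule.smul_mem _ _ (Submodule.subset_span ⟨p, hpS, ?_⟩)
    simp only [hp]
    exact cylBasis_comb_ae α c hT
  refine projAway_eq_modeProj cylBasis (lowSet d₀ d₁) (fun p hp f hf => ?_) ?_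
  · rcases hp with (⟨q, hq, rfl⟩ | ⟨q, hq, rfl⟩) | ⟨q, hq, rfl⟩
    · obtain ⟨α, hα, c, hc⟩ := h₀.eq_mode q hq
      exact hspan hone (by simpa [lowDegree] using hα) (by simpa [lowDegree] using hα)
        (fun x => by rw [hc, mul_one]) hf
    · obtain ⟨α, hα, c, hc⟩ := h₁.eq_mode q hq
      exact hspan hcos (by simpa [lowDegree] using hα) (by simpa [lowDegree] using hα)
        (fun x => by rw [hc]) hf
    · obtain ⟨α, hα, c, hc⟩ := h₁.eq_mode q hq
      exact hspan hsin (by simpa [lowDegree] using hα) (by simpa [lowDegree] using hα)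
        (fun x => by rw [hc]) hf
  · rintro ⟨n, α⟩ hn
    rw [isLowSet d₀ d₁ n α] at hn
    unfold lowDegree at hn
    split_ifs at hn with h1 h2
    · subst h1
      obtain ⟨q, hq, c, hc0, hc⟩ := h₀.exists_mode α hn
      have h3 := hset (p := fun x => q x.1) hc0 hone (Or.inl (Or.inl ⟨q, hq, rfl⟩))
        (fun x => by rw [hc, mul_one])
      simpa using h3
    · obtain ⟨q, hq, c, hc0, hc⟩ := h₁.exists_mode α hn
      have h3 := hset (p := fun x => q x.1 * Real.cos x.2) hc0 hcos (Or.inl (Or.inr ⟨q, hq, rfl⟩))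
        (fun x => by rw [hc])
      have h4 := hset (p := fun x => q x.1 * Real.sin x.2) hc0 hsin (Or.inr ⟨q, hq, rfl⟩)
        (fun x => by rw [hc])
      -- Recover the exponentials from `e^{±iθ} = cos θ ± i sin θ`.
      rcases h2 with rfl | rfl
      · convert Submodule.add_mem _ h3 (Submodule.smul_mem _ Complex.I h4) using 1
        rw [smul_add, smul_smul, smul_smul,
          show Complex.I * (-Complex.I / 2) = 1 / 2 by linear_combination (-1 / 2 : ℂ) * Complex.I_mul_I,
          show Complex.I * (Complex.I / 2) = -(1 / 2) by linear_combination (1 / 2 : ℂ) * Complex.I_mul_I]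
        module
      · convert Submodule.sub_mem _ h3 (Submodule.smul_mem _ Complex.I h4) using 1
        rw [smul_add, smul_smul, smul_smul,
          show Complex.I * (-Complex.I / 2) = 1 / 2 by linear_combination (-1 / 2 : ℂ) * Complex.I_mul_I,
          show Complex.I * (Complex.I / 2) = -(1 / 2) by linear_combination (1 / 2 : ℂ) * Complex.I_mul_I]
        module
    · exact absurd hn (Nat.not_lt_zero _)

theorem Pt4_eq : Pt4 = modeProj hermBasis (lowModes 2) := projAway_modes isModeSet_modes4

theorem Pt10_eq : Pt10 = modeProj hermBasis (lowModes 3) := projAway_modes isModeSet_modes10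

theorem P1_eq : P1 = modeProj cylBasis (lowSet 1 0) := by
  rw [P1, ← projAway_trigModes isModeSet_gauss isModeSet_empty]
  congr 1
  ext p
  simp [cylModes1, trigModes]

theorem P6_eq : P6 = modeProj cylBasis (lowSet 2 1) := by
  rw [P6, ← projAway_trigModes isModeSet_modes4 isModeSet_gauss]
  congr 1
  ext p
  simp [cylModes6, trigModes]
  tauto

theorem P18_eq : P18 = modeProj cylBasis (lowSet 3 2) :=
  projAway_trigModes isModeSet_modes10 isModeSet_modes4

/-! ### Conditions in the angle -/

theorem coef_eq_zero_of_fourierVanishes {n : ℤ} {g : HC} (h : FourierVanishes n g) : coef n g = 0 := by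
  rw [Lp.eq_zero_iff_ae_eq_zero]
  filter_upwards [coef_ae n g, h] with y h1 h2
  rw [h1, integral_circ]
  have h3 : (fun θ : ℝ => em (-n) θ * g (y, θ)) = fun θ : ℝ => (((Real.sqrt (2 * Real.pi))⁻¹ : ℝ) : ℂ)
      * (g (y, θ) * Complex.exp (-(Complex.I * (n : ℂ) * (θ : ℂ)))) := by
    funext θ
    rw [em, Int.cast_neg, mul_neg, neg_mul]
    ring
  rw [h3, intervalIntegral.integral_const_mul, h2, mul_zero]
  rfl

/-- Test the weak derivative against functions independent of `θ`. -/
theorem coef_zero_eq_zero_of_isThetaDeriv {g d : HC} (h : IsThetaDeriv g d) : coef 0 d = 0 := by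
  refine hilbert_ext hermBasis fun α => ?_
  rw [inner_hermBasis_coef, inner_zero_right, inner_cylBasis]
  have h1 := h _ (isCylTest_mul (hermSchwartz α) 0)
  have h2 : ∀ x : Cyl, deriv (fun θ : ℝ => hermSchwartz α x.1 * em 0 θ) x.2 = 0 := by
    intro x
    simp only [em_zero, deriv_const']
  simp only [h2, mul_zero, integral_zero] at h1
  have h3 : ∫ x, hermSchwartz α x.1 * em (-0) x.2 * d x ∂cylMeasure
      = ∫ x, d x * (hermSchwartz α x.1 * em 0 x.2) ∂cylMeasure := by
    refine integral_congr_ae (Eventually.of_forall fun x => ?_)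
    simp only [neg_zero]
    ring
  rw [h3, neg_eq_zero.1 h1.symm, mul_zero]

/-! ### Existence and bounds for the propagators -/

section Propagators

variable {V : ℝ → E → ℝ} {τ₀ : ℝ}

theorem modes_oscillator (hv : IsPotential fun s => V (max s τ₀)) (c : ℝ) : ∀ s ≥ τ₀,
    HasModes hermBasis (fun α => rate α + (3 / 4 - c)) (potOp volume hv s) (oscillator c (V s)) := by
  intro s hs
  have h : V s = V (max s τ₀) := by rw [max_eq_left hs]
  rw [h]
  exact hasModes_oscillator c hv s

theorem modes_cylOscillator (hv : IsPotential fun s => V (max s τ₀)) (c : ℝ) : ∀ s ≥ τ₀,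
    HasModes cylBasis (fun p => cylRate p + (3 / 4 - c))
      (potOp cylMeasure (hv.comp (f := Prod.fst) measurable_fst) s) (cylOscillator c (V s)) := by
  intro s hs
  have h : V s = V (max s τ₀) := by rw [max_eq_left hs]
  rw [h]
  exact hasModes_cylOscillator c hv s

theorem exists_oscillator_propagator (hv : IsPotential fun s => V (max s τ₀)) (c : ℝ) :
    ∃ U, IsPropagator (fun τ => oscillator c (V τ)) τ₀ U :=
  exists_propagator rate_nonneg (continuous_potOp hv) (isPos_potOp hv) (modes_oscillator hv c)

theorem exists_compressed_oscillator_propagator (hv : IsPotential fun s => V (max s τ₀)) (c : ℝ)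
    (J : Finset (Fin 3 → ℕ)) :
    ∃ U, IsPropagator (fun τ => compression (modeProj hermBasis J) (oscillator c (V τ))) τ₀ U :=
  exists_compressed_propagator rate_nonneg (continuous_potOp hv) (isPos_potOp hv) (modes_oscillator hv c)
    (fun _ _ => zero_mem_oscillator _ _) J

theorem exists_cylOscillator_propagator (hv : IsPotential fun s => V (max s τ₀)) (c : ℝ) :
    ∃ U, IsPropagator (fun τ => cylOscillator c (V τ)) τ₀ U :=
  exists_propagator cylRate_nonneg (continuous_potOp (hv.comp (f := Prod.fst) measurable_fst))
    (isPos_potOp (hv.comp (f := Prod.fst) measurable_fst)) (modes_cylOscillator hv c)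

theorem exists_compressed_cylOscillator_propagator (hv : IsPotential fun s => V (max s τ₀)) (c : ℝ)
    (J : Finset (ℤ × (Fin 3 → ℕ))) :
    ∃ U, IsPropagator (fun τ => compression (modeProj cylBasis J) (cylOscillator c (V τ))) τ₀ U :=
  exists_compressed_propagator cylRate_nonneg (continuous_potOp (hv.comp (f := Prod.fst) measurable_fst))
    (isPos_potOp (hv.comp (f := Prod.fst) measurable_fst)) (modes_cylOscillator hv c)
    (fun _ _ => zero_mem_cylOscillator _ _) J

end Propagators

theorem exists_bound_compressed {d k : ℕ} (hdk : d ≤ k) (hk : k ≤ 3) : ∃ C : ℝ, 0 < C ∧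
    ∀ (V : ℝ → E → ℝ) (τ₀ : ℝ), IsPotential (fun s => V (max s τ₀)) → (∀ s y, V (max s τ₀) y ≤ ‖y‖) →
    ∀ (c : ℝ) (U : ℝ → ℝ → HE →L[ℂ] HE),
      IsPropagator (fun τ => compression (modeProj hermBasis (lowModes d)) (oscillator c (V τ))) τ₀ U →
      ∀ σ τ : ℝ, τ₀ ≤ σ → σ ≤ τ → ∀ g : HE, normE k (U τ σ (modeProj hermBasis (lowModes d) g))
        ≤ ENNReal.ofReal (C * Real.exp (-(decay d + (3 / 4 - c)) * (τ - σ))) * normE k g := by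
  obtain ⟨C, hC0, hC⟩ := exists_decay_projected hdk hk
  refine ⟨C, hC0, fun V τ₀ hv hvy c U hU σ τ hσ hst g => ?_⟩
  obtain ⟨h1, h2⟩ := compressed_linSol (τ := τ) (continuous_potOp hv) (isPos_potOp hv) (modes_oscillator hv c)
    (fun _ _ => zero_mem_oscillator _ _) hU hσ (modeProj_idem hermBasis (lowModes d) g)
  exact hC (fun s => V (max s τ₀)) hv hvy (3 / 4 - c) σ τ hst
    (fun s => U s σ (modeProj hermBasis (lowModes d) g)) g h2 h1 (by
      rw [hU.self σ hσ, ContinuousLinearMap.id_apply])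

theorem exists_bound_free {k : ℕ} (hk : k ≤ 3) : ∃ C : ℝ, 0 < C ∧
    ∀ (V : ℝ → E → ℝ) (τ₀ : ℝ), IsPotential (fun s => V (max s τ₀)) → (∀ s y, V (max s τ₀) y ≤ ‖y‖) →
    ∀ (c : ℝ) (U : ℝ → ℝ → HE →L[ℂ] HE), IsPropagator (fun τ => oscillator c (V τ)) τ₀ U →
      ∀ σ τ : ℝ, τ₀ ≤ σ → σ ≤ τ → ∀ g : HE, normE k (U τ σ g)
        ≤ ENNReal.ofReal (C * Real.exp (-(decay 0 + (3 / 4 - c)) * (τ - σ))) * normE k g := by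
  obtain ⟨C, hC0, hC⟩ := exists_decay_projected (Nat.zero_le k) hk
  refine ⟨C, hC0, fun V τ₀ hv hvy c U hU σ τ hσ hst g => ?_⟩
  obtain ⟨h1, h2⟩ := free_linSol (τ := τ) (continuous_potOp hv) (isPos_potOp hv) (modes_oscillator hv c) hU hσ g
  rw [← lowModes_zero] at h1 h2
  refine hC (fun s => V (max s τ₀)) hv hvy (3 / 4 - c) σ τ hst (fun s => U s σ g) g h2 h1 ?_
  rw [hU.self σ hσ, lowModes_zero, modeProj_empty, ContinuousLinearMap.id_apply]

theorem exists_bound_cyl_compressed {d₀ d₁ k : ℕ} (hk : k ≤ 3) (h₀ : d₀ ≤ k + 1) (h₁ : d₁ ≤ k + 1) {r : ℝ}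
    (hr : 0 ≤ r) : ∃ C : ℝ, 0 < C ∧
    ∀ (V : ℝ → E → ℝ) (τ₀ : ℝ), IsPotential (fun s => V (max s τ₀)) → (∀ s y, V (max s τ₀) y ≤ ‖y‖) →
    ∀ (c : ℝ) (U : ℝ → ℝ → HC →L[ℂ] HC),
      IsPropagator (fun τ => compression (modeProj cylBasis (lowSet d₀ d₁)) (cylOscillator c (V τ))) τ₀ U →
      ∀ σ τ : ℝ, τ₀ ≤ σ → σ ≤ τ → ∀ g : HC,
        (∀ n : ℤ, lowDegree d₀ d₁ n ≤ k ∧ r ≤ decay (lowDegree d₀ d₁ n) + (n : ℝ) ^ 2 / 2 ∨ coef n g = 0) →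
        normC k (U τ σ (modeProj cylBasis (lowSet d₀ d₁) g))
          ≤ ENNReal.ofReal (C * Real.exp (-(r + (3 / 4 - c)) * (τ - σ))) * normC k g := by
  obtain ⟨C, hC0, hC⟩ := exists_cyl_decay_projected (isLowSet d₀ d₁) hk (fun n => by
    unfold lowDegree; split_ifs <;> omega) hr
  refine ⟨C, hC0, fun V τ₀ hv hvy c U hU σ τ hσ hst g hn => ?_⟩
  obtain ⟨h1, h2⟩ := compressed_linSol (τ := τ)
    (continuous_potOp (hv.comp (f := Prod.fst) measurable_fst))
    (isPos_potOp (hv.comp (f := Prod.fst) measurable_fst)) (modes_cylOscillator hv c)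
    (fun _ _ => zero_mem_cylOscillator _ _) hU hσ (modeProj_idem cylBasis (lowSet d₀ d₁) g)
  exact hC (fun s => V (max s τ₀)) hv hvy (3 / 4 - c) σ τ hst
    (fun s => U s σ (modeProj cylBasis (lowSet d₀ d₁) g)) g h2 h1 (by
      rw [hU.self σ hσ, ContinuousLinearMap.id_apply]) hn

theorem exists_bound_cyl_free {k : ℕ} (hk : k ≤ 3) {r : ℝ} (hr : 0 ≤ r) : ∃ C : ℝ, 0 < C ∧
    ∀ (V : ℝ → E → ℝ) (τ₀ : ℝ), IsPotential (fun s => V (max s τ₀)) → (∀ s y, V (max s τ₀) y ≤ ‖y‖) →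
    ∀ (c : ℝ) (U : ℝ → ℝ → HC →L[ℂ] HC), IsPropagator (fun τ => cylOscillator c (V τ)) τ₀ U →
      ∀ σ τ : ℝ, τ₀ ≤ σ → σ ≤ τ → ∀ g : HC, (∀ n : ℤ, r ≤ (n : ℝ) ^ 2 / 2 ∨ coef n g = 0) →
        normC k (U τ σ g)
          ≤ ENNReal.ofReal (C * Real.exp (-(r + (3 / 4 - c)) * (τ - σ))) * normC k g := by
  obtain ⟨C, hC0, hC⟩ := exists_cyl_decay_projected (J := ∅) (d := fun _ => 0) (fun n α => by simp) hk
    (fun n => Nat.zero_le _) hr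
  refine ⟨C, hC0, fun V τ₀ hv hvy c U hU σ τ hσ hst g hn => ?_⟩
  obtain ⟨h1, h2⟩ := free_linSol (τ := τ)
    (continuous_potOp (hv.comp (f := Prod.fst) measurable_fst))
    (isPos_potOp (hv.comp (f := Prod.fst) measurable_fst)) (modes_cylOscillator hv c) hU hσ g
  refine hC (fun s => V (max s τ₀)) hv hvy (3 / 4 - c) σ τ hst (fun s => U s σ g) g h2 h1 (by
    rw [hU.self σ hσ, modeProj_empty, ContinuousLinearMap.id_apply]) fun n => ?_
  simpa [decay] using hn n

theorem two_le_sq_div_two {n : ℤ} (h0 : n ≠ 0) (h1 : ¬(n = 1 ∨ n = -1)) : (2 : ℝ) ≤ (n : ℝ) ^ 2 / 2 := by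
  have h2 : (4 : ℤ) ≤ n ^ 2 := by
    rcases lt_or_ge n 0 with h | h
    · have : n ≤ -2 := by omega
      nlinarith
    · have : 2 ≤ n := by omega
      nlinarith
  have h3 : (4 : ℝ) ≤ (n : ℝ) ^ 2 := by exact_mod_cast h2
  linarith

/-- For `|n| ≥ 2` nothing is projected away, but the damping `n²/2 ≥ 2` alone exceeds `r`. The mode
`n = 0` may instead be excluded by the alternative `Q 0`. -/
theorem lowDegree_cases {d₀ d₁ k : ℕ} {r : ℝ} {Q : ℤ → Prop} (hr : r ≤ 2)
    (h₀ : d₀ ≤ k ∧ r ≤ decay d₀ ∨ Q 0) (h₁ : d₁ ≤ k) (h₁' : r ≤ decay d₁ + 1 / 2) (n : ℤ) :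
    lowDegree d₀ d₁ n ≤ k ∧ r ≤ decay (lowDegree d₀ d₁ n) + (n : ℝ) ^ 2 / 2 ∨ Q n := by
  unfold lowDegree
  split_ifs with h2 h3
  · subst h2
    simpa using h₀
  · refine Or.inl ⟨h₁, ?_⟩
    rcases h3 with rfl | rfl <;> simpa using h₁'
  · refine Or.inl ⟨Nat.zero_le _, ?_⟩
    have := two_le_sq_div_two h2 h3
    simp only [decay, if_true]
    linarith

theorem bound_mono {C C' e e' : ℝ} {a b : ℝ≥0∞} (hC : C ≤ C') (he : 0 ≤ e) (hee : e = e')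
    (h : a ≤ ENNReal.ofReal (C * e) * b) : a ≤ ENNReal.ofReal (C' * e') * b :=
  h.trans (mul_le_mul_left (ENNReal.ofReal_le_ofReal (hee ▸ mul_le_mul_of_nonneg_right hC he)) b)

end CylinderPropagator

end

/-! ### The numerical rates and the conclusion -/

open CylinderPropagator in
theorem theorem6 :
    ∃ C : ℝ, 0 < C ∧
      ∀ (ε : ℝ) (χ : ℝ → ℝ) (χt : ℝ → E → ℝ), 0 < ε → IsCutoff ε χ → IsInnerCutoff ε χt →
      ∃ τmin : ℝ, 0 < τmin ∧ ∀ τ₀ : ℝ, τmin ≤ τ₀ →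
        -- `Ũ₁`, generated by `-P̃₁₀ (𝓛₁ + 1) P̃₁₀`
        ((∃ U, IsPropagator (fun τ => compression Pt10 (oscillator (3 / 4) (potential χ χt τ₀ τ))) τ₀ U) ∧
          ∀ U, IsPropagator (fun τ => compression Pt10 (oscillator (3 / 4) (potential χ χt τ₀ τ))) τ₀ U →
            ∀ σ τ : ℝ, τ₀ ≤ σ → σ ≤ τ → ∀ g : HE,
              normE 3 (U τ σ (Pt10 g))
                ≤ ENNReal.ofReal (C * Real.exp (-(7 / 5) * (τ - σ))) * normE 3 g) ∧
        -- `Ũ₂`, generated by `-P̃₄ (𝓛₁ + 1) P̃₄`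
        ((∃ U, IsPropagator (fun τ => compression Pt4 (oscillator (3 / 4) (potential χ χt τ₀ τ))) τ₀ U) ∧
          ∀ U, IsPropagator (fun τ => compression Pt4 (oscillator (3 / 4) (potential χ χt τ₀ τ))) τ₀ U →
            ∀ σ τ : ℝ, τ₀ ≤ σ → σ ≤ τ → ∀ g : HE, ∀ k : ℕ, k = 2 ∨ k = 3 →
              normE k (U τ σ (Pt4 g))
                ≤ ENNReal.ofReal (C * Real.exp (-(9 / 10) * (τ - σ))) * normE k g) ∧
        -- `Ũ₃`, generated by `-𝓛₁`, `𝓛₁ = -Δ + |y|²/16 - 7/4 + V`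
        ((∃ U, IsPropagator (fun τ => oscillator (7 / 4) (potential χ χt τ₀ τ)) τ₀ U) ∧
          ∀ U, IsPropagator (fun τ => oscillator (7 / 4) (potential χ χt τ₀ τ)) τ₀ U →
            ∀ σ τ : ℝ, τ₀ ≤ σ → σ ≤ τ → ∀ g : HE, ∀ k : ℕ, k ≤ 3 →
              normE k (U τ σ g) ≤ ENNReal.ofReal (C * Real.exp (τ - σ)) * normE k g) ∧
        -- `U₁`, generated by `-P₁₈ 𝓛 P₁₈`, `𝓛 = -Δ + |y|²/16 - 7/4 - ½ ∂_θ² + V`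
        ((∃ U, IsPropagator (fun τ => compression P18 (cylOscillator (7 / 4) (potential χ χt τ₀ τ))) τ₀ U) ∧
          ∀ U, IsPropagator (fun τ => compression P18 (cylOscillator (7 / 4) (potential χ χt τ₀ τ))) τ₀ U →
            ∀ σ τ : ℝ, τ₀ ≤ σ → σ ≤ τ →
              (∀ g : HC, normC 3 (U τ σ (P18 g))
                ≤ ENNReal.ofReal (C * Real.exp (-(2 / 5) * (τ - σ))) * normC 3 g) ∧
              (∀ g d : HC, IsThetaDeriv g d → normC 2 (U τ σ (P18 d))
                ≤ ENNReal.ofReal (C * Real.exp (-(2 / 5) * (τ - σ))) * normC 2 d)) ∧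
        -- `U₂`, generated by `-P₆ (𝓛 + 1/2) P₆`
        ((∃ U, IsPropagator (fun τ => compression P6 (cylOscillator (5 / 4) (potential χ χt τ₀ τ))) τ₀ U) ∧
          ∀ U, IsPropagator (fun τ => compression P6 (cylOscillator (5 / 4) (potential χ χt τ₀ τ))) τ₀ U →
            ∀ σ τ : ℝ, τ₀ ≤ σ → σ ≤ τ → ∀ g : HC,
              normC 2 (U τ σ (P6 g))
                ≤ ENNReal.ofReal (C * Real.exp (-(2 / 5) * (τ - σ))) * normC 2 g) ∧
        -- `U₃`, generated by `-𝓛`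
        ((∃ U, IsPropagator (fun τ => cylOscillator (7 / 4) (potential χ χt τ₀ τ)) τ₀ U) ∧
          ∀ U, IsPropagator (fun τ => cylOscillator (7 / 4) (potential χ χt τ₀ τ)) τ₀ U →
            ∀ σ τ : ℝ, τ₀ ≤ σ → σ ≤ τ → ∀ g : HC,
              (∀ n : ℤ, n = -1 ∨ n = 0 ∨ n = 1 → FourierVanishes n g) →
              normC 1 (U τ σ g)
                ≤ ENNReal.ofReal (C * Real.exp (-(2 / 5) * (τ - σ))) * normC 1 g) ∧
        -- `U₄`, generated by `-P₁ (𝓛 + 1) P₁`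
        ((∃ U, IsPropagator (fun τ => compression P1 (cylOscillator (3 / 4) (potential χ χt τ₀ τ))) τ₀ U) ∧
          ∀ U, IsPropagator (fun τ => compression P1 (cylOscillator (3 / 4) (potential χ χt τ₀ τ))) τ₀ U →
            ∀ σ τ : ℝ, τ₀ ≤ σ → σ ≤ τ → ∀ g : HC,
              normC 1 (U τ σ (P1 g))
                ≤ ENNReal.ofReal (C * Real.exp (-(2 / 5) * (τ - σ))) * normC 1 g) := by
  -- The generator on `ℝ³` is `Λ + 3/4 - c + V`, without shift for `c = 3/4`. The rates are `3/2 -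
  -- 1/10 = 7/5` here and `1 - 1/10 = 9/10` for `d = 2`.
  obtain ⟨C₁, hC₁, H₁⟩ := exists_bound_compressed (d := 3) (k := 3) le_rfl le_rfl
  obtain ⟨C₂, hC₂, H₂⟩ := exists_bound_compressed (d := 2) (k := 2) le_rfl (by norm_num)
  obtain ⟨C₃, hC₃, H₃⟩ := exists_bound_compressed (d := 2) (k := 3) (by norm_num) le_rfl
  choose c hc h using fun k : Fin 4 => exists_bound_free (k := k) (Nat.lt_succ_iff.1 k.2)
  -- Both `n = 0`, with `3/2 - 1/10`, and `n = ±1`, with `1 - 1/10 + 1/2`, give exactly `7/5`; the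
  -- shift by `-1` leaves `2/5`.
  obtain ⟨C₄, hC₄, H₄⟩ := exists_bound_cyl_compressed (d₀ := 3) (d₁ := 2) (k := 3) (r := 7 / 5)
    le_rfl (by norm_num) (by norm_num) (by norm_num)
  -- Here `d₀ = k + 1`, too many modes for the weight at `n = 0`; a derivative in `θ` has no such
  -- component.
  obtain ⟨C₅, hC₅, H₅⟩ := exists_bound_cyl_compressed (d₀ := 3) (d₁ := 2) (k := 2) (r := 7 / 5)
    (by norm_num) (by norm_num) (by norm_num) (by norm_num)
  -- The rate is `1 - 1/10` for `n = 0` and `1/2 - 1/10 + 1/2` for `n = ±1`; the shift is `3/4 - 5/4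
  -- = -1/2`.
  obtain ⟨C₆, hC₆, H₆⟩ := exists_bound_cyl_compressed (d₀ := 2) (d₁ := 1) (k := 2) (r := 9 / 10)
    (by norm_num) (by norm_num) (by norm_num) (by norm_num)
  -- Only `|n| ≥ 2` is present, with damping at least `2`; the rate `7/5` is what remains necessary
  -- after the shift by `-1`.
  obtain ⟨C₇, hC₇, H₇⟩ := exists_bound_cyl_free (k := 1) (r := 7 / 5) (by norm_num) (by norm_num)
  -- For `n = 0` the rate is `1/2 - 1/10`, for `n = ±1` the damping `1/2` suffices without
  -- projection, and there is no shift.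
  obtain ⟨C₈, hC₈, H₈⟩ := exists_bound_cyl_compressed (d₀ := 1) (d₁ := 0) (k := 1) (r := 2 / 5)
    (by norm_num) (by norm_num) (by norm_num) (by norm_num)
  have hc0 : 0 ≤ ∑ k, c k := Finset.sum_nonneg fun k _ => (hc k).le
  refine ⟨C₁ + C₂ + C₃ + ∑ k, c k + C₄ + C₅ + C₆ + C₇ + C₈, by positivity,
    fun ε χ χt hε hχ hχt => ?_⟩
  obtain ⟨τmin, hτmin, hmin⟩ := exists_isPotential hε hχ hχt
  refine ⟨τmin, hτmin, fun τ₀ hτ₀ => ?_⟩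
  obtain ⟨hv, hvy⟩ := hmin τ₀ hτ₀
  rw [Pt4_eq, Pt10_eq, P1_eq, P6_eq, P18_eq]
  refine ⟨⟨exists_compressed_oscillator_propagator hv _ _, fun U hU σ τ hσ hst g => ?_⟩,
    ⟨exists_compressed_oscillator_propagator hv _ _, fun U hU σ τ hσ hst g k hk => ?_⟩,
    ⟨exists_oscillator_propagator hv _, fun U hU σ τ hσ hst g k hk => ?_⟩,
    ⟨exists_compressed_cylOscillator_propagator hv _ _, fun U hU σ τ hσ hst =>
      ⟨fun g => ?_, fun g d hgd => ?_⟩⟩,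
    ⟨exists_compressed_cylOscillator_propagator hv _ _, fun U hU σ τ hσ hst g => ?_⟩,
    ⟨exists_cylOscillator_propagator hv _, fun U hU σ τ hσ hst g hg => ?_⟩,
    ⟨exists_compressed_cylOscillator_propagator hv _ _, fun U hU σ τ hσ hst g => ?_⟩⟩
  · refine bound_mono (by linarith) (Real.exp_pos _).le ?_ (H₁ _ _ hv hvy _ U hU σ τ hσ hst g)
    norm_num [decay]
  · rcases hk with rfl | rfl
    · refine bound_mono (by linarith) (Real.exp_pos _).le ?_ (H₂ _ _ hv hvy _ U hU σ τ hσ hst g)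
      norm_num [decay]
    · refine bound_mono (by linarith) (Real.exp_pos _).le ?_ (H₃ _ _ hv hvy _ U hU σ τ hσ hst g)
      norm_num [decay]
  · have hle := Finset.single_le_sum (fun k _ => (hc k).le) (Finset.mem_univ (⟨k, Nat.lt_succ_iff.2 hk⟩ : Fin 4))
    refine bound_mono (by linarith) (Real.exp_pos _).le ?_
      (h ⟨k, Nat.lt_succ_iff.2 hk⟩ _ _ hv hvy _ U hU σ τ hσ hst g)
    norm_num [decay]
  · refine bound_mono (by linarith) (Real.exp_pos _).le ?_ (H₄ _ _ hv hvy _ U hU σ τ hσ hst g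
      (lowDegree_cases (by norm_num) (Or.inl ⟨le_rfl, ?_⟩) (by norm_num) ?_)) <;> norm_num [decay]
  · refine bound_mono (by linarith) (Real.exp_pos _).le ?_ (H₅ _ _ hv hvy _ U hU σ τ hσ hst d
      (lowDegree_cases (Q := fun n => coef n d = 0) (by norm_num)
        (Or.inr (coef_zero_eq_zero_of_isThetaDeriv hgd)) le_rfl ?_)) <;> norm_num [decay]
  · refine bound_mono (by linarith) (Real.exp_pos _).le ?_ (H₆ _ _ hv hvy _ U hU σ τ hσ hst g
      (lowDegree_cases (by norm_num) (Or.inl ⟨le_rfl, ?_⟩) (by norm_num) ?_)) <;> norm_num [decay]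
  · refine bound_mono (by linarith) (Real.exp_pos _).le ?_ (H₇ _ _ hv hvy _ U hU σ τ hσ hst g fun n => ?_)
    · norm_num
    · by_cases hn : n = -1 ∨ n = 0 ∨ n = 1
      · exact Or.inr (coef_eq_zero_of_fourierVanishes (hg n hn))
      · exact Or.inl ((by norm_num : (7 / 5 : ℝ) ≤ 2).trans (two_le_sq_div_two (by tauto) (by tauto)))
  · refine bound_mono (by linarith) (Real.exp_pos _).le ?_ (H₈ _ _ hv hvy _ U hU σ τ hσ hst g
      (lowDegree_cases (by norm_num) (Or.inl ⟨le_rfl, ?_⟩) (by norm_num) ?_)) <;> norm_num [decay]
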